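/- Let $\Lambda=\mathbb Z+\mathbb Z\tau$ with $\operatorname{Im}\tau>0$, $E=\mathbb C/\Lambda$, $X=E\setminus\{0\}$, and let $\Gamma_n$ be the coordinate ring of the configuration space $F(X,n)$ of $n$ distinct points of $X$, with its derivations $\partial_i=\partial_{x_i}$. Let $V$ be a vertex algebra over $\mathbb C$ (with nonzero vacuum), graded by $\mathbb Z_{\ge 0}$, $V=\bigoplus_{\Delta\ge 0}V_\Delta$ (so $\mathbf 1\in V_0$, $TV_\Delta\subset V_{\Delta+1}$, and $V_{\Delta\,(m)}V_{\Delta'}\subset V_{\Delta+\Delta'-m-1}$, with $V_k=0$ for $k<0$), and let $\{a^i\}_{i\in I}$ be a finite family of nonzero homogeneous vectors, $a^i\in V_{\Delta_i}$, strongly generating $V$, i.e. $V$ is spanned by the monomials $a^{i_1}_{(-n_1-1)}\cdots a^{i_s}_{(-n_s-1)}\mathbf 1$, $s\ge 0$, $n_k\ge 0$. Let $R=R_V=V/V_{(-2)}V$ be the Zhu Poisson algebra of $V$, where $V_{(-2)}V$ is the span of all $a_{(-2)}b$, with the commutative product induced by $a_{(-1)}b$; write $\bar a\in R$ for the class of $a\in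 V$. **The complex.** Put $\widetilde C_n=\Gamma_n\otimes V^{\otimes n+1}$ and $C_n=\widetilde C_n/\sum_{i=1}^n(\partial_i+T_i)\widetilde C_n$, where $T_i$ is the translation operator acting on the $i$-th factor. Write $f\cdot a^1\cdots a^n\mid b$ for $f\otimes a^1\otimes\cdots\otimes a^n\otimes b$. The differential $d:C_n\to C_{n-1}$ is $$d=\sum_{1\le i<j\le n}(-1)^{n-i}d^{(ij)}+\sum_{1\le i\le n}(-1)^{n-i}p^{(i)},$$ $$d^{(ij)}(f\cdot a^1\cdots a^n\mid b)=\operatorname{Res}_{x_i=x_j}f\cdot a^1\cdots\widehat{a^i}\cdots Y(a^i,x_i-x_j)a^j\cdots a^n\mid b,$$ $$p^{(i)}(f\cdot a^1\cdots a^n\mid b)=\operatorname{Res}_{x_i=0}f\cdot a^1\cdots\widehat{a^i}\cdots a^n\mid Y(a^i,x_i)b,$$ where after the residue the remaining variables are relabelled $x_1,\dots,x_{n-1}$ in order, and $d=0$ on $C_0$. **The filtrations.** Let $G_pV$ be the standard filtration: the span of the monomials $a^{i_1}_{(-n_1-1)}\cdots a^{i_s}_{(-n_s-1)}\mathbf 1$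 with $\Delta_{i_1}+\cdots+\Delta_{i_s}\le p$; extend it to $V^{\otimes n+1}$ in the natural way. Let $G_{-n+k}\Gamma_n$ be the space of those functions in $\Gamma_n$ which are, locally on $E^n$, sums of products of at most $k$ functions each having poles on a single one of the divisors $x_i=0$ and $x_i=x_j$. The Hodge filtration $G_rC_n$ is the image in $C_n$ of $\sum_{p+q\le r}G_p\Gamma_n\otimes G_qV^{\otimes n+1}$; it is preserved by $d$. On $\operatorname{gr}^GC_\bullet$ let $E^p\operatorname{gr}^GC_n$ be the image of $\bigoplus_{p'\ge p}\operatorname{gr}^G_{p'}\Gamma_n\otimes\operatorname{gr}^GV^{\otimes n+1}$; this is a decreasing filtration of the complex $\operatorname{gr}^GC_\bullet$. Let ${}'C_\bullet=\operatorname{gr}_E\operatorname{gr}^GC_\bullet$, with components ${}'C_n^p=\operatorname{gr}_E^p\operatorname{gr}^GC_n$ and the induced differential ${}'C_n^p\to{}'C_{n-1}^p$, and let $H_n({}'C_\bullet)^p$ be its homology in bidegree $(n,p)$. **Proposition.** For every $n\ge 0$ there is an isomorphism of complex vector spaces $$H_n({}'C_\bullet)^{-n}\;\cong\;\textstyle\bigwedge^n_R\Omega_R,$$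 where $\Omega_R=\Omega_{R/\mathbb C}$ is the module of Kähler differentials. It can be chosen so that for all homogeneous $a^1\in V_{\delta_1},\dots,a^n\in V_{\delta_n}$, $b\in V_{\delta_{n+1}}$ the element of $\operatorname{gr}^G_r C_n$, $r=\delta_1+\cdots+\delta_{n+1}-n$, represented by $1\cdot a^1\cdots a^n\mid b$ defines a cycle of ${}'C_n^{-n}$, whose class corresponds to $\bar b\,d\bar a^1\wedge\cdots\wedge d\bar a^n$. -/

import Mathlib

open Filter Topology TensorProduct DirectSum
open scoped BigOperators

noncomputable section

/-- A vertex algebra over `ℂ`: bilinear products `a ₍ₙ₎ b = prod n a b`, `n ∈ ℤ`, and a nonzero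
vacuum vector, subject to the quantum field property, the unit axiom and the Borcherds identity.
The sums in the Borcherds identity have finite support by the quantum field property. -/
class VertexAlgebra (V : Type*) [AddCommGroup V] [Module ℂ V] where
  /-- the product `a ₍ₙ₎ b` -/
  prod : ℤ → V →ₗ[ℂ] V →ₗ[ℂ] V
  /-- the vacuum vector -/
  vac : V
  vac_ne_zero : vac ≠ 0
  field : ∀ a b : V, ∃ N : ℤ, ∀ n : ℤ, N ≤ n → prod n a b = 0
  vac_prod : ∀ (n : ℤ) (b : V), prod n vac b = if n = -1 then b else 0
  prod_vac_nonneg : ∀ (n : ℤ) (a : V), 0 ≤ n → prod n a vac = 0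
  prod_vac_neg_one : ∀ a : V, prod (-1) a vac = a
  borcherds : ∀ (a b c : V) (m n k : ℤ),
    ∑ᶠ j : ℕ, Ring.choose m j • prod (m + k - j) (prod (n + j) a b) c =
      ∑ᶠ j : ℕ, ((-1 : ℤ) ^ j * Ring.choose n j) •
        (prod (n + m - j) a (prod (k + j) b c)
          - (n.negOnePow : ℤ) • prod (n + k - j) b (prod (m + j) a c))

namespace VertexAlgebra

variable {V : Type*} [AddCommGroup V] [Module ℂ V] [VertexAlgebra V]

/-- The translation operator `T a = a ₍₋₂₎ 𝟏`. -/
def translation : V →ₗ[ℂ] V := (prod (-2) : V →ₗ[ℂ] V →ₗ[ℂ] V).flip vac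

variable (V) in
/-- The subspace `V₍₋₂₎V`, the linear span of all `a ₍₋₂₎ b`. -/
def c2 : Submodule ℂ V := Submodule.span ℂ {v | ∃ a b : V, prod (-2) a b = v}

lemma prod_neg_two_mem (a b : V) : prod (-2) a b ∈ c2 V := Submodule.subset_span ⟨a, b, rfl⟩

/-- Iterate formula. -/
lemma iterate_formula (a b c : V) (n k : ℤ) :
    prod k (prod n a b) c = ∑ᶠ j : ℕ, ((-1 : ℤ) ^ j * Ring.choose n j) •
        (prod (n - j) a (prod (k + j) b c)
          - (n.negOnePow : ℤ) • prod (n + k - j) b (prod j a c)) := by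
  have h := borcherds a b c 0 n k
  rw [finsum_eq_single _ 0] at h
  · simpa using h
  · intro j hj
    obtain ⟨j, rfl⟩ := Nat.exists_eq_succ_of_ne_zero hj
    simp [Ring.choose_zero_succ]

/-- Commutator formula. -/
lemma commutator_formula (a b c : V) (m k : ℤ) :
    ∑ᶠ j : ℕ, Ring.choose m j • prod (m + k - j) (prod j a b) c =
      prod m a (prod k b c) - prod k b (prod m a c) := by
  have h := borcherds a b c m 0 k
  rw [finsum_eq_single (f := fun j : ℕ => ((-1 : ℤ) ^ j * Ring.choose (0 : ℤ) j) • _) (a := 0)] at h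
  · simpa using h
  · intro j hj
    obtain ⟨j, rfl⟩ := Nat.exists_eq_succ_of_ne_zero hj
    simp [Ring.choose_zero_succ]

lemma neg_one_pow_choose_neg_two (j : ℕ) :
    ((-1 : ℤ) ^ j * Ring.choose (-2 : ℤ) j) = j + 1 := by
  rw [Ring.choose_neg, Units.smul_def, smul_eq_mul, ← mul_assoc]
  have h1 : (2 + (j : ℤ) - 1) = ((j + 1 : ℕ) : ℤ) := by push_cast; ring
  have h2 : (((j : ℤ).negOnePow : ℤˣ) : ℤ) = (-1) ^ j := by
    simp [Int.negOnePow_def]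
  rw [h1, Ring.choose_natCast, h2, ← mul_pow]
  simp

lemma neg_one_pow_choose_neg_one (j : ℕ) :
    ((-1 : ℤ) ^ j * Ring.choose (-1 : ℤ) j) = 1 := by
  rw [Ring.choose_neg, Units.smul_def, smul_eq_mul, ← mul_assoc]
  have h1 : (1 + (j : ℤ) - 1) = ((j : ℕ) : ℤ) := by ring
  have h2 : (((j : ℤ).negOnePow : ℤˣ) : ℤ) = (-1) ^ j := by
    simp [Int.negOnePow_def]
  rw [h1, Ring.choose_natCast, h2, ← mul_pow]
  simp

lemma translation_prod (a b : V) (k : ℕ) :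
    prod (-k - 1) (translation a) b = ((k : ℤ) + 1) • prod (-k - 2) a b := by
  change prod (-k - 1) (prod (-2) a vac) b = _
  rw [iterate_formula a vac b (-2), finsum_eq_single _ k]
  · rw [neg_one_pow_choose_neg_two, vac_prod, vac_prod, if_pos (by ring), if_neg (by omega)]
    simp only [smul_zero, sub_zero]
    congr 4
    ring
  · intro j hj
    rw [vac_prod, vac_prod, if_neg (by omega), if_neg (by omega)]
    simp

lemma prod_mem_c2 (k : ℕ) (a b : V) : prod (-k - 2) a b ∈ c2 V := by
  induction k generalizing a with
  | zero => simpa using prod_neg_two_mem a b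
  | succ k ih =>
    have h := translation_prod a b (k + 1)
    have h' := ih (translation a)
    rw [show (-(k : ℤ) - 2) = -((k + 1 : ℕ) : ℤ) - 1 by push_cast; ring, h] at h'
    have h2 : ((((k + 1 : ℕ) : ℤ) + 1 : ℤ) : ℂ) ≠ 0 := by
      exact_mod_cast (show ((k + 1 : ℕ) : ℤ) + 1 ≠ 0 by omega)
    rw [← Int.cast_smul_eq_zsmul ℂ] at h'
    exact ((c2 V).smul_mem_iff h2).1 h'

lemma prod_mem_c2_of_le {n : ℤ} (hn : n ≤ -2) (a b : V) : prod n a b ∈ c2 V := by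
  have h := prod_mem_c2 (-n - 2).toNat a b
  rwa [show -(((-n - 2).toNat : ℕ) : ℤ) - 2 = n by omega] at h

lemma finsum_mem_submodule {V : Type*} [AddCommGroup V] [Module ℂ V] {ι : Type*} (p : Submodule ℂ V) {f : ι → V} (h : ∀ i, f i ∈ p) :
    ∑ᶠ i, f i ∈ p :=
  finsum_induction (· ∈ p) p.zero_mem (fun _ _ => p.add_mem) h

/-- Commutativity of the `(-1)`-product modulo `V₍₋₂₎V`. -/
lemma comm_mod_c2 (a b : V) : prod (-1) a b - prod (-1) b a ∈ c2 V := by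
  have h := commutator_formula a b vac (-1) (-1)
  rw [prod_vac_neg_one, prod_vac_neg_one] at h
  rw [← h]
  exact finsum_mem_submodule _ fun j =>
    (c2 V).toAddSubgroup.zsmul_mem (prod_mem_c2_of_le (by omega) _ _) _

lemma prod_neg_one_mem_right (c : V) {v : V} (hv : v ∈ c2 V) : prod (-1) c v ∈ c2 V := by
  induction hv using Submodule.span_induction with
  | mem v hv =>
    obtain ⟨a, b, rfl⟩ := hv
    have h := commutator_formula c a b (-1) (-2)
    rw [eq_sub_iff_add_eq] at h
    rw [← h]
    refine (c2 V).add_mem (finsum_mem_submodule _ fun j =>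
      (c2 V).toAddSubgroup.zsmul_mem (prod_mem_c2_of_le (by omega) _ _) _) (prod_neg_two_mem _ _)
  | zero => simp
  | add x y _ _ hx hy => rw [map_add]; exact add_mem hx hy
  | smul r x _ hx => rw [map_smul]; exact (c2 V).smul_mem _ hx

lemma prod_neg_one_mem_left (c : V) {v : V} (hv : v ∈ c2 V) : prod (-1) v c ∈ c2 V := by
  have := (c2 V).add_mem (comm_mod_c2 v c) (prod_neg_one_mem_right c hv)
  simpa using this

/-- Associativity of the `(-1)`-product modulo `V₍₋₂₎V`. -/
lemma assoc_mod_c2 (a b c : V) :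
    prod (-1) (prod (-1) a b) c - prod (-1) a (prod (-1) b c) ∈ c2 V := by
  obtain ⟨N, hN⟩ := field b c
  obtain ⟨M, hM⟩ := field a c
  rw [iterate_formula a b c (-1) (-1)]
  have hs : (Function.support fun j : ℕ => ((-1 : ℤ) ^ j * Ring.choose (-1 : ℤ) j) •
        (prod (-1 - j) a (prod (-1 + j) b c)
          - ((-1 : ℤ).negOnePow : ℤ) • prod (-1 + -1 - j) b (prod j a c))) ⊆
      (Finset.range ((N + 1).toNat + M.toNat + 1) : Finset ℕ) := by
    intro j hj
    by_contra hj'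
    simp only [Finset.coe_range, Set.mem_Iio, not_lt] at hj'
    apply hj
    simp only
    rw [hN _ (by omega), hM _ (by omega)]
    simp
  rw [finsum_eq_sum_of_support_subset _ hs, Finset.sum_range_succ', add_sub_assoc]
  refine (c2 V).add_mem (Submodule.sum_mem _ fun j _ => ?_) ?_
  · refine (c2 V).toAddSubgroup.zsmul_mem ((c2 V).sub_mem (prod_mem_c2_of_le (by push_cast; omega) _ _) ?_) _
    exact (c2 V).toAddSubgroup.zsmul_mem (prod_mem_c2_of_le (by push_cast; omega) _ _) _
  · rw [neg_one_pow_choose_neg_one]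
    simp only [one_smul, Nat.cast_zero, sub_zero, add_zero]
    rw [sub_right_comm, sub_self, zero_sub]
    refine (c2 V).neg_mem ((c2 V).toAddSubgroup.zsmul_mem (prod_mem_c2_of_le (by omega) _ _) _)

variable (V) in
/-- The algebra `R_V = V / V₍₋₂₎V`. -/
def ZhuAlgebra : Type _ := V ⧸ c2 V

namespace ZhuAlgebra

instance : AddCommGroup (ZhuAlgebra V) := inferInstanceAs (AddCommGroup (V ⧸ c2 V))

/-- The vector space structure of `R_V`. -/
@[reducible] def moduleAux : Module ℂ (ZhuAlgebra V) := inferInstanceAs (Module ℂ (V ⧸ c2 V))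

attribute [local instance] moduleAux

/-- The product of `R_V`, induced by the `(-1)`-product of `V`. -/
def mulAux : ZhuAlgebra V →ₗ[ℂ] ZhuAlgebra V →ₗ[ℂ] ZhuAlgebra V :=
  (c2 V).liftQ
    (LinearMap.flip ((c2 V).liftQ
      (((prod (-1) : V →ₗ[ℂ] V →ₗ[ℂ] V).compr₂ (c2 V).mkQ).flip)
      (fun v hv => LinearMap.ext fun c =>
        (Submodule.Quotient.mk_eq_zero _).2 (prod_neg_one_mem_right c hv))))
    (fun v hv => by
      refine LinearMap.ext fun c => ?_
      induction c using Submodule.Quotient.induction_on with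
      | H c => exact (Submodule.Quotient.mk_eq_zero _).2 (prod_neg_one_mem_left c hv))

lemma mulAux_mk (a b : V) :
    mulAux (V := V) ((c2 V).mkQ a) ((c2 V).mkQ b) = (c2 V).mkQ (prod (-1) a b) := rfl

instance : CommRing (ZhuAlgebra V) where
  __ := (inferInstance : AddCommGroup (ZhuAlgebra V))
  mul x y := mulAux x y
  one := (c2 V).mkQ vac
  left_distrib x y z := map_add (mulAux x) y z
  right_distrib x y z := by
    change mulAux (x + y) z = mulAux x z + mulAux y z
    rw [map_add, LinearMap.add_apply]
  zero_mul x := by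
    change mulAux 0 x = 0
    rw [map_zero, LinearMap.zero_apply]
  mul_zero x := map_zero (mulAux x)
  mul_assoc x y z := by
    induction x using Submodule.Quotient.induction_on with | H x =>
    induction y using Submodule.Quotient.induction_on with | H y =>
    induction z using Submodule.Quotient.induction_on with | H z =>
    exact (Submodule.Quotient.eq _).2 (assoc_mod_c2 x y z)
  one_mul x := by
    induction x using Submodule.Quotient.induction_on with | H x =>
    change (c2 V).mkQ (prod (-1) vac x) = (c2 V).mkQ x
    rw [vac_prod, if_pos rfl]
  mul_one x := by
    induction x using Submodule.Quotient.induction_on with | H x =>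
    change (c2 V).mkQ (prod (-1) x vac) = (c2 V).mkQ x
    rw [prod_vac_neg_one]
  mul_comm x y := by
    induction x using Submodule.Quotient.induction_on with | H x =>
    induction y using Submodule.Quotient.induction_on with | H y =>
    exact (Submodule.Quotient.eq _).2 (comm_mod_c2 x y)

instance : Algebra ℂ (ZhuAlgebra V) :=
  Algebra.ofModule
    (fun r x y => by
      change mulAux (r • x) y = r • mulAux x y
      rw [map_smul, LinearMap.smul_apply])
    (fun r x y => map_smul (mulAux x) r y)

end ZhuAlgebra

/-- The projection `V → R_V`. -/
def toZhu : V →ₗ[ℂ] ZhuAlgebra V where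
  toFun v := (c2 V).mkQ v
  map_add' _ _ := rfl
  map_smul' _ _ := rfl

lemma toZhu_mul (a b : V) : toZhu a * toZhu b = toZhu (prod (-1) a b) := rfl

/-- A grading `V = ⨁ V_Δ`, `Δ ∈ ℤ_{≥ 0}`, making `V` a graded vertex algebra. -/
structure Grading (V : Type*) [AddCommGroup V] [Module ℂ V] [VertexAlgebra V] where
  /-- the homogeneous component `V_Δ` -/
  component : ℕ → Submodule ℂ V
  isInternal : DirectSum.IsInternal component
  vac_mem : vac ∈ component 0
  translation_mem : ∀ (p : ℕ) (a : V), a ∈ component p → translation a ∈ component (p + 1)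
  prod_mem : ∀ (p q r : ℕ) (n : ℤ) (a b : V), a ∈ component p → b ∈ component q →
    (r : ℤ) = p + q - n - 1 → prod n a b ∈ component r
  prod_eq_zero : ∀ (p q : ℕ) (n : ℤ) (a b : V), a ∈ component p → b ∈ component q →
    (p + q - n - 1 : ℤ) < 0 → prod n a b = 0

/-- The vector `a^{i₁}₍₋ₙ₁₋₁₎ a^{i₂}₍₋ₙ₂₋₁₎ ⋯ a^{i_s}₍₋ₙₛ₋₁₎ 𝟏` attached to the list of pairs
`(i₁, n₁), …, (i_s, nₛ)`. -/
def monomial {ι : Type*} (a : ι → V) (l : List (ι × ℕ)) : V :=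
  l.foldr (fun s v => prod (-(s.2 : ℤ) - 1) (a s.1) v) vac

/-- The family `a` is a strong generating set of `V`. -/
def StronglyGenerates {ι : Type*} (a : ι → V) : Prop :=
  Submodule.span ℂ (Set.range (monomial a)) = ⊤

/-- The standard filtration of `V` relative to a family `a` of strong generators, homogeneous of
degrees `Δ`: the span of the monomials with `Δ(a^{i₁}) + ⋯ + Δ(a^{i_s}) ≤ p`. -/
def standardFiltration {ι : Type*} (a : ι → V) (Δ : ι → ℕ) (p : ℤ) : Submodule ℂ V :=
  Submodule.span ℂ {v | ∃ l : List (ι × ℕ), ((l.map fun s => (Δ s.1 : ℤ)).sum ≤ p) ∧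
    monomial a l = v}

end VertexAlgebra

namespace LaurentCoeff

/-- The coefficient of `t ^ m` in the Laurent expansion at `t = 0` of a function `h` with an
isolated singularity there: the contour integral `(2πi)⁻¹ ∮ h(t) t ^ (-m-1) dt` over a small
circle around `0`. -/
def laurentCoeff (h : ℂ → ℂ) (m : ℤ) : ℂ :=
  limUnder (𝓝[>] (0 : ℝ))
    (fun r => (2 * Real.pi * Complex.I)⁻¹ * ∮ t in C(0, r), t ^ (-m - 1) * h t)

lemma laurentCoeff_eq {h φ : ℂ → ℂ} {s : ℤ} (hφ : AnalyticAt ℂ φ 0)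
    (hh : ∀ᶠ t in 𝓝[≠] (0 : ℂ), h t = t ^ s * φ t) (m : ℤ) :
    laurentCoeff h m = if m < s then 0 else
      iteratedDeriv (m - s).toNat φ 0 / ((m - s).toNat.factorial : ℂ) := by
  apply Filter.Tendsto.limUnder_eq
  refine Tendsto.congr' ?_ tendsto_const_nhds
  have h1 := hφ.eventually_analyticAt
  rw [Metric.eventually_nhds_iff] at h1
  rw [eventually_nhdsWithin_iff, Metric.eventually_nhds_iff] at hh
  obtain ⟨ε, hε, h1⟩ := h1
  obtain ⟨ε', hε', hh⟩ := hh
  have hmin : Set.Ioo (0 : ℝ) (min ε ε') ∈ 𝓝[>] (0 : ℝ) := Ioo_mem_nhdsGT (lt_min hε hε')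
  filter_upwards [hmin] with r hr
  obtain ⟨hr0, hr⟩ := hr
  have hd : DifferentiableOn ℂ φ (Metric.closedBall 0 r) := by
    intro t ht
    refine (h1 ?_).differentiableAt.differentiableWithinAt
    exact lt_of_le_of_lt (Metric.mem_closedBall.1 ht) (hr.trans_le (min_le_left _ _))
  have hint : (∮ t in C(0, r), t ^ (-m - 1) * h t) = ∮ t in C(0, r), t ^ (s - m - 1) * φ t := by
    refine circleIntegral.integral_congr hr0.le fun t ht => ?_
    have htr : dist t 0 = r := Metric.mem_sphere.1 ht
    have ht0 : t ≠ 0 := by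
      rintro rfl
      simp at htr
      exact hr0.ne htr
    rw [hh (by rw [htr]; exact hr.trans_le (min_le_right _ _)) ht0, ← mul_assoc,
      ← zpow_add₀ ht0]
    congr 2
    ring
  rw [hint]
  split_ifs with hms
  · have : (∮ t in C(0, r), t ^ (s - m - 1) * φ t) = 0 := by
      have hk : ∀ t : ℂ, t ^ (s - m - 1) = t ^ (s - m - 1).toNat := by
        intro t
        rw [← zpow_natCast]
        congr 1
        omega
      simp only [hk]
      apply Complex.circleIntegral_eq_zero_of_differentiable_on_off_countable hr0.le
        Set.countable_empty
      · exact ((continuous_pow _).continuousOn).mul hd.continuousOn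
      · intro z hz
        refine ((differentiableAt_id).pow _).mul (h1 ?_).differentiableAt
        exact lt_trans (Metric.mem_ball.1 hz.1) (hr.trans_le (min_le_left _ _))
    rw [this, mul_zero]
  · have hk : ∀ t : ℂ, t ^ (s - m - 1) * φ t = (1 / (t - 0) ^ ((m - s).toNat + 1)) • φ t := by
      intro t
      rw [sub_zero, smul_eq_mul, one_div, ← zpow_natCast, ← zpow_neg]
      congr 2
      push_cast
      omega
    simp only [hk]
    rw [hd.circleIntegral_one_div_sub_center_pow_smul hr0, smul_eq_mul]
    have := Complex.two_pi_I_ne_zero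
    have h2 : ((m - s).toNat.factorial : ℂ) ≠ 0 := by
      exact_mod_cast Nat.factorial_ne_zero _
    field_simp

lemma exists_common {h : ℂ → ℂ} (hh : MeromorphicAt h 0) :
    ∃ s₀ : ℤ, ∀ s ≤ s₀, ∃ φ : ℂ → ℂ, AnalyticAt ℂ φ 0 ∧
      ∀ᶠ t in 𝓝[≠] (0 : ℂ), h t = t ^ s * φ t := by
  obtain ⟨s₀, φ, hφ, he⟩ := MeromorphicAt.iff_eventuallyEq_zpow_smul_analyticAt.1 hh
  refine ⟨s₀, fun s hs => ⟨fun t => t ^ (s₀ - s).toNat * φ t, ?_, ?_⟩⟩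
  · exact (analyticAt_id.pow _).mul hφ
  · filter_upwards [he, self_mem_nhdsWithin] with t ht ht0
    rw [ht, ← zpow_natCast, ← mul_assoc, ← zpow_add₀ ht0, smul_eq_mul, sub_zero]
    congr 2
    omega

lemma laurentCoeff_congr {h₁ h₂ : ℂ → ℂ} (hh : MeromorphicAt h₁ 0) (he : h₁ =ᶠ[𝓝[≠] 0] h₂)
    (m : ℤ) : laurentCoeff h₁ m = laurentCoeff h₂ m := by
  obtain ⟨s, hs⟩ := exists_common hh
  obtain ⟨φ, hφ, h1⟩ := hs s le_rfl
  rw [laurentCoeff_eq hφ h1, laurentCoeff_eq hφ (s := s)]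
  filter_upwards [he, h1] with t h2 h3
  rw [← h2, h3]

lemma laurentCoeff_add {h₁ h₂ : ℂ → ℂ} (hh₁ : MeromorphicAt h₁ 0) (hh₂ : MeromorphicAt h₂ 0)
    (m : ℤ) : laurentCoeff (fun t => h₁ t + h₂ t) m = laurentCoeff h₁ m + laurentCoeff h₂ m := by
  obtain ⟨s₁, hs₁⟩ := exists_common hh₁
  obtain ⟨s₂, hs₂⟩ := exists_common hh₂
  obtain ⟨φ₁, hφ₁, h1⟩ := hs₁ (min s₁ s₂) (min_le_left _ _)
  obtain ⟨φ₂, hφ₂, h2⟩ := hs₂ (min s₁ s₂) (min_le_right _ _)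
  rw [laurentCoeff_eq hφ₁ h1, laurentCoeff_eq hφ₂ h2,
    laurentCoeff_eq (φ := φ₁ + φ₂) (s := min s₁ s₂) (hφ₁.add hφ₂)]
  · split_ifs
    · simp
    · rw [iteratedDeriv_add hφ₁.contDiffAt hφ₂.contDiffAt, add_div]
  · filter_upwards [h1, h2] with t ht1 ht2
    rw [ht1, ht2, Pi.add_apply, mul_add]

lemma laurentCoeff_const_mul {h : ℂ → ℂ} (hh : MeromorphicAt h 0) (c : ℂ)
    (m : ℤ) : laurentCoeff (fun t => c * h t) m = c * laurentCoeff h m := by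
  obtain ⟨s, hs⟩ := exists_common hh
  obtain ⟨φ, hφ, h1⟩ := hs s le_rfl
  rw [laurentCoeff_eq hφ h1, laurentCoeff_eq (φ := fun t => c * φ t) (s := s)
    (analyticAt_const.mul hφ)]
  · split_ifs
    · simp
    · rw [iteratedDeriv_const_mul_field, mul_div_assoc]
  · filter_upwards [h1] with t ht1
    rw [ht1]
    ring

/-- Taylor coefficients in one variable of a jointly analytic function are analytic. -/
lemma analyticAt_iteratedDeriv {E : Type*} [NormedAddCommGroup E] [NormedSpace ℂ E]
    [CompleteSpace E] {G : E × ℂ → ℂ} {p : E} (hG : AnalyticAt ℂ G (p, 0)) (k : ℕ) :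
    AnalyticAt ℂ (fun x => iteratedDeriv k (fun t => G (x, t)) 0) p := by
  have key : ∀ k : ℕ, ∃ H : E × ℂ → ℂ, AnalyticAt ℂ H (p, 0) ∧
      ∀ᶠ z in 𝓝 (p, (0 : ℂ)), iteratedDeriv k (fun t => G (z.1, t)) z.2 = H z := by
    intro k
    induction k with
    | zero => exact ⟨G, hG, Eventually.of_forall fun z => by simp⟩
    | succ k ih =>
      obtain ⟨H, hH, he⟩ := ih
      refine ⟨fun z => fderiv ℂ H z (0, 1), 
        ((ContinuousLinearMap.apply ℂ ℂ ((0 : E), (1 : ℂ))).analyticAt _).comp hH.fderiv, ?_⟩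
      filter_upwards [eventually_eventually_nhds.2 he, hH.eventually_analyticAt] with z hz hHz
      rw [iteratedDeriv_succ]
      have hl : HasDerivAt (fun t : ℂ => (z.1, t)) ((0 : E), (1 : ℂ)) z.2 :=
        (hasDerivAt_const _ _).prodMk (hasDerivAt_id _)
      have h1 : (iteratedDeriv k fun t => G (z.1, t)) =ᶠ[𝓝 z.2] fun t => H (z.1, t) := by
        have : Tendsto (fun t : ℂ => (z.1, t)) (𝓝 z.2) (𝓝 z) := hl.continuousAt.tendsto
        exact this.eventually hz
      rw [h1.deriv_eq]
      exact (hHz.differentiableAt.hasFDerivAt.comp_hasDerivAt z.2 hl).deriv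
  obtain ⟨H, hH, he⟩ := key k
  have hc : AnalyticAt ℂ (fun x : E => (x, (0 : ℂ))) p := analyticAt_id.prod analyticAt_const
  refine (AnalyticAt.fun_comp (g := H) (f := fun x : E => (x, (0 : ℂ))) hH hc).congr ?_
  have : Tendsto (fun x : E => (x, (0 : ℂ))) (𝓝 p) (𝓝 (p, 0)) := hc.continuousAt.tendsto
  filter_upwards [this.eventually he] with x hx
  exact hx.symm

end LaurentCoeff

namespace EllipticConfig

open LaurentCoeff

/-- The periods `1, τ`, generating the lattice `Λ = ℤ + ℤ τ`. -/
def periods (τ : UpperHalfPlane) : PeriodPair where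
  ω₁ := 1
  ω₂ := τ
  indep := by
    rw [LinearIndependent.pair_iff]
    intro s t h
    have him := congrArg Complex.im h
    have ht : t = 0 := by
      have : t * (τ : ℂ).im = 0 := by simpa using him
      rcases mul_eq_zero.1 this with h1 | h1
      · exact h1
      · exact absurd h1 τ.im_pos.ne'
    subst ht
    have hre := congrArg Complex.re h
    exact ⟨by simpa using hre, rfl⟩

/-- The points `x₁, …, xₙ` together with the marked point `x_{n+1} = 0`. -/
def pts {n : ℕ} (x : Fin n → ℂ) : Fin (n + 1) → ℂ := Fin.snoc (α := fun _ => ℂ) x 0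

/-- The preimage in `ℂⁿ` of the configuration space `F(X, n)` of `n` distinct points on
`X = (ℂ / Λ) \ {0}`. -/
def conf (L : PeriodPair) (n : ℕ) : Set (Fin n → ℂ) :=
  {x | ∀ a b : Fin (n + 1), a ≠ b → pts x a - pts x b ∉ L.lattice}

open Classical in
/-- The product of local equations `(y_a - y_b) - (q_a - q_b)` near `q` of those divisors
`y_a = y_b` (mod `Λ`), `a ≠ b`, which pass through `q`. -/
def discr (L : PeriodPair) {k : ℕ} (q y : Fin k → ℂ) : ℂ :=
  ∏ a, ∏ b, if a ≠ b ∧ q a - q b ∈ L.lattice then (y a - y b) - (q a - q b) else 1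

/-- Regular functions on `F(X, n)`, i.e. `Λ`-periodic functions on `ℂⁿ`, holomorphic on the
configuration space and meromorphic along its complement, the divisor
`D = ⋃ {xᵢ = 0} ∪ ⋃ {xᵢ = xⱼ}` of `Eⁿ`, with poles of bounded order (the functions are normalised
to be zero on `D`). By compactness of `Eⁿ` and GAGA this is the coordinate ring of `F(X, n)`. -/
structure IsRegular (L : PeriodPair) (n : ℕ) (f : (Fin n → ℂ) → ℂ) : Prop where
  zero_off : ∀ x ∉ conf L n, f x = 0
  periodic : ∀ x l : Fin n → ℂ, (∀ i, l i ∈ L.lattice) → f (x + l) = f x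
  merom : ∃ N : ℕ, ∀ p : Fin n → ℂ, ∃ g : (Fin n → ℂ) → ℂ, AnalyticAt ℂ g p ∧
    ∀ᶠ x in 𝓝 p, x ∈ conf L n → f x * discr L (pts p) (pts x) ^ N = g x

lemma pts_analyticAt {n : ℕ} (a : Fin (n + 1)) (p : Fin n → ℂ) :
    AnalyticAt ℂ (fun x : Fin n → ℂ => pts x a) p := by
  induction a using Fin.lastCases with
  | last => simpa [pts] using analyticAt_const
  | cast i =>
    simp only [pts, Fin.snoc_castSucc]
    exact (ContinuousLinearMap.proj (R := ℂ) (φ := fun _ : Fin n => ℂ) i).analyticAt p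

lemma pts_continuous {n : ℕ} (a : Fin (n + 1)) :
    Continuous (fun x : Fin n → ℂ => pts x a) :=
  continuous_iff_continuousAt.2 fun p => (pts_analyticAt a p).continuousAt

lemma discr_analyticAt (L : PeriodPair) {n : ℕ} (q : Fin (n + 1) → ℂ) (p : Fin n → ℂ) :
    AnalyticAt ℂ (fun x : Fin n → ℂ => discr L q (pts x)) p := by
  unfold discr
  refine Finset.analyticAt_fun_prod _ fun a _ => Finset.analyticAt_fun_prod _ fun b _ => ?_
  split_ifs
  · exact ((pts_analyticAt a p).sub (pts_analyticAt b p)).sub analyticAt_const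
  · exact analyticAt_const

lemma discr_ne_zero (L : PeriodPair) {n : ℕ} (q : Fin (n + 1) → ℂ) {x : Fin n → ℂ}
    (hx : x ∈ conf L n) : discr L q (pts x) ≠ 0 := by
  unfold discr
  refine Finset.prod_ne_zero_iff.2 fun a _ => Finset.prod_ne_zero_iff.2 fun b _ => ?_
  split_ifs with h
  · intro h0
    exact hx a b h.1 (by rw [sub_eq_zero.1 h0]; exact h.2)
  · exact one_ne_zero

lemma discr_self (L : PeriodPair) {n : ℕ} {p : Fin n → ℂ} (hp : p ∈ conf L n)
    (y : Fin (n + 1) → ℂ) : discr L (pts p) y = 1 := by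
  unfold discr
  refine Finset.prod_eq_one fun a _ => Finset.prod_eq_one fun b _ => ?_
  rw [if_neg]
  rintro ⟨h1, h2⟩
  exact hp a b h1 h2

lemma isOpen_conf (L : PeriodPair) (n : ℕ) : IsOpen (conf L n) := by
  have : conf L n = ⋂ a : Fin (n + 1), ⋂ b : Fin (n + 1), ⋂ _ : a ≠ b,
      {x | pts x a - pts x b ∉ L.lattice} := by
    ext x
    simp [conf]
  rw [this]
  refine isOpen_iInter_of_finite fun a => isOpen_iInter_of_finite fun b =>
    isOpen_iInter_of_finite fun _ => ?_
  exact L.isClosed_lattice.isOpen_compl.preimage ((pts_continuous a).sub (pts_continuous b))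

lemma pts_add {n : ℕ} (x l : Fin n → ℂ) : pts (x + l) = pts x + pts l := by
  funext a
  induction a using Fin.lastCases with
  | last => simp [pts]
  | cast i => simp [pts]

lemma pts_mem {L : PeriodPair} {n : ℕ} {l : Fin n → ℂ} (hl : ∀ i, l i ∈ L.lattice)
    (a : Fin (n + 1)) : pts l a ∈ L.lattice := by
  induction a using Fin.lastCases with
  | last => simp [pts]
  | cast i => simpa [pts] using hl i

lemma conf_add {L : PeriodPair} {n : ℕ} {x l : Fin n → ℂ} (hl : ∀ i, l i ∈ L.lattice) :
    x + l ∈ conf L n ↔ x ∈ conf L n := by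
  have key : ∀ a b, pts (x + l) a - pts (x + l) b ∈ L.lattice ↔ pts x a - pts x b ∈ L.lattice := by
    intro a b
    have h := L.lattice.sub_mem (pts_mem hl a) (pts_mem hl b)
    rw [pts_add, Pi.add_apply, Pi.add_apply, add_sub_add_comm]
    exact Submodule.add_mem_iff_left _ h
  simp only [conf, Set.mem_ofPred_eq, key]

variable {L : PeriodPair} {n : ℕ}

lemma IsRegular.analyticAt {f : (Fin n → ℂ) → ℂ} (hf : IsRegular L n f) {x : Fin n → ℂ}
    (hx : x ∈ conf L n) : AnalyticAt ℂ f x := by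
  obtain ⟨N, hN⟩ := hf.merom
  obtain ⟨g, hg, he⟩ := hN x
  refine hg.congr ?_
  filter_upwards [he, (isOpen_conf L n).mem_nhds hx] with y hy hyc
  rw [← hy hyc, discr_self L hx, one_pow, mul_one]

lemma merom_mono {f : (Fin n → ℂ) → ℂ} {N M : ℕ} (h : N ≤ M) {p : Fin n → ℂ}
    (hf : ∃ g : (Fin n → ℂ) → ℂ, AnalyticAt ℂ g p ∧
      ∀ᶠ x in 𝓝 p, x ∈ conf L n → f x * discr L (pts p) (pts x) ^ N = g x) :
    ∃ g : (Fin n → ℂ) → ℂ, AnalyticAt ℂ g p ∧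
      ∀ᶠ x in 𝓝 p, x ∈ conf L n → f x * discr L (pts p) (pts x) ^ M = g x := by
  obtain ⟨g, hg, he⟩ := hf
  refine ⟨fun x => g x * discr L (pts p) (pts x) ^ (M - N),
    hg.mul ((discr_analyticAt L _ p).pow _), ?_⟩
  filter_upwards [he] with x hx hxc
  rw [← hx hxc, mul_assoc, ← pow_add]
  congr 2
  omega

variable (L n) in
/-- The coordinate ring of `F(X, n)`, as a space of functions on `ℂⁿ`. -/
def regularSubmodule : Submodule ℂ ((Fin n → ℂ) → ℂ) where
  carrier := {f | IsRegular L n f}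
  zero_mem' := ⟨fun _ _ => rfl, fun _ _ _ => rfl, 0, fun _ => ⟨0, analyticAt_const,
    Eventually.of_forall fun _ _ => by simp⟩⟩
  add_mem' := by
    intro f g hf hg
    refine ⟨fun x hx => ?_, fun x l hl => ?_, ?_⟩
    · rw [Pi.add_apply, hf.zero_off x hx, hg.zero_off x hx, add_zero]
    · rw [Pi.add_apply, Pi.add_apply, hf.periodic x l hl, hg.periodic x l hl]
    · obtain ⟨N, hN⟩ := hf.merom
      obtain ⟨M, hM⟩ := hg.merom
      refine ⟨max N M, fun p => ?_⟩
      obtain ⟨u, hu, hu'⟩ := merom_mono (le_max_left N M) (hN p)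
      obtain ⟨v, hv, hv'⟩ := merom_mono (le_max_right N M) (hM p)
      refine ⟨u + v, hu.add hv, ?_⟩
      filter_upwards [hu', hv'] with x h1 h2 hx
      rw [Pi.add_apply, Pi.add_apply, add_mul, h1 hx, h2 hx]
  smul_mem' := by
    intro c f hf
    refine ⟨fun x hx => ?_, fun x l hl => ?_, ?_⟩
    · rw [Pi.smul_apply, hf.zero_off x hx, smul_zero]
    · rw [Pi.smul_apply, Pi.smul_apply, hf.periodic x l hl]
    · obtain ⟨N, hN⟩ := hf.merom
      refine ⟨N, fun p => ?_⟩
      obtain ⟨u, hu, hu'⟩ := hN p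
      refine ⟨c • u, analyticAt_const.smul hu, ?_⟩
      filter_upwards [hu'] with x h1 hx
      rw [Pi.smul_apply, Pi.smul_apply, smul_eq_mul, mul_assoc, h1 hx, smul_eq_mul]

variable (L n) in
/-- The coordinate ring `Γₙ` of `F(X, n)`, as a complex vector space. -/
def RegularFunctions : Type := regularSubmodule L n

instance : AddCommGroup (RegularFunctions L n) := inferInstanceAs (AddCommGroup (regularSubmodule L n))

instance : Module ℂ (RegularFunctions L n) := inferInstanceAs (Module ℂ (regularSubmodule L n))

/-- An element of `Γₙ` as a function on `ℂⁿ`. -/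
def RegularFunctions.toFun (f : RegularFunctions L n) : (Fin n → ℂ) → ℂ := f.1

lemma RegularFunctions.isRegular (f : RegularFunctions L n) : IsRegular L n f.toFun := f.2

@[ext]
lemma RegularFunctions.ext {f g : RegularFunctions L n} (h : ∀ x, f.toFun x = g.toFun x) : f = g :=
  Subtype.ext (funext h)

/-- The element of `Γₙ` given by a function on `ℂⁿ`. -/
def RegularFunctions.mk (f : (Fin n → ℂ) → ℂ) (h : IsRegular L n f) : RegularFunctions L n := ⟨f, h⟩

@[simp]
lemma RegularFunctions.toFun_mk {f : (Fin n → ℂ) → ℂ} (h : IsRegular L n f) :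
    (RegularFunctions.mk f h).toFun = f := rfl

@[simp]
lemma RegularFunctions.toFun_add (f g : RegularFunctions L n) :
    (f + g).toFun = f.toFun + g.toFun := rfl

@[simp]
lemma RegularFunctions.toFun_smul (c : ℂ) (f : RegularFunctions L n) :
    (c • f).toFun = c • f.toFun := rfl

open Classical in
variable (L n) in
/-- The constant function `1 ∈ Γₙ`. -/
def one : RegularFunctions L n :=
  RegularFunctions.mk (fun x => if x ∈ conf L n then 1 else 0) ⟨fun x hx => if_neg hx,
    fun x l hl => by simp only [conf_add hl], 0, fun p => ⟨fun _ => 1, analyticAt_const,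
      Eventually.of_forall fun x hx => by simp [hx]⟩⟩

open Classical in
lemma isRegular_partial {f : (Fin n → ℂ) → ℂ} (hf : IsRegular L n f) (v : Fin n → ℂ) :
    IsRegular L n (fun x => if x ∈ conf L n then fderiv ℂ f x v else 0) := by
  refine ⟨fun x hx => if_neg hx, fun x l hl => ?_, ?_⟩
  · simp only [conf_add hl]
    congr 2
    have : f = fun y => f (y + l) := funext fun y => (hf.periodic y l hl).symm
    conv_rhs => rw [this]
    rw [fderiv_comp_add_right]
  · obtain ⟨N, hN⟩ := hf.merom
    refine ⟨N + 1, fun p => ?_⟩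
    obtain ⟨g, hg, he⟩ := hN p
    set δ : (Fin n → ℂ) → ℂ := fun x => discr L (pts p) (pts x) with hδ
    have hδa : AnalyticAt ℂ δ p := discr_analyticAt L _ p
    have ev : ∀ {u : (Fin n → ℂ) → ℂ}, AnalyticAt ℂ u p →
        AnalyticAt ℂ (fun x => fderiv ℂ u x v) p := fun hu =>
      ((ContinuousLinearMap.apply ℂ ℂ v).analyticAt _).comp hu.fderiv
    refine ⟨fun x => fderiv ℂ g x v * δ x - N * g x * fderiv ℂ δ x v,
      ((ev hg).mul hδa).sub ((analyticAt_const.mul hg).mul (ev hδa)), ?_⟩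
    filter_upwards [eventually_eventually_nhds.2 he, hδa.eventually_analyticAt] with x hx hδx hxc
    rw [if_pos hxc]
    have hfx := (hf.analyticAt hxc).differentiableAt.hasFDerivAt
    have hδx' := hδx.differentiableAt.hasFDerivAt
    have heq : (fun y => f y * δ y ^ N) =ᶠ[𝓝 x] g := by
      filter_upwards [hx, (isOpen_conf L n).mem_nhds hxc] with y hy hyc
      exact hy hyc
    have hd : fderiv ℂ g x = _ := (heq.fderiv_eq (𝕜 := ℂ)).symm.trans (hfx.mul (hδx'.pow N)).fderiv
    have hgx : g x = f x * δ x ^ N := heq.eq_of_nhds.symm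
    rw [hd, hgx]
    simp only [_root_.add_apply, _root_.smul_apply, smul_eq_mul, nsmul_eq_mul]
    change fderiv ℂ f x v * δ x ^ (N + 1) = _
    rcases N with _ | N
    · simp
    · simp
      ring

open Classical in
/-- The derivation `∂ᵢ` of `Γₙ`. -/
def partialDeriv (i : Fin n) : RegularFunctions L n →ₗ[ℂ] RegularFunctions L n where
  toFun f := RegularFunctions.mk
    (fun x => if x ∈ conf L n then fderiv ℂ f.toFun x (Pi.single i 1) else 0)
    (isRegular_partial f.isRegular _)
  map_add' f g := by
    ext x
    by_cases hx : x ∈ conf L n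
    · have h1 := (f.isRegular.analyticAt hx).differentiableAt
      have h2 := (g.isRegular.analyticAt hx).differentiableAt
      simp [hx, fderiv_add h1 h2]
    · simp [hx]
  map_smul' c f := by
    ext x
    by_cases hx : x ∈ conf L n
    · have h1 := (f.isRegular.analyticAt hx).differentiableAt
      simp [hx, fderiv_const_smul h1]
    · simp [hx]

/-- The configuration of `n + 1` points obtained from `x₁, …, xₙ` (and `x_{n+1} = 0`) by inserting
in position `i` a new point `t + x_j`. -/
def insertNear (i j : Fin (n + 1)) (x : Fin n → ℂ) (t : ℂ) : Fin (n + 1) → ℂ :=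
  Fin.insertNth (α := fun _ => ℂ) i (pts x j + t) x

lemma pts_insertNear_same (i j : Fin (n + 1)) (x : Fin n → ℂ) (t : ℂ) :
    pts (insertNear i j x t) i.castSucc = pts x j + t := by
  simp [pts, insertNear]

lemma pts_insertNear_succAbove (i j k : Fin (n + 1)) (x : Fin n → ℂ) (t : ℂ) :
    pts (insertNear i j x t) (i.castSucc.succAbove k) = pts x k := by
  induction k using Fin.lastCases with
  | last =>
    rw [Fin.succAbove_ne_last_last (Fin.castSucc_lt_last i).ne]
    simp [pts]
  | cast k =>
    rw [Fin.castSucc_succAbove_castSucc]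
    simp [pts, insertNear]

open Classical in
variable (L) in
/-- Auxiliary factor of `discr`. -/
def psi (c d : ℂ) : ℂ := if c ∈ L.lattice then -(d - c) ^ 2 else 1

lemma psi_analyticAt {E : Type*} [NormedAddCommGroup E] [NormedSpace ℂ E] (c : ℂ) {u : E → ℂ}
    {p : E} (hu : AnalyticAt ℂ u p) : AnalyticAt ℂ (fun x => psi L c (u x)) p := by
  unfold psi
  split_ifs
  · exact ((hu.sub analyticAt_const).pow 2).neg
  · exact analyticAt_const

lemma psi_ne_zero {c d : ℂ} (hd : d ∉ L.lattice) : psi L c d ≠ 0 := by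
  unfold psi
  split_ifs with h
  · intro h0
    have : d - c = 0 := by simpa using h0
    rw [sub_eq_zero.1 this] at hd
    exact hd h
  · exact one_ne_zero

open Classical in
lemma discr_succAbove {k : ℕ} (q y : Fin (k + 1) → ℂ) (i : Fin (k + 1)) :
    discr L q y = (∏ b : Fin k, psi L (q i - q (i.succAbove b)) (y i - y (i.succAbove b))) *
      discr L (fun b => q (i.succAbove b)) (fun b => y (i.succAbove b)) := by
  unfold discr
  rw [Fin.prod_univ_succAbove _ i, Fin.prod_univ_succAbove _ i]
  simp only [ne_eq, not_true_eq_false, false_and, if_false, one_mul]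
  have h1 : ∀ a : Fin k, (∏ b, if ¬ i.succAbove a = b ∧ q (i.succAbove a) - q b ∈ L.lattice then
      (y (i.succAbove a) - y b) - (q (i.succAbove a) - q b) else 1) =
      (if q (i.succAbove a) - q i ∈ L.lattice then
        (y (i.succAbove a) - y i) - (q (i.succAbove a) - q i) else 1) *
      ∏ b, if ¬ a = b ∧ q (i.succAbove a) - q (i.succAbove b) ∈ L.lattice then
      (y (i.succAbove a) - y (i.succAbove b)) - (q (i.succAbove a) - q (i.succAbove b)) else 1 := by
    intro a
    rw [Fin.prod_univ_succAbove _ i]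
    simp [Fin.succAbove_ne]
  simp only [h1]
  rw [Finset.prod_mul_distrib, ← mul_assoc, ← Finset.prod_mul_distrib]
  congr 1
  refine Finset.prod_congr rfl fun a _ => ?_
  have h2 : q (i.succAbove a) - q i ∈ L.lattice ↔ q i - q (i.succAbove a) ∈ L.lattice := by
    rw [← neg_sub, neg_mem_iff]
  simp only [(Fin.succAbove_ne i a).symm, not_false_eq_true, true_and, h2, psi]
  split_ifs
  · ring
  · ring

lemma insertNear_analyticAt (i j : Fin (n + 1)) (z : (Fin n → ℂ) × ℂ) :
    AnalyticAt ℂ (fun z : (Fin n → ℂ) × ℂ => insertNear i j z.1 z.2) z := by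
  rw [analyticAt_pi_iff]
  intro a
  induction a using Fin.succAboveCases i with
  | x => 
    simp only [insertNear, Fin.insertNth_apply_same]
    exact (AnalyticAt.fun_comp (g := fun x : Fin n → ℂ => pts x j) (f := Prod.fst)
      (pts_analyticAt j z.1) analyticAt_fst).add analyticAt_snd
  | p k =>
    simp only [insertNear, Fin.insertNth_apply_succAbove]
    exact ((ContinuousLinearMap.proj (R := ℂ) (φ := fun _ : Fin n => ℂ) k).analyticAt _).comp
      analyticAt_fst

lemma insertNear_mem_conf (i j : Fin (n + 1)) {x : Fin n → ℂ} (hx : x ∈ conf L n) :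
    ∀ᶠ t in 𝓝[≠] (0 : ℂ), insertNear i j x t ∈ conf L (n + 1) := by
  have h1 : ∀ k : Fin (n + 1), ∀ᶠ t in 𝓝[≠] (0 : ℂ), pts x j + t - pts x k ∉ L.lattice := by
    intro k
    by_cases hk : j = k
    · subst hk
      have := L.compl_lattice_sdiff_singleton_mem_nhds 0
      filter_upwards [mem_nhdsWithin_of_mem_nhds this, self_mem_nhdsWithin] with t ht ht0 h
      exact ht ⟨by simpa using h, ht0⟩
    · apply Filter.Eventually.filter_mono nhdsWithin_le_nhds
      have hc : Continuous fun t : ℂ => pts x j + t - pts x k := by fun_prop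
      have ho := L.isClosed_lattice.isOpen_compl.preimage hc
      exact ho.mem_nhds (by simpa using hx j k hk)
  filter_upwards [eventually_all.2 h1] with t ht a b hab
  induction a using Fin.succAboveCases i.castSucc with
  | x =>
    induction b using Fin.succAboveCases i.castSucc with
    | x => exact absurd rfl hab
    | p b =>
      rw [pts_insertNear_same, pts_insertNear_succAbove]
      exact ht b
  | p a =>
    induction b using Fin.succAboveCases i.castSucc with
    | x =>
      rw [pts_insertNear_same, pts_insertNear_succAbove, ← neg_sub, neg_mem_iff]
      exact ht a
    | p b =>
      rw [pts_insertNear_succAbove, pts_insertNear_succAbove]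
      exact hx a b fun h => hab (by rw [h])

variable (L) in
/-- Auxiliary: the part of `discr` at an inserted point which does not vanish at `t = 0`. -/
def crossFactor (j : Fin (n + 1)) (p : Fin n → ℂ) (x : Fin n → ℂ) (t : ℂ) : ℂ :=
  ∏ b : Fin n, psi L (pts p j - pts p (j.succAbove b)) (pts x j + t - pts x (j.succAbove b))

variable (L) in
/-- Auxiliary: the part of `discr` not involving the point `j`. -/
def restFactor (j : Fin (n + 1)) (p : Fin n → ℂ) (x : Fin n → ℂ) : ℂ :=
  discr L (fun b => pts p (j.succAbove b)) (fun b => pts x (j.succAbove b))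

lemma discr_eq_cross (j : Fin (n + 1)) (p x : Fin n → ℂ) :
    discr L (pts p) (pts x) = crossFactor L j p x 0 * restFactor L j p x := by
  rw [discr_succAbove _ _ j]
  simp [crossFactor, restFactor]

lemma discr_insertNear (i j : Fin (n + 1)) (p x : Fin n → ℂ) (t : ℂ) :
    discr L (pts (insertNear i j p 0)) (pts (insertNear i j x t)) =
      -t ^ 2 * crossFactor L j p x t * (crossFactor L j p x 0 * restFactor L j p x) := by
  rw [discr_succAbove _ _ i.castSucc, ← discr_eq_cross]
  simp only [pts_insertNear_same, pts_insertNear_succAbove, add_zero]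
  rw [Fin.prod_univ_succAbove _ j]
  simp [crossFactor, psi]

lemma crossFactor_analyticAt (j : Fin (n + 1)) (p : Fin n → ℂ) (z : (Fin n → ℂ) × ℂ) :
    AnalyticAt ℂ (fun z : (Fin n → ℂ) × ℂ => crossFactor L j p z.1 z.2) z := by
  unfold crossFactor
  have h : ∀ a, AnalyticAt ℂ (fun z : (Fin n → ℂ) × ℂ => pts z.1 a) z := fun a =>
    AnalyticAt.fun_comp (g := fun x : Fin n → ℂ => pts x a) (f := Prod.fst)
      (pts_analyticAt a z.1) analyticAt_fst
  refine Finset.analyticAt_fun_prod _ fun b _ => psi_analyticAt _ ?_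
  exact ((h j).add analyticAt_snd).sub (h _)

lemma restFactor_analyticAt (j : Fin (n + 1)) (p q : Fin n → ℂ) :
    AnalyticAt ℂ (fun x : Fin n → ℂ => restFactor L j p x) q := by
  unfold restFactor discr
  refine Finset.analyticAt_fun_prod _ fun a _ => Finset.analyticAt_fun_prod _ fun b _ => ?_
  split_ifs
  · exact ((pts_analyticAt _ _).sub (pts_analyticAt _ _)).sub analyticAt_const
  · exact analyticAt_const

/-- The Laurent expansion of a regular function `f(x₁, …, x_{n+1})` along `xᵢ = x_j`: shape of
the local expansion near an arbitrary point `p` of `ℂⁿ`. -/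
lemma local_expansion {f : (Fin (n + 1) → ℂ) → ℂ} {N : ℕ} (i j : Fin (n + 1)) (p : Fin n → ℂ)
    (hf : ∃ g : (Fin (n + 1) → ℂ) → ℂ, AnalyticAt ℂ g (insertNear i j p 0) ∧
      ∀ᶠ x in 𝓝 (insertNear i j p 0), x ∈ conf L (n + 1) →
        f x * discr L (pts (insertNear i j p 0)) (pts x) ^ N = g x) :
    ∃ G : (Fin n → ℂ) × ℂ → ℂ, AnalyticAt ℂ G (p, 0) ∧ ∀ᶠ x in 𝓝 p, AnalyticAt ℂ G (x, 0) ∧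
      (x ∈ conf L n → ∀ᶠ t in 𝓝[≠] (0 : ℂ), f (insertNear i j x t) * t ^ (2 * N) *
        crossFactor L j p x t ^ N * (crossFactor L j p x 0 * restFactor L j p x) ^ N =
          G (x, t)) := by
  obtain ⟨g, hg, he⟩ := hf
  have ha := insertNear_analyticAt i j (p, (0 : ℂ))
  have hG : AnalyticAt ℂ (fun z : (Fin n → ℂ) × ℂ => (-1) ^ N * g (insertNear i j z.1 z.2))
      (p, 0) := analyticAt_const.mul (AnalyticAt.fun_comp (g := g) hg ha)
  refine ⟨_, hG, ?_⟩
  have h1 : ∀ᶠ x in 𝓝 p, AnalyticAt ℂ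
      (fun z : (Fin n → ℂ) × ℂ => (-1) ^ N * g (insertNear i j z.1 z.2)) (x, 0) := by
    have : Tendsto (fun x : Fin n → ℂ => (x, (0 : ℂ))) (𝓝 p) (𝓝 (p, 0)) :=
      (Continuous.tendsto (by fun_prop) p)
    exact this.eventually hG.eventually_analyticAt
  have h2 : ∀ᶠ z in 𝓝 (p, (0 : ℂ)), insertNear i j z.1 z.2 ∈ conf L (n + 1) →
      f (insertNear i j z.1 z.2) *
        discr L (pts (insertNear i j p 0)) (pts (insertNear i j z.1 z.2)) ^ N =
          g (insertNear i j z.1 z.2) := ha.continuousAt.tendsto.eventually he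
  filter_upwards [h1, h2.curry_nhds] with x hx1 hx2
  refine ⟨hx1, fun hx => ?_⟩
  filter_upwards [mem_nhdsWithin_of_mem_nhds hx2, insertNear_mem_conf i j hx] with t ht htc
  have h3 := ht htc
  rw [← h3, discr_insertNear]
  have h4 : ((-1 : ℂ) ^ N) * (-1) ^ N = 1 := by rw [← mul_pow]; simp
  rw [show (-t ^ 2 * crossFactor L j p x t * (crossFactor L j p x 0 * restFactor L j p x)) =
    (-1) * (t ^ 2 * crossFactor L j p x t * (crossFactor L j p x 0 * restFactor L j p x)) by ring,
    mul_pow (-1 : ℂ), mul_pow (t ^ 2 * _), mul_pow (t ^ 2), ← pow_mul]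
  linear_combination (-(f (insertNear i j x t) * t ^ (2 * N) *
        crossFactor L j p x t ^ N * (crossFactor L j p x 0 * restFactor L j p x) ^ N)) * h4

lemma crossFactor_ne_zero {j : Fin (n + 1)} (p : Fin n → ℂ) {x : Fin n → ℂ}
    (hx : x ∈ conf L n) : crossFactor L j p x 0 ≠ 0 := fun h =>
  discr_ne_zero L (pts p) hx (by rw [discr_eq_cross j, h, zero_mul])

lemma slice_expansion {f : (Fin (n + 1) → ℂ) → ℂ} {N : ℕ} {i j : Fin (n + 1)} {p x : Fin n → ℂ}
    {G : (Fin n → ℂ) × ℂ → ℂ} (hx : x ∈ conf L n) (hG : AnalyticAt ℂ G (x, 0))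
    (he : ∀ᶠ t in 𝓝[≠] (0 : ℂ), f (insertNear i j x t) * t ^ (2 * N) *
        crossFactor L j p x t ^ N * (crossFactor L j p x 0 * restFactor L j p x) ^ N =
          G (x, t)) :
    ∃ φ : ℂ → ℂ, AnalyticAt ℂ φ 0 ∧
      ∀ᶠ t in 𝓝[≠] (0 : ℂ), f (insertNear i j x t) = t ^ (-(2 * N : ℤ)) * φ t := by
  have hl : AnalyticAt ℂ (fun t : ℂ => (x, t)) 0 := analyticAt_const.prod analyticAt_id
  have hw : AnalyticAt ℂ (fun t : ℂ => crossFactor L j p x t) 0 :=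
    AnalyticAt.fun_comp (g := fun z : (Fin n → ℂ) × ℂ => crossFactor L j p z.1 z.2)
      (f := fun t : ℂ => (x, t)) (crossFactor_analyticAt j p _) hl
  have hw0 := crossFactor_ne_zero (j := j) p hx
  have hd0 : crossFactor L j p x 0 * restFactor L j p x ≠ 0 := by
    rw [← discr_eq_cross]
    exact discr_ne_zero L _ hx
  refine ⟨fun t => G (x, t) / (crossFactor L j p x t ^ N *
    (crossFactor L j p x 0 * restFactor L j p x) ^ N), ?_, ?_⟩
  · exact (AnalyticAt.fun_comp (g := G) (f := fun t : ℂ => (x, t)) hG hl).fun_div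
      ((hw.pow N).mul analyticAt_const) (mul_ne_zero (pow_ne_zero _ hw0) (pow_ne_zero _ hd0))
  · have hne : ∀ᶠ t in 𝓝[≠] (0 : ℂ), crossFactor L j p x t ≠ 0 :=
      (hw.continuousAt.eventually_ne hw0).filter_mono nhdsWithin_le_nhds
    filter_upwards [he, hne, self_mem_nhdsWithin] with t ht htn ht0
    have ht0' : t ≠ 0 := ht0
    rw [← ht, zpow_neg, show (2 * N : ℤ) = ((2 * N : ℕ) : ℤ) by push_cast; ring, zpow_natCast]
    field_simp

lemma slice_meromorphicAt {f : (Fin (n + 1) → ℂ) → ℂ} (hf : IsRegular L (n + 1) f)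
    (i j : Fin (n + 1)) {x : Fin n → ℂ} (hx : x ∈ conf L n) :
    MeromorphicAt (fun t => f (insertNear i j x t)) 0 := by
  obtain ⟨N, hN⟩ := hf.merom
  obtain ⟨G, hG, he⟩ := local_expansion i j x (hN (insertNear i j x 0))
  obtain ⟨φ, hφ, h⟩ := slice_expansion hx hG (he.self_of_nhds.2 hx)
  refine MeromorphicAt.iff_eventuallyEq_zpow_smul_analyticAt.2 ⟨-(2 * N : ℤ), φ, hφ, ?_⟩
  filter_upwards [h] with t ht
  simpa using ht

lemma coeff_times_discr {f : (Fin (n + 1) → ℂ) → ℂ} {N : ℕ} {i j : Fin (n + 1)} {p x : Fin n → ℂ}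
    {G : (Fin n → ℂ) × ℂ → ℂ} (hx : x ∈ conf L n) (hG : AnalyticAt ℂ G (x, 0))
    (he : ∀ᶠ t in 𝓝[≠] (0 : ℂ), f (insertNear i j x t) * t ^ (2 * N) *
        crossFactor L j p x t ^ N * (crossFactor L j p x 0 * restFactor L j p x) ^ N =
          G (x, t)) (k : ℕ) :
    laurentCoeff (fun t => f (insertNear i j x t)) (k - 2 * N) *
      discr L (pts p) (pts x) ^ (N * (k + 2)) =
    iteratedDeriv k (fun t => G (x, t) * ∑ a ∈ Finset.range (k + 1),
      (crossFactor L j p x 0 ^ N) ^ a *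
        (crossFactor L j p x 0 ^ N - crossFactor L j p x t ^ N) ^ (k + 1 - 1 - a)) 0 /
      (k.factorial : ℂ) * restFactor L j p x ^ (N * (k + 1)) := by
  have hl : AnalyticAt ℂ (fun t : ℂ => (x, t)) 0 := analyticAt_const.prod analyticAt_id
  have hw : AnalyticAt ℂ (fun t : ℂ => crossFactor L j p x t) 0 :=
    AnalyticAt.fun_comp (g := fun z : (Fin n → ℂ) × ℂ => crossFactor L j p z.1 z.2)
      (f := fun t : ℂ => (x, t)) (crossFactor_analyticAt j p _) hl
  obtain ⟨φ, hφ, hfe⟩ := slice_expansion hx hG he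
  set w₀ := crossFactor L j p x 0 with hw₀
  set R := restFactor L j p x with hR
  set w : ℂ → ℂ := fun t => crossFactor L j p x t with hwdef
  set h : ℂ → ℂ := fun t => f (insertNear i j x t) with hh
  have hmer : MeromorphicAt h 0 := by
    refine MeromorphicAt.iff_eventuallyEq_zpow_smul_analyticAt.2 ⟨-(2 * N : ℤ), φ, hφ, ?_⟩
    filter_upwards [hfe] with t ht
    simpa using ht
  set Q : ℂ → ℂ := fun t => ∑ a ∈ Finset.range (k + 1),
      (w₀ ^ N) ^ a * (w₀ ^ N - w t ^ N) ^ (k + 1 - 1 - a) with hQ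
  have hQa : AnalyticAt ℂ Q 0 := by
    refine Finset.analyticAt_fun_sum _ fun a _ => ?_
    exact analyticAt_const.mul ((analyticAt_const.sub (hw.pow N)).pow _)
  have hQw : ∀ t, w t ^ N * Q t = (w₀ ^ N) ^ (k + 1) - (w₀ ^ N - w t ^ N) ^ (k + 1) := by
    intro t
    have := geom_sum₂_mul (w₀ ^ N) (w₀ ^ N - w t ^ N) (k + 1)
    rw [← this]
    simp only [hQ]
    ring
  -- the error term
  obtain ⟨u, hu, hue⟩ : ∃ u : ℂ → ℂ, AnalyticAt ℂ u 0 ∧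
      ∀ᶠ t in 𝓝 (0 : ℂ), w₀ ^ N - w t ^ N = t * u t := by
    have hd : AnalyticAt ℂ (fun t => w₀ ^ N - w t ^ N) 0 := analyticAt_const.sub (hw.pow N)
    have h1 : ((1 : ℕ) : ℕ∞) ≤ analyticOrderAt (fun t => w₀ ^ N - w t ^ N) 0 := by
      rw [Nat.cast_one, Order.one_le_iff_ne_zero, hd.analyticOrderAt_ne_zero]
      simp [hwdef, hw₀]
    obtain ⟨u, hu, hue⟩ := (natCast_le_analyticOrderAt hd).1 h1
    refine ⟨u, hu, ?_⟩
    filter_upwards [hue] with t ht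
    simpa using ht
  have hmer2 : MeromorphicAt (fun t => (w₀ * R) ^ N * (w₀ ^ N - w t ^ N) ^ (k + 1) * h t) 0 :=
    ((analyticAt_const.mul ((analyticAt_const.sub (hw.pow N)).pow _)).meromorphicAt).mul hmer
  have hmer1 : MeromorphicAt (fun t => t ^ (-(2 * N : ℤ)) * (G (x, t) * Q t)) 0 := by
    refine MeromorphicAt.iff_eventuallyEq_zpow_smul_analyticAt.2
      ⟨-(2 * N : ℤ), fun t => G (x, t) * Q t,
        (AnalyticAt.fun_comp (g := G) (f := fun t : ℂ => (x, t)) hG hl).mul hQa, ?_⟩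
    exact Eventually.of_forall fun t => by simp
  have hmain : (fun t => ((w₀ * R) ^ N * (w₀ ^ N) ^ (k + 1)) * h t) =ᶠ[𝓝[≠] 0]
      fun t => t ^ (-(2 * N : ℤ)) * (G (x, t) * Q t) +
        (w₀ * R) ^ N * (w₀ ^ N - w t ^ N) ^ (k + 1) * h t := by
    filter_upwards [he, self_mem_nhdsWithin] with t ht ht0
    have ht0' : t ≠ 0 := ht0
    have h1 : t ^ (-(2 * N : ℤ)) * t ^ (2 * N) = 1 := by
      rw [← zpow_natCast, ← zpow_add₀ ht0']
      simp
    have h2 := hQw t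
    rw [← ht]
    linear_combination (-(h t * (w₀ * R) ^ N * (w t ^ N * Q t))) * h1 -
      h t * (w₀ * R) ^ N * h2
  have hmer3 : MeromorphicAt (fun t => ((w₀ * R) ^ N * (w₀ ^ N) ^ (k + 1)) * h t) 0 :=
    (analyticAt_const.meromorphicAt).mul hmer
  have e1 := laurentCoeff_congr hmer3 hmain (k - 2 * N)
  have e2 : laurentCoeff (fun t => (w₀ * R) ^ N * (w₀ ^ N - w t ^ N) ^ (k + 1) * h t)
      (k - 2 * N) = 0 := by
    rw [laurentCoeff_eq (φ := fun t => (w₀ * R) ^ N * (u t) ^ (k + 1) * φ t)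
      (s := k + 1 - 2 * N) ((analyticAt_const.mul (hu.pow _)).mul hφ), if_pos (by omega)]
    filter_upwards [hfe, hue.filter_mono nhdsWithin_le_nhds, self_mem_nhdsWithin] with t h1 h2 h3
    have ht0' : t ≠ 0 := h3
    rw [h2, show h t = _ from h1, show (k + 1 - 2 * N : ℤ) = ((k + 1 : ℕ) : ℤ) + -(2 * N : ℤ) by
      push_cast; ring, zpow_add₀ ht0', zpow_natCast]
    ring
  rw [laurentCoeff_const_mul hmer, laurentCoeff_add hmer1 hmer2, e2,
    laurentCoeff_eq (h := fun t => t ^ (-(2 * N : ℤ)) * (G (x, t) * Q t))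
      (φ := fun t => G (x, t) * Q t) (s := -(2 * N : ℤ))
      ((AnalyticAt.fun_comp (g := G) (f := fun t : ℂ => (x, t)) hG hl).mul hQa)
      (Eventually.of_forall fun t => rfl), if_neg (by omega),
    add_zero, show ((k : ℤ) - 2 * N - -(2 * N : ℤ)).toNat = k by omega] at e1
  rw [discr_eq_cross j, ← hw₀, ← hR]
  change _ = iteratedDeriv k (fun t => G (x, t) * Q t) 0 / _ * _
  rw [← e1]
  ring

open Classical in
/-- The function `f^{(m)}(x₁, …, xₙ)`: the coefficient of `(xᵢ - x_j) ^ m` in the Laurent expansion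
of `f(x₁, …, x_{n+1})` along `xᵢ = x_j`, with the variable `xᵢ` removed (and the others relabelled);
for `j` the last index this is the expansion along `xᵢ = 0`. -/
def coeffFun (i j : Fin (n + 1)) (m : ℤ) (f : (Fin (n + 1) → ℂ) → ℂ) (x : Fin n → ℂ) : ℂ :=
  if x ∈ conf L n then laurentCoeff (fun t => f (insertNear i j x t)) m else 0

lemma insertNear_add (i j : Fin (n + 1)) (x l : Fin n → ℂ) (t : ℂ) :
    insertNear i j (x + l) t = insertNear i j x t + insertNear i j l 0 := by
  funext a
  induction a using Fin.succAboveCases i with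
  | x => 
    simp only [insertNear, Fin.insertNth_apply_same, pts_add, Pi.add_apply]
    ring
  | p k => simp [insertNear]

lemma insertNear_mem_lattice {i j : Fin (n + 1)} {l : Fin n → ℂ} (hl : ∀ i, l i ∈ L.lattice)
    (a : Fin (n + 1)) : insertNear i j l 0 a ∈ L.lattice := by
  induction a using Fin.succAboveCases i with
  | x => simpa [insertNear] using pts_mem hl j
  | p k => simpa [insertNear] using hl k

lemma coeffFun_eq_zero {f : (Fin (n + 1) → ℂ) → ℂ} (hf : IsRegular L (n + 1) f)
    (i j : Fin (n + 1)) :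
    ∃ M : ℤ, ∀ m < M, coeffFun (L := L) i j m f = 0 := by
  obtain ⟨N, hN⟩ := hf.merom
  refine ⟨-(2 * N : ℤ), fun m hm => ?_⟩
  funext x
  unfold coeffFun
  split_ifs with hx
  · obtain ⟨G, hG, he⟩ := local_expansion i j x (hN (insertNear i j x 0))
    obtain ⟨φ, hφ, h⟩ := slice_expansion hx hG (he.self_of_nhds.2 hx)
    rw [laurentCoeff_eq hφ h, if_pos hm]
    rfl
  · rfl

lemma coeffFun_isRegular {f : (Fin (n + 1) → ℂ) → ℂ} (hf : IsRegular L (n + 1) f)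
    (i j : Fin (n + 1)) (m : ℤ) : IsRegular L n (coeffFun (L := L) i j m f) := by
  refine ⟨fun x hx => if_neg hx, fun x l hl => ?_, ?_⟩
  · unfold coeffFun
    simp only [conf_add hl, insertNear_add,
      hf.periodic _ _ (fun a => insertNear_mem_lattice (i := i) (j := j) hl a)]
    congr 1
    exact propext (conf_add hl)
  · obtain ⟨N, hN⟩ := hf.merom
    by_cases hm : m < -(2 * N : ℤ)
    · refine ⟨0, fun p => ⟨fun _ => 0, analyticAt_const, ?_⟩⟩
      obtain ⟨G, hG, he⟩ := local_expansion i j p (hN (insertNear i j p 0))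
      filter_upwards [he] with x hx hxc
      obtain ⟨φ, hφ, h⟩ := slice_expansion hxc hx.1 (hx.2 hxc)
      rw [coeffFun, if_pos hxc, laurentCoeff_eq hφ h, if_pos hm, zero_mul]
    · obtain ⟨k, rfl⟩ : ∃ k : ℕ, m = k - 2 * N := ⟨(m + 2 * N).toNat, by omega⟩
      refine ⟨N * (k + 2), fun p => ?_⟩
      obtain ⟨G, hG, he⟩ := local_expansion i j p (hN (insertNear i j p 0))
      have h0 : AnalyticAt ℂ (fun z : (Fin n → ℂ) × ℂ => crossFactor L j p z.1 0) (p, 0) :=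
        AnalyticAt.fun_comp (g := fun z : (Fin n → ℂ) × ℂ => crossFactor L j p z.1 z.2)
          (f := fun z : (Fin n → ℂ) × ℂ => (z.1, (0 : ℂ))) (crossFactor_analyticAt j p _)
          (analyticAt_fst.prod analyticAt_const)
      have hH : AnalyticAt ℂ (fun z : (Fin n → ℂ) × ℂ => G z * ∑ a ∈ Finset.range (k + 1),
          (crossFactor L j p z.1 0 ^ N) ^ a *
          (crossFactor L j p z.1 0 ^ N - crossFactor L j p z.1 z.2 ^ N) ^ (k + 1 - 1 - a))
          (p, 0) := by
        refine hG.mul (Finset.analyticAt_fun_sum _ fun a _ => ?_)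
        exact ((h0.pow N).pow a).mul
          (((h0.pow N).sub ((crossFactor_analyticAt j p _).pow N)).pow _)
      have hT := ((analyticAt_iteratedDeriv hH k).fun_div analyticAt_const
        (show (k.factorial : ℂ) ≠ 0 by exact_mod_cast Nat.factorial_ne_zero k)).fun_mul
        ((restFactor_analyticAt (L := L) j p p).fun_pow (N * (k + 1)))
      refine ⟨_, hT, ?_⟩
      filter_upwards [he] with x hx hxc
      rw [coeffFun, if_pos hxc]
      exact coeff_times_discr hxc hx.1 (hx.2 hxc) k

/-- The linear map `f ↦ f^{(m)}`, `Γ_{n+1} → Γ_n`, of Laurent coefficients along `xᵢ = x_j`. -/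
def coeff (i j : Fin (n + 1)) (m : ℤ) : RegularFunctions L (n + 1) →ₗ[ℂ] RegularFunctions L n where
  toFun f := RegularFunctions.mk (coeffFun (L := L) i j m f.toFun)
    (coeffFun_isRegular f.isRegular i j m)
  map_add' f g := by
    ext x
    by_cases hx : x ∈ conf L n
    · simp only [RegularFunctions.toFun_mk, coeffFun, if_pos hx, RegularFunctions.toFun_add, Pi.add_apply]
      exact laurentCoeff_add (slice_meromorphicAt f.isRegular i j hx) (slice_meromorphicAt g.isRegular i j hx) m
    · simp [coeffFun, hx]
  map_smul' c f := by
    ext x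
    by_cases hx : x ∈ conf L n
    · simp only [RegularFunctions.toFun_mk, coeffFun, if_pos hx, RegularFunctions.toFun_smul, Pi.smul_apply, RingHom.id_apply,
        smul_eq_mul]
      exact laurentCoeff_const_mul (slice_meromorphicAt f.isRegular i j hx) c m
    · simp [coeffFun, hx]

lemma coeff_eq_zero (f : RegularFunctions L (n + 1)) (i j : Fin (n + 1)) :
    ∃ M : ℤ, ∀ m < M, coeff i j m f = 0 := by
  obtain ⟨M, hM⟩ := coeffFun_eq_zero f.isRegular i j
  exact ⟨M, fun m hm => Subtype.ext (hM m hm)⟩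

end EllipticConfig

namespace EllipticConfig

open Classical in
/-- The divisors `x_a = x_b` (mod `Λ`), `a < b`, passing through a point `p` of `ℂⁿ`
(where `x_{n+1} = 0`). -/
def divisorsThrough (L : PeriodPair) {n : ℕ} (p : Fin n → ℂ) :
    Finset (Fin (n + 1) × Fin (n + 1)) :=
  Finset.univ.filter fun D => D.1 < D.2 ∧ pts p D.1 - pts p D.2 ∈ L.lattice

/-- The filtration `G` of `Γₙ`: `G_q Γₙ` with `q = -n + k` is spanned by the functions which are,
locally on `Eⁿ`, sums of products of at most `k` functions each having poles on a single one of the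
divisors `xᵢ = 0` and `xᵢ = x_j`. -/
def functionFiltration (L : PeriodPair) (n : ℕ) (q : ℤ) : Submodule ℂ (RegularFunctions L n) :=
  Submodule.span ℂ {f | ∀ p : Fin n → ℂ, ∃ (N : ℕ)
    (g : Finset (Fin (n + 1) × Fin (n + 1)) → (Fin n → ℂ) → ℂ), (∀ S, AnalyticAt ℂ (g S) p) ∧
    ∀ᶠ x in 𝓝 p, x ∈ conf L n → f.toFun x =
      ∑ S ∈ (divisorsThrough L p).powerset with (S.card : ℤ) ≤ q + n,
        g S x / ∏ D ∈ S, ((pts x D.1 - pts x D.2) - (pts p D.1 - pts p D.2)) ^ N}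

end EllipticConfig

namespace ChiralComplex

open VertexAlgebra EllipticConfig

variable {V : Type*} [AddCommGroup V] [Module ℂ V]

variable (V) in
/-- `V ^ ⊗ (n+1)`. -/
abbrev TPow (n : ℕ) : Type _ := ⨂[ℂ] _ : Fin (n + 1), V

variable (V) in
/-- `C̃ₙ = Γₙ ⊗ V ^ ⊗ (n+1)`. -/
abbrev PreChains (L : PeriodPair) (n : ℕ) : Type _ := RegularFunctions L n ⊗[ℂ] TPow V n

/-- The filtration of `V ^ ⊗ (n+1)` induced by a filtration of `V`. -/
def tensorFiltration (F : ℤ → Submodule ℂ V) (n : ℕ) (q : ℤ) : Submodule ℂ (TPow V n) :=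
  Submodule.span ℂ {w | ∃ (v : Fin (n + 1) → V) (δ : Fin (n + 1) → ℤ),
    (∀ k, v k ∈ F (δ k)) ∧ ∑ k, δ k ≤ q ∧ PiTensorProduct.tprod ℂ v = w}

/-- `G_p Γₙ ⊗ G_q V ^ ⊗ (n+1)`, as a subspace of `C̃ₙ`. -/
def tensorPiece (L : PeriodPair) (F : ℤ → Submodule ℂ V) (n : ℕ) (p q : ℤ) :
    Submodule ℂ (PreChains V L n) :=
  Submodule.map₂ (TensorProduct.mk ℂ (RegularFunctions L n) (TPow V n))
    (functionFiltration L n p) (tensorFiltration F n q)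

/-- The subspace `∑_{p + q ≤ r} G_p Γₙ ⊗ G_q V ^ ⊗ (n+1)` of `C̃ₙ`, whose image in `Cₙ` is
`G_r Cₙ`. -/
def hodgeFiltration (L : PeriodPair) (F : ℤ → Submodule ℂ V) (n : ℕ) (r : ℤ) :
    Submodule ℂ (PreChains V L n) :=
  ⨆ (p : ℤ) (q : ℤ) (_ : p + q ≤ r), tensorPiece L F n p q

variable [VertexAlgebra V]

/-- The translation operator acting on the `i`-th tensor factor. -/
def translationAt {n : ℕ} (i : Fin (n + 1)) : TPow V n →ₗ[ℂ] TPow V n :=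
  PiTensorProduct.map (Function.update (fun _ => LinearMap.id) i translation)

variable (V) in
/-- The subspace `∑ᵢ (∂ᵢ + Tᵢ) C̃ₙ` of `C̃ₙ`; the quotient by it is `Cₙ`. -/
def relations (L : PeriodPair) (n : ℕ) : Submodule ℂ (PreChains V L n) :=
  ⨆ i : Fin n, LinearMap.range
    (TensorProduct.map (partialDeriv (L := L) i) (LinearMap.id : TPow V n →ₗ[ℂ] TPow V n) +
      TensorProduct.map LinearMap.id (translationAt i.castSucc))

/-- The entries of a tensor after contraction: entry `i` is removed, and the entry in the new
position `j` is replaced by its image under `v_i ₍ₘ₎`. -/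
def contractFun {n : ℕ} (i j : Fin (n + 1)) (m : ℤ) (v : Fin (n + 2) → V) : Fin (n + 1) → V :=
  Function.update (fun k => v (i.castSucc.succAbove k)) j
    (prod m (v i.castSucc) (v (i.castSucc.succAbove j)))

lemma contractFun_update_same {n : ℕ} (i j : Fin (n + 1)) (m : ℤ) (v : Fin (n + 2) → V) (x : V) :
    contractFun i j m (Function.update v i.castSucc x) =
      Function.update (fun k => v (i.castSucc.succAbove k)) j
        (prod m x (v (i.castSucc.succAbove j))) := by
  simp [contractFun, Fin.succAbove_ne]

lemma contractFun_update_target {n : ℕ} (i j : Fin (n + 1)) (m : ℤ) (v : Fin (n + 2) → V) (x : V) :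
    contractFun i j m (Function.update v (i.castSucc.succAbove j) x) =
      Function.update (fun k => v (i.castSucc.succAbove k)) j (prod m (v i.castSucc) x) := by
  funext k
  by_cases hk : k = j
  · subst hk
    simp [contractFun, (Fin.succAbove_ne i.castSucc k).symm]
  · simp [contractFun, hk]

lemma contractFun_update_other {n : ℕ} (i j : Fin (n + 1)) (m : ℤ) (v : Fin (n + 2) → V)
    {k : Fin (n + 1)} (hk : k ≠ j) (x : V) :
    contractFun i j m (Function.update v (i.castSucc.succAbove k) x) =
      Function.update (contractFun i j m v) k x := by
  funext l
  by_cases hl : l = j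
  · subst hl
    simp [contractFun, (Fin.succAbove_ne i.castSucc k).symm, hk.symm]
  · by_cases hlk : l = k
    · subst hlk
      simp [contractFun, hl]
    · simp [contractFun, hl, hlk]

/-- The multilinear map underlying `contract`. -/
def contractMultilinear {n : ℕ} (i j : Fin (n + 1)) (m : ℤ) :
    MultilinearMap ℂ (fun _ : Fin (n + 2) => V) (TPow V n) where
  toFun v := PiTensorProduct.tprod ℂ (contractFun i j m v)
  map_update_add' := by
    intro inst v a x y
    obtain rfl : inst = instDecidableEqFin (n + 2) := Subsingleton.elim _ _
    induction a using Fin.succAboveCases i.castSucc with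
    | x => simp only [contractFun_update_same, map_add, LinearMap.add_apply,
        MultilinearMap.map_update_add]
    | p k =>
      by_cases hk : k = j
      · subst hk
        simp only [contractFun_update_target, map_add, MultilinearMap.map_update_add]
      · simp only [contractFun_update_other i j m v hk, MultilinearMap.map_update_add]
  map_update_smul' := by
    intro inst v a c x
    obtain rfl : inst = instDecidableEqFin (n + 2) := Subsingleton.elim _ _
    induction a using Fin.succAboveCases i.castSucc with
    | x => simp only [contractFun_update_same, map_smul, LinearMap.smul_apply,
        MultilinearMap.map_update_smul]
    | p k =>
      by_cases hk : k = j
      · subst hk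
        simp only [contractFun_update_target, map_smul, MultilinearMap.map_update_smul]
      · simp only [contractFun_update_other i j m v hk, MultilinearMap.map_update_smul]

/-- The contraction `V ^ ⊗ (n+2) → V ^ ⊗ (n+1)` sending `a¹ ⊗ ⋯ ⊗ a^{n+2}` to
`a¹ ⊗ ⋯ ⊗ âⁱ ⊗ ⋯ ⊗ (aⁱ ₍ₘ₎ aʲ) ⊗ ⋯ ⊗ a^{n+2}`; here `j` is the position after removal of the
`i`-th factor. -/
def contract {n : ℕ} (i j : Fin (n + 1)) (m : ℤ) : TPow V (n + 1) →ₗ[ℂ] TPow V n :=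
  PiTensorProduct.lift (contractMultilinear i j m)

lemma contract_eq_zero {n : ℕ} (i j : Fin (n + 1)) (w : TPow V (n + 1)) :
    ∃ M : ℤ, ∀ m, M ≤ m → contract i j m w = 0 := by
  induction w using PiTensorProduct.induction_on with
  | smul_tprod c v =>
    obtain ⟨M, hM⟩ := field (v i.castSucc) (v (i.castSucc.succAbove j))
    refine ⟨M, fun m hm => ?_⟩
    rw [map_smul, contract, PiTensorProduct.lift.tprod]
    change c • PiTensorProduct.tprod ℂ (contractFun i j m v) = 0
    rw [MultilinearMap.map_coord_zero _ j, smul_zero]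
    simp [contractFun, hM m hm]
  | add x y hx hy =>
    obtain ⟨M, hM⟩ := hx
    obtain ⟨M', hM'⟩ := hy
    refine ⟨max M M', fun m hm => ?_⟩
    rw [map_add, hM m (le_trans (le_max_left _ _) hm), hM' m (le_trans (le_max_right _ _) hm),
      add_zero]

lemma residue_support_finite {L : PeriodPair} {n : ℕ} (i j : Fin (n + 1))
    (f : RegularFunctions L (n + 1)) (w : TPow V (n + 1)) :
    (Function.support fun m : ℤ => coeff i j m f ⊗ₜ[ℂ] contract i j m w).Finite := by
  obtain ⟨M, hM⟩ := coeff_eq_zero f i j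
  obtain ⟨M', hM'⟩ := contract_eq_zero i j w
  refine (Set.finite_Ico M M').subset fun m hm => ?_
  by_contra h
  apply hm
  simp only
  rw [Set.mem_Ico, not_and_or, not_le, not_lt] at h
  rcases h with h | h
  · rw [hM m h, TensorProduct.zero_tmul]
  · rw [hM' m h, TensorProduct.tmul_zero]

variable (V) in
/-- The map `d^{(ij)}` (`p^{(i)}` if `j` is the last index), sending `f ⊗ a¹ ⊗ ⋯ ⊗ a^{n+2}` to
`Res_{xᵢ = x_j} f · a¹ ⊗ ⋯ ⊗ âⁱ ⊗ ⋯ ⊗ Y(aⁱ, xᵢ - x_j) aʲ ⊗ ⋯ ⊗ a^{n+2}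
  = ∑ₘ f^{(m)} ⊗ (a¹ ⊗ ⋯ ⊗ âⁱ ⊗ ⋯ ⊗ aⁱ ₍ₘ₎ aʲ ⊗ ⋯ ⊗ a^{n+2})`. -/
def residue (L : PeriodPair) {n : ℕ} (i j : Fin (n + 1)) :
    PreChains V L (n + 1) →ₗ[ℂ] PreChains V L n :=
  TensorProduct.lift (LinearMap.mk₂ ℂ
    (fun f w => ∑ᶠ m : ℤ, coeff i j m f ⊗ₜ[ℂ] contract i j m w)
    (fun f g w => by
      rw [← finsum_add_distrib (residue_support_finite i j f w) (residue_support_finite i j g w)]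
      simp only [map_add, TensorProduct.add_tmul])
    (fun c f w => by
      rw [smul_finsum' c (residue_support_finite i j f w)]
      simp only [map_smul, TensorProduct.smul_tmul'])
    (fun f w z => by
      rw [← finsum_add_distrib (residue_support_finite i j f w) (residue_support_finite i j f z)]
      simp only [map_add, TensorProduct.tmul_add])
    (fun c f w => by
      rw [smul_finsum' c (residue_support_finite i j f w)]
      simp only [map_smul, TensorProduct.tmul_smul]))

variable (V) in
/-- The differential `d = ∑_{i < j} (-1)^{n+1-i} d^{(ij)} + ∑ᵢ (-1)^{n+1-i} p^{(i)}` from `C̃_{n+1}`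
to `C̃ₙ` (with indices `1 ≤ i ≤ n + 1`). As `j` stands for a position after removal of the `i`-th
factor and indices start from `0`, the condition on `j` is `i ≤ j`, and the sign is `(-1)^{n-i}`. -/
def differential (L : PeriodPair) (n : ℕ) : PreChains V L (n + 1) →ₗ[ℂ] PreChains V L n :=
  ∑ i : Fin (n + 1), ∑ j : Fin (n + 1) with i ≤ j, ((-1 : ℂ) ^ (n - (i : ℕ))) • residue V L i j

/-- The subspace of `C̃ₙ`, containing `relations`, whose image in `Cₙ` is the preimage in `G_r Cₙ`
of `E^p gr^G_r Cₙ`. Thus `gr_E^p gr^G_r Cₙ` is the quotient of the subspace with index `p` by the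
one with index `p + 1`. -/
def bifiltration (L : PeriodPair) (F : ℤ → Submodule ℂ V) (n : ℕ) (p r : ℤ) :
    Submodule ℂ (PreChains V L n) :=
  (⨆ (p' : ℤ) (_ : p ≤ p'), tensorPiece L F n p' (r - p')) ⊔ hodgeFiltration L F n (r - 1) ⊔
    relations V L n

/-- Representatives of the cycles of the complex `'C_• = gr_E gr^G C_•` in bidegree `(n, p)` and
`G`-degree `r`: elements of (the subspace of `C̃ₙ` representing) `E^p` sent by `d` to `E^{p+1}`. -/
def cycles (L : PeriodPair) (F : ℤ → Submodule ℂ V) : (n : ℕ) → (p r : ℤ) →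
    Submodule ℂ (PreChains V L n)
  | 0, p, r => bifiltration L F 0 p r
  | n + 1, p, r => bifiltration L F (n + 1) p r ⊓
      (bifiltration L F n (p + 1) r).comap (differential V L n)

/-- Representatives of the boundaries of `'C_•` in bidegree `(n, p)` and `G`-degree `r`, together
with the elements of `C̃ₙ` representing zero in `'C_n^p`. -/
def boundaries (L : PeriodPair) (F : ℤ → Submodule ℂ V) (n : ℕ) (p r : ℤ) :
    Submodule ℂ (PreChains V L n) :=
  bifiltration L F n (p + 1) r ⊔ (bifiltration L F (n + 1) p r).map (differential V L n)

/-- The part of `G`-degree `r` of the homology `H_n('C_•)^p` of `'C_• = gr_E gr^G C_•` in bidegree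
`(n, p)`. -/
abbrev HomologyPiece (L : PeriodPair) (F : ℤ → Submodule ℂ V) (n : ℕ) (p r : ℤ) : Type _ :=
  cycles L F n p r ⧸ (boundaries L F n p r).submoduleOf (cycles L F n p r)

/-- The homology `H_n('C_•)^p = ⨁_r H_n('C_•)^p_r`. -/
abbrev Homology (L : PeriodPair) (F : ℤ → Submodule ℂ V) (n : ℕ) (p : ℤ) : Type _ :=
  DirectSum ℤ fun r => HomologyPiece L F n p r

end ChiralComplex

end

/-! Functions in `G_p Γₙ` vanish for `p < -n`, and for `p = -n` they have no poles, so they are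
constant by Liouville's theorem. Hence `'C_n^{-n}` consists of classes of tensors `1 · a¹⋯aⁿ | b`,
and all of them are cycles because `G_{-n} Γ_{n-1} = 0`. What has to be understood is which of them
are boundaries, that is, the image of functions `f ∈ G_{-n} Γ_{n+1}`: those which locally have poles
on one divisor at a time.

The polar coefficients of such an `f` along `xᵢ = x_j` have no poles themselves, so they are
constants. Subtracting Weierstrass zeta functions and their derivatives in `xᵢ - x_j`, one variable
after the other, leaves a function which is quasi-periodic and without poles in that variable. The
quasi-periods of zeta are not a complex linear function of the period (`eta_not_linear`), so the
remaining function does not depend on that variable and the residues balance in each variable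
(`exists_residues`). Conversely, every choice of constant polar parts with balanced residues is
realised by a sum of derivatives of zeta (`exists_of_residues`).

The products `(m)` with `m ≥ 0` lower the standard filtration, so only polar coefficients matter for
the boundary. Poles of order at least two produce tensors with a factor in `V₍₋₂₎V`. A simple pole
along `xᵢ = x_j` produces the contraction `aⁱ₍₋₁₎aʲ`, whose form `b̄ dā¹ ∧ ⋯` is, up to sign, a
difference of terms `φᵢ - φ_j` (`toForm_contract`); balanced residues therefore give zero. In the
other direction, the function `ζ(xᵢ - x_j) - ζ(xᵢ) + ζ(x_j)` yields a relation from which both the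
Leibniz rule and antisymmetry follow. These are the relations defining the exterior powers of the
Kähler differentials.

The isomorphism is induced by `formMap`, sending `f ⊗ w` to the mean value of `f` over a real torus
times the form of the degree `s` part of `w`, where `s = r + n`. The mean is a functional on all of
`Γₙ` which kills derivatives and is `1` on the constant `1`; as translations land in `V₍₋₂₎V`, the
map respects the relations `∂ᵢ + Tᵢ`. It kills boundaries by the residue theorem
(`boundaries_le_ker_formMap`). The projection to degree `s` is the right one because `V_d ⊆ G_d V`,
while a monomial whose degree exceeds its filtration lies in `V₍₋₂₎V`. Injectivity comes from a map
in the opposite direction, from forms to chains modulo boundaries, given by the universal property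
of the exterior power (`exists_linearMap_toForm`). Surjectivity holds because the forms of
homogeneous tensors span. -/

noncomputable section

/-! ### Conformal degree and the standard filtration. -/

namespace VertexAlgebra

variable {V : Type*} [AddCommGroup V] [Module ℂ V] [VertexAlgebra V]

namespace Grading

variable (𝒱 : Grading V)

/-- The projection to a homogeneous component. -/
def proj (d : ℕ) : V →ₗ[ℂ] V :=
  (𝒱.component d).subtype ∘ₗ DirectSum.component ℂ ℕ (fun d => 𝒱.component d) d ∘ₗ
    ((LinearEquiv.ofBijective (DirectSum.coeLinearMap 𝒱.component) 𝒱.isInternal).symm :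
      V →ₗ[ℂ] DirectSum ℕ fun d => 𝒱.component d)

lemma proj_of_mem {d : ℕ} {v : V} (hv : v ∈ 𝒱.component d) (e : ℕ) :
    𝒱.proj e v = if d = e then v else 0 := by
  have h : (LinearEquiv.ofBijective (DirectSum.coeLinearMap 𝒱.component) 𝒱.isInternal).symm v =
      DirectSum.lof ℂ ℕ (fun d => 𝒱.component d) d ⟨v, hv⟩ := by
    rw [LinearEquiv.symm_apply_eq]
    exact (DirectSum.coeLinearMap_lof 𝒱.component d ⟨v, hv⟩).symm
  simp only [proj, LinearMap.comp_apply, LinearEquiv.coe_coe, h]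
  split_ifs with hde
  · subst hde
    rw [DirectSum.component.lof_self]
    rfl
  · rw [DirectSum.component.of, dif_neg hde]
    rfl

variable (V) in
/-- Homogeneous vectors. -/
def homogeneous : Set V := {v | ∃ d, v ∈ 𝒱.component d}

lemma span_homogeneous : Submodule.span ℂ 𝒱.homogeneous = ⊤ := by
  rw [eq_top_iff, ← 𝒱.isInternal.submodule_iSup_eq_top]
  exact iSup_le fun d v hv => Submodule.subset_span ⟨d, hv⟩

/-- The projection of a homogeneous product. -/
lemma prod_mem_or_eq_zero {p q : ℕ} {a b : V} (ha : a ∈ 𝒱.component p) (hb : b ∈ 𝒱.component q)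
    (n : ℤ) : prod n a b = 0 ∨ ∃ r : ℕ, (r : ℤ) = p + q - n - 1 ∧ prod n a b ∈ 𝒱.component r := by
  rcases lt_or_ge (p + q - n - 1 : ℤ) 0 with h | h
  · exact Or.inl (𝒱.prod_eq_zero p q n a b ha hb h)
  · obtain ⟨r, hr⟩ := Int.eq_ofNat_of_zero_le h
    exact Or.inr ⟨r, hr.symm, 𝒱.prod_mem p q r n a b ha hb hr.symm⟩

end Grading

section Filtration

variable {ι : Type*} (a : ι → V) (Δ : ι → ℕ)

/-- The filtration weight of a monomial. -/
def weight (l : List (ι × ℕ)) : ℤ := (l.map fun s => (Δ s.1 : ℤ)).sum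

/-- The conformal degree of a monomial. -/
def degree (l : List (ι × ℕ)) : ℕ := (l.map fun s => Δ s.1 + s.2).sum

@[simp] lemma weight_nil : weight Δ [] = 0 := rfl

@[simp] lemma weight_cons (s : ι × ℕ) (l : List (ι × ℕ)) :
    weight Δ (s :: l) = Δ s.1 + weight Δ l := by simp [weight]

@[simp] lemma degree_nil : degree Δ [] = 0 := rfl

@[simp] lemma degree_cons (s : ι × ℕ) (l : List (ι × ℕ)) :
    degree Δ (s :: l) = Δ s.1 + s.2 + degree Δ l := by simp [degree]

@[simp] lemma monomial_nil : monomial a [] = vac := rfl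

@[simp] lemma monomial_cons (s : ι × ℕ) (l : List (ι × ℕ)) :
    monomial a (s :: l) = prod (-(s.2 : ℤ) - 1) (a s.1) (monomial a l) := rfl

lemma weight_nonneg (l : List (ι × ℕ)) : 0 ≤ weight Δ l := by
  induction l with
  | nil => simp
  | cons s l ih => rw [weight_cons]; positivity

lemma weight_le_degree (l : List (ι × ℕ)) : weight Δ l ≤ degree Δ l := by
  induction l with
  | nil => simp
  | cons s l ih => rw [weight_cons, degree_cons]; push_cast; linarith [Int.natCast_nonneg s.2]

variable {a Δ}

lemma monomial_mem_standardFiltration {l : List (ι × ℕ)} {p : ℤ} (h : weight Δ l ≤ p) :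
    monomial a l ∈ standardFiltration a Δ p := Submodule.subset_span ⟨l, h, rfl⟩

lemma standardFiltration_mono {p q : ℤ} (h : p ≤ q) :
    standardFiltration a Δ p ≤ standardFiltration a Δ q :=
  Submodule.span_mono fun _ ⟨l, hl, e⟩ => ⟨l, hl.trans h, e⟩

lemma standardFiltration_eq_bot {p : ℤ} (h : p < 0) : standardFiltration a Δ p = ⊥ := by
  refine Submodule.span_eq_bot.2 fun v ⟨l, hl, _⟩ => ?_
  have := weight_nonneg Δ l
  exact absurd (this.trans hl) (not_le.2 h)

lemma monomial_mem_component (𝒱 : Grading V) (hΔ : ∀ i, a i ∈ 𝒱.component (Δ i))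
    (l : List (ι × ℕ)) : monomial a l ∈ 𝒱.component (degree Δ l) := by
  induction l with
  | nil => exact 𝒱.vac_mem
  | cons s l ih =>
    rw [monomial_cons, degree_cons]
    exact 𝒱.prod_mem _ _ _ _ _ _ (hΔ s.1) ih (by push_cast; ring)

/-- If the weight is less than the degree, some factor is a mode `(-k-2)`. That factor produces an
element of `V₍₋₂₎V`, and the modes `(-1)` in front of it preserve this subspace. -/
lemma monomial_mem_c2 {l : List (ι × ℕ)} (h : weight Δ l < degree Δ l) : monomial a l ∈ c2 V := by
  induction l with
  | nil => simp at h
  | cons s l ih =>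
    rw [monomial_cons]
    rcases Nat.eq_zero_or_pos s.2 with h0 | h0
    · rw [h0]
      refine prod_neg_one_mem_right _ (ih ?_)
      rw [weight_cons, degree_cons, h0] at h
      push_cast at h
      linarith
    · exact prod_mem_c2_of_le (by omega) _ _

/-- Projecting the spanning monomials to degree `d` keeps only those of degree `d`, and the weight
of a monomial never exceeds its degree. -/
lemma component_le_standardFiltration (𝒱 : Grading V) (hΔ : ∀ i, a i ∈ 𝒱.component (Δ i))
    (hgen : StronglyGenerates a) (d : ℕ) :
    𝒱.component d ≤ standardFiltration a Δ d := by
  intro v hv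
  have key : ∀ v : V, 𝒱.proj d v ∈ standardFiltration a Δ d := by
    intro v
    have hv : v ∈ Submodule.span ℂ (Set.range (monomial a)) := by
      rw [hgen]
      trivial
    induction hv using Submodule.span_induction with
    | mem v hv =>
      obtain ⟨l, rfl⟩ := hv
      rw [𝒱.proj_of_mem (monomial_mem_component 𝒱 hΔ l)]
      split_ifs with h
      · refine monomial_mem_standardFiltration ?_
        rw [← h]
        exact weight_le_degree Δ l
      · exact Submodule.zero_mem _
    | zero => rw [map_zero]; exact Submodule.zero_mem _
    | add x y _ _ hx hy => rw [map_add]; exact Submodule.add_mem _ hx hy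
    | smul c x _ hx => rw [map_smul]; exact Submodule.smul_mem _ c hx
  have := key v
  rwa [𝒱.proj_of_mem hv, if_pos rfl] at this

lemma generator_prod_mem (i : ι) {m : ℤ} (hm : m < 0) {p : ℤ} {v : V}
    (hv : v ∈ standardFiltration a Δ p) :
    prod m (a i) v ∈ standardFiltration a Δ (Δ i + p) := by
  refine (Submodule.span_le.2 ?_ : standardFiltration a Δ p ≤
    (standardFiltration a Δ (Δ i + p)).comap (prod m (a i))) hv
  rintro v ⟨l, hl, rfl⟩
  have : prod m (a i) (monomial a l) = monomial a ((i, (-m - 1).toNat) :: l) := by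
    have e : -(((-m - 1).toNat : ℕ) : ℤ) - 1 = m := by omega
    rw [monomial_cons, e]
  change prod m (a i) (monomial a l) ∈ standardFiltration a Δ (Δ i + p)
  rw [this]
  refine monomial_mem_standardFiltration ?_
  rw [weight_cons]
  exact Int.add_le_add_left hl _

lemma zsmul_mem_submodule {V : Type*} [AddCommGroup V] [Module ℂ V] (W : Submodule ℂ V) (c : ℤ)
    {v : V} (hv : v ∈ W) : c • v ∈ W :=
  W.toAddSubgroup.zsmul_mem hv c

/-- The standard filtration is compatible with the products; the gain for the nonnegative products
is what makes the associated graded vertex algebra commutative. -/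
theorem prod_mem_standardFiltration (𝒱 : Grading V) (hΔ : ∀ i, a i ∈ 𝒱.component (Δ i))
    (hgen : StronglyGenerates a) {p q : ℤ} {u v : V} (hu : u ∈ standardFiltration a Δ p)
    (hv : v ∈ standardFiltration a Δ q) (m : ℤ) :
    prod m u v ∈ standardFiltration a Δ (p + q) ∧
      (0 ≤ m → prod m u v ∈ standardFiltration a Δ (p + q - 1)) := by
  -- Both bounds are proved together by induction on `p + q`. The commutator and iterate formulas
  -- produce products of strictly smaller total filtration, thanks to the gain of one for
  -- nonnegative modes.
  suffices H : ∀ N : ℕ, ∀ p q : ℤ, p + q < N → ∀ u ∈ standardFiltration a Δ p,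
      ∀ v ∈ standardFiltration a Δ q, ∀ m : ℤ,
      prod m u v ∈ standardFiltration a Δ (if 0 ≤ m then p + q - 1 else p + q) by
    have h := H (p + q + 1).toNat p q (by omega) u hu v hv m
    split_ifs at h with hm
    · exact ⟨standardFiltration_mono (by omega) h, fun _ => h⟩
    · exact ⟨h, fun h0 => absurd h0 hm⟩
  intro N
  induction N with
  | zero =>
    intro p q hpq u hu v hv m
    rcases lt_or_ge p 0 with hp | hp
    · rw [standardFiltration_eq_bot hp, Submodule.mem_bot] at hu
      rw [hu, map_zero, LinearMap.zero_apply]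
      exact Submodule.zero_mem _
    · rw [standardFiltration_eq_bot (by omega : q < 0), Submodule.mem_bot] at hv
      rw [hv, map_zero]
      exact Submodule.zero_mem _
  | succ N ih =>
    -- First a nonnegative mode of a generator: it is commuted through the monomial until it reaches
    -- the vacuum, which it kills.
    have gen : ∀ (i : ι) (l : List (ι × ℕ)), Δ i + weight Δ l < N + 1 → ∀ m : ℤ, 0 ≤ m →
        prod m (a i) (monomial a l) ∈ standardFiltration a Δ (Δ i + weight Δ l - 1) := by
      intro i l
      induction l with
      | nil =>
        intro _ m hm
        rw [monomial_nil, prod_vac_nonneg m _ hm]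
        exact Submodule.zero_mem _
      | cons s l ihl =>
        intro hN m hm
        rw [weight_cons] at hN ⊢
        have hs : (0 : ℤ) ≤ Δ s.1 := Int.natCast_nonneg _
        have hcomm := commutator_formula (a i) (a s.1) (monomial a l) m (-(s.2 : ℤ) - 1)
        rw [eq_sub_iff_add_eq] at hcomm
        rw [monomial_cons, ← hcomm]
        refine Submodule.add_mem _ (finsum_mem_submodule _ fun j => zsmul_mem_submodule _ _ ?_) ?_
        -- Here the grading enters: the product has degree `Δ i + Δ s.1 - j - 1`, and a component of
        -- degree `r` lies in filtration `r`. So at least one step is gained.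
        · have h1 : prod (j : ℤ) (a i) (a s.1) ∈ standardFiltration a Δ (Δ i + Δ s.1 - 1) := by
            rcases 𝒱.prod_mem_or_eq_zero (hΔ i) (hΔ s.1) j with h | ⟨r, hr, h⟩
            · rw [h]
              exact Submodule.zero_mem _
            · exact standardFiltration_mono (by omega)
                (component_le_standardFiltration 𝒱 hΔ hgen r h)
          refine standardFiltration_mono ?_ (ih _ _ ?_ _ h1 _
            (monomial_mem_standardFiltration (le_refl (weight Δ l))) _)
          · split_ifs <;> omega
          · omega
        · have h1 := ihl (by omega) m hm
          exact standardFiltration_mono (by omega)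
            (generator_prod_mem (m := -(s.2 : ℤ) - 1) s.1 (by omega) h1)
    -- Next a mode of a whole monomial: the iterate formula peels off its first generator. In one
    -- half that generator acts last, by a negative mode; in the other it acts first, by a
    -- nonnegative mode, and the gain from `gen` makes the outer induction applicable.
    have mon : ∀ l l' : List (ι × ℕ), weight Δ l + weight Δ l' < N + 1 → ∀ m : ℤ,
        prod m (monomial a l) (monomial a l') ∈
          standardFiltration a Δ (if 0 ≤ m then weight Δ l + weight Δ l' - 1 else
            weight Δ l + weight Δ l') := by
      intro l l'
      have hl' := weight_nonneg Δ l'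
      induction l with
      | nil =>
        intro _ m
        rw [monomial_nil, vac_prod]
        by_cases h : m = -1
        · rw [if_pos h, if_neg (by omega)]
          exact monomial_mem_standardFiltration (by simp)
        · rw [if_neg h]
          exact Submodule.zero_mem _
      | cons s l ihl =>
        intro hN m
        rw [weight_cons] at hN ⊢
        have hs : (0 : ℤ) ≤ Δ s.1 := Int.natCast_nonneg _
        have hl := weight_nonneg Δ l
        rw [monomial_cons, iterate_formula]
        refine finsum_mem_submodule _ fun j => zsmul_mem_submodule _ _
          (Submodule.sub_mem _ ?_ (zsmul_mem_submodule _ _ ?_))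
        · refine standardFiltration_mono ?_
            (generator_prod_mem (m := -(s.2 : ℤ) - 1 - j) s.1 (by omega) (ihl (by omega) (m + j)))
          split_ifs <;> omega
        · refine standardFiltration_mono ?_ (ih _ _ ?_ _
            (monomial_mem_standardFiltration (le_refl (weight Δ l))) _
            (gen s.1 l' (by omega) j (Int.natCast_nonneg _)) _)
          · split_ifs <;> omega
          · omega
    intro p q hpq u hu v hv m
    induction hu using Submodule.span_induction with
    | mem u hu =>
      obtain ⟨l, hl, rfl⟩ := hu
      induction hv using Submodule.span_induction with
      | mem v hv =>
        obtain ⟨l', hl', rfl⟩ := hv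
        change weight Δ l ≤ p at hl
        change weight Δ l' ≤ q at hl'
        refine standardFiltration_mono ?_ (mon l l' (by push_cast at hpq; omega) m)
        split_ifs <;> omega
      | zero => rw [map_zero]; exact Submodule.zero_mem _
      | add x y _ _ hx hy => rw [map_add]; exact Submodule.add_mem _ hx hy
      | smul c x _ hx => rw [map_smul]; exact Submodule.smul_mem _ c hx
    | zero => rw [map_zero, LinearMap.zero_apply]; exact Submodule.zero_mem _
    | add x y _ _ hx hy => rw [map_add, LinearMap.add_apply]; exact Submodule.add_mem _ hx hy
    | smul c x _ hx => rw [map_smul, LinearMap.smul_apply]; exact Submodule.smul_mem _ c hx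

lemma translation_mem_standardFiltration (𝒱 : Grading V) (hΔ : ∀ i, a i ∈ 𝒱.component (Δ i))
    (hgen : StronglyGenerates a) {p : ℤ} {v : V} (hv : v ∈ standardFiltration a Δ p) :
    translation v ∈ standardFiltration a Δ p := by
  have := (prod_mem_standardFiltration 𝒱 hΔ hgen hv
    (monomial_mem_standardFiltration (l := []) le_rfl) (-2)).1
  rwa [weight_nil, add_zero] at this

end Filtration

end VertexAlgebra

/-- A multilinear map sends vectors from the spans of given sets to a submodule as soon as it does
so for vectors from these sets. -/
lemma MultilinearMap.mem_of_forall_mem_span {R ι N : Type*} {M : ι → Type*} [CommSemiring R]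
    [Finite ι] [∀ i, AddCommMonoid (M i)] [∀ i, Module R (M i)] [AddCommMonoid N] [Module R N]
    (g : MultilinearMap R M N) (W : Submodule R N) (S : ∀ i, Set (M i))
    (h : ∀ v, (∀ i, v i ∈ S i) → g v ∈ W) (v : ∀ i, M i)
    (hv : ∀ i, v i ∈ Submodule.span R (S i)) : g v ∈ W := by
  classical
  have := Fintype.ofFinite ι
  -- The arguments are moved from the generating sets to their spans one at a time; `s` is the set
  -- of arguments already treated.
  suffices H : ∀ (s : Finset ι) (v : ∀ i, M i), (∀ i ∈ s, v i ∈ Submodule.span R (S i)) →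
      (∀ i ∉ s, v i ∈ S i) → g v ∈ W from
    H Finset.univ v (fun i _ => hv i) fun i hi => absurd (Finset.mem_univ i) hi
  intro s
  induction s using Finset.induction_on with
  | empty => exact fun v _ h2 => h v fun i => h2 i (Finset.notMem_empty i)
  | insert a s ha ih =>
    intro v h1 h2
    have key : ∀ x ∈ Submodule.span R (S a), g (Function.update v a x) ∈ W := by
      intro x hx
      induction hx using Submodule.span_induction with
      | mem x hx =>
        refine ih _ (fun i hi => ?_) fun i hi => ?_
        · rw [Function.update_of_ne (by rintro rfl; exact ha hi)]
          exact h1 i (Finset.mem_insert_of_mem hi)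
        · by_cases hia : i = a
          · subst hia
            simpa using hx
          · rw [Function.update_of_ne hia]
            exact h2 i fun h => (Finset.mem_insert.1 h).elim hia hi
      | zero => rw [g.map_update_zero]; exact W.zero_mem
      | add x y _ _ hx hy => rw [g.map_update_add]; exact W.add_mem hx hy
      | smul c x _ hx => rw [g.map_update_smul]; exact W.smul_mem c hx
    have := key (v a) (h1 a (Finset.mem_insert_self a s))
    rwa [Function.update_eq_self] at this

/-! ### Translation covariance of the products. -/

namespace VertexAlgebra

variable {V : Type*} [AddCommGroup V] [Module ℂ V] [VertexAlgebra V]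

lemma translation_prod_eq (a b : V) (m : ℤ) :
    prod m (translation a) b = -m • prod (m - 1) a b := by
  change prod m (prod (-2) a vac) b = _
  rw [iterate_formula a vac b (-2)]
  have hs : ∀ j : ℕ, ((-2 : ℤ).negOnePow : ℤ) = 1 := fun _ => by
    rw [Int.negOnePow_even _ ⟨-1, by ring⟩]
    rfl
  simp only [neg_one_pow_choose_neg_two, vac_prod, hs 0, one_smul]
  -- Only the mode `(-1)` of the vacuum is nonzero. It occurs in the first half of the iterate
  -- formula when `m < 0`, in the second when `m > 0`, and nowhere when `m = 0`.
  rcases lt_trichotomy m 0 with hm | hm | hm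
  · rw [finsum_eq_single _ (-m - 1).toNat]
    · have e : (((-m - 1).toNat : ℕ) : ℤ) = -m - 1 := by omega
      rw [e, if_pos (by ring), if_neg (by omega), sub_zero]
      congr 4 <;> ring
    · intro j hj
      rw [if_neg (by omega), if_neg (by omega)]
      simp
  · rw [finsum_eq_zero_of_forall_eq_zero]
    · simp [hm]
    · intro j
      rw [if_neg (by omega), if_neg (by omega)]
      simp
  · rw [finsum_eq_single _ (m - 1).toNat]
    · have e : (((m - 1).toNat : ℕ) : ℤ) = m - 1 := by omega
      rw [e, if_neg (by omega), if_pos (by ring)]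
      simp
    · intro j hj
      rw [if_neg (by omega), if_neg (by omega)]
      simp

/-- Read `T(a₍ₘ₎b)` as `(a₍ₘ₎b)₍₋₂₎𝟏` and apply the iterate formula: nonnegative modes kill the
vacuum, so only the terms `j = 0, 1` survive. -/
lemma prod_translation (a b : V) (m : ℤ) :
    prod m a (translation b) = translation (prod m a b) + m • prod (m - 1) a b := by
  have h : translation (prod m a b) = prod m a (translation b) - m • prod (m - 1) a b := by
    change prod (-2) (prod m a b) vac = _
    rw [iterate_formula a b vac m]
    rw [finsum_eq_sum_of_support_subset (s := Finset.range 2), Finset.sum_range_succ,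
      Finset.sum_range_one]
    · rw [prod_vac_nonneg _ a (by omega), prod_vac_nonneg _ a (by omega)]
      simp only [Nat.cast_zero, Nat.cast_one, add_zero, sub_zero, map_zero, smul_zero, pow_zero,
        Ring.choose_zero_right, pow_one, Ring.choose_one_right]
      rw [show (-2 : ℤ) + 1 = -1 by norm_num, prod_vac_neg_one, mul_one, one_smul, neg_one_mul,
        neg_smul, ← sub_eq_add_neg]
      rfl
    · intro j hj
      by_contra hj'
      simp only [Finset.coe_range, Set.mem_Iio, not_lt] at hj'
      apply hj
      simp only
      rw [prod_vac_nonneg _ b (by omega), prod_vac_nonneg _ a (by omega)]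
      simp
  rw [h, sub_add_cancel]

lemma translation_mem_c2 (a : V) : translation a ∈ c2 V := prod_neg_two_mem a vac

end VertexAlgebra

/-! ### Contractions of tensors: translations, filtration and total degree. -/

namespace ChiralComplex

open VertexAlgebra

variable {V : Type*} [AddCommGroup V] [Module ℂ V] [VertexAlgebra V] {n : ℕ}

lemma contract_tprod (i j : Fin (n + 1)) (m : ℤ) (v : Fin (n + 2) → V) :
    contract i j m (PiTensorProduct.tprod ℂ v) = PiTensorProduct.tprod ℂ (contractFun i j m v) := by
  rw [contract, PiTensorProduct.lift.tprod]
  rfl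

lemma translationAt_tprod (i : Fin (n + 1)) (v : Fin (n + 1) → V) :
    translationAt i (PiTensorProduct.tprod ℂ v) =
      PiTensorProduct.tprod ℂ (Function.update v i (translation (v i))) := by
  rw [translationAt, PiTensorProduct.map_tprod]
  congr 1
  funext k
  by_cases hk : k = i
  · subst hk
    simp
  · simp [hk]

lemma contract_translationAt_self (i j : Fin (n + 1)) (m : ℤ) (w : TPow V (n + 1)) :
    contract i j m (translationAt i.castSucc w) = -(m : ℂ) • contract i j (m - 1) w := by
  induction w using PiTensorProduct.induction_on with
  | smul_tprod c v =>
    rw [map_smul, map_smul, map_smul, smul_comm]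
    congr 1
    rw [translationAt_tprod, contract_tprod, contract_tprod, contractFun_update_same,
      translation_prod_eq, ← Int.cast_smul_eq_zsmul ℂ, MultilinearMap.map_update_smul, Int.cast_neg]
    rfl
  | add x y hx hy => rw [map_add, map_add, map_add, hx, hy, smul_add]

/-- The correction for `j = k` is the commutator of `T` with the mode `(m)`. -/
lemma contract_translationAt_succAbove (i j k : Fin (n + 1)) (m : ℤ) (w : TPow V (n + 1)) :
    contract i j m (translationAt (i.castSucc.succAbove k) w) =
      translationAt k (contract i j m w) + if j = k then (m : ℂ) • contract i j (m - 1) w else 0 := by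
  induction w using PiTensorProduct.induction_on with
  | smul_tprod c v =>
    have h : contract i j m (translationAt (i.castSucc.succAbove k) (PiTensorProduct.tprod ℂ v)) =
        translationAt k (contract i j m (PiTensorProduct.tprod ℂ v)) +
          if j = k then (m : ℂ) • contract i j (m - 1) (PiTensorProduct.tprod ℂ v) else 0 := by
      rw [translationAt_tprod, contract_tprod, contract_tprod, contract_tprod, translationAt_tprod]
      by_cases hk : j = k
      · subst hk
        rw [contractFun_update_target, if_pos rfl, prod_translation,
          MultilinearMap.map_update_add, ← Int.cast_smul_eq_zsmul ℂ,
          MultilinearMap.map_update_smul]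
        congr 2
        simp [contractFun]
      · rw [if_neg hk, add_zero, contractFun_update_other i j m v (Ne.symm hk)]
        congr 2
        simp [contractFun, Ne.symm hk]
    simp only [map_smul, h, smul_add]
    congr 1
    split_ifs
    · rw [smul_comm]
    · rw [smul_zero]
  | add x y hx hy =>
    simp only [map_add, hx, hy]
    split_ifs
    · rw [smul_add]
      abel
    · abel

section Filtration

variable {ι : Type*} {a : ι → V} {Δ : ι → ℕ}

/-- Used for the filtration, where `c` is `1` or `0` according to the sign of the mode, and for the
conformal degree, where `c = m + 1`. -/
lemma sum_contract_degrees {M : Type*} [AddCommGroup M] (i j : Fin (n + 1)) (δ : Fin (n + 2) → M)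
    (c : M) :
    ∑ k, Function.update (fun k => δ (i.castSucc.succAbove k)) j
      (δ i.castSucc + δ (i.castSucc.succAbove j) - c) k = ∑ k, δ k - c := by
  rw [Finset.sum_update_of_mem (Finset.mem_univ j), Fin.sum_univ_succAbove δ i.castSucc,
    ← Finset.add_sum_erase _ (fun k => δ (i.castSucc.succAbove k)) (Finset.mem_univ j),
    Finset.sdiff_singleton_eq_erase]
  abel

lemma tprod_mem_tensorFiltration {V : Type*} [AddCommGroup V] [Module ℂ V]
    {F : ℤ → Submodule ℂ V} {v : Fin (n + 1) → V}
    {δ : Fin (n + 1) → ℤ} (h : ∀ k, v k ∈ F (δ k)) {q : ℤ} (hq : ∑ k, δ k ≤ q) :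
    PiTensorProduct.tprod ℂ v ∈ tensorFiltration F n q :=
  Submodule.subset_span ⟨v, δ, h, hq, rfl⟩

lemma tensorFiltration_mono {V : Type*} [AddCommGroup V] [Module ℂ V]
    {F : ℤ → Submodule ℂ V} {q q' : ℤ} (h : q ≤ q') :
    tensorFiltration F n q ≤ tensorFiltration F n q' :=
  Submodule.span_mono fun _ ⟨v, δ, h1, h2, e⟩ => ⟨v, δ, h1, h2.trans h, e⟩

lemma contract_mem_tensorFiltration (𝒱 : Grading V) (hΔ : ∀ i, a i ∈ 𝒱.component (Δ i))
    (hgen : StronglyGenerates a) (i j : Fin (n + 1)) (m : ℤ) {q : ℤ} {w : TPow V (n + 1)}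
    (hw : w ∈ tensorFiltration (standardFiltration a Δ) (n + 1) q) :
    contract i j m w ∈
      tensorFiltration (standardFiltration a Δ) n (if 0 ≤ m then q - 1 else q) := by
  refine (Submodule.span_le.2 ?_ : tensorFiltration (standardFiltration a Δ) (n + 1) q ≤
    (tensorFiltration (standardFiltration a Δ) n (if 0 ≤ m then q - 1 else q)).comap
      (contract i j m)) hw
  rintro w ⟨v, δ, hv, hδ, rfl⟩
  change contract i j m (PiTensorProduct.tprod ℂ v) ∈
    tensorFiltration (standardFiltration a Δ) n (if 0 ≤ m then q - 1 else q)
  rw [contract_tprod]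
  refine tprod_mem_tensorFiltration (δ := Function.update (fun k => δ (i.castSucc.succAbove k)) j
      (δ i.castSucc + δ (i.castSucc.succAbove j) - if 0 ≤ m then 1 else 0)) (fun k => ?_) ?_
  · by_cases hk : k = j
    · subst hk
      simp only [contractFun, Function.update_self]
      have := prod_mem_standardFiltration 𝒱 hΔ hgen (hv i.castSucc) (hv (i.castSucc.succAbove k)) m
      split_ifs with hm
      · exact this.2 hm
      · rw [sub_zero]
        exact this.1
    · simp only [contractFun, Function.update_of_ne hk]
      exact hv _
  · rw [sum_contract_degrees]
    split_ifs
    · exact Int.sub_le_sub_right hδ 1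
    · rw [sub_zero]
      exact hδ

/-- The filtration of the tensor power is spanned by tensors of monomials. -/
lemma tensorFiltration_le_span_monomial (q : ℤ) :
    tensorFiltration (standardFiltration a Δ) n q ≤ Submodule.span ℂ
      {w | ∃ l : Fin (n + 1) → List (ι × ℕ), ∑ k, weight Δ (l k) ≤ q ∧
        PiTensorProduct.tprod ℂ (fun k => monomial a (l k)) = w} := by
  refine Submodule.span_le.2 ?_
  rintro w ⟨v, δ, hv, hδ, rfl⟩
  refine (PiTensorProduct.tprod ℂ).mem_of_forall_mem_span _
    (fun k => {x | ∃ l : List (ι × ℕ), weight Δ l ≤ δ k ∧ monomial a l = x}) (fun v hv => ?_) v hv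
  choose l hl hlv using hv
  obtain rfl : (fun k => monomial a (l k)) = v := funext hlv
  exact Submodule.subset_span ⟨l, (Finset.sum_le_sum fun k _ => hl k).trans hδ, rfl⟩

end Filtration

section Grading

variable (𝒱 : Grading V)

lemma linearMap_ext_homogeneous {N : Type*} [AddCommGroup N] [Module ℂ N] {f g : TPow V n →ₗ[ℂ] N}
    (h : ∀ (v : Fin (n + 1) → V) (δ : Fin (n + 1) → ℕ), (∀ k, v k ∈ 𝒱.component (δ k)) →
      f (PiTensorProduct.tprod ℂ v) = g (PiTensorProduct.tprod ℂ v)) : f = g := by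
  refine PiTensorProduct.ext (MultilinearMap.ext fun v => ?_)
  have := ((f - g).compMultilinearMap (PiTensorProduct.tprod ℂ)).mem_of_forall_mem_span ⊥
    (fun _ => 𝒱.homogeneous) (fun v hv => ?_) v (fun k => by rw [𝒱.span_homogeneous]; trivial)
  · rw [Submodule.mem_bot] at this
    exact sub_eq_zero.1 this
  · choose δ hδ using hv
    rw [Submodule.mem_bot]
    exact sub_eq_zero.2 (h v δ hδ)

/-- The projection of the tensor power to the component of total degree `s`. -/
def totalProj (s : ℤ) : TPow V n →ₗ[ℂ] TPow V n :=
  -- For negative `s` the number `s.toNat` is `0`; the extra condition then makes the sum empty.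
  ∑ δ ∈ Finset.piAntidiag Finset.univ s.toNat with ∑ k, (δ k : ℤ) = s,
    PiTensorProduct.map fun k => 𝒱.proj (δ k)

lemma totalProj_tprod (s : ℤ) {v : Fin (n + 1) → V} {δ : Fin (n + 1) → ℕ}
    (hv : ∀ k, v k ∈ 𝒱.component (δ k)) :
    totalProj 𝒱 s (PiTensorProduct.tprod ℂ v) =
      if ∑ k, (δ k : ℤ) = s then PiTensorProduct.tprod ℂ v else 0 := by
  have hterm : ∀ δ' : Fin (n + 1) → ℕ, PiTensorProduct.map (fun k => 𝒱.proj (δ' k))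
      (PiTensorProduct.tprod ℂ v) = if δ' = δ then PiTensorProduct.tprod ℂ v else 0 := by
    intro δ'
    rw [PiTensorProduct.map_tprod]
    split_ifs with h
    · subst h
      congr 1
      funext k
      rw [𝒱.proj_of_mem (hv k), if_pos rfl]
    · obtain ⟨k, hk⟩ := Function.ne_iff.1 h
      refine MultilinearMap.map_coord_zero _ k ?_
      rw [𝒱.proj_of_mem (hv k), if_neg (Ne.symm hk)]
  rw [totalProj, LinearMap.sum_apply, Finset.sum_congr rfl fun δ' _ => hterm δ',
    Finset.sum_ite_eq' _ δ]
  congr 1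
  rw [Finset.mem_filter, Finset.mem_piAntidiag]
  refine propext ⟨fun h => h.2, fun h => ⟨⟨?_, fun _ _ => Finset.mem_univ _⟩, h⟩⟩
  rw [← h]
  exact_mod_cast (Int.toNat_natCast (∑ k, δ k)).symm

/-- Contraction by the mode `(m)` lowers the total degree by `m + 1`; in particular the mode `(-1)`
commutes with the projections. -/
lemma totalProj_contract (s m : ℤ) (i j : Fin (n + 1)) (w : TPow V (n + 1)) :
    totalProj 𝒱 s (contract i j m w) = contract i j m (totalProj 𝒱 (s + m + 1) w) := by
  suffices H : totalProj 𝒱 s ∘ₗ contract i j m = contract i j m ∘ₗ totalProj 𝒱 (s + m + 1) from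
    LinearMap.congr_fun H w
  refine linearMap_ext_homogeneous 𝒱 fun v δ hv => ?_
  rw [LinearMap.comp_apply, LinearMap.comp_apply, totalProj_tprod 𝒱 _ hv, contract_tprod]
  rcases 𝒱.prod_mem_or_eq_zero (hv i.castSucc) (hv (i.castSucc.succAbove j)) m with h | ⟨r, hr, h⟩
  · have h0 : PiTensorProduct.tprod ℂ (contractFun i j m v) = 0 :=
      MultilinearMap.map_coord_zero _ j (by simp [contractFun, h])
    rw [h0, map_zero]
    split_ifs
    · rw [contract_tprod, h0]
    · rw [map_zero]
  · have hδ : ∀ k, contractFun i j m v k ∈ 𝒱.component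
        (Function.update (fun k => δ (i.castSucc.succAbove k)) j r k) := by
      intro k
      by_cases hk : k = j
      · subst hk
        simpa [contractFun] using h
      · simpa [contractFun, hk] using hv _
    rw [totalProj_tprod 𝒱 _ hδ]
    have hsum : ∑ k, ((Function.update (fun k => δ (i.castSucc.succAbove k)) j r k : ℕ) : ℤ) =
        ∑ k, (δ k : ℤ) - (m + 1) := by
      rw [← sum_contract_degrees i j (fun k => (δ k : ℤ)) (m + 1)]
      refine Finset.sum_congr rfl fun k _ => ?_
      by_cases hk : k = j
      · subst hk
        rw [Function.update_self, Function.update_self, hr]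
        ring
      · rw [Function.update_of_ne hk, Function.update_of_ne hk]
    rw [hsum]
    by_cases hs : ∑ k, (δ k : ℤ) = s + m + 1
    · rw [if_pos hs, if_pos (by rw [hs]; ring), contract_tprod]
    · rw [if_neg hs, if_neg (fun h => hs (by rw [← h]; ring)), map_zero]

lemma totalProj_translationAt (s : ℤ) (i : Fin (n + 1)) (w : TPow V n) :
    totalProj 𝒱 s (translationAt i w) = translationAt i (totalProj 𝒱 (s - 1) w) := by
  suffices H : totalProj 𝒱 s ∘ₗ translationAt i = translationAt i ∘ₗ totalProj 𝒱 (s - 1) from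
    LinearMap.congr_fun H w
  refine linearMap_ext_homogeneous 𝒱 fun v δ hv => ?_
  rw [LinearMap.comp_apply, LinearMap.comp_apply, totalProj_tprod 𝒱 _ hv, translationAt_tprod]
  have hδ : ∀ k, Function.update v i (translation (v i)) k ∈ 𝒱.component
      (Function.update δ i (δ i + 1) k) := by
    intro k
    by_cases hk : k = i
    · subst hk
      simpa using 𝒱.translation_mem _ _ (hv k)
    · simpa [hk] using hv k
  rw [totalProj_tprod 𝒱 _ hδ]
  have hsum : ∑ k, ((Function.update δ i (δ i + 1) k : ℕ) : ℤ) = ∑ k, (δ k : ℤ) + 1 := by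
    have : ∀ k, ((Function.update δ i (δ i + 1) k : ℕ) : ℤ) = δ k + if k = i then 1 else 0 := by
      intro k
      by_cases hk : k = i
      · subst hk
        simp
      · simp [hk]
    simp [this, Finset.sum_add_distrib]
  rw [hsum]
  by_cases hs : ∑ k, (δ k : ℤ) = s - 1
  · rw [if_pos hs, if_pos (by rw [hs]; ring), translationAt_tprod]
  · rw [if_neg hs, if_neg (fun h => hs (by rw [← h]; ring)), map_zero]

end Grading

end ChiralComplex

/-! ### Multiderivations and exterior powers of Kähler differentials. -/

/-- Linear maps out of an `R`-algebra with values in a vector space, with the `R`-module structure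
given by precomposition. -/
def CoinducedModule (K R Q : Type*) [CommRing K] [CommRing R] [Algebra K R] [AddCommGroup Q]
    [Module K Q] : Type _ := R →ₗ[K] Q

namespace CoinducedModule

variable {K R Q : Type*} [CommRing K] [CommRing R] [Algebra K R] [AddCommGroup Q] [Module K Q]

instance : AddCommGroup (CoinducedModule K R Q) := inferInstanceAs (AddCommGroup (R →ₗ[K] Q))

instance : Module K (CoinducedModule K R Q) := inferInstanceAs (Module K (R →ₗ[K] Q))

/-- The linear map underlying an element of the coinduced module. -/
def toLinearMap (f : CoinducedModule K R Q) : R →ₗ[K] Q := f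

instance : SMul R (CoinducedModule K R Q) :=
  ⟨fun r f => (f.toLinearMap.comp (LinearMap.mulLeft K r) : R →ₗ[K] Q)⟩

lemma ext {f g : CoinducedModule K R Q} (h : ∀ x, f.toLinearMap x = g.toLinearMap x) : f = g :=
  LinearMap.ext h

lemma toLinearMap_smul (r x : R) (f : CoinducedModule K R Q) :
    (r • f).toLinearMap x = f.toLinearMap (r * x) := rfl

lemma toLinearMap_add (x : R) (f g : CoinducedModule K R Q) :
    (f + g).toLinearMap x = f.toLinearMap x + g.toLinearMap x := rfl

instance : Module R (CoinducedModule K R Q) where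
  one_smul f := ext fun x => by rw [toLinearMap_smul, one_mul]
  mul_smul r s f := ext fun x => by
    simp only [toLinearMap_smul]
    congr 1
    ring
  smul_zero r := ext fun x => rfl
  smul_add r f g := ext fun x => rfl
  add_smul r s f := ext fun x => by
    rw [toLinearMap_add, toLinearMap_smul, toLinearMap_smul, toLinearMap_smul, add_mul, map_add]
  zero_smul f := ext fun x => by
    rw [toLinearMap_smul, zero_mul, map_zero]
    rfl

/-- Evaluation of an element of the coinduced module. -/
def eval (x : R) : CoinducedModule K R Q →ₗ[K] Q :=
  (LinearMap.applyₗ x : (R →ₗ[K] Q) →ₗ[K] Q)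

lemma eval_smul (r x : R) (f : CoinducedModule K R Q) : eval x (r • f) = eval (r * x) f := rfl

instance : IsScalarTower K R (CoinducedModule K R Q) where
  smul_assoc k r f := ext fun x => by
    rw [toLinearMap_smul, smul_mul_assoc, map_smul]
    rfl

end CoinducedModule

section Kaehler

variable {K R N : Type*} [CommRing K] [CommRing R] [Algebra K R] [AddCommGroup N] [Module K N]
  [Module R N] [IsScalarTower K R N]

lemma MultilinearMap.ext_kaehler {n : ℕ} {N : Type*} [AddCommGroup N] [Module R N]
    {f g : MultilinearMap R (fun _ : Fin n => Ω[R⁄K]) N}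
    (h : ∀ a : Fin n → R, f (fun i => KaehlerDifferential.D K R (a i)) =
      g (fun i => KaehlerDifferential.D K R (a i))) : f = g := by
  refine MultilinearMap.ext fun v => sub_eq_zero.1 ?_
  have := (f - g).mem_of_forall_mem_span ⊥
    (fun _ => Set.range (KaehlerDifferential.D K R)) (fun v hv => ?_) v
    (fun i => by rw [KaehlerDifferential.span_range_derivation]; trivial)
  · simpa using this
  · choose a ha using hv
    obtain rfl : (fun i => KaehlerDifferential.D K R (a i)) = v := funext ha
    rw [Submodule.mem_bot]
    exact sub_eq_zero.2 (h a)

/-- A multilinear map which is a derivation in each argument factors through the Kähler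
differentials. -/
theorem exists_multilinearMap_kaehler {n : ℕ} (θ : MultilinearMap K (fun _ : Fin n => R) N)
    (hθ : ∀ (a : Fin n → R) (i : Fin n) (x y : R), θ (Function.update a i (x * y)) =
      x • θ (Function.update a i y) + y • θ (Function.update a i x)) :
    ∃ Θ : MultilinearMap R (fun _ : Fin n => Ω[R⁄K]) N,
      ∀ a : Fin n → R, Θ (fun i => KaehlerDifferential.D K R (a i)) = θ a := by
  induction n with
  | zero =>
    refine ⟨MultilinearMap.constOfIsEmpty R _ (θ 0), fun a => ?_⟩
    rw [MultilinearMap.constOfIsEmpty_apply]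
    exact congrArg θ (Subsingleton.elim _ _)
  | succ n ih =>
    have hcons : ∀ (x : R) (a : Fin n → R), θ.curryLeft x a = θ (Fin.cons x a) := fun _ _ => rfl
    choose T hT using fun x : R => ih (θ.curryLeft x) fun a i y z => by
      simp only [hcons, Fin.cons_update]
      exact hθ _ _ _ _
    have : IsScalarTower K R (MultilinearMap R (fun _ : Fin n => Ω[R⁄K]) N) :=
      ⟨fun k r f => MultilinearMap.ext fun v => smul_assoc k r (f v)⟩
    -- Fixing the first argument `x`, induction gives a multilinear map `T x` in the remaining ones.
    -- As `T` is a derivation in `x`, it factors through the differentials, and uncurrying finishes.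
    let D : Derivation K R (MultilinearMap R (fun _ : Fin n => Ω[R⁄K]) N) :=
      Derivation.mk'
        { toFun := T
          map_add' := fun x y => MultilinearMap.ext_kaehler fun a => by
            rw [_root_.add_apply, hT, hT, hT, map_add, _root_.add_apply]
          map_smul' := fun c x => MultilinearMap.ext_kaehler fun a => by
            rw [RingHom.id_apply, _root_.smul_apply, hT, hT, map_smul, _root_.smul_apply] }
        (fun x y => MultilinearMap.ext_kaehler fun a => by
          change T (x * y) _ = x • T y _ + y • T x _
          rw [hT, hT, hT, hcons, hcons, hcons]
          have := hθ (Fin.cons 0 a) 0 x y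
          simpa only [Fin.update_cons_zero] using this)
    refine ⟨LinearMap.uncurryLeft D.liftKaehlerDifferential, fun a => ?_⟩
    rw [LinearMap.uncurryLeft_apply, Derivation.liftKaehlerDifferential_comp_D]
    change T (a 0) _ = _
    refine (hT (a 0) (Fin.tail a)).trans ?_
    rw [hcons, Fin.cons_self_tail]

/-- A multilinear map which is a derivation in each argument and antisymmetric in neighbouring
arguments factors through the exterior power of the Kähler differentials. -/
theorem exists_linearMap_exteriorPower_kaehler [Invertible (2 : R)] {n : ℕ}
    (θ : MultilinearMap K (fun _ : Fin n => R) N)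
    (hθ : ∀ (a : Fin n → R) (i : Fin n) (x y : R), θ (Function.update a i (x * y)) =
      x • θ (Function.update a i y) + y • θ (Function.update a i x))
    (hswap : ∀ (a : Fin n → R) (i j : Fin n), (i : ℕ) + 1 = j →
      θ (a ∘ Equiv.swap i j) = -θ a) :
    ∃ Ψ : ⋀[R]^n (Ω[R⁄K]) →ₗ[R] N, ∀ a : Fin n → R,
      Ψ (exteriorPower.ιMulti R n fun i => KaehlerDifferential.D K R (a i)) = θ a := by
  obtain ⟨Θ, hΘ⟩ := exists_multilinearMap_kaehler θ hθ
  have hperm : ∀ σ : Equiv.Perm (Fin n), Θ.domDomCongr σ = (Equiv.Perm.sign σ : ℤ) • Θ := by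
    have hsw : ∀ i j : Fin n, (i : ℕ) + 1 = j → Θ.domDomCongr (Equiv.swap i j) = -Θ := by
      intro i j hij
      refine MultilinearMap.ext_kaehler fun a => ?_
      rw [MultilinearMap.domDomCongr_apply, _root_.neg_apply, hΘ a, ← hswap a i j hij]
      exact hΘ (a ∘ Equiv.swap i j)
    cases n with
    | zero =>
      intro σ
      rw [Subsingleton.elim σ 1]
      ext v
      simp
    | succ n =>
      intro σ
      have hσ : σ ∈ Submonoid.closure
          (Set.range fun i : Fin n => Equiv.swap i.castSucc i.succ) := by
        rw [Equiv.Perm.mclosure_swap_castSucc_succ]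
        trivial
      induction hσ using Submonoid.closure_induction with
      | mem σ hσ =>
        obtain ⟨i, rfl⟩ := hσ
        rw [hsw _ _ (by simp), Equiv.Perm.sign_swap (Fin.castSucc_lt_succ).ne]
        simp
      | one => ext v; simp
      | mul σ τ _ _ hσ hτ =>
        have e : Θ.domDomCongr (σ * τ) = (Θ.domDomCongr τ).domDomCongr σ := by
          ext v
          rfl
        rw [e, hτ]
        have e2 : ((Equiv.Perm.sign τ : ℤ) • Θ).domDomCongr σ =
            (Equiv.Perm.sign τ : ℤ) • Θ.domDomCongr σ := by
          ext v
          rfl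
        rw [e2, hσ, smul_smul, map_mul, mul_comm (Equiv.Perm.sign σ)]
        push_cast
        rfl
  let A : (Ω[R⁄K]) [⋀^Fin n]→ₗ[R] N :=
    { Θ with
      map_eq_zero_of_eq' := fun v i j hv hij => by
        have h := congrArg (fun F => F v) (hperm (Equiv.swap i j))
        simp only [MultilinearMap.domDomCongr_apply, Equiv.Perm.sign_swap hij,
          _root_.smul_apply] at h
        have e : (fun k => v (Equiv.swap i j k)) = v := by
          funext k
          by_cases hki : k = i
          · subst hki
            rw [Equiv.swap_apply_left, hv]
          · by_cases hkj : k = j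
            · subst hkj
              rw [Equiv.swap_apply_right, hv]
            · rw [Equiv.swap_apply_of_ne_of_ne hki hkj]
        rw [e] at h
        -- Antisymmetry for two equal arguments gives only `2Θ(v) = 0`; this is where `2` has to be
        -- invertible.
        have h2 : (2 : R) • Θ v = 0 := by
          rw [two_smul]
          nth_rewrite 1 [h]
          simp
        have h3 := congrArg (fun x => (⅟2 : R) • x) h2
        simpa [smul_smul] using h3 }
  refine ⟨exteriorPower.alternatingMapLinearEquiv A, fun a => ?_⟩
  rw [exteriorPower.alternatingMapLinearEquiv_apply_ιMulti]
  exact hΘ a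

/-- The form of `exists_linearMap_exteriorPower_kaehler` with one further linear argument. -/
theorem exists_linearMap_of_multiderivation {Q : Type*} [AddCommGroup Q] [Module K Q]
    [Invertible (2 : R)] {n : ℕ} (ψ : MultilinearMap K (fun _ : Fin n => R) (R →ₗ[K] Q))
    (hψ : ∀ (a : Fin n → R) (i : Fin n) (x y b : R), ψ (Function.update a i (x * y)) b =
      ψ (Function.update a i y) (x * b) + ψ (Function.update a i x) (y * b))
    (hswap : ∀ (a : Fin n → R) (i j : Fin n) (b : R), (i : ℕ) + 1 = j →
      ψ (a ∘ Equiv.swap i j) b = -ψ a b) :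
    ∃ Ψ : ⋀[R]^n (Ω[R⁄K]) →ₗ[K] Q, ∀ (b : R) (a : Fin n → R),
      Ψ (b • exteriorPower.ιMulti R n fun i => KaehlerDifferential.D K R (a i)) = ψ a b := by
  -- With values in `Hom_K(R, Q)`, on which `R` acts by precomposition, the twisted Leibniz rule for
  -- `ψ` becomes an honest Leibniz rule over `R`. Evaluation at `1` returns to `Q`.
  let θ : MultilinearMap K (fun _ : Fin n => R) (CoinducedModule K R Q) := ψ
  obtain ⟨Ψ, hΨ⟩ := exists_linearMap_exteriorPower_kaehler θ
    (fun a i x y => LinearMap.ext fun b => hψ a i x y b)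
    (fun a i j hij => LinearMap.ext fun b => hswap a i j b hij)
  refine ⟨(CoinducedModule.eval 1).comp (Ψ.restrictScalars K), fun b a => ?_⟩
  change CoinducedModule.eval 1 (Ψ _) = _
  rw [map_smul, CoinducedModule.eval_smul, mul_one, hΨ]
  rfl

end Kaehler

/-- An alternating map evaluated on a family from which the entry `i` was removed and put in the
place of a later entry. -/
lemma AlternatingMap.map_update_removeNth {R M N : Type*} [CommRing R] [AddCommGroup M]
    [AddCommGroup N] [Module R M] [Module R N] {n : ℕ} (g : M [⋀^Fin n]→ₗ[R] N)
    (y : Fin (n + 1) → M) (i : Fin (n + 1)) (k : Fin n) (h : i ≤ k.castSucc) :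
    (-1 : ℤ) ^ (i : ℕ) • g (Function.update (i.removeNth y) k (y i)) =
      (-1 : ℤ) ^ (k : ℕ) • g (k.succ.removeNth y) := by
  have hne : i ≠ k.succ := (lt_of_le_of_lt h Fin.castSucc_lt_succ).ne
  -- Overwriting entry `k + 1` of `y` by `y i` creates two equal entries. Deleting one or the other
  -- of them gives the two sides, up to sign.
  have h1 := g.neg_one_pow_smul_map_removeNth_add_eq_zero_of_eq
    (v := Function.update y k.succ (y i)) (i := i) (j := k.succ) (by simp [hne]) hne
  have e1 : i.removeNth (Function.update y k.succ (y i)) =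
      Function.update (i.removeNth y) k (y i) := by
    rw [← Fin.succAbove_of_le_castSucc i k h, Fin.removeNth_update_succAbove]
  rw [e1, Fin.removeNth_update, Fin.val_succ, pow_succ, mul_neg_one, neg_smul,
    ← sub_eq_add_neg] at h1
  exact sub_eq_zero.1 h1

/-! ### The Weierstrass zeta function and its quasi-periods. -/

namespace PeriodPair

variable (L : PeriodPair)

/-- The term of the series of the Weierstrass zeta function attached to a lattice point. -/
def zetaTerm (l z : ℂ) : ℂ := 1 / (z - l) + 1 / l + z / l ^ 2

/-- The Weierstrass zeta function with the term of `l₀` omitted. -/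
def zetaExcept (l₀ z : ℂ) : ℂ := ∑' l : L.lattice, if l.1 = l₀ then 0 else zetaTerm l z

/-- The Weierstrass zeta function. -/
def zeta (z : ℂ) : ℂ := ∑' l : L.lattice, zetaTerm l z

/-- The term equals `s² / ((s - l) l²)`, so it decays like the inverse cube of `‖l‖`, which is
summable over a lattice of rank two. -/
lemma norm_zetaTerm_le {r : ℝ} (hr : 0 < r) {s : ℂ} (hs : ‖s‖ < r) {l : ℂ} (h : 2 * r ≤ ‖l‖) :
    ‖zetaTerm l s‖ ≤ 2 * r ^ 2 * ‖l‖ ^ (-3 : ℝ) := by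
  have hl : 0 < ‖l‖ := by linarith
  have hl0 : l ≠ 0 := norm_pos_iff.1 hl
  have hsl : ‖l‖ / 2 ≤ ‖s - l‖ := by
    rw [norm_sub_rev]
    exact le_trans (by linarith) (norm_sub_norm_le l s)
  have hsl0 : s - l ≠ 0 := norm_pos_iff.1 (by linarith)
  have h1 : zetaTerm l s = s ^ 2 / ((s - l) * l ^ 2) := by
    unfold zetaTerm
    field_simp
    ring
  calc ‖zetaTerm l s‖ = ‖s‖ ^ 2 / (‖s - l‖ * ‖l‖ ^ 2) := by rw [h1]; simp
    _ ≤ r ^ 2 / (‖l‖ / 2 * ‖l‖ ^ 2) := by gcongr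
    _ = 2 * r ^ 2 / ‖l‖ ^ 3 := by field_simp
    _ = _ := by
      rw [Real.rpow_neg hl.le, ← div_eq_mul_inv]
      norm_cast

lemma hasSumLocallyUniformly_zetaExcept (l₀ : ℂ) :
    HasSumLocallyUniformly
      (fun (l : L.lattice) (z : ℂ) ↦ if l.1 = l₀ then 0 else zetaTerm l z) (L.zetaExcept l₀) := by
  refine L.hasSumLocallyUniformly_aux (u := (2 * · ^ 2 * ‖·‖ ^ (-3 : ℝ))) _
    (fun _ _ ↦ (ZLattice.summable_norm_rpow _ _ (by simp; norm_num)).mul_left _) fun r hr ↦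
    Filter.eventually_atTop.mpr ⟨2 * r, ?_⟩
  rintro _ h s hs l rfl
  split_ifs
  · simp only [norm_zero]
    positivity
  · exact norm_zetaTerm_le hr hs h

lemma differentiableAt_zetaTerm {l z : ℂ} (h : z ≠ l) : DifferentiableAt ℂ (zetaTerm l) z := by
  unfold zetaTerm
  have : z - l ≠ 0 := sub_ne_zero.2 h
  fun_prop (disch := assumption)

lemma ne_of_mem_compl_lattice_sdiff {l₀ z : ℂ} {l : L.lattice} (hz : z ∈ ((L.lattice : Set ℂ) \ {l₀})ᶜ)
    (hl : l.1 ≠ l₀) : z ≠ l := by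
  rintro rfl
  exact hz ⟨l.2, hl⟩

lemma differentiableOn_zetaExcept (l₀ : ℂ) :
    DifferentiableOn ℂ (L.zetaExcept l₀) (L.lattice \ {l₀})ᶜ := by
  refine (L.hasSumLocallyUniformly_zetaExcept l₀).hasSumLocallyUniformlyOn.differentiableOn
    (.of_forall fun s ↦ .fun_sum fun i hi ↦ ?_) L.isOpen_compl_lattice_sdiff
  split_ifs with h
  · simp
  · exact fun z hz => (differentiableAt_zetaTerm
      (L.ne_of_mem_compl_lattice_sdiff hz h)).differentiableWithinAt

lemma analyticAt_zetaExcept (l₀ : ℂ) : AnalyticAt ℂ (L.zetaExcept l₀) l₀ :=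
  (L.differentiableOn_zetaExcept l₀).analyticOnNhd L.isOpen_compl_lattice_sdiff _ (by simp)

lemma zetaExcept_of_notMem {l₀ : ℂ} (h : l₀ ∉ L.lattice) : L.zetaExcept l₀ = L.zeta := by
  funext z
  refine tsum_congr fun l => if_neg ?_
  rintro rfl
  exact h l.2

lemma zetaExcept_add {l₀ : ℂ} (h : l₀ ∈ L.lattice) (z : ℂ) :
    L.zeta z = L.zetaExcept l₀ z + zetaTerm l₀ z := by
  have h1 := (L.hasSumLocallyUniformly_zetaExcept l₀).hasSum (x := z)
  have h2 : HasSum (fun l : L.lattice => if l.1 = l₀ then zetaTerm l z else 0)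
      (zetaTerm l₀ z) := by
    have := hasSum_ite_eq (⟨l₀, h⟩ : L.lattice) (zetaTerm l₀ z)
    convert this using 2 with l
    by_cases hl : l.1 = l₀
    · rw [if_pos hl, if_pos (Subtype.ext hl), hl]
    · rw [if_neg hl, if_neg (fun h => hl (congrArg Subtype.val h))]
  rw [← (h1.add h2).tsum_eq, zeta]
  refine tsum_congr fun l => ?_
  split_ifs <;> simp

lemma analyticAt_zeta {z : ℂ} (hz : z ∉ L.lattice) : AnalyticAt ℂ L.zeta z := by
  rw [← L.zetaExcept_of_notMem hz]
  exact L.analyticAt_zetaExcept z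

/-- At a lattice point the zeta function has a simple pole with residue `1`. -/
lemma exists_zeta_eq {l : ℂ} (hl : l ∈ L.lattice) :
    ∃ φ : ℂ → ℂ, AnalyticAt ℂ φ l ∧ ∀ z, L.zeta z = 1 / (z - l) + φ z := by
  -- For `l = 0` the quotients `1 / l` and `z / l ^ 2` are zero by convention, so this covers the
  -- pole at the origin too.
  refine ⟨fun z => L.zetaExcept l z + (1 / l + z / l ^ 2), ?_, fun z => ?_⟩
  · refine (L.analyticAt_zetaExcept l).add (analyticAt_const.add ?_)
    simp only [div_eq_mul_inv]
    exact analyticAt_id.mul analyticAt_const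
  · rw [L.zetaExcept_add hl, zetaTerm]
    ring

lemma zeta_neg (z : ℂ) : L.zeta (-z) = -L.zeta z := by
  unfold zeta
  rw [← tsum_neg, ← (Equiv.neg L.lattice).tsum_eq]
  refine tsum_congr fun l => ?_
  simp only [zetaTerm, Equiv.neg_apply, NegMemClass.coe_neg]
  rw [show -z - -(l : ℂ) = -(z - l) by ring, div_neg, div_neg, neg_sq, neg_div]
  ring

lemma deriv_zeta {z : ℂ} (hz : z ∉ L.lattice) : deriv L.zeta z = -L.weierstrassP z := by
  have hopen : IsOpen ((L.lattice : Set ℂ)ᶜ) := L.isClosed_lattice.isOpen_compl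
  -- Omitting the term of a point outside the lattice omits nothing; `ω₁ / 2` serves as such a
  -- point, so that the uniform convergence of `zetaExcept` applies to `zeta`.
  have e : L.zetaExcept (L.ω₁ / 2) = L.zeta := L.zetaExcept_of_notMem L.ω₁_div_two_notMem_lattice
  have hne : ∀ l : L.lattice, l.1 ≠ L.ω₁ / 2 := fun l h =>
    L.ω₁_div_two_notMem_lattice (h ▸ l.2)
  have h1 := (L.hasSumLocallyUniformly_zetaExcept (L.ω₁ / 2)).tendstoLocallyUniformlyOn (s := (L.lattice : Set ℂ)ᶜ)
  simp only [hne, if_false, e] at h1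
  have hd : ∀ l : L.lattice, ∀ w ∈ ((L.lattice : Set ℂ)ᶜ), DifferentiableAt ℂ (zetaTerm l) w :=
    fun l w hw => differentiableAt_zetaTerm (by rintro rfl; exact hw l.2)
  have h2 := (h1.deriv (.of_forall fun s => .fun_sum fun l _ => fun w hw =>
    (hd l w hw).differentiableWithinAt) hopen).tendsto_at hz
  have h3 := ((L.hasSum_weierstrassP z).neg)
  refine tendsto_nhds_unique (h2.congr fun s => ?_) h3
  simp only [Function.comp_apply]
  rw [deriv_fun_sum fun l _ => hd l z hz]
  refine Finset.sum_congr rfl fun l _ => ?_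
  have hzl : z - l ≠ 0 := sub_ne_zero.2 (by rintro rfl; exact hz l.2)
  have h4 : HasDerivAt (zetaTerm l) (-1 / (z - l) ^ 2 + 0 + 1 / (l : ℂ) ^ 2) z := by
    unfold zetaTerm
    have hs := ((hasDerivAt_id z).sub_const (l : ℂ))
    have h5 : HasDerivAt (fun w : ℂ => 1 / (w - l)) (-1 / (z - l) ^ 2) z := by
      simpa [one_div] using hs.fun_inv hzl
    simpa using (h5.add_const (1 / (l : ℂ))).fun_add ((hasDerivAt_id z).div_const ((l : ℂ) ^ 2))
  rw [h4.deriv]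
  ring

lemma isPreconnected_compl_lattice : IsPreconnected ((L.lattice : Set ℂ)ᶜ) := by
  have hc : (L.lattice : Set ℂ).Countable := by
    have : Countable L.lattice := L.latticeEquivProd.toEquiv.countable_iff.2 inferInstance
    exact Set.to_countable _
  exact (hc.isPathConnected_compl_of_one_lt_rank
    (by rw [Complex.rank_real_complex]; norm_num)).isConnected.isPreconnected

lemma add_mem_lattice_iff {l : ℂ} (hl : l ∈ L.lattice) (z : ℂ) :
    z + l ∈ L.lattice ↔ z ∈ L.lattice := Submodule.add_mem_iff_left _ hl

/-- The quasi-period of the zeta function. -/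
def eta (l : ℂ) : ℂ := L.zeta (L.ω₁ / 2 + l) - L.zeta (L.ω₁ / 2)

/-- The derivative of `ζ(z + l) - ζ(z)` is a difference of values of the periodic function `℘`,
hence zero, and the complement of the lattice is connected. -/
lemma zeta_add {l : ℂ} (hl : l ∈ L.lattice) {z : ℂ} (hz : z ∉ L.lattice) :
    L.zeta (z + l) = L.zeta z + L.eta l := by
  have hopen : IsOpen ((L.lattice : Set ℂ)ᶜ) := L.isClosed_lattice.isOpen_compl
  have hd : ∀ w ∈ ((L.lattice : Set ℂ)ᶜ),
      HasDerivAt (fun z => L.zeta (z + l) - L.zeta z) 0 w := by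
    intro w hw
    have hw' : w + l ∉ L.lattice := by rwa [L.add_mem_lattice_iff hl]
    have h1 := (L.analyticAt_zeta hw').differentiableAt.hasDerivAt.comp_add_const w l
    have h2 := (L.analyticAt_zeta hw).differentiableAt.hasDerivAt
    have h3 := h1.sub h2
    rw [L.deriv_zeta hw, L.deriv_zeta hw', L.weierstrassP_add_coe w ⟨l, hl⟩, sub_self] at h3
    exact h3
  have h := hopen.is_const_of_deriv_eq_zero L.isPreconnected_compl_lattice
    (fun w hw => (hd w hw).differentiableAt.differentiableWithinAt)
    (fun w hw => (hd w hw).deriv) hz L.ω₁_div_two_notMem_lattice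
  rw [eta, ← h]
  ring

/-- Every point is congruent modulo the lattice to a point of a fixed compact set. -/
lemma exists_isCompact_translate :
    ∃ K : Set ℂ, IsCompact K ∧ ∀ z : ℂ, ∃ l ∈ L.lattice, z + l ∈ K := by
  refine ⟨Metric.closedBall 0 (∑ i, ‖L.basis i‖), isCompact_closedBall _ _, fun z => ?_⟩
  refine ⟨-(ZSpan.floor L.basis z : ℂ), ?_, ?_⟩
  · rw [L.lattice_eq_span_range_basis]
    exact neg_mem (ZSpan.floor L.basis z).2
  · rw [mem_closedBall_zero_iff, ← sub_eq_add_neg, ← ZSpan.fract_apply]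
    exact ZSpan.norm_fract_le _ _

end PeriodPair

/-- A function on a dense set which extends analytically near every point extends analytically. -/
lemma exists_analytic_extension {E : Type*} [NormedAddCommGroup E] [NormedSpace ℂ E] {C : Set E}
    (hC : Dense C) {u : E → ℂ}
    (hu : ∀ p, ∃ φ : E → ℂ, AnalyticAt ℂ φ p ∧ ∀ᶠ x in 𝓝 p, x ∈ C → u x = φ x) :
    ∃ U : E → ℂ, (∀ p, AnalyticAt ℂ U p) ∧ ∀ x ∈ C, u x = U x := by
  choose φ hφ he using hu
  -- The value at `p` is that of the local extension at `p`. Near `p` the extensions centred at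
  -- different points agree, since they coincide with `u` on a dense set.
  refine ⟨fun p => φ p p, fun p => ?_, fun x hx => (he x).self_of_nhds hx⟩
  refine (hφ p).congr ?_
  filter_upwards [(he p).eventually_nhds, (hφ p).eventually_analyticAt] with q hq hqa
  have hne : (𝓝[C] q).NeBot := mem_closure_iff_nhdsWithin_neBot.1 (hC q)
  have h1 : Tendsto (φ p) (𝓝[C] q) (𝓝 (φ p q)) :=
    hqa.continuousAt.tendsto.mono_left nhdsWithin_le_nhds
  have h2 : Tendsto (φ q) (𝓝[C] q) (𝓝 (φ q q)) :=
    (hφ q).continuousAt.tendsto.mono_left nhdsWithin_le_nhds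
  refine tendsto_nhds_unique (h1.congr' ?_) h2
  filter_upwards [nhdsWithin_le_nhds hq, nhdsWithin_le_nhds (he q), self_mem_nhdsWithin]
    with x hx1 hx2 hxC
  rw [← hx1 hxC, hx2 hxC]

namespace PeriodPair

variable (L : PeriodPair)

/-- Liouville's theorem for functions on a power of an elliptic curve. -/
lemma eq_of_periodic_of_differentiable {n : ℕ} {U : (Fin n → ℂ) → ℂ} (hU : Differentiable ℂ U)
    (hp : ∀ x l : Fin n → ℂ, (∀ i, l i ∈ L.lattice) → U (x + l) = U x) (x y : Fin n → ℂ) :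
    U x = U y := by
  obtain ⟨K, hK, hKl⟩ := L.exists_isCompact_translate
  have hK' : IsCompact (Set.univ.pi fun _ : Fin n => K) := isCompact_univ_pi fun _ => hK
  refine hU.apply_eq_apply_of_bounded ?_ x y
  refine (hK'.image hU.continuous).isBounded.subset ?_
  rintro _ ⟨z, rfl⟩
  choose l hl hlK using fun i => hKl (z i)
  exact ⟨z + l, fun i _ => hlK i, hp z l hl⟩

/-- Liouville's theorem for elliptic functions. -/
lemma eq_of_periodic_of_differentiable_one {U : ℂ → ℂ} (hU : Differentiable ℂ U)
    (hp : ∀ z, ∀ l ∈ L.lattice, U (z + l) = U z) (x y : ℂ) : U x = U y := by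
  obtain ⟨K, hK, hKl⟩ := L.exists_isCompact_translate
  refine hU.apply_eq_apply_of_bounded ?_ x y
  refine (hK.image hU.continuous).isBounded.subset ?_
  rintro _ ⟨z, rfl⟩
  obtain ⟨l, hl, hlK⟩ := hKl z
  exact ⟨z + l, hlK, hp z l hl⟩

lemma ω₂_add_ω₁_div_two_notMem_lattice : L.ω₂ / 2 + L.ω₁ / 2 ∉ L.lattice := by
  have := (L.mul_ω₁_add_mul_ω₂_mem_lattice (α := 1 / 2) (β := 1 / 2)).not.mpr (by norm_num)
  convert this using 2
  push_cast
  ring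

lemma dense_compl_of_countable {Z : Set ℂ} (hZ : Z.Countable) : Dense Zᶜ :=
  hZ.dense_compl ℝ

lemma countable_lattice : (L.lattice : Set ℂ).Countable := by
  have : Countable L.lattice := L.latticeEquivProd.toEquiv.countable_iff.2 inferInstance
  exact Set.to_countable _

/-- The quasi-periods of the zeta function are not a complex linear function on the lattice. -/
lemma eta_not_linear (α : ℂ) : ¬ ∀ l ∈ L.lattice, L.eta l = α * l := by
  intro hα
  set w := L.ω₁ / 2 with hw
  have hwL : w ∉ L.lattice := L.ω₁_div_two_notMem_lattice
  have h2w : w + w ∈ L.lattice := by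
    rw [hw, add_halves]
    exact L.ω₁_mem_lattice
  -- If the quasi-periods were linear, `g` would be an odd elliptic function with a single simple
  -- pole modulo the lattice. Such a function is excluded by looking at its zeros at the
  -- half-periods.
  set g : ℂ → ℂ := fun z => L.zeta z - α * z with hg
  have hga : ∀ z ∉ L.lattice, AnalyticAt ℂ g z := fun z hz =>
    (L.analyticAt_zeta hz).sub (analyticAt_const.mul analyticAt_id)
  have hgp : ∀ l ∈ L.lattice, ∀ z ∉ L.lattice, g (z + l) = g z := by
    intro l hl z hz
    simp only [hg, L.zeta_add hl hz, hα l hl]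
    ring
  have hgn : ∀ z, g (-z) = -g z := fun z => by
    simp only [hg, L.zeta_neg]
    ring
  have hgz : ∀ v ∉ L.lattice, v + v ∈ L.lattice → g v = 0 := by
    intro v hv hvv
    have h1 := hgp _ hvv (-v) (by rwa [neg_mem_iff])
    rw [show -v + (v + v) = v by ring, hgn] at h1
    exact self_eq_neg.1 h1
  have hgl : ∀ l ∈ L.lattice, ∃ φ : ℂ → ℂ, AnalyticAt ℂ φ l ∧ ∀ z, g z = 1 / (z - l) + φ z := by
    intro l hl
    obtain ⟨φ, hφ, he⟩ := L.exists_zeta_eq hl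
    refine ⟨fun z => φ z - α * z, hφ.sub (analyticAt_const.mul analyticAt_id), fun z => ?_⟩
    simp only [hg, he]
    ring
  set C : Set ℂ := ((L.lattice : Set ℂ) ∪ (fun z => z + w) ⁻¹' (L.lattice : Set ℂ))ᶜ with hC
  have hCm : ∀ z, z ∈ C ↔ z ∉ L.lattice ∧ z + w ∉ L.lattice := fun z => by simp [hC]
  have hCd : Dense C := dense_compl_of_countable
    (L.countable_lattice.union (L.countable_lattice.preimage (add_left_injective w)))
  -- The zero of `g` at the half-period `w` cancels the simple pole at lattice points, so `h`
  -- extends to an entire elliptic function. It is also invariant under translation by `w`, which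
  -- reduces its poles at the translates of `w` to those at the lattice.
  set h : ℂ → ℂ := fun z => g z * g (z + w) with hh
  have hshift : ∀ z ∈ C, h (z + w) = h z := by
    intro z hz
    rw [hCm] at hz
    simp only [hh]
    rw [add_assoc, hgp _ h2w z hz.1, mul_comm]
  have hCw : ∀ z, z + w ∈ C ↔ z ∈ C := fun z => by
    rw [hCm, hCm, add_assoc, L.add_mem_lattice_iff h2w, and_comm]
  have hloc : ∀ l ∈ L.lattice, ∃ φ : ℂ → ℂ, AnalyticAt ℂ φ l ∧
      ∀ᶠ x in 𝓝 l, x ∈ C → h x = φ x := by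
    intro l hl
    obtain ⟨φ, hφ, he⟩ := hgl l hl
    have hlw : l + w ∉ L.lattice := by rwa [add_comm, L.add_mem_lattice_iff hl]
    have hB : AnalyticAt ℂ (fun z => g (z + w)) l :=
      AnalyticAt.fun_comp (g := g) (f := fun z => z + w) (hga _ hlw)
        (analyticAt_id.add analyticAt_const)
    have hB0 : g (l + w) = 0 := by rw [add_comm, hgp l hl w hwL, hgz w hwL h2w]
    have h1 : ((1 : ℕ) : ℕ∞) ≤ analyticOrderAt (fun z => g (z + w)) l := by
      rw [Nat.cast_one, Order.one_le_iff_ne_zero, hB.analyticOrderAt_ne_zero]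
      exact hB0
    obtain ⟨u, hu, hue⟩ := (natCast_le_analyticOrderAt hB).1 h1
    refine ⟨fun z => (1 + (z - l) * φ z) * u z,
      (analyticAt_const.add ((analyticAt_id.sub analyticAt_const).mul hφ)).mul hu, ?_⟩
    filter_upwards [hue] with z hz hzC
    have hzl : z - l ≠ 0 := sub_ne_zero.2 (by rintro rfl; exact ((hCm _).1 hzC).1 hl)
    change g z * g (z + w) = _
    rw [hz, he, pow_one, smul_eq_mul]
    field_simp
  obtain ⟨U, hU, hUe⟩ := exists_analytic_extension hCd (u := h) fun z => by
    by_cases hz : z ∈ L.lattice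
    · exact hloc z hz
    by_cases hzw : z + w ∈ L.lattice
    · obtain ⟨φ, hφ, he⟩ := hloc _ hzw
      refine ⟨fun x => φ (x + w), AnalyticAt.fun_comp (g := φ) (f := fun z => z + w) hφ
        (analyticAt_id.add analyticAt_const), ?_⟩
      have ht : Tendsto (fun x : ℂ => x + w) (𝓝 z) (𝓝 (z + w)) :=
        (continuous_add_const w).tendsto z
      filter_upwards [ht.eventually he] with x hx hxC
      rw [← hx ((hCw x).2 hxC), hshift x hxC]
    · exact ⟨h, (hga z hz).mul (AnalyticAt.fun_comp (g := g) (f := fun z => z + w) (hga _ hzw)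
        (analyticAt_id.add analyticAt_const)), Eventually.of_forall fun _ _ => rfl⟩
  have hUd : Differentiable ℂ U := fun z => (hU z).differentiableAt
  have hUp : ∀ z, ∀ l ∈ L.lattice, U (z + l) = U z := by
    intro z l hl
    refine congrFun (Continuous.ext_on hCd (hUd.continuous.comp (continuous_add_const l))
      hUd.continuous fun x hx => ?_) z
    have hx' := (hCm x).1 hx
    have hxl : x + l ∈ C := by
      rw [hCm, L.add_mem_lattice_iff hl, add_right_comm, L.add_mem_lattice_iff hl]
      exact hx'
    simp only [Function.comp_apply]
    rw [← hUe _ hxl, ← hUe _ hx]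
    simp only [hh]
    rw [hgp l hl x hx'.1, add_right_comm, hgp l hl _ hx'.2]
  -- The constant is found at the other half-period `ω₂ / 2`, where `g` vanishes.
  have h0 : ∀ z ∈ C, h z = 0 := by
    intro z hz
    have hv : L.ω₂ / 2 ∈ C := (hCm _).2
      ⟨L.ω₂_div_two_notMem_lattice, L.ω₂_add_ω₁_div_two_notMem_lattice⟩
    rw [hUe z hz, L.eq_of_periodic_of_differentiable_one hUd hUp z (L.ω₂ / 2), ← hUe _ hv]
    simp only [hh]
    rw [hgz _ L.ω₂_div_two_notMem_lattice (by rw [add_halves]; exact L.ω₂_mem_lattice), zero_mul]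
  obtain ⟨φ, hφ, he⟩ := hgl 0 L.lattice.zero_mem
  have hnz : ∀ᶠ z in 𝓝[≠] (0 : ℂ), g z ≠ 0 := by
    have hc : ContinuousAt (fun z => 1 + z * φ z) 0 :=
      continuousAt_const.add (continuousAt_id.mul hφ.continuousAt)
    filter_upwards [nhdsWithin_le_nhds (hc.eventually_ne (y := 0) (by simp)),
      self_mem_nhdsWithin] with z hz hz0
    have hz0' : z ≠ 0 := hz0
    intro h1
    apply hz
    have := he z
    rw [h1, sub_zero] at this
    field_simp at this
    linear_combination -this
  have hnL : ∀ᶠ z in 𝓝[≠] (0 : ℂ), z ∉ L.lattice := by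
    filter_upwards [mem_nhdsWithin_of_mem_nhds (L.compl_lattice_sdiff_singleton_mem_nhds 0),
      self_mem_nhdsWithin] with z hz hz0 h
    exact hz ⟨h, hz0⟩
  -- Near `0` the first factor of `h` is nonzero because of its pole, so the second factor vanishes;
  -- hence `g` vanishes near `w`, and then everywhere by the identity theorem, contradicting the
  -- pole.
  have hzero : ∀ᶠ z in 𝓝[≠] w, g z = 0 := by
    have h1 : ∀ᶠ z in 𝓝[≠] (0 : ℂ), g (z + w) = 0 := by
      have ht : Tendsto (fun x : ℂ => x + w) (𝓝 0) (𝓝 w) := by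
        simpa using (continuous_add_const w).tendsto 0
      have hwn : ∀ᶠ z in 𝓝[≠] (0 : ℂ), z + w ∉ L.lattice :=
        nhdsWithin_le_nhds (ht (L.isClosed_lattice.isOpen_compl.mem_nhds hwL))
      filter_upwards [hnz, hnL, hwn] with z hz hzL hzw
      exact (mul_eq_zero.1 (h0 z ((hCm z).2 ⟨hzL, hzw⟩))).resolve_left hz
    have ht : Tendsto (fun x : ℂ => x - w) (𝓝[≠] w) (𝓝[≠] 0) := by
      refine tendsto_nhdsWithin_iff.2 ⟨?_, ?_⟩
      · have : Tendsto (fun x : ℂ => x - w) (𝓝 w) (𝓝 0) := by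
          simpa using (continuous_sub_right w).tendsto w
        exact this.mono_left nhdsWithin_le_nhds
      · filter_upwards [self_mem_nhdsWithin] with x hx
        exact sub_ne_zero.2 hx
    filter_upwards [ht.eventually h1] with z hz
    simpa using hz
  have hall := AnalyticOnNhd.eqOn_zero_of_preconnected_of_frequently_eq_zero
    (f := g) (fun z hz => hga z hz) L.isPreconnected_compl_lattice hwL hzero.frequently
  obtain ⟨z, hz1, hz2⟩ := (hnz.and hnL).exists
  exact hz1 (hall hz2)

/-- A function with at most removable singularities which is quasi-periodic like a multiple of the
zeta function is constant. -/
lemma const_of_quasiperiodic {C : Set ℂ} (hC : Dense C) {u : ℂ → ℂ} {s : ℂ}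
    (hu : ∀ p, ∃ φ : ℂ → ℂ, AnalyticAt ℂ φ p ∧ ∀ᶠ x in 𝓝 p, x ∈ C → u x = φ x)
    (hp : ∀ l ∈ L.lattice, ∀ z ∈ C, z + l ∈ C ∧ u (z + l) = u z + s * L.eta l) :
    s = 0 ∧ ∀ x ∈ C, ∀ y ∈ C, u x = u y := by
  obtain ⟨U, hU, hUe⟩ := exists_analytic_extension hC hu
  have hUd : Differentiable ℂ U := fun z => (hU z).differentiableAt
  have hUp : ∀ l ∈ L.lattice, ∀ z, U (z + l) = U z + s * L.eta l := by
    intro l hl z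
    refine congrFun (Continuous.ext_on hC (hUd.continuous.comp (continuous_add_const l))
      (hUd.continuous.add continuous_const) fun x hx => ?_) z
    change U (x + l) = U x + s * L.eta l
    rw [← hUe _ (hp l hl x hx).1, ← hUe _ hx, (hp l hl x hx).2]
  -- The derivative of the entire extension is honestly periodic, hence constant by Liouville, so
  -- the extension is affine.
  have hU' : Differentiable ℂ (deriv U) := fun z => (hU z).deriv.differentiableAt
  have hconst := L.eq_of_periodic_of_differentiable_one hU' fun z l hl => by
    rw [← deriv_comp_add_const]
    simp only [hUp l hl, deriv_add_const]
  set α := deriv U 0 with hα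
  have hlin : ∀ z, U z = α * z + U 0 := by
    intro z
    have hd : ∀ x, HasDerivAt (fun x => U x - α * x) 0 x := by
      intro x
      have := (hUd x).hasDerivAt.sub ((hasDerivAt_id x).const_mul α)
      rw [hconst x 0, ← hα, mul_one, sub_self] at this
      exact this
    have := is_const_of_deriv_eq_zero (fun x => (hd x).differentiableAt)
      (fun x => (hd x).deriv) z 0
    simp only [mul_zero, sub_zero] at this
    linear_combination this
  have hαs : ∀ l ∈ L.lattice, α * l = s * L.eta l := by
    intro l hl
    have := hUp l hl 0
    rw [zero_add, hlin l] at this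
    linear_combination this
  -- Comparing increments along a period gives `α l = s η(l)`; if `s` were nonzero, `η` would be
  -- linear.
  have hs : s = 0 := by
    by_contra hs
    refine L.eta_not_linear (α / s) fun l hl => ?_
    rw [div_mul_eq_mul_div, hαs l hl]
    field_simp
  have hω : L.ω₁ ≠ 0 := fun h => L.ω₁_div_two_notMem_lattice (by simp [h])
  have hα0 : α = 0 := by
    have := hαs _ L.ω₁_mem_lattice
    rw [hs, zero_mul] at this
    exact (mul_eq_zero.1 this).resolve_right hω
  refine ⟨hs, fun x hx y hy => ?_⟩
  rw [hUe x hx, hUe y hy, hlin x, hlin y, hα0]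
  simp

end PeriodPair

/-! ### Removable singularities, polar parts and derivatives of zeta. -/

/-- The function `u`, considered on `C`, extends analytically to a neighbourhood of `p`. -/
def ExtendsAt {E : Type*} [NormedAddCommGroup E] [NormedSpace ℂ E] (C : Set E) (u : E → ℂ)
    (p : E) : Prop :=
  ∃ φ : E → ℂ, AnalyticAt ℂ φ p ∧ ∀ᶠ x in 𝓝 p, x ∈ C → u x = φ x

namespace ExtendsAt

variable {E : Type*} [NormedAddCommGroup E] [NormedSpace ℂ E] {C : Set E} {u v : E → ℂ} {p : E}

lemma of_analyticAt (h : AnalyticAt ℂ u p) : ExtendsAt C u p :=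
  ⟨u, h, Eventually.of_forall fun _ _ => rfl⟩

lemma add (hu : ExtendsAt C u p) (hv : ExtendsAt C v p) :
    ExtendsAt C (fun x => u x + v x) p := by
  obtain ⟨φ, hφ, h1⟩ := hu
  obtain ⟨ψ, hψ, h2⟩ := hv
  refine ⟨φ + ψ, hφ.add hψ, ?_⟩
  filter_upwards [h1, h2] with x hx1 hx2 hx
  rw [hx1 hx, hx2 hx, Pi.add_apply]

lemma sub (hu : ExtendsAt C u p) (hv : ExtendsAt C v p) :
    ExtendsAt C (fun x => u x - v x) p := by
  obtain ⟨φ, hφ, h1⟩ := hu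
  obtain ⟨ψ, hψ, h2⟩ := hv
  refine ⟨φ - ψ, hφ.sub hψ, ?_⟩
  filter_upwards [h1, h2] with x hx1 hx2 hx
  rw [hx1 hx, hx2 hx, Pi.sub_apply]

lemma sum {ι : Type*} {s : Finset ι} {w : ι → E → ℂ} (h : ∀ i ∈ s, ExtendsAt C (w i) p) :
    ExtendsAt C (fun x => ∑ i ∈ s, w i x) p := by
  classical
  induction s using Finset.induction_on with
  | empty => simpa using of_analyticAt analyticAt_const
  | insert a s ha ih =>
    simp only [Finset.sum_insert ha]
    exact (h a (Finset.mem_insert_self a s)).add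
      (ih fun i hi => h i (Finset.mem_insert_of_mem hi))

lemma congr (hu : ExtendsAt C u p) (h : ∀ᶠ x in 𝓝 p, x ∈ C → v x = u x) : ExtendsAt C v p := by
  obtain ⟨φ, hφ, h1⟩ := hu
  refine ⟨φ, hφ, ?_⟩
  filter_upwards [h1, h] with x hx1 hx2 hx
  rw [hx2 hx, hx1 hx]

end ExtendsAt

namespace LaurentCoeff

lemma laurentCoeff_zpow (s m : ℤ) : laurentCoeff (fun t => t ^ s) m = if m = s then 1 else 0 := by
  rw [laurentCoeff_eq (φ := fun _ => (1 : ℂ)) (s := s) analyticAt_const (by simp)]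
  split_ifs with h1 h2 h2
  · omega
  · rfl
  · simp [h2]
  · rw [iteratedDeriv_const, if_neg (by omega), zero_div]

lemma laurentCoeff_of_analyticAt {h : ℂ → ℂ} (hh : AnalyticAt ℂ h 0) (m : ℤ) :
    laurentCoeff h m = if m < 0 then 0 else iteratedDeriv m.toNat h 0 / (m.toNat.factorial : ℂ) := by
  rw [laurentCoeff_eq (φ := h) (s := 0) hh (by simp)]
  simp

lemma laurentCoeff_sum {ι : Type*} (s : Finset ι) {h : ι → ℂ → ℂ}
    (hh : ∀ i ∈ s, MeromorphicAt (h i) 0) (m : ℤ) :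
    laurentCoeff (fun t => ∑ i ∈ s, h i t) m = ∑ i ∈ s, laurentCoeff (h i) m := by
  classical
  induction s using Finset.induction_on with
  | empty =>
    simp only [Finset.sum_empty]
    rw [laurentCoeff_of_analyticAt analyticAt_const]
    split_ifs
    · rfl
    · rw [iteratedDeriv_const]
      simp
  | insert a s ha ih =>
    simp only [Finset.sum_insert ha]
    rw [laurentCoeff_add (hh a (Finset.mem_insert_self a s)), ih fun i hi =>
      hh i (Finset.mem_insert_of_mem hi)]
    exact MeromorphicAt.fun_sum fun i hi => hh i (Finset.mem_insert_of_mem hi)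

/-- A function without polar part extends analytically. -/
lemma extendsAt_of_laurentCoeff_eq_zero {h : ℂ → ℂ} (hh : MeromorphicAt h 0)
    (h0 : ∀ m < 0, laurentCoeff h m = 0) : ExtendsAt ({0}ᶜ) h 0 := by
  by_cases htop : meromorphicOrderAt h 0 = ⊤
  · rw [meromorphicOrderAt_eq_top_iff] at htop
    exact ⟨0, analyticAt_const, eventually_nhdsWithin_iff.1 htop⟩
  obtain ⟨s, hs⟩ := WithTop.ne_top_iff_exists.1 htop
  obtain ⟨φ, hφ, hφ0, he⟩ := (meromorphicOrderAt_eq_int_iff hh).1 hs.symm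
  simp only [sub_zero, smul_eq_mul] at he
  have hs0 : 0 ≤ s := by
    by_contra hlt
    have h1 := h0 s (not_le.1 hlt)
    rw [laurentCoeff_eq hφ he] at h1
    simp at h1
    exact hφ0 h1
  refine ⟨fun t => t ^ s.toNat * φ t, (analyticAt_id.pow _).mul hφ, ?_⟩
  filter_upwards [eventually_nhdsWithin_iff.1 he] with t ht ht0
  rw [ht ht0, ← zpow_natCast, Int.toNat_of_nonneg hs0]

/-- A function differs from its polar part by an analytic function. -/
lemma extendsAt_sub_polarPart {h : ℂ → ℂ} (hh : MeromorphicAt h 0) {K : ℕ}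
    (hK : ∀ k : ℕ, K ≤ k → laurentCoeff h (-k - 1) = 0) :
    ExtendsAt ({0}ᶜ)
      (fun t => h t - ∑ k ∈ Finset.range K, laurentCoeff h (-k - 1) * t ^ (-(k : ℤ) - 1)) 0 := by
  have hz1 : ∀ s : ℤ, MeromorphicAt (fun t : ℂ => t ^ s) 0 := fun s => (MeromorphicAt.id 0).zpow s
  have hz : ∀ (c : ℂ) (s : ℤ), MeromorphicAt (fun t : ℂ => c * t ^ s) 0 := fun c s =>
    analyticAt_const.meromorphicAt.mul (hz1 s)
  have hS : MeromorphicAt (fun t : ℂ => ∑ k ∈ Finset.range K,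
      laurentCoeff h (-k - 1) * t ^ (-(k : ℤ) - 1)) 0 := MeromorphicAt.fun_sum fun k _ => hz _ _
  refine extendsAt_of_laurentCoeff_eq_zero (hh.sub hS) fun m hm => ?_
  have hd : MeromorphicAt (fun t => h t - ∑ k ∈ Finset.range K,
      laurentCoeff h (-k - 1) * t ^ (-(k : ℤ) - 1)) 0 := hh.sub hS
  have e : laurentCoeff h m = laurentCoeff (fun t => (h t - ∑ k ∈ Finset.range K,
      laurentCoeff h (-k - 1) * t ^ (-(k : ℤ) - 1)) + ∑ k ∈ Finset.range K,
      laurentCoeff h (-k - 1) * t ^ (-(k : ℤ) - 1)) m := by simp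
  rw [laurentCoeff_add hd hS, laurentCoeff_sum _ fun k _ => hz _ _] at e
  simp only [laurentCoeff_const_mul (hz1 _), laurentCoeff_zpow] at e
  have e2 : ∑ k ∈ Finset.range K, laurentCoeff h (-(k : ℤ) - 1) *
      (if m = -(k : ℤ) - 1 then 1 else 0) = laurentCoeff h m := by
    obtain ⟨k, rfl⟩ : ∃ k : ℕ, m = -(k : ℤ) - 1 := ⟨(-m - 1).toNat, by omega⟩
    by_cases hk : k < K
    · rw [Finset.sum_eq_single k]
      · simp
      · intro b _ hb
        rw [if_neg (by omega), mul_zero]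
      · intro h
        exact absurd (Finset.mem_range.2 hk) h
    · rw [hK k (by omega)]
      refine Finset.sum_eq_zero fun b hb => ?_
      rw [if_neg, mul_zero]
      have := Finset.mem_range.1 hb
      omega
  rw [e2] at e
  exact (left_eq_add.1 (e.trans (add_comm _ _)))

end LaurentCoeff

namespace PeriodPair

variable (L : PeriodPair)

/-- The functions `(-1)ᵏ ζ⁽ᵏ⁾ / k!`. -/
def zetaDeriv : ℕ → ℂ → ℂ
  | 0 => L.zeta
  | k + 1 => fun z => -(1 / ((k : ℂ) + 1)) * deriv (zetaDeriv k) z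

lemma analyticAt_zetaDeriv (k : ℕ) {z : ℂ} (hz : z ∉ L.lattice) :
    AnalyticAt ℂ (L.zetaDeriv k) z := by
  induction k with
  | zero => exact L.analyticAt_zeta hz
  | succ k ih => exact analyticAt_const.mul ih.deriv

/-- The factor `(-1)ᵏ / k!` is chosen so that the polar part is exactly `(z - l) ^ (-k-1)` with
coefficient one, which makes these functions a basis for prescribing polar parts. -/
lemma exists_zetaDeriv_eq (k : ℕ) {l : ℂ} (hl : l ∈ L.lattice) :
    ∃ φ : ℂ → ℂ, AnalyticAt ℂ φ l ∧
      ∀ᶠ z in 𝓝[≠] l, L.zetaDeriv k z = (z - l) ^ (-(k : ℤ) - 1) + φ z := by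
  induction k with
  | zero =>
    obtain ⟨φ, hφ, he⟩ := L.exists_zeta_eq hl
    refine ⟨φ, hφ, Eventually.of_forall fun z => ?_⟩
    simp [zetaDeriv, he]
  | succ k ih =>
    obtain ⟨φ, hφ, he⟩ := ih
    refine ⟨fun z => -(1 / ((k : ℂ) + 1)) * deriv φ z, analyticAt_const.mul hφ.deriv, ?_⟩
    filter_upwards [eventually_eventually_nhdsWithin.2 he, self_mem_nhdsWithin,
      nhdsWithin_le_nhds hφ.eventually_analyticAt] with z hz hzl hφz
    have hzl' : z - l ≠ 0 := sub_ne_zero.2 hzl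
    have h1 : L.zetaDeriv k =ᶠ[𝓝 z] fun z => (z - l) ^ (-(k : ℤ) - 1) + φ z := by
      rwa [isOpen_compl_singleton.nhdsWithin_eq hzl] at hz
    have h2 : HasDerivAt (fun z => (z - l) ^ (-(k : ℤ) - 1))
        (((-(k : ℤ) - 1 : ℤ) : ℂ) * (z - l) ^ (-(k : ℤ) - 1 - 1)) z :=
      (hasDerivAt_zpow _ _ (Or.inl hzl')).comp_sub_const z l
    have h3 := h2.fun_add hφz.differentiableAt.hasDerivAt
    change -(1 / ((k : ℂ) + 1)) * deriv (L.zetaDeriv k) z = _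
    rw [h1.deriv_eq, h3.deriv]
    have hk : (k : ℂ) + 1 ≠ 0 := Nat.cast_add_one_ne_zero k
    rw [show -((k + 1 : ℕ) : ℤ) - 1 = -(k : ℤ) - 1 - 1 by push_cast; ring]
    push_cast
    field_simp
    ring

/-- Differentiation removes the additive quasi-period, so only `k = 0` obstructs periodicity. This
is why residues are constrained while higher polar coefficients are free. -/
lemma zetaDeriv_add (k : ℕ) {l : ℂ} (hl : l ∈ L.lattice) {z : ℂ} (hz : z ∉ L.lattice) :
    L.zetaDeriv k (z + l) = L.zetaDeriv k z + if k = 0 then L.eta l else 0 := by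
  induction k generalizing z with
  | zero => simpa [zetaDeriv] using L.zeta_add hl hz
  | succ k ih =>
    have h1 : (fun w => L.zetaDeriv k (w + l)) =ᶠ[𝓝 z] fun w => L.zetaDeriv k w +
        if k = 0 then L.eta l else 0 := by
      filter_upwards [L.isClosed_lattice.isOpen_compl.mem_nhds hz] with w hw
      exact ih hw
    have h2 := h1.deriv_eq
    rw [deriv_comp_add_const, deriv_add_const] at h2
    simp [zetaDeriv, h2]

/-- A linear combination of derivatives of the zeta function. -/
def zetaComb (K : ℕ) (c : ℕ → ℂ) (z : ℂ) : ℂ := ∑ k ∈ Finset.range K, c k * L.zetaDeriv k z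

lemma analyticAt_zetaComb (K : ℕ) (c : ℕ → ℂ) {z : ℂ} (hz : z ∉ L.lattice) :
    AnalyticAt ℂ (L.zetaComb K c) z :=
  Finset.analyticAt_fun_sum _ fun k _ => analyticAt_const.mul (L.analyticAt_zetaDeriv k hz)

lemma zetaComb_eq_zero {K : ℕ} {c : ℕ → ℂ} (hc : ∀ k, c k = 0) (z : ℂ) : L.zetaComb K c z = 0 := by
  simp [zetaComb, hc]

lemma exists_zetaComb_eq (K : ℕ) (c : ℕ → ℂ) {l : ℂ} (hl : l ∈ L.lattice) :
    ∃ φ : ℂ → ℂ, AnalyticAt ℂ φ l ∧ ∀ᶠ z in 𝓝[≠] l,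
      L.zetaComb K c z = ∑ k ∈ Finset.range K, c k * (z - l) ^ (-(k : ℤ) - 1) + φ z := by
  choose φ hφ he using fun k => L.exists_zetaDeriv_eq k hl
  refine ⟨fun z => ∑ k ∈ Finset.range K, c k * φ k z,
    Finset.analyticAt_fun_sum _ fun k _ => analyticAt_const.mul (hφ k), ?_⟩
  filter_upwards [eventually_all_finset (Finset.range K) |>.2 fun k _ => he k] with z hz
  rw [zetaComb, ← Finset.sum_add_distrib]
  exact Finset.sum_congr rfl fun k hk => by rw [hz k hk, mul_add]

lemma zetaComb_add {K : ℕ} (c : ℕ → ℂ) (hK : 0 < K) {l : ℂ} (hl : l ∈ L.lattice) {z : ℂ}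
    (hz : z ∉ L.lattice) :
    L.zetaComb K c (z + l) = L.zetaComb K c z + c 0 * L.eta l := by
  simp only [zetaComb, L.zetaDeriv_add _ hl hz, mul_add, Finset.sum_add_distrib]
  congr 1
  rw [Finset.sum_eq_single 0]
  · simp
  · intro b _ hb
    simp [hb]
  · intro h
    exact absurd (Finset.mem_range.2 hK) h

end PeriodPair

/-! ### Regular functions without poles, and polar coefficients in the first step of the filtration.
-/

namespace EllipticConfig

open LaurentCoeff PeriodPair

variable {L : PeriodPair} {n : ℕ}

lemma pts_castSucc (x : Fin n → ℂ) (i : Fin n) : pts x i.castSucc = x i := by simp [pts]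

lemma pts_last (x : Fin n → ℂ) : pts x (Fin.last n) = 0 := by simp [pts]

lemma pts_update (x : Fin n → ℂ) (i : Fin n) (z : ℂ) :
    pts (Function.update x i z) = Function.update (pts x) i.castSucc z := by
  simp only [pts, Fin.snoc_update]

lemma pts_smul (t : ℂ) (x : Fin n → ℂ) (a : Fin (n + 1)) : pts (t • x) a = t * pts x a := by
  induction a using Fin.lastCases with
  | last => simp [pts]
  | cast i => simp [pts]

/-- Through any point there is a complex line whose direction has distinct nonzero entries. None of
the differences is constant along it, so it leaves the configuration space only at countably many
parameters. -/
lemma dense_conf (L : PeriodPair) (n : ℕ) : Dense (conf L n) := by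
  set v : Fin n → ℂ := fun i => (i : ℂ) + 1 with hv
  have hinj : ∀ a b : Fin (n + 1), a ≠ b → pts v a - pts v b ≠ 0 := by
    have h1 : ∀ i j : Fin n, i ≠ j → v i ≠ v j := by
      intro i j hij h
      simp only [hv, add_left_inj, Nat.cast_inj] at h
      exact hij (Fin.ext h)
    have h2 : ∀ i : Fin n, v i ≠ 0 := fun i => Nat.cast_add_one_ne_zero _
    intro a b hab
    induction a using Fin.lastCases with
    | last =>
      induction b using Fin.lastCases with
      | last => exact absurd rfl hab
      | cast j => simpa [pts_last, pts_castSucc] using h2 j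
    | cast i =>
      induction b using Fin.lastCases with
      | last => simpa [pts_last, pts_castSucc] using h2 i
      | cast j =>
        rw [pts_castSucc, pts_castSucc]
        exact sub_ne_zero.2 (h1 i j fun h => hab (by rw [h]))
  intro p
  set Z : Set ℂ := ⋃ a : Fin (n + 1), ⋃ b : Fin (n + 1), ⋃ _ : a ≠ b,
    (fun t : ℂ => pts p a - pts p b + t * (pts v a - pts v b)) ⁻¹' (L.lattice : Set ℂ) with hZ
  have hZc : Z.Countable := by
    refine Set.countable_iUnion fun a => Set.countable_iUnion fun b => Set.countable_iUnion
      fun hab => L.countable_lattice.preimage fun s t hst => ?_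
    exact mul_right_cancel₀ (hinj a b hab) (add_left_cancel hst)
  have hd : (0 : ℂ) ∈ closure Zᶜ := dense_compl_of_countable hZc 0
  have hc : Continuous fun t : ℂ => p + t • v := by fun_prop
  have h0 : p + (0 : ℂ) • v ∈ closure (conf L n) := by
    refine closure_mono ?_ (image_closure_subset_closure_image hc (Set.mem_image_of_mem _ hd))
    rintro _ ⟨t, ht, rfl⟩ a b hab h
    refine ht ?_
    simp only [hZ, Set.mem_iUnion]
    refine ⟨a, b, hab, ?_⟩
    simp only [pts_add, Pi.add_apply, pts_smul] at h
    change _ ∈ L.lattice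
    convert h using 1
    ring
  simpa using h0

lemma toFun_one (x : Fin n → ℂ) (hx : x ∈ conf L n) : (one L n).toFun x = 1 := by
  simp [one, hx]

lemma nonempty_conf (L : PeriodPair) (n : ℕ) : (conf L n).Nonempty := (dense_conf L n).nonempty

lemma toFun_eq_zero (f : RegularFunctions L n) {x : Fin n → ℂ} (hx : x ∉ conf L n) :
    f.toFun x = 0 := f.isRegular.zero_off x hx

/-- A regular function without poles is constant. -/
lemma exists_eq_smul_one {f : RegularFunctions L n}
    (hf : ∀ p, ExtendsAt (conf L n) f.toFun p) : ∃ c : ℂ, f = c • one L n := by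
  obtain ⟨U, hU, hUe⟩ := exists_analytic_extension (dense_conf L n) hf
  have hUd : Differentiable ℂ U := fun z => (hU z).differentiableAt
  have hUp : ∀ x l : Fin n → ℂ, (∀ i, l i ∈ L.lattice) → U (x + l) = U x := by
    intro x l hl
    refine congrFun (Continuous.ext_on (dense_conf L n) (hUd.continuous.comp (continuous_add_const l))
      hUd.continuous fun y hy => ?_) x
    simp only [Function.comp_apply]
    rw [← hUe _ hy, ← hUe _ ((conf_add hl).2 hy), f.isRegular.periodic y l hl]
  refine ⟨U 0, RegularFunctions.ext fun x => ?_⟩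
  by_cases hx : x ∈ conf L n
  · rw [hUe x hx, RegularFunctions.toFun_smul, Pi.smul_apply, toFun_one x hx, smul_eq_mul, mul_one]
    exact L.eq_of_periodic_of_differentiable hUd hUp _ _
  · rw [toFun_eq_zero f hx, toFun_eq_zero _ hx]

lemma smul_one_injective {c d : ℂ} (h : c • one L n = d • one L n) : c = d := by
  obtain ⟨x, hx⟩ := nonempty_conf L n
  have := congrArg (fun f => f.toFun x) h
  simpa [toFun_one x hx] using this

lemma toFun_coeff (i j : Fin (n + 1)) (m : ℤ) (f : RegularFunctions L (n + 1)) {x : Fin n → ℂ}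
    (hx : x ∈ conf L n) :
    (coeff i j m f).toFun x = laurentCoeff (fun t => f.toFun (insertNear i j x t)) m := by
  change coeffFun i j m f.toFun x = _
  rw [coeffFun, if_pos hx]

/-! ### The filtration of the regular functions -/

lemma functionFiltration_eq_bot {q : ℤ} (hq : q + n < 0) : functionFiltration L n q = ⊥ := by
  rw [functionFiltration, Submodule.span_eq_bot]
  intro f hf
  ext x
  by_cases hx : x ∈ conf L n
  · obtain ⟨N, g, -, he⟩ := hf x
    rw [he.self_of_nhds hx, Finset.sum_eq_zero]
    · rfl
    · intro S hS
      have := (Finset.mem_filter.1 hS).2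
      omega
  · rw [toFun_eq_zero f hx]
    rfl

/-- At most the empty set of divisors is admissible, so the function has no pole and Liouville's
theorem applies. -/
lemma functionFiltration_le_span_one {q : ℤ} (hq : q + n ≤ 0) :
    functionFiltration L n q ≤ Submodule.span ℂ {one L n} := by
  refine Submodule.span_le.2 fun f hf => ?_
  obtain ⟨c, rfl⟩ := exists_eq_smul_one (f := f) fun p => by
    obtain ⟨N, g, hg, he⟩ := hf p
    refine ⟨fun x => if 0 ≤ q + n then g ∅ x else 0, ?_, ?_⟩
    · split_ifs
      · exact hg ∅
      · exact analyticAt_const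
    · filter_upwards [he] with x hx hxc
      rw [hx hxc]
      split_ifs with h
      · rw [Finset.sum_eq_single ∅]
        · simp
        · intro S hS hS0
          have h1 := (Finset.mem_filter.1 hS).2
          have h2 := Finset.card_pos.2 (Finset.nonempty_iff_ne_empty.2 hS0)
          omega
        · intro h1
          exact absurd (Finset.mem_filter.2 ⟨Finset.empty_mem_powerset _, by simpa using h⟩) h1
      · refine Finset.sum_eq_zero fun S hS => ?_
        have h1 := (Finset.mem_filter.1 hS).2
        omega
  exact Submodule.smul_mem _ _ (Submodule.mem_span_singleton_self _)


lemma divisor_mem {p : Fin n → ℂ} {D : Fin (n + 1) × Fin (n + 1)} :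
    D ∈ divisorsThrough L p ↔ D.1 < D.2 ∧ pts p D.1 - pts p D.2 ∈ L.lattice := by
  simp [divisorsThrough]

lemma castSucc_succAbove_of_le {i j : Fin (n + 1)} (h : i ≤ j) :
    i.castSucc.succAbove j = j.succ :=
  Fin.succAbove_of_le_castSucc _ _ (Fin.castSucc_le_castSucc_iff.2 h)

/-- At a configuration whose points are otherwise distinct, letting point `i` collide with its
target creates exactly one coincidence. Thus only the divisor `xᵢ = x_j` is met. -/
lemma pts_insertNear_sub_notMem {i j : Fin (n + 1)} {x : Fin n → ℂ} (hx : x ∈ conf L n)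
    {a b : Fin (n + 2)} (hab : a < b) (hne : (a, b) ≠ (i.castSucc, j.succ)) (hij : i ≤ j) :
    pts (insertNear i j x 0) a - pts (insertNear i j x 0) b ∉ L.lattice := by
  have hj : pts (insertNear i j x 0) i.castSucc = pts x j := by
    rw [pts_insertNear_same, add_zero]
  induction a using Fin.succAboveCases i.castSucc with
  | x =>
    induction b using Fin.succAboveCases i.castSucc with
    | x => exact absurd hab (lt_irrefl _)
    | p b =>
      rw [hj, pts_insertNear_succAbove]
      refine hx j b fun h => hne ?_
      rw [← h, castSucc_succAbove_of_le hij]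
  | p a =>
    induction b using Fin.succAboveCases i.castSucc with
    | x =>
      rw [hj, pts_insertNear_succAbove]
      refine hx a j fun h => ?_
      rw [h, castSucc_succAbove_of_le hij] at hab
      have : (j : ℕ) + 1 < i := hab
      have h2 : (i : ℕ) ≤ j := hij
      omega
    | p b =>
      rw [pts_insertNear_succAbove, pts_insertNear_succAbove]
      exact hx a b fun h => hab.ne (by rw [h])

/-- Locally each summand has a pole along at most one divisor. A polar coefficient along `xᵢ = x_j`
sees only the summand attached to that divisor, whose numerator is holomorphic; so the coefficient
extends across all other divisors and is constant by Liouville. -/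
lemma exists_coeff_eq_smul_one {f : RegularFunctions L (n + 1)} {q : ℤ} (hq : q + n ≤ 0)
    (hf : f ∈ functionFiltration L (n + 1) q) {i j : Fin (n + 1)} (hij : i ≤ j) {m : ℤ}
    (hm : m < 0) : ∃ c : ℂ, coeff i j m f = c • one L n := by
  suffices h : functionFiltration L (n + 1) q ≤
      (Submodule.span ℂ {one L n}).comap (coeff i j m) by
    obtain ⟨c, hc⟩ := Submodule.mem_span_singleton.1 (h hf)
    exact ⟨c, hc.symm⟩
  refine Submodule.span_le.2 fun f hf => ?_
  obtain ⟨c, hc⟩ := exists_eq_smul_one (f := coeff i j m f) fun p => by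
    obtain ⟨N, g, hg, he⟩ := hf (insertNear i j p 0)
    set P := insertNear i j p 0 with hP
    set D₀ : Fin (n + 2) × Fin (n + 2) := (i.castSucc, j.succ) with hD₀
    classical
    set 𝒮 := (divisorsThrough L P).powerset.filter
      fun S => (S.card : ℤ) ≤ q + ((n + 1 : ℕ) : ℤ) with h𝒮
    -- In `n + 1` variables the cardinality bound is `q + n + 1`, which is at most `1`.
    have hcard : ∀ S ∈ 𝒮, S.card ≤ 1 := fun S hS => by
      have := (Finset.mem_filter.1 hS).2
      push_cast at this
      omega
    have ha := insertNear_analyticAt i j (p, (0 : ℂ))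
    have hG : ∀ S, AnalyticAt ℂ (fun z : (Fin n → ℂ) × ℂ => g S (insertNear i j z.1 z.2)) (p, 0) :=
      fun S => AnalyticAt.fun_comp (g := g S) (hg S) ha
    have hGe : ∀ᶠ x in 𝓝 p, ∀ S,
        AnalyticAt ℂ (fun z : (Fin n → ℂ) × ℂ => g S (insertNear i j z.1 z.2)) (x, 0) := by
      have ht : Tendsto (fun x : Fin n → ℂ => (x, (0 : ℂ))) (𝓝 p) (𝓝 (p, 0)) :=
        Continuous.tendsto (by fun_prop) p
      exact eventually_all.2 fun S => ht.eventually (hG S).eventually_analyticAt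
    have he2 := (ha.continuousAt.tendsto.eventually he).curry_nhds
    refine ⟨fun x => ∑ S ∈ 𝒮 with D₀ ∈ S, if m < -(N : ℤ) then 0 else
      iteratedDeriv (m - -(N : ℤ)).toNat (fun t => g S (insertNear i j x t)) 0 /
        ((m - -(N : ℤ)).toNat.factorial : ℂ), ?_, ?_⟩
    · refine Finset.analyticAt_fun_sum _ fun S _ => ?_
      split_ifs
      · exact analyticAt_const
      · exact (analyticAt_iteratedDeriv (hG S) _).fun_div analyticAt_const
          (by exact_mod_cast Nat.factorial_ne_zero _)
    · filter_upwards [hGe, he2] with x hGx hex hxc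
      rw [toFun_coeff _ _ _ _ hxc]
      have hline : AnalyticAt ℂ (fun t : ℂ => (x, t)) 0 := analyticAt_const.prod analyticAt_id
      have hGt : ∀ S, AnalyticAt ℂ (fun t => g S (insertNear i j x t)) 0 := fun S =>
        AnalyticAt.fun_comp (g := fun z : (Fin n → ℂ) × ℂ => g S (insertNear i j z.1 z.2))
          (f := fun t : ℂ => (x, t)) (hGx S) hline
      set lin : Fin (n + 2) × Fin (n + 2) → ℂ → ℂ := fun D t =>
        (pts (insertNear i j x t) D.1 - pts (insertNear i j x t) D.2) -
          (pts P D.1 - pts P D.2) with hlin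
      set term : Finset (Fin (n + 2) × Fin (n + 2)) → ℂ → ℂ := fun S t =>
        g S (insertNear i j x t) / ∏ D ∈ S, lin D t ^ N with hterm
      have hlin_an : ∀ D, AnalyticAt ℂ (lin D) 0 := fun D => by
        have h1 : ∀ a, AnalyticAt ℂ (fun t : ℂ => pts (insertNear i j x t) a) 0 := fun a =>
          AnalyticAt.fun_comp (g := fun y : Fin (n + 1) → ℂ => pts y a)
            (f := fun t : ℂ => insertNear i j x t) (pts_analyticAt a _)
            (AnalyticAt.fun_comp (g := fun z : (Fin n → ℂ) × ℂ => insertNear i j z.1 z.2)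
              (f := fun t : ℂ => (x, t)) (insertNear_analyticAt i j _) hline)
        exact ((h1 _).sub (h1 _)).sub analyticAt_const
      -- A set `S` containing the divisor is the singleton, where the denominator is `t ^ N`. For
      -- any other `S` the denominator does not vanish at `t = 0`, so there is no polar part.
      have hcoef : ∀ S ∈ 𝒮, laurentCoeff (term S) m = if D₀ ∈ S then (if m < -(N : ℤ) then 0 else
          iteratedDeriv (m - -(N : ℤ)).toNat (fun t => g S (insertNear i j x t)) 0 /
          ((m - -(N : ℤ)).toNat.factorial : ℂ)) else 0 := by
        intro S hS
        split_ifs with hD hmN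
        all_goals try
          have hS1 : S = {D₀} := by
            obtain ⟨D, rfl⟩ := Finset.card_eq_one.1
              (le_antisymm (hcard S hS) (Finset.card_pos.2 ⟨_, hD⟩))
            rw [Finset.mem_singleton.1 hD]
          have hD₀t : ∀ t, lin D₀ t = t := by
            intro t
            have hjj : j.succ = i.castSucc.succAbove j := (castSucc_succAbove_of_le hij).symm
            simp only [hlin, hD₀, hP]
            rw [hjj, pts_insertNear_same, pts_insertNear_same, pts_insertNear_succAbove,
              pts_insertNear_succAbove]
            ring
          have hth : ∀ᶠ t in 𝓝[≠] (0 : ℂ), term S t =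
              t ^ (-(N : ℤ)) * g S (insertNear i j x t) := by
            refine Eventually.of_forall fun t => ?_
            simp only [hterm]
            rw [hS1, Finset.prod_singleton, hD₀t, zpow_neg, zpow_natCast, div_eq_mul_inv, mul_comm]
        · rw [laurentCoeff_eq (hGt S) hth, if_pos hmN]
        · rw [laurentCoeff_eq (hGt S) hth, if_neg hmN]
        · rw [laurentCoeff_of_analyticAt, if_pos hm]
          refine (hGt S).fun_div (Finset.analyticAt_fun_prod _ fun D _ => (hlin_an D).pow N) ?_
          refine Finset.prod_ne_zero_iff.2 fun D hDS => pow_ne_zero _ fun h0 => ?_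
          have hDd := divisor_mem.1
            (Finset.mem_powerset.1 (Finset.mem_filter.1 hS).1 hDS)
          refine pts_insertNear_sub_notMem hxc hDd.1 (i := i) (j := j)
            (fun h => hD (by rw [hD₀, ← h]; exact hDS)) hij ?_
          rw [sub_eq_zero.1 h0]
          exact hDd.2
      have hmero : ∀ S ∈ 𝒮, MeromorphicAt (term S) 0 := fun S _ =>
        (hGt S).meromorphicAt.fun_div
          (MeromorphicAt.fun_prod fun D _ => (hlin_an D).meromorphicAt.pow N)
      rw [laurentCoeff_congr (slice_meromorphicAt f.isRegular i j hxc)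
        (h₂ := fun t => ∑ S ∈ 𝒮, term S t), laurentCoeff_sum _ hmero, Finset.sum_congr rfl hcoef,
        ← Finset.sum_filter]
      filter_upwards [mem_nhdsWithin_of_mem_nhds hex, insertNear_mem_conf i j hxc] with t ht htc
      exact ht htc
  exact Submodule.mem_span_singleton.2 ⟨c, hc.symm⟩

end EllipticConfig

/-! ### The residue theorem in each variable. -/

namespace EllipticConfig

open LaurentCoeff PeriodPair

variable {L : PeriodPair} {n : ℕ}

lemma update_mem_conf_iff {x : Fin n → ℂ} (hx : x ∈ conf L n) (i : Fin n) (z : ℂ) :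
    Function.update x i z ∈ conf L n ↔ ∀ b, b ≠ i.castSucc → z - pts x b ∉ L.lattice := by
  constructor
  · intro h b hb
    have := h i.castSucc b hb.symm
    rwa [pts_update, Function.update_self, Function.update_of_ne hb] at this
  · intro h a b hab
    rw [pts_update]
    by_cases ha : a = i.castSucc
    · subst ha
      rw [Function.update_self, Function.update_of_ne hab.symm]
      exact h b hab.symm
    · rw [Function.update_of_ne ha]
      by_cases hb : b = i.castSucc
      · subst hb
        rw [Function.update_self, ← neg_sub, neg_mem_iff]
        exact h a ha
      · rw [Function.update_of_ne hb]
        exact hx a b hab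

lemma countable_update_notMem_conf {x : Fin n → ℂ} (hx : x ∈ conf L n) (i : Fin n) :
    {z | Function.update x i z ∉ conf L n}.Countable := by
  have : {z | Function.update x i z ∉ conf L n} ⊆
      ⋃ b : Fin (n + 1), (fun z => z - pts x b) ⁻¹' (L.lattice : Set ℂ) := by
    intro z hz
    simp only [Set.mem_ofPred_eq, update_mem_conf_iff hx, not_forall, not_not] at hz
    obtain ⟨b, -, hb⟩ := hz
    exact Set.mem_iUnion.2 ⟨b, hb⟩
  refine Set.Countable.mono this (Set.countable_iUnion fun b => L.countable_lattice.preimage ?_)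
  exact sub_left_injective

lemma update_add_eq (x : Fin n → ℂ) (i : Fin n) (z l : ℂ) :
    Function.update x i (z + l) = Function.update x i z + Pi.single i l := by
  funext k
  by_cases hk : k = i
  · subst hk
    simp
  · simp [hk]

lemma single_mem_lattice {i : Fin n} {l : ℂ} (hl : l ∈ L.lattice) (k : Fin n) :
    (Pi.single i l : Fin n → ℂ) k ∈ L.lattice := by
  by_cases hk : k = i
  · subst hk
    simpa
  · simp [hk]

lemma insertNear_removeNth (i j : Fin (n + 1)) (x : Fin (n + 1) → ℂ) (t : ℂ) :
    insertNear i j (i.removeNth x) t =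
      Function.update x i (pts x (i.castSucc.succAbove j) + t) := by
  have h : pts (i.removeNth x) j = pts x (i.castSucc.succAbove j) := by
    induction j using Fin.lastCases with
    | last =>
      rw [Fin.succAbove_ne_last_last (Fin.castSucc_lt_last i).ne, pts_last, pts_last]
    | cast k =>
      rw [Fin.castSucc_succAbove_castSucc, pts_castSucc, pts_castSucc]
      rfl
  rw [insertNear, h, Fin.insertNth_removeNth]

lemma removeNth_mem_conf (i : Fin (n + 1)) {x : Fin (n + 1) → ℂ} (hx : x ∈ conf L (n + 1)) :
    i.removeNth x ∈ conf L n := by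
  have h : ∀ j, pts (i.removeNth x) j = pts x (i.castSucc.succAbove j) := fun j => by
    induction j using Fin.lastCases with
    | last =>
      rw [Fin.succAbove_ne_last_last (Fin.castSucc_lt_last i).ne, pts_last, pts_last]
    | cast k =>
      rw [Fin.castSucc_succAbove_castSucc, pts_castSucc, pts_castSucc]
      rfl
  intro a b hab
  rw [h, h]
  exact hx _ _ fun h => hab (Fin.succAbove_right_injective h)

/-- A regular function whose polar coefficients along the divisors `x_a = x_b`, `a < b`, are the
constants `C a b k`. -/
structure HasConstantPoles (f : RegularFunctions L (n + 1)) (K : ℕ)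
    (C : Fin (n + 1) → Fin (n + 2) → ℕ → ℂ) : Prop where
  pos : 0 < K
  coeff_eq : ∀ a j, a ≤ j → ∀ k : ℕ, coeff a j (-(k : ℤ) - 1) f = C a j.succ k • one L n
  zero : ∀ a b, b ≤ a.castSucc → ∀ k, C a b k = 0
  zero_of_le : ∀ a b k, K ≤ k → C a b k = 0

/-- The function `f` with the poles along the divisors `x_a = x_b`, `a < i`, `a < b`, removed. -/
def removePoles (f : RegularFunctions L (n + 1)) (K : ℕ) (C : Fin (n + 1) → Fin (n + 2) → ℕ → ℂ)
    (i : ℕ) (x : Fin (n + 1) → ℂ) : ℂ :=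
  f.toFun x - ∑ a : Fin (n + 1) with a.val < i, ∑ b,
    L.zetaComb K (C a b) (pts x a.castSucc - pts x b)

namespace HasConstantPoles

variable {f : RegularFunctions L (n + 1)} {K : ℕ} {C : Fin (n + 1) → Fin (n + 2) → ℕ → ℂ}

lemma removePoles_succ (i : Fin (n + 1)) (x : Fin (n + 1) → ℂ) :
    removePoles f K C (i + 1) x = removePoles f K C i x -
      ∑ b, L.zetaComb K (C i b) (pts x i.castSucc - pts x b) := by
  have h : (Finset.univ.filter fun a : Fin (n + 1) => a.val < i.val + 1) =
      insert i (Finset.univ.filter fun a : Fin (n + 1) => a.val < i.val) := by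
    ext a
    simp only [Finset.mem_filter, Finset.mem_univ, true_and, Finset.mem_insert, Fin.ext_iff]
    omega
  rw [removePoles, removePoles, h, Finset.sum_insert (by simp)]
  ring

lemma pts_update_analyticAt (x : Fin n → ℂ) (i : Fin n) (a : Fin (n + 1)) (z₀ : ℂ) :
    AnalyticAt ℂ (fun z => pts (Function.update x i z) a) z₀ := by
  simp only [pts_update]
  by_cases ha : a = i.castSucc
  · subst ha
    simpa using! analyticAt_id (𝕜 := ℂ) (z := z₀)
  · simpa [Function.update_of_ne ha] using analyticAt_const

lemma update_analyticAt (x : Fin n → ℂ) (i : Fin n) (z₀ : ℂ) :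
    AnalyticAt ℂ (fun z => Function.update x i z) z₀ := by
  rw [analyticAt_pi_iff]
  intro a
  simpa [pts_castSucc] using pts_update_analyticAt x i a.castSucc z₀

lemma term_analyticAt (h : HasConstantPoles f K C) (x : Fin (n + 1) → ℂ) (i a : Fin (n + 1))
    (b : Fin (n + 2)) {z₀ : ℂ} (hz : a.castSucc < b →
      pts (Function.update x i z₀) a.castSucc - pts (Function.update x i z₀) b ∉ L.lattice) :
    AnalyticAt ℂ (fun z => L.zetaComb K (C a b)
      (pts (Function.update x i z) a.castSucc - pts (Function.update x i z) b)) z₀ := by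
  by_cases hab : a.castSucc < b
  · exact AnalyticAt.fun_comp (g := L.zetaComb K (C a b)) (L.analyticAt_zetaComb K _ (hz hab))
      ((pts_update_analyticAt x i _ z₀).sub (pts_update_analyticAt x i _ z₀))
  · simp only [L.zetaComb_eq_zero (h.zero a b (not_lt.1 hab))]
    exact analyticAt_const

lemma removePoles_analyticAt (h : HasConstantPoles f K C) (m : ℕ) {x : Fin (n + 1) → ℂ}
    {i : Fin (n + 1)} {z₀ : ℂ} (hz : Function.update x i z₀ ∈ conf L (n + 1)) :
    AnalyticAt ℂ (fun z => removePoles f K C m (Function.update x i z)) z₀ := by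
  refine AnalyticAt.fun_sub ?_ (Finset.analyticAt_fun_sum _ fun a _ =>
    Finset.analyticAt_fun_sum _ fun b _ => h.term_analyticAt x i a b fun hab => hz _ _ hab.ne)
  exact AnalyticAt.fun_comp (g := f.toFun) (f.isRegular.analyticAt hz) (update_analyticAt x i z₀)

/-- The polar part of `f` along `x_i = x_b` is removed by subtracting a combination of zeta
functions. -/
lemma extendsAt_slice (h : HasConstantPoles f K C) {x : Fin (n + 1) → ℂ}
    (hx : x ∈ conf L (n + 1)) (i j : Fin (n + 1)) (hij : i ≤ j) {z₀ : ℂ}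
    (hz : z₀ - pts x j.succ ∈ L.lattice) :
    ExtendsAt {z | Function.update x i z ∈ conf L (n + 1)}
      (fun z => f.toFun (Function.update x i z) - L.zetaComb K (C i j.succ) (z - pts x j.succ))
      z₀ := by
  set q := pts x j.succ with hq
  have hx' := removeNth_mem_conf i hx
  have hco : ∀ k : ℕ, laurentCoeff (fun t => f.toFun (insertNear i j (i.removeNth x) t)) (-k - 1) =
      C i j.succ k := by
    intro k
    rw [← toFun_coeff i j _ f hx', h.coeff_eq i j hij, RegularFunctions.toFun_smul, Pi.smul_apply,
      toFun_one _ hx', smul_eq_mul, mul_one]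
  obtain ⟨φ, hφ, h1⟩ := extendsAt_sub_polarPart (slice_meromorphicAt f.isRegular i j hx') (K := K)
    fun k hk => by rw [hco, h.zero_of_le i _ k hk]
  obtain ⟨ψ, hψ, h2⟩ := L.exists_zetaComb_eq K (C i j.succ) hz
  have hins : ∀ t, f.toFun (insertNear i j (i.removeNth x) t) =
      f.toFun (Function.update x i (q + t)) := fun t => by
    rw [insertNear_removeNth, castSucc_succAbove_of_le hij]
  simp only [hins] at h1 hco
  simp only [hco] at h1
  have hψ' : AnalyticAt ℂ (fun z => ψ (z - q)) z₀ :=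
    AnalyticAt.fun_comp (g := ψ) hψ (analyticAt_id.sub analyticAt_const)
  have hφ' : AnalyticAt ℂ (fun z => φ (z - z₀)) z₀ :=
    AnalyticAt.fun_comp (g := φ) (by simpa using hφ) (analyticAt_id.sub analyticAt_const)
  refine ⟨fun z => φ (z - z₀) - ψ (z - q), hφ'.sub hψ', ?_⟩
  have ht1 : Tendsto (fun z : ℂ => z - z₀) (𝓝 z₀) (𝓝 0) := by
    simpa using (continuous_sub_right z₀).tendsto z₀
  have ht2 : Tendsto (fun z : ℂ => z - q) (𝓝 z₀) (𝓝 (z₀ - q)) :=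
    (continuous_sub_right q).tendsto z₀
  filter_upwards [ht1.eventually h1, ht2.eventually (eventually_nhdsWithin_iff.1 h2)]
    with z hz1 hz2 hzc
  have hne : z ≠ z₀ := by
    rintro rfl
    refine (update_mem_conf_iff hx i z).1 hzc j.succ ?_ hz
    exact (Fin.castSucc_lt_succ_iff.2 hij).ne'
  rw [hz2 (by simpa [sub_left_inj] using hne)]
  have h3 := hz1 (by simpa [sub_eq_zero] using hne)
  -- The point `z₀` may be any lattice translate of `x_{j+1}`; periodicity of `f` carries the
  -- expansion at `x_{j+1}` over to `z₀`.
  have h4 : f.toFun (Function.update x i z) =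
      f.toFun (Function.update x i (q + (z - z₀))) := by
    have h5 : z = (q + (z - z₀)) + (z₀ - q) := by ring
    conv_lhs => rw [h5]
    rw [update_add_eq]
    exact f.isRegular.periodic _ _ (single_mem_lattice hz)
  rw [h4, ← h3]
  simp only [sub_sub_sub_cancel_right]
  ring

/-- The inductive statement: removing the poles along `x_a = x_b` makes `f` independent of `x_a`. -/
def Indep (f : RegularFunctions L (n + 1)) (K : ℕ) (C : Fin (n + 1) → Fin (n + 2) → ℕ → ℂ)
    (i : ℕ) : Prop :=
  ∀ a : Fin (n + 1), a.val < i → ∀ x ∈ conf L (n + 1), ∀ z,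
    Function.update x a z ∈ conf L (n + 1) →
      removePoles f K C i (Function.update x a z) = removePoles f K C i x

/-- As a function of `xᵢ`, collisions with a point of larger index are handled by subtracting the
zeta terms. At a collision with `x_a`, `a < i`, nothing is subtracted in this step; there `x_a` can
first be moved away, since the function is already independent of `x_a`. -/
lemma extendsAt_removePoles_succ (h : HasConstantPoles f K C) {i : Fin (n + 1)}
    (hI : Indep f K C i) {x : Fin (n + 1) → ℂ} (hx : x ∈ conf L (n + 1)) (z₀ : ℂ) :
    ExtendsAt {z | Function.update x i z ∈ conf L (n + 1)}
      (fun z => removePoles f K C (i + 1) (Function.update x i z)) z₀ := by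
  by_cases hz : Function.update x i z₀ ∈ conf L (n + 1)
  · exact .of_analyticAt (h.removePoles_analyticAt _ hz)
  obtain ⟨b, hbi, hb⟩ : ∃ b, b ≠ i.castSucc ∧ z₀ - pts x b ∈ L.lattice := by
    simpa [update_mem_conf_iff hx] using hz
  have huniq : ∀ b', b' ≠ b → z₀ - pts x b' ∉ L.lattice := by
    intro b' hb' h'
    refine hx b' b hb' ?_
    have := L.lattice.sub_mem hb h'
    rwa [sub_sub_sub_cancel_left] at this
  rcases lt_or_gt_of_ne hbi with hlt | hgt
  · obtain ⟨a, rfl⟩ : ∃ a : Fin (n + 1), a.castSucc = b :=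
      ⟨b.castPred (ne_of_lt (lt_of_lt_of_le hlt (Fin.le_last _))), Fin.castSucc_castPred _ _⟩
    have hai : a < i := Fin.castSucc_lt_castSucc_iff.1 hlt
    simp only [removePoles_succ]
    refine ExtendsAt.sub ?_ (ExtendsAt.sum fun c _ => ExtendsAt.of_analyticAt ?_)
    -- The countable set to be avoided by the new value of `x_a`: outside it the configuration with
    -- `x_a` replaced by `y` stays admissible, and `z₀` no longer collides with it.
    · set B := {y | Function.update x a y ∉ conf L (n + 1)} ∪
        (fun y => z₀ - y) ⁻¹' (L.lattice : Set ℂ) with hB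
      have hBc : B.Countable := (countable_update_notMem_conf hx a).union
        (L.countable_lattice.preimage sub_right_injective)
      obtain ⟨y, hy⟩ := (dense_compl_of_countable hBc).nonempty
      simp only [hB, Set.mem_compl_iff, Set.mem_union, Set.mem_ofPred_eq, not_or, not_not] at hy
      obtain ⟨hy1, hy2⟩ := hy
      have hia : i.castSucc ≠ a.castSucc := fun h => hai.ne' (Fin.castSucc_injective _ h)
      have hy3 : Function.update (Function.update x a y) i z₀ ∈ conf L (n + 1) := by
        rw [update_mem_conf_iff hy1]
        intro c hc
        rw [pts_update]
        by_cases hca : c = a.castSucc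
        · subst hca
          rw [Function.update_self]
          exact hy2
        · rw [Function.update_of_ne hca]
          exact huniq c hca
      refine (ExtendsAt.of_analyticAt (h.removePoles_analyticAt i hy3)).congr ?_
      have hev : ∀ᶠ z in 𝓝 z₀, Function.update (Function.update x a y) i z ∈ conf L (n + 1) :=
        (update_analyticAt _ i z₀).continuousAt.eventually ((isOpen_conf L (n + 1)).mem_nhds hy3)
      filter_upwards [hev] with z hz1 hz2
      rw [Function.update_comm hai.ne] at hz1 ⊢
      exact (hI a hai _ hz2 _ hz1).symm
    · refine h.term_analyticAt x i i c fun hic => ?_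
      rw [pts_update, Function.update_self, Function.update_of_ne hic.ne']
      exact huniq c (hlt.trans hic).ne'
  · obtain ⟨j, rfl⟩ : ∃ j : Fin (n + 1), j.succ = b :=
      ⟨b.pred (ne_of_gt (lt_of_le_of_lt (Fin.zero_le _) hgt)), Fin.succ_pred _ _⟩
    have hij : i ≤ j := Fin.castSucc_lt_succ_iff.1 hgt
    have hmem : i ∈ Finset.univ.filter fun a : Fin (n + 1) => a.val < i.val + 1 := by simp
    have hsplit : ∀ z, removePoles f K C (i + 1) (Function.update x i z) =
        (f.toFun (Function.update x i z) - L.zetaComb K (C i j.succ) (z - pts x j.succ)) -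
        (∑ c ∈ Finset.univ.erase j.succ, L.zetaComb K (C i c)
            (pts (Function.update x i z) i.castSucc - pts (Function.update x i z) c) +
          ∑ a ∈ (Finset.univ.filter fun a : Fin (n + 1) => a.val < i.val + 1).erase i, ∑ c,
            L.zetaComb K (C a c)
            (pts (Function.update x i z) a.castSucc - pts (Function.update x i z) c)) := by
      intro z
      rw [removePoles, ← Finset.add_sum_erase _ _ hmem,
        ← Finset.add_sum_erase _ _ (Finset.mem_univ j.succ)]
      simp only [pts_update, Function.update_self, Function.update_of_ne hgt.ne']
      ring
    simp only [hsplit]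
    refine (h.extendsAt_slice hx i j hij hb).sub ?_
    refine ExtendsAt.add (ExtendsAt.sum fun c hc => .of_analyticAt
      (h.term_analyticAt x i i c fun hic => ?_)) (ExtendsAt.sum fun a ha => ExtendsAt.sum fun c _ =>
        .of_analyticAt (h.term_analyticAt x i a c fun hac => ?_))
    · rw [pts_update, Function.update_self, Function.update_of_ne hic.ne']
      exact huniq c (Finset.ne_of_mem_erase hc)
    · have hai : a ≠ i := Finset.ne_of_mem_erase ha
      have hai' : a.val < i.val + 1 := (Finset.mem_filter.1 (Finset.mem_of_mem_erase ha)).2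
      have hac' : a.castSucc ≠ i.castSucc := fun h => hai (Fin.castSucc_injective _ h)
      rw [pts_update, Function.update_of_ne hac']
      by_cases hc : c = i.castSucc
      · subst hc
        rw [Function.update_self, ← neg_sub, neg_mem_iff]
        refine huniq _ fun h => ?_
        have h1 := congrArg Fin.val h
        have h2 : (i : ℕ) ≤ j := hij
        simp only [Fin.val_castSucc, Fin.val_succ] at h1
        omega
      · rw [Function.update_of_ne hc]
        exact hx _ _ hac.ne

/-- Only `f` is periodic. The zeta terms with `xᵢ` as first point and those with `xᵢ` as second
point are shifted by the period with opposite signs, each contributing its residue times the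
quasi-period. -/
lemma removePoles_quasiperiodic (h : HasConstantPoles f K C) (i : Fin (n + 1))
    {x : Fin (n + 1) → ℂ} (hx : x ∈ conf L (n + 1)) {l : ℂ} (hl : l ∈ L.lattice) {z : ℂ}
    (hz : Function.update x i z ∈ conf L (n + 1)) :
    removePoles f K C (i + 1) (Function.update x i (z + l)) =
      removePoles f K C (i + 1) (Function.update x i z) +
        (∑ a, C a i.castSucc 0 - ∑ b, C i b 0) * L.eta l := by
  have hz' := (update_mem_conf_iff hx i z).1 hz
  have hl' := L.lattice.neg_mem hl
  have h1 : ∀ b, L.zetaComb K (C i b) (pts (Function.update x i (z + l)) i.castSucc -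
      pts (Function.update x i (z + l)) b) = L.zetaComb K (C i b)
      (pts (Function.update x i z) i.castSucc - pts (Function.update x i z) b) +
        C i b 0 * L.eta l := by
    intro b
    by_cases hb : b = i.castSucc
    · subst hb
      rw [L.zetaComb_eq_zero (h.zero i _ le_rfl), L.zetaComb_eq_zero (h.zero i _ le_rfl),
        h.zero i _ le_rfl]
      simp
    · simp only [pts_update, Function.update_self, Function.update_of_ne hb]
      rw [add_sub_right_comm, L.zetaComb_add _ h.pos hl (hz' b hb)]
  have h2 : ∀ a, a ≠ i → ∀ b, L.zetaComb K (C a b) (pts (Function.update x i (z + l)) a.castSucc -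
      pts (Function.update x i (z + l)) b) = L.zetaComb K (C a b)
      (pts (Function.update x i z) a.castSucc - pts (Function.update x i z) b) -
        if b = i.castSucc then C a b 0 * L.eta l else 0 := by
    intro a ha b
    have ha' : a.castSucc ≠ i.castSucc := fun h => ha (Fin.castSucc_injective _ h)
    split_ifs with hb
    · subst hb
      simp only [pts_update, Function.update_self, Function.update_of_ne ha']
      have h3 : pts x a.castSucc - (z + l) ∉ L.lattice := by
        have := hz' _ ha'
        rw [← neg_mem_iff, neg_sub, add_sub_right_comm, L.add_mem_lattice_iff hl]
        exact this
      have h4 := L.zetaComb_add (C a i.castSucc) h.pos hl h3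
      rw [show pts x a.castSucc - (z + l) + l = pts x a.castSucc - z by ring] at h4
      rw [h4]
      ring
    · simp only [pts_update, Function.update_of_ne ha', Function.update_of_ne hb, sub_zero]
  have hmem : i ∈ Finset.univ.filter fun a : Fin (n + 1) => a.val < i.val + 1 := by simp
  have hper : f.toFun (Function.update x i (z + l)) = f.toFun (Function.update x i z) := by
    rw [update_add_eq]
    exact f.isRegular.periodic _ _ (single_mem_lattice hl)
  -- The coefficients `C a i` vanish for `a ≥ i`, so the full sum is the sum over the variables
  -- already treated.
  have hC : ∑ a, C a i.castSucc 0 =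
      ∑ a ∈ (Finset.univ.filter fun a : Fin (n + 1) => a.val < i.val + 1).erase i,
        C a i.castSucc 0 := by
    refine (Finset.sum_subset (Finset.subset_univ _) fun a _ ha => h.zero a _ ?_ 0).symm
    rw [Fin.castSucc_le_castSucc_iff, Fin.le_def]
    by_contra hlt
    exact ha (Finset.mem_erase.2 ⟨fun h => hlt (by rw [h]), Finset.mem_filter.2
      ⟨Finset.mem_univ _, by omega⟩⟩)
  rw [removePoles, removePoles, hper, ← Finset.add_sum_erase _ _ hmem,
    ← Finset.add_sum_erase (Finset.univ.filter fun a : Fin (n + 1) => a.val < i.val + 1) _ hmem,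
    Finset.sum_congr rfl fun b _ => h1 b,
    Finset.sum_congr (g := fun a => ∑ b, _) rfl fun a ha => Finset.sum_congr rfl fun b _ =>
      h2 a (Finset.ne_of_mem_erase ha) b, hC]
  simp only [Finset.sum_add_distrib, Finset.sum_sub_distrib, Finset.sum_ite_eq', Finset.mem_univ,
    if_true, ← Finset.sum_mul]
  ring

/-- Fixing all other variables, the function is without poles and quasi-periodic with factor the
defect of the residue sums. `const_of_quasiperiodic` gives both conclusions at once: the defect is
zero and the function is constant in `xᵢ`, which feeds the induction. -/
lemma residue_sum_and_indep (h : HasConstantPoles f K C) (i : Fin (n + 1)) (hI : Indep f K C i) :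
    ∑ a, C a i.castSucc 0 - ∑ b, C i b 0 = 0 ∧ Indep f K C (i + 1) := by
  have key : ∀ x ∈ conf L (n + 1), ∑ a, C a i.castSucc 0 - ∑ b, C i b 0 = 0 ∧
      ∀ z ∈ {z | Function.update x i z ∈ conf L (n + 1)},
        ∀ w ∈ {z | Function.update x i z ∈ conf L (n + 1)},
          removePoles f K C (i + 1) (Function.update x i z) =
            removePoles f K C (i + 1) (Function.update x i w) := by
    intro x hx
    refine L.const_of_quasiperiodic (C := {z | Function.update x i z ∈ conf L (n + 1)})
      (u := fun z => removePoles f K C (i + 1) (Function.update x i z)) ?_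
      (h.extendsAt_removePoles_succ hI hx) fun l hl z hz =>
        ⟨?_, h.removePoles_quasiperiodic i hx hl hz⟩
    · have := dense_compl_of_countable (countable_update_notMem_conf hx i)
      convert this using 1
      ext z
      simp
    · change Function.update x i (z + l) ∈ conf L (n + 1)
      rw [update_add_eq, conf_add (single_mem_lattice hl)]
      exact hz
  obtain ⟨x₀, hx₀⟩ := nonempty_conf L (n + 1)
  refine ⟨(key x₀ hx₀).1, fun a ha x hx z hz => ?_⟩
  by_cases hai : a = i
  · subst hai
    have := (key x hx).2 z hz (x a) (by simpa using hx)
    rwa [Function.update_eq_self] at this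
  · have ha' : a.val < i.val := by
      have : a.val ≠ i.val := fun h => hai (Fin.ext h)
      omega
    have hne : i.castSucc ≠ a.castSucc := fun h => hai (Fin.castSucc_injective _ h.symm)
    rw [removePoles_succ, removePoles_succ, hI a ha' x hx z hz]
    congr 1
    refine Finset.sum_congr rfl fun b _ => ?_
    by_cases hb : b = a.castSucc
    · have hz0 : ∀ k, C i b k = 0 := h.zero i b (by
        rw [hb]
        exact Fin.castSucc_le_castSucc_iff.2 ha'.le)
      rw [L.zetaComb_eq_zero hz0, L.zetaComb_eq_zero hz0]
    · rw [pts_update, Function.update_of_ne hne, Function.update_of_ne hb]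

/-- The residue theorem for regular functions with constant poles. -/
theorem residue_sum (h : HasConstantPoles f K C) (i : Fin (n + 1)) :
    ∑ a, C a i.castSucc 0 = ∑ b, C i b 0 := by
  have hall : ∀ m : ℕ, m ≤ n + 1 → Indep f K C m := by
    intro m
    induction m with
    | zero => exact fun _ a ha => absurd ha (Nat.not_lt_zero _)
    | succ m ih => exact fun hm => (h.residue_sum_and_indep ⟨m, hm⟩ (ih (by omega))).2
  exact sub_eq_zero.1 (h.residue_sum_and_indep i (hall i i.2.le)).1

end HasConstantPoles

/-- The residues of a function in the first nontrivial step of the filtration are constants, and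
satisfy the residue theorem in each variable. -/
theorem exists_residues {f : RegularFunctions L (n + 1)} {q : ℤ} (hq : q + n ≤ 0)
    (hf : f ∈ functionFiltration L (n + 1) q) :
    ∃ c : Fin (n + 1) → Fin (n + 2) → ℂ,
      (∀ i j, i ≤ j → coeff i j (-1) f = c i j.succ • one L n) ∧
      (∀ a b, b ≤ a.castSucc → c a b = 0) ∧ ∀ i, ∑ a, c a i.castSucc = ∑ b, c i b := by
  have hex : ∀ (i j : Fin (n + 1)) (k : ℕ), ∃ c : ℂ, i ≤ j →
      coeff i j (-(k : ℤ) - 1) f = c • one L n := by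
    intro i j k
    by_cases hij : i ≤ j
    · obtain ⟨c, hc⟩ := exists_coeff_eq_smul_one hq hf hij (m := -(k : ℤ) - 1) (by omega)
      exact ⟨c, fun _ => hc⟩
    · exact ⟨0, fun h => absurd h hij⟩
  choose c hc using hex
  have hM : ∀ i j : Fin (n + 1), ∃ K : ℕ, ∀ k : ℕ, K ≤ k → coeff i j (-(k : ℤ) - 1) f = 0 := by
    intro i j
    obtain ⟨M, hM⟩ := coeff_eq_zero f i j
    exact ⟨(-M).toNat, fun k hk => hM _ (by omega)⟩
  choose K hK using hM
  -- A common bound for the pole orders along all divisors; adding `1` makes it positive.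
  set K₀ := (∑ i, ∑ j, K i j) + 1 with hK₀
  have hKle : ∀ i j, K i j ≤ K₀ := fun i j =>
    ((Finset.single_le_sum (f := fun j => K i j) (fun _ _ => Nat.zero_le _)
      (Finset.mem_univ j)).trans (Finset.single_le_sum (f := fun i => ∑ j, K i j)
        (fun _ _ => Nat.zero_le _) (Finset.mem_univ i))).trans (Nat.le_succ _)
  set C : Fin (n + 1) → Fin (n + 2) → ℕ → ℂ := fun a b k =>
    if h : a.castSucc < b then c a (b.pred (Fin.ne_zero_of_lt h)) k else 0 with hC
  have hCs : ∀ a j, a ≤ j → ∀ k, C a j.succ k = c a j k := by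
    intro a j haj k
    simp only [hC]
    rw [dif_pos (Fin.castSucc_lt_succ_iff.2 haj), Fin.pred_succ]
  have h0 : ∀ a b, b ≤ a.castSucc → ∀ k, C a b k = 0 := fun a b hab k => dif_neg (not_lt.2 hab)
  have hP : HasConstantPoles f K₀ C :=
    { pos := Nat.succ_pos _
      coeff_eq := fun a j haj k => by rw [hCs a j haj]; exact hc a j k haj
      zero := h0
      zero_of_le := fun a b k hk => by
        by_cases hab : a.castSucc < b
        · obtain ⟨j, rfl⟩ : ∃ j : Fin (n + 1), j.succ = b :=
            ⟨b.pred (Fin.ne_zero_of_lt hab), Fin.succ_pred _ _⟩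
          have haj : a ≤ j := Fin.castSucc_lt_succ_iff.1 hab
          rw [hCs a j haj]
          refine smul_one_injective (L := L) (n := n) ?_
          rw [← hc a j k haj, hK a j k ((hKle a j).trans hk), zero_smul]
        · exact h0 a b (not_lt.1 hab) k }
  refine ⟨fun a b => C a b 0, fun i j hij => ?_, fun a b hab => h0 a b hab 0, hP.residue_sum⟩
  have := hP.coeff_eq i j hij 0
  simpa using this

end EllipticConfig

/-! ### Laurent coefficients and differentiation. -/

namespace LaurentCoeff

lemma iteratedDeriv_succ_id_mul {g : ℂ → ℂ} (hg : AnalyticAt ℂ g 0) (k : ℕ) :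
    iteratedDeriv (k + 1) (fun t => t * g t) 0 = (k + 1) * iteratedDeriv k g 0 := by
  have hd : ∀ {g : ℂ → ℂ}, AnalyticAt ℂ g 0 →
      deriv (fun t => t * g t) =ᶠ[𝓝 0] fun t => g t + t * deriv g t := by
    intro g hg
    filter_upwards [hg.eventually_analyticAt] with t ht
    rw [deriv_fun_mul differentiableAt_fun_id ht.differentiableAt]
    simp
  induction k generalizing g with
  | zero =>
    rw [iteratedDeriv_succ', (hd hg).iteratedDeriv_eq]
    simp
  | succ k ih =>
    have h1 : AnalyticAt ℂ (fun t => t * deriv g t) 0 := analyticAt_id.mul hg.deriv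
    rw [iteratedDeriv_succ', (hd hg).iteratedDeriv_eq,
      iteratedDeriv_fun_add hg.contDiffAt h1.contDiffAt, ih hg.deriv, ← iteratedDeriv_succ']
    push_cast
    ring

lemma laurentCoeff_deriv {h h' : ℂ → ℂ} (hh : MeromorphicAt h 0)
    (hd : ∀ᶠ t in 𝓝[≠] (0 : ℂ), HasDerivAt h (h' t) t) (m : ℤ) :
    laurentCoeff h' m = (m + 1) * laurentCoeff h (m + 1) := by
  obtain ⟨s, hs⟩ := exists_common hh
  obtain ⟨φ, hφ, he⟩ := hs s le_rfl
  have hψ : AnalyticAt ℂ (fun t => s * φ t + t * deriv φ t) 0 :=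
    (analyticAt_const.mul hφ).add (analyticAt_id.mul hφ.deriv)
  -- From `h = t ^ s φ` one gets `h' = t ^ (s - 1) (s φ + t φ')`, whose Taylor coefficients can be
  -- compared with those of `φ`.
  have he' : ∀ᶠ t in 𝓝[≠] (0 : ℂ), h' t = t ^ (s - 1) * (s * φ t + t * deriv φ t) := by
    filter_upwards [hd, eventually_eventually_nhdsWithin.2 he, self_mem_nhdsWithin,
      nhdsWithin_le_nhds hφ.eventually_analyticAt] with t ht hte ht0 hφt
    have ht0' : t ≠ 0 := ht0
    rw [isOpen_compl_singleton.nhdsWithin_eq ht0] at hte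
    have h1 := ((hasDerivAt_zpow s t (Or.inl ht0')).fun_mul
      hφt.differentiableAt.hasDerivAt).congr_of_eventuallyEq hte
    rw [ht.unique h1]
    have h2 : t ^ s = t ^ (s - 1) * t := by rw [← zpow_add_one₀ ht0', sub_add_cancel]
    rw [h2]
    ring
  rw [laurentCoeff_eq hψ he', laurentCoeff_eq hφ he]
  by_cases hms : m < s - 1
  · rw [if_pos hms, if_pos (by omega), mul_zero]
  · rw [if_neg hms, if_neg (by omega), show m - (s - 1) = m + 1 - s by ring]
    obtain ⟨k, hk⟩ : ∃ k : ℕ, m + 1 - s = k := ⟨(m + 1 - s).toNat, by omega⟩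
    have h1 : AnalyticAt ℂ (fun t => s * φ t) 0 := analyticAt_const.mul hφ
    have h2 : AnalyticAt ℂ (fun t => t * deriv φ t) 0 := analyticAt_id.mul hφ.deriv
    have hm : (m : ℂ) + 1 = k + s := by
      have : m + 1 = k + s := by omega
      exact_mod_cast this
    rw [hk, Int.toNat_natCast, iteratedDeriv_fun_add h1.contDiffAt h2.contDiffAt,
      iteratedDeriv_const_mul_field, hm]
    cases k with
    | zero => simp
    | succ k =>
      rw [iteratedDeriv_succ_id_mul hφ.deriv, ← iteratedDeriv_succ']
      push_cast
      ring

/-- Taylor coefficients in one variable commute with differentiation in the other variables. -/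
lemma fderiv_iteratedDeriv {E : Type*} [NormedAddCommGroup E] [NormedSpace ℂ E]
    [CompleteSpace E] {G : E × ℂ → ℂ} {p : E} (hG : AnalyticAt ℂ G (p, 0)) (v : E) (k : ℕ) :
    fderiv ℂ (fun x => iteratedDeriv k (fun t => G (x, t)) 0) p v =
      iteratedDeriv k (fun t => fderiv ℂ G (p, t) (v, 0)) 0 := by
  have hline : ∀ x : E, ∀ t : ℂ, HasDerivAt (fun t : ℂ => (x, t)) ((0 : E), (1 : ℂ)) t :=
    fun x t => (hasDerivAt_const _ _).prodMk (hasDerivAt_id _)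
  have hlt : ∀ x : E, Tendsto (fun t : ℂ => (x, t)) (𝓝 0) (𝓝 (x, 0)) := fun x =>
    (hline x 0).continuousAt.tendsto
  induction k generalizing G with
  | zero =>
    simp only [iteratedDeriv_zero]
    have h1 : HasFDerivAt (fun x : E => (x, (0 : ℂ))) (ContinuousLinearMap.inl ℂ E ℂ) p :=
      (ContinuousLinearMap.inl ℂ E ℂ).hasFDerivAt
    have h2 := HasFDerivAt.comp p (hG.differentiableAt.hasFDerivAt) h1
    have h3 : fderiv ℂ (fun x => G (x, 0)) p v = _ := congrArg (fun T => T v) h2.fderiv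
    simpa using h3
  | succ k ih =>
    set G' : E × ℂ → ℂ := fun z => fderiv ℂ G z (0, 1) with hG'
    have hG'a : AnalyticAt ℂ G' (p, 0) :=
      ((ContinuousLinearMap.apply ℂ ℂ ((0 : E), (1 : ℂ))).analyticAt _).comp hG.fderiv
    have hx : ∀ᶠ x in 𝓝 p, iteratedDeriv (k + 1) (fun t => G (x, t)) 0 =
        iteratedDeriv k (fun t => G' (x, t)) 0 := by
      have ht : Tendsto (fun x : E => (x, (0 : ℂ))) (𝓝 p) (𝓝 (p, 0)) :=
        Continuous.tendsto (by fun_prop) p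
      filter_upwards [ht.eventually hG.eventually_analyticAt] with x hx
      rw [iteratedDeriv_succ']
      refine Filter.EventuallyEq.iteratedDeriv_eq k ?_
      filter_upwards [(hlt x).eventually hx.eventually_analyticAt] with t ht
      exact (ht.differentiableAt.hasFDerivAt.comp_hasDerivAt t (hline x t)).deriv
    rw [Filter.EventuallyEq.fderiv_eq hx, ih hG'a, iteratedDeriv_succ']
    refine Filter.EventuallyEq.iteratedDeriv_eq k ?_
    filter_upwards [(hlt p).eventually hG.eventually_analyticAt] with t ht
    -- The interchange of the derivative in `t` with the derivative in the direction `v` is the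
    -- symmetry of the second derivative.
    have hsymm : IsSymmSndFDerivAt ℂ G (p, t) := ht.contDiffAt.isSymmSndFDerivAt_of_omega
    have hd2 := ht.fderiv.differentiableAt.hasFDerivAt
    have e1 : fderiv ℂ G' (p, t) (v, 0) = fderiv ℂ (fderiv ℂ G) (p, t) (v, 0) (0, 1) := by
      have := ((ContinuousLinearMap.apply ℂ ℂ ((0 : E), (1 : ℂ))).hasFDerivAt).comp (p, t) hd2
      exact congrArg (fun T => T ((v, 0) : E × ℂ)) this.fderiv
    have e2 : deriv (fun t => fderiv ℂ G (p, t) (v, 0)) t =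
        fderiv ℂ (fderiv ℂ G) (p, t) (0, 1) (v, 0) := by
      have := (((ContinuousLinearMap.apply ℂ ℂ ((v : E), (0 : ℂ))).hasFDerivAt).comp (p, t)
        hd2).comp_hasDerivAt t (hline p t)
      exact this.deriv
    rw [e1, e2, hsymm.eq]

end LaurentCoeff

namespace EllipticConfig

open LaurentCoeff PeriodPair

variable {L : PeriodPair} {n : ℕ}

lemma toFun_partialDeriv (f : RegularFunctions L n) (i : Fin n) {x : Fin n → ℂ}
    (hx : x ∈ conf L n) :
    (partialDeriv i f).toFun x = fderiv ℂ f.toFun x (Pi.single i 1) := by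
  classical
  exact if_pos hx

lemma hasDerivAt_insertNear (i j : Fin (n + 1)) (x : Fin n → ℂ) (t : ℂ) :
    HasDerivAt (fun t => insertNear i j x t) (Pi.single i 1) t := by
  rw [hasDerivAt_pi]
  intro a
  induction a using Fin.succAboveCases i with
  | x =>
    simp only [insertNear, Fin.insertNth_apply_same, Pi.single_eq_same]
    exact (hasDerivAt_id t).const_add _
  | p k =>
    simp only [insertNear, Fin.insertNth_apply_succAbove, Pi.single_eq_of_ne (Fin.succAbove_ne i k)]
    exact hasDerivAt_const _ _

/-- The Laurent coefficients of `∂ᵢ f` along `xᵢ = x_j`. -/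
lemma coeff_partialDeriv_self (i j : Fin (n + 1)) (m : ℤ) (f : RegularFunctions L (n + 1)) :
    coeff i j m (partialDeriv i f) = ((m : ℂ) + 1) • coeff i j (m + 1) f := by
  ext x
  by_cases hx : x ∈ conf L n
  · rw [RegularFunctions.toFun_smul, Pi.smul_apply, toFun_coeff _ _ _ _ hx,
      toFun_coeff _ _ _ _ hx, smul_eq_mul]
    refine laurentCoeff_deriv (slice_meromorphicAt f.isRegular i j hx) ?_ m
    filter_upwards [insertNear_mem_conf i j hx] with t ht
    rw [toFun_partialDeriv f i ht]
    exact (f.isRegular.analyticAt ht).differentiableAt.hasFDerivAt.comp_hasDerivAt t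
      (hasDerivAt_insertNear i j x t)
  · rw [toFun_eq_zero _ hx, toFun_eq_zero _ hx]

/-- Near a point of the configuration space, the Laurent expansion of a regular function has
analytic coefficients. -/
lemma exists_joint_expansion (f : RegularFunctions L (n + 1)) (i j : Fin (n + 1)) {p : Fin n → ℂ}
    (hp : p ∈ conf L n) :
    ∃ (M : ℕ) (Φ : (Fin n → ℂ) × ℂ → ℂ), AnalyticAt ℂ Φ (p, 0) ∧
      (∀ᶠ z in 𝓝 (p, (0 : ℂ)), z.2 ≠ 0 → insertNear i j z.1 z.2 ∈ conf L (n + 1)) ∧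
      ∀ᶠ z in 𝓝 (p, (0 : ℂ)), z.2 ≠ 0 →
        f.toFun (insertNear i j z.1 z.2) = z.2 ^ (-(M : ℤ)) * Φ z := by
  obtain ⟨N, hN⟩ := f.isRegular.merom
  obtain ⟨g, hg, he⟩ := hN (insertNear i j p 0)
  have ha := insertNear_analyticAt i j (p, (0 : ℂ))
  have hcf := crossFactor_analyticAt (L := L) j p (p, (0 : ℂ))
  have hcf0 : crossFactor L j p p 0 ≠ 0 := crossFactor_ne_zero p hp
  have hδ : AnalyticAt ℂ (fun z : (Fin n → ℂ) × ℂ => discr L (pts p) (pts z.1)) (p, 0) :=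
    AnalyticAt.fun_comp (g := fun x : Fin n → ℂ => discr L (pts p) (pts x)) (f := Prod.fst)
      (discr_analyticAt L _ _) analyticAt_fst
  have hδ0 : discr L (pts p) (pts p) ≠ 0 := discr_ne_zero L _ hp
  have hconf : ∀ᶠ z in 𝓝 (p, (0 : ℂ)), z.2 ≠ 0 → insertNear i j z.1 z.2 ∈ conf L (n + 1) := by
    have hcont : ∀ a : Fin (n + 1), Continuous fun z : (Fin n → ℂ) × ℂ => pts z.1 a := fun a =>
      (pts_continuous a).comp continuous_fst
    have h1 : ∀ k : Fin (n + 1), ∀ᶠ z in 𝓝 (p, (0 : ℂ)), z.2 ≠ 0 →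
        pts z.1 j + z.2 - pts z.1 k ∉ L.lattice := by
      intro k
      by_cases hk : j = k
      · subst hk
        have h2 : Tendsto (fun z : (Fin n → ℂ) × ℂ => z.2) (𝓝 (p, 0)) (𝓝 0) :=
          continuous_snd.tendsto _
        filter_upwards [h2.eventually (L.compl_lattice_sdiff_singleton_mem_nhds 0)] with z hz hz0 h
        rw [add_sub_cancel_left] at h
        exact hz ⟨h, hz0⟩
      · have h2 : Tendsto (fun z : (Fin n → ℂ) × ℂ => pts z.1 j + z.2 - pts z.1 k) (𝓝 (p, 0))
            (𝓝 (pts p j + 0 - pts p k)) :=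
          (((hcont j).add continuous_snd).sub (hcont k)).tendsto _
        filter_upwards [h2.eventually (L.isClosed_lattice.isOpen_compl.mem_nhds
          (by rw [add_zero]; exact hp j k hk))] with z hz _
        exact hz
    have h2 : ∀ᶠ z in 𝓝 (p, (0 : ℂ)), z.1 ∈ conf L n :=
      (continuous_fst.tendsto (p, (0 : ℂ))).eventually ((isOpen_conf L n).mem_nhds hp)
    filter_upwards [eventually_all.2 h1, h2] with z hz hzc hz0 a b hab
    induction a using Fin.succAboveCases i.castSucc with
    | x =>
      induction b using Fin.succAboveCases i.castSucc with
      | x => exact absurd rfl hab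
      | p b =>
        rw [pts_insertNear_same, pts_insertNear_succAbove]
        exact hz b hz0
    | p a =>
      induction b using Fin.succAboveCases i.castSucc with
      | x =>
        rw [pts_insertNear_same, pts_insertNear_succAbove, ← neg_sub, neg_mem_iff]
        exact hz a hz0
      | p b =>
        rw [pts_insertNear_succAbove, pts_insertNear_succAbove]
        exact hzc a b fun h => hab (by rw [h])
  have hden : AnalyticAt ℂ (fun z : (Fin n → ℂ) × ℂ => (-(crossFactor L j p z.1 z.2 *
      discr L (pts p) (pts z.1))) ^ N) (p, 0) := ((hcf.mul hδ).neg).pow N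
  have hden0 : (-(crossFactor L j p p 0 * discr L (pts p) (pts p))) ^ N ≠ 0 :=
    pow_ne_zero _ (neg_ne_zero.2 (mul_ne_zero hcf0 hδ0))
  refine ⟨2 * N, fun z => g (insertNear i j z.1 z.2) / (-(crossFactor L j p z.1 z.2 *
    discr L (pts p) (pts z.1))) ^ N,
    (AnalyticAt.fun_comp (g := g)
    (f := fun z : (Fin n → ℂ) × ℂ => insertNear i j z.1 z.2) hg ha).fun_div hden hden0, hconf, ?_⟩
  filter_upwards [hconf, ha.continuousAt.tendsto.eventually he,
    hden.continuousAt.eventually_ne hden0] with z hzc hze hzd hz0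
  have h1 := hze (hzc hz0)
  rw [discr_insertNear, ← discr_eq_cross] at h1
  rw [← h1, zpow_neg, zpow_natCast, show -z.2 ^ 2 * crossFactor L j p z.1 z.2 *
    discr L (pts p) (pts z.1) = z.2 ^ 2 * (-(crossFactor L j p z.1 z.2 *
    discr L (pts p) (pts z.1))) by ring, mul_pow, ← pow_mul]
  have : z.2 ^ (2 * N) ≠ 0 := pow_ne_zero _ hz0
  field_simp

/-- The inserted point is `x_j + t`, so moving `x_j` drags it along. This is the source of the extra
`∂ᵢ` in the commutation of coefficients with derivations. -/
lemma hasFDerivAt_insertNear_smul (i j : Fin (n + 1)) (x : Fin n → ℂ) (t : ℂ) (k : Fin n) :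
    HasDerivAt (fun s : ℂ => insertNear i j (x + s • Pi.single k 1) t)
      (Pi.single (i.succAbove k) 1 + if j = k.castSucc then Pi.single i 1 else 0) 0 := by
  rw [hasDerivAt_pi]
  intro a
  have hl : ∀ b : Fin n, HasDerivAt (fun s : ℂ => (x + s • Pi.single k 1 : Fin n → ℂ) b)
      ((Pi.single k 1 : Fin n → ℂ) b) 0 := fun b => by
    simpa using ((hasDerivAt_id (0 : ℂ)).mul_const ((Pi.single k 1 : Fin n → ℂ) b)).const_add (x b)
  induction a using Fin.succAboveCases i with
  | x =>
    simp only [insertNear, Fin.insertNth_apply_same, Pi.add_apply,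
      Pi.single_eq_of_ne (Fin.succAbove_ne i k).symm, zero_add]
    refine HasDerivAt.add_const _ ?_
    induction j using Fin.lastCases with
    | last =>
      simp only [pts_last, if_neg (Fin.castSucc_lt_last k).ne', Pi.zero_apply]
      exact hasDerivAt_const _ _
    | cast j =>
      simp only [pts_castSucc]
      refine (hl j).congr_deriv ?_
      by_cases hjk : j = k
      · subst hjk
        simp
      · rw [Pi.single_eq_of_ne hjk, if_neg (fun h => hjk (Fin.castSucc_injective _ h))]
        rfl
  | p b =>
    simp only [insertNear, Fin.insertNth_apply_succAbove, Pi.add_apply]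
    refine (hl b).congr_deriv ?_
    have h0 : (if j = k.castSucc then Pi.single i 1 else 0 : Fin (n + 1) → ℂ) (i.succAbove b) = 0 := by
      split_ifs
      · exact Pi.single_eq_of_ne (Fin.succAbove_ne i b) _
      · rfl
    rw [h0, add_zero]
    by_cases hbk : b = k
    · subst hbk
      simp
    · rw [Pi.single_eq_of_ne hbk,
        Pi.single_eq_of_ne fun h => hbk (Fin.succAbove_right_injective h)]

/-- Laurent coefficients commute with the derivations in the remaining variables. -/
lemma coeff_partialDeriv_succAbove (i j : Fin (n + 1)) (k : Fin n) (m : ℤ)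
    (f : RegularFunctions L (n + 1)) :
    partialDeriv k (coeff i j m f) = coeff i j m (partialDeriv (i.succAbove k) f +
      if j = k.castSucc then partialDeriv i f else 0) := by
  ext p
  by_cases hp : p ∈ conf L n
  swap
  · rw [toFun_eq_zero _ hp, toFun_eq_zero _ hp]
  obtain ⟨M, Φ, hΦ, hconf, he⟩ := exists_joint_expansion f i j hp
  set g := partialDeriv (i.succAbove k) f + if j = k.castSucc then partialDeriv i f else 0 with hg
  have hgx : ∀ y ∈ conf L (n + 1), g.toFun y = fderiv ℂ f.toFun y
      (Pi.single (i.succAbove k) 1 + if j = k.castSucc then Pi.single i 1 else 0) := by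
    intro y hy
    rw [hg, RegularFunctions.toFun_add, Pi.add_apply, map_add, toFun_partialDeriv _ _ hy]
    congr 1
    split_ifs
    · exact toFun_partialDeriv _ _ hy
    · rw [map_zero]
      rfl
  have hlt : ∀ x : Fin n → ℂ, Tendsto (fun t : ℂ => (x, t)) (𝓝 0) (𝓝 (x, 0)) := fun x =>
    Continuous.tendsto (by fun_prop) 0
  have hΦ' : AnalyticAt ℂ (fun z => fderiv ℂ Φ z (Pi.single k 1, 0)) (p, 0) :=
    ((ContinuousLinearMap.apply ℂ ℂ ((Pi.single k 1 : Fin n → ℂ), (0 : ℂ))).analyticAt _).comp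
      hΦ.fderiv
  have hslice : ∀ {Ψ : (Fin n → ℂ) × ℂ → ℂ} {x : Fin n → ℂ}, AnalyticAt ℂ Ψ (x, 0) →
      AnalyticAt ℂ (fun t => Ψ (x, t)) 0 := fun {Ψ x} h =>
    AnalyticAt.fun_comp (g := Ψ) (f := fun t : ℂ => (x, t)) h
      (analyticAt_const.prod analyticAt_id)
  have hgs : ∀ᶠ t in 𝓝[≠] (0 : ℂ), g.toFun (insertNear i j p t) =
      t ^ (-(M : ℤ)) * fderiv ℂ Φ (p, t) (Pi.single k 1, 0) := by
    filter_upwards [mem_nhdsWithin_of_mem_nhds ((hlt p).eventually hconf),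
      mem_nhdsWithin_of_mem_nhds ((hlt p).eventually he.eventually_nhds),
      mem_nhdsWithin_of_mem_nhds ((hlt p).eventually hΦ.eventually_analyticAt),
      self_mem_nhdsWithin] with t htc hte htΦ ht0
    have hy := htc ht0
    rw [hgx _ hy]
    have h1 : HasDerivAt (fun s : ℂ => f.toFun (insertNear i j (p + s • Pi.single k 1) t)) _ 0 :=
      HasFDerivAt.comp_hasDerivAt_of_eq (0 : ℂ)
        (f.isRegular.analyticAt hy).differentiableAt.hasFDerivAt
        (hasFDerivAt_insertNear_smul i j p t k) (by simp)
    have hl : HasDerivAt (fun s : ℂ => (p + s • (Pi.single k 1 : Fin n → ℂ), t))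
        ((Pi.single k 1 : Fin n → ℂ), (0 : ℂ)) 0 := by
      refine HasDerivAt.prodMk ?_ (hasDerivAt_const _ _)
      simpa using ((hasDerivAt_id (0 : ℂ)).smul_const (Pi.single k 1 : Fin n → ℂ)).const_add p
    have h2 : HasDerivAt (fun s : ℂ => t ^ (-(M : ℤ)) * Φ (p + s • Pi.single k 1, t)) _ 0 :=
      (HasFDerivAt.comp_hasDerivAt_of_eq (0 : ℂ) htΦ.differentiableAt.hasFDerivAt hl
        (by simp)).const_mul _
    -- Both sides compute the derivative at `s = 0`, with `t` fixed, of the same function: once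
    -- through `f`, once through its expansion.
    refine h1.unique (h2.congr_of_eventuallyEq ?_)
    have htend : Tendsto (fun s : ℂ => (p + s • (Pi.single k 1 : Fin n → ℂ), t)) (𝓝 0)
        (𝓝 (p, t)) := by simpa using hl.continuousAt.tendsto
    filter_upwards [htend.eventually hte] with s hs
    exact hs ht0
  rw [toFun_coeff _ _ _ _ hp, laurentCoeff_eq (hslice hΦ') hgs, toFun_partialDeriv _ _ hp]
  have hcoe : (coeff i j m f).toFun =ᶠ[𝓝 p] fun x => if m < -(M : ℤ) then 0 else
      iteratedDeriv (m - -(M : ℤ)).toNat (fun t => Φ (x, t)) 0 /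
        ((m - -(M : ℤ)).toNat.factorial : ℂ) := by
    have ht : Tendsto (fun x : Fin n → ℂ => (x, (0 : ℂ))) (𝓝 p) (𝓝 (p, 0)) :=
      Continuous.tendsto (by fun_prop) p
    filter_upwards [(isOpen_conf L n).mem_nhds hp, ht.eventually hΦ.eventually_analyticAt,
      ht.eventually he.eventually_nhds] with x hx hxΦ hxe
    rw [toFun_coeff _ _ _ _ hx]
    refine laurentCoeff_eq (hslice hxΦ) ?_ m
    filter_upwards [mem_nhdsWithin_of_mem_nhds ((hlt x).eventually hxe), self_mem_nhdsWithin]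
      with t ht1 ht2
    exact ht1 ht2
  rw [hcoe.fderiv_eq]
  split_ifs with hm
  · simp
  · have hd := (analyticAt_iteratedDeriv hΦ (m - -(M : ℤ)).toNat).differentiableAt
    have e : (fun x => iteratedDeriv (m - -(M : ℤ)).toNat (fun t => Φ (x, t)) 0 /
        ((m - -(M : ℤ)).toNat.factorial : ℂ)) = fun x =>
        ((m - -(M : ℤ)).toNat.factorial : ℂ)⁻¹ •
          iteratedDeriv (m - -(M : ℤ)).toNat (fun t => Φ (x, t)) 0 := by
      funext x
      rw [div_eq_inv_mul, smul_eq_mul]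
    rw [e, fderiv_fun_const_smul hd, _root_.smul_apply, fderiv_iteratedDeriv hΦ, smul_eq_mul,
      div_eq_inv_mul]

end EllipticConfig

/-! ### Mean values over a real torus. -/

namespace EllipticConfig

open LaurentCoeff PeriodPair MeasureTheory

variable {L : PeriodPair} {n : ℕ}

variable (L) in
/-- A parametrised real torus contained in the configuration space. -/
def torus (θ : Fin n → ℝ) (i : Fin n) : ℂ :=
  θ i * L.ω₁ + (((i : ℕ) + 1 : ℝ) / (n + 1) : ℝ) * L.ω₂

/-- The `ω₂`-coordinates of the points are `(i + 1) / (n + 1)`, and that of the marked point is `0`.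
They are distinct modulo `1`, so no two points are congruent modulo the lattice. -/
lemma torus_mem_conf (θ : Fin n → ℝ) : torus L θ ∈ conf L n := by
  have hn : (0 : ℝ) < n + 1 := by positivity
  have hpts : ∀ a : Fin (n + 1), ∃ (s : ℝ) (k : ℕ), k ≤ n ∧
      (k = if a = Fin.last n then 0 else (a : ℕ) + 1) ∧
      pts (torus L θ) a = s * L.ω₁ + ((k : ℝ) / (n + 1) : ℝ) * L.ω₂ := by
    intro a
    induction a using Fin.lastCases with
    | last => exact ⟨0, 0, by omega, by simp, by simp [pts_last]⟩
    | cast i =>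
      refine ⟨θ i, i + 1, by omega, by simp [(Fin.castSucc_lt_last i).ne], ?_⟩
      rw [pts_castSucc, torus]
      push_cast
      rfl
  intro a b hab h
  obtain ⟨s, k, hk, hka, ha⟩ := hpts a
  obtain ⟨s', k', hk', hkb, hb⟩ := hpts b
  obtain ⟨m, l, hml⟩ := mem_lattice.1 h
  rw [ha, hb] at hml
  have hind := (LinearIndependent.pair_iff.1 L.indep) (m - (s - s'))
    (l - ((k : ℝ) / (n + 1) - (k' : ℝ) / (n + 1))) (by
      simp only [Complex.real_smul]
      push_cast
      push_cast at hml
      linear_combination hml)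
  have h1 : (l : ℝ) * (n + 1) = k - k' := by
    have := hind.2
    field_simp at this
    linarith
  have h2 : l * (n + 1) = (k : ℤ) - k' := by exact_mod_cast h1
  have hl : l = 0 := by
    rcases lt_trichotomy l 0 with hl | hl | hl
    · nlinarith
    · exact hl
    · nlinarith
  rw [hl, zero_mul] at h2
  apply hab
  have ha' := a.isLt
  have hb' := b.isLt
  split_ifs at hka hkb with e1 e2 e2
  · rw [e1, e2]
  · omega
  · omega
  · exact Fin.ext (by omega)

lemma continuous_torus : Continuous fun θ : Fin n → ℝ => torus L θ := by
  unfold torus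
  fun_prop

lemma continuous_toFun_torus (f : RegularFunctions L n) :
    Continuous fun θ : Fin n → ℝ => f.toFun (torus L θ) :=
  continuous_iff_continuousAt.2 fun θ =>
    ContinuousAt.comp (g := f.toFun) (f := fun θ => torus L θ)
      (f.isRegular.analyticAt (torus_mem_conf θ)).continuousAt continuous_torus.continuousAt

variable (L n) in
/-- The mean value of a regular function over a real torus. -/
def mean : RegularFunctions L n →ₗ[ℂ] ℂ where
  toFun f := ∫ θ in Set.Icc (0 : Fin n → ℝ) 1, f.toFun (torus L θ)
  map_add' f g := by
    simp only [RegularFunctions.toFun_add, Pi.add_apply]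
    exact integral_add (continuous_toFun_torus f).integrableOn_Icc
      (continuous_toFun_torus g).integrableOn_Icc
  map_smul' c f := by
    simp only [RegularFunctions.toFun_smul, Pi.smul_apply]
    exact integral_smul c _

lemma mean_one : mean L n (one L n) = 1 := by
  change ∫ θ in Set.Icc (0 : Fin n → ℝ) 1, (one L n).toFun (torus L θ) = 1
  simp only [toFun_one _ (torus_mem_conf _)]
  simp [measureReal_def, Real.volume_Icc_pi]

lemma hasFDerivAt_toFun_torus (f : RegularFunctions L n) (θ : Fin n → ℝ) :
    HasFDerivAt (fun θ : Fin n → ℝ => f.toFun (torus L θ))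
      (((fderiv ℂ f.toFun (torus L θ)).restrictScalars ℝ).comp
        (ContinuousLinearMap.pi fun i =>
          (ContinuousLinearMap.proj (R := ℝ) (φ := fun _ : Fin n => ℝ) i).smulRight L.ω₁)) θ := by
  have h1 : HasFDerivAt (fun θ : Fin n → ℝ => torus L θ) (ContinuousLinearMap.pi fun i =>
          (ContinuousLinearMap.proj (R := ℝ) (φ := fun _ : Fin n => ℝ) i).smulRight L.ω₁) θ := by
    rw [hasFDerivAt_pi]
    intro i
    have := (((ContinuousLinearMap.proj (R := ℝ) (φ := fun _ : Fin n => ℝ) i).smulRight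
      L.ω₁).hasFDerivAt (x := θ)).add_const
        ((((i : ℕ) + 1 : ℝ) / (n + 1) : ℝ) * L.ω₂)
    exact this
  exact HasFDerivAt.comp θ ((f.isRegular.analyticAt
    (torus_mem_conf θ)).differentiableAt.hasFDerivAt.restrictScalars ℝ) h1

lemma ω₁_ne_zero : L.ω₁ ≠ 0 := by
  simpa using L.indep.ne_zero 0

/-- Up to the factor `ω₁`, the function `∂ᵢ f` restricted to the torus is the derivative in `θᵢ` of
the restriction of `f`. Its integral is a difference over opposite faces of the cube, which cancels
by periodicity. -/
lemma mean_partialDeriv (i : Fin n) (f : RegularFunctions L n) :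
    mean L n (partialDeriv i f) = 0 := by
  obtain ⟨k, rfl⟩ : ∃ k, n = k + 1 := ⟨n - 1, by have := i.isLt; omega⟩
  have hpd : ∀ θ : Fin (k + 1) → ℝ, fderiv ℂ f.toFun (torus L θ) (fun j =>
      (Pi.single i (1 : ℝ) : Fin (k + 1) → ℝ) j • L.ω₁) =
      L.ω₁ * (partialDeriv i f).toFun (torus L θ) := by
    intro θ
    rw [toFun_partialDeriv f i (torus_mem_conf θ), ← smul_eq_mul, ← map_smul]
    congr 1
    funext j
    by_cases hj : j = i
    · subst hj
      simp
    · simp [hj]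
  have h := integral_divergence_of_hasFDerivAt_off_countable' (0 : Fin (k + 1) → ℝ) 1
    (fun _ => zero_le_one)
    (fun j θ => if j = i then f.toFun (torus L θ) else 0)
    (fun j θ => if j = i then ((fderiv ℂ f.toFun (torus L θ)).restrictScalars ℝ).comp
        (ContinuousLinearMap.pi fun i =>
          (ContinuousLinearMap.proj (R := ℝ) (φ := fun _ : Fin (k + 1) => ℝ) i).smulRight L.ω₁)
        else 0)
    ∅ Set.countable_empty
    (fun j => by
      by_cases hj : j = i
      · simpa only [if_pos hj] using (continuous_toFun_torus f).continuousOn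
      · simpa only [if_neg hj] using continuousOn_const)
    (fun θ _ j => by
      by_cases hj : j = i
      · simpa only [if_pos hj] using hasFDerivAt_toFun_torus f θ
      · simpa only [if_neg hj] using hasFDerivAt_const _ _)
    (by
      have e : (fun θ : Fin (k + 1) → ℝ => ∑ j : Fin (k + 1), (if j = i then
          ((fderiv ℂ f.toFun (torus L θ)).restrictScalars ℝ).comp
          (ContinuousLinearMap.pi fun i =>
          (ContinuousLinearMap.proj (R := ℝ) (φ := fun _ : Fin (k + 1) => ℝ) i).smulRight L.ω₁)
          else 0) (Pi.single j 1)) = fun θ => L.ω₁ * (partialDeriv i f).toFun (torus L θ) := by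
        funext θ
        rw [Finset.sum_eq_single i (fun j _ hj => by rw [if_neg hj]; rfl) (by simp), if_pos rfl]
        exact hpd θ
      rw [e]
      exact (continuous_const.mul (continuous_toFun_torus _)).integrableOn_Icc)
  have e : (∫ θ in Set.Icc (0 : Fin (k + 1) → ℝ) 1, ∑ j : Fin (k + 1), (if j = i then
      ((fderiv ℂ f.toFun (torus L θ)).restrictScalars ℝ).comp
      (ContinuousLinearMap.pi fun i =>
      (ContinuousLinearMap.proj (R := ℝ) (φ := fun _ : Fin (k + 1) => ℝ) i).smulRight L.ω₁)
      else 0) (Pi.single j 1)) = L.ω₁ * mean L (k + 1) (partialDeriv i f) := by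
    change _ = L.ω₁ * ∫ θ in Set.Icc (0 : Fin (k + 1) → ℝ) 1, _
    rw [← integral_const_mul]
    refine integral_congr_ae (Eventually.of_forall fun θ => ?_)
    simp only
    rw [Finset.sum_eq_single i (fun j _ hj => by rw [if_neg hj]; rfl) (by simp), if_pos rfl]
    exact hpd θ
  rw [e, Finset.sum_eq_zero] at h
  · exact (mul_eq_zero.1 h).resolve_left ω₁_ne_zero
  · intro j _
    by_cases hj : j = i
    · subst hj
      simp only [if_true]
      rw [sub_eq_zero]
      refine integral_congr_ae (Eventually.of_forall fun θ => ?_)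
      -- Opposite faces of the cube differ by the period `ω₁` in one coordinate.
      have hp : torus L (j.insertNth (1 : ℝ) θ) =
          torus L (j.insertNth (0 : ℝ) θ) + Pi.single j L.ω₁ := by
        funext a
        induction a using Fin.succAboveCases j with
        | x => simp [torus, add_comm]
        | p a => simp [torus, Fin.succAbove_ne]
      change f.toFun (torus L (j.insertNth (1 : ℝ) θ)) = f.toFun (torus L (j.insertNth (0 : ℝ) θ))
      rw [hp]
      refine f.isRegular.periodic _ _ fun a => ?_
      by_cases ha : a = j
      · subst ha
        simpa using L.ω₁_mem_lattice
      · simp [ha]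
    · simp only [if_neg hj, sub_self]

end EllipticConfig

/-! ### Sums of functions of one difference, and functions with prescribed polar parts. -/

namespace EllipticConfig

open LaurentCoeff PeriodPair

variable {L : PeriodPair} {n : ℕ}

variable (L) in
/-- Meromorphic functions on `ℂ` with poles at most at the points of the lattice. -/
structure HasLatticePoles (w : ℂ → ℂ) : Prop where
  analyticAt : ∀ z ∉ L.lattice, AnalyticAt ℂ w z
  meromorphicAt : ∀ z, MeromorphicAt w z

namespace HasLatticePoles

lemma zero : HasLatticePoles L fun _ => 0 := ⟨fun _ _ => analyticAt_const, fun _ => .const 0 _⟩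

lemma add {v w : ℂ → ℂ} (hv : HasLatticePoles L v) (hw : HasLatticePoles L w) :
    HasLatticePoles L fun z => v z + w z :=
  ⟨fun z hz => (hv.1 z hz).add (hw.1 z hz), fun z => (hv.2 z).add (hw.2 z)⟩

lemma const_mul {w : ℂ → ℂ} (hw : HasLatticePoles L w) (c : ℂ) :
    HasLatticePoles L fun z => c * w z :=
  ⟨fun z hz => analyticAt_const.mul (hw.1 z hz), fun z => (MeromorphicAt.const c z).mul (hw.2 z)⟩

lemma comp_neg {w : ℂ → ℂ} (hw : HasLatticePoles L w) : HasLatticePoles L fun z => w (-z) := by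
  refine ⟨fun z hz => ?_, fun z => ?_⟩
  · exact AnalyticAt.fun_comp (g := w) (f := fun z : ℂ => -z)
      (hw.1 (-z) (by rwa [neg_mem_iff])) analyticAt_id.neg
  · exact MeromorphicAt.comp_analyticAt (f := w) (g := fun z : ℂ => -z) (hw.2 (-z))
      analyticAt_id.neg

lemma iteratedDeriv {w : ℂ → ℂ} (hw : HasLatticePoles L w) (k : ℕ) :
    HasLatticePoles L (iteratedDeriv k w) := by
  refine ⟨fun z hz => ?_, fun z => ?_⟩
  · rw [iteratedDeriv_eq_iterate]
    exact (hw.1 z hz).iterated_deriv k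
  · rw [iteratedDeriv_eq_iterate]
    exact Meromorphic.iterated_deriv (n := k) (fun z => hw.2 z) z

end HasLatticePoles

variable (L) in
/-- Functions on the configuration space which are sums of functions of one difference of
coordinates. -/
def IsPairSum (u : (Fin n → ℂ) → ℂ) : Prop :=
  ∃ (c : ℂ) (w : Fin (n + 1) × Fin (n + 1) → ℂ → ℂ), (∀ D, HasLatticePoles L (w D)) ∧
    ∀ x ∈ conf L n, u x = c + ∑ D with D.1 < D.2, w D (pts x D.1 - pts x D.2)

namespace IsPairSum

lemma const (c : ℂ) : IsPairSum L fun _ : Fin n → ℂ => c :=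
  ⟨c, fun _ _ => 0, fun _ => .zero, fun _ _ => by simp⟩

lemma add {u v : (Fin n → ℂ) → ℂ} (hu : IsPairSum L u) (hv : IsPairSum L v) :
    IsPairSum L fun x => u x + v x := by
  obtain ⟨c, w, hw, h⟩ := hu
  obtain ⟨c', w', hw', h'⟩ := hv
  refine ⟨c + c', fun D z => w D z + w' D z, fun D => (hw D).add (hw' D), fun x hx => ?_⟩
  beta_reduce
  rw [h x hx, h' x hx, Finset.sum_add_distrib]
  ring

lemma congr {u v : (Fin n → ℂ) → ℂ} (hu : IsPairSum L u) (h : ∀ x ∈ conf L n, v x = u x) :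
    IsPairSum L v := by
  obtain ⟨c, w, hw, h'⟩ := hu
  exact ⟨c, w, hw, fun x hx => by rw [h x hx, h' x hx]⟩

lemma sum {ι : Type*} {s : Finset ι} {u : ι → (Fin n → ℂ) → ℂ} (h : ∀ i ∈ s, IsPairSum L (u i)) :
    IsPairSum L fun x => ∑ i ∈ s, u i x := by
  classical
  induction s using Finset.induction_on with
  | empty => simpa using const 0
  | insert a s ha ih =>
    simp only [Finset.sum_insert ha]
    exact (h a (Finset.mem_insert_self a s)).add
      (ih fun i hi => h i (Finset.mem_insert_of_mem hi))

lemma single {w : ℂ → ℂ} (hw : HasLatticePoles L w) {a b : Fin (n + 1)} (hab : a ≠ b) :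
    IsPairSum L fun x : Fin n → ℂ => w (pts x a - pts x b) := by
  wlog h : a < b generalizing a b w
  · refine (this hw.comp_neg hab.symm (lt_of_le_of_ne (not_lt.1 h) hab.symm)).congr fun x _ => ?_
    rw [neg_sub]
  refine ⟨0, fun D => if D = (a, b) then w else fun _ => 0, fun D => ?_, fun x _ => ?_⟩
  · beta_reduce
    split_ifs
    · exact hw
    · exact .zero
  · beta_reduce
    rw [Finset.sum_eq_single (a, b), if_pos rfl, zero_add]
    · intro D _ hD
      rw [if_neg hD]
    · simp [h]

/-- Each summand has poles along a single divisor and its translates, so one divisor at a time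
suffices locally. -/
lemma mem_functionFiltration {f : RegularFunctions L n} (hf : IsPairSum L f.toFun) :
    f ∈ functionFiltration L n (-n + 1) := by
  classical
  obtain ⟨c, w, hw, h⟩ := hf
  refine Submodule.subset_span fun p => ?_
  set z₀ : Fin (n + 1) × Fin (n + 1) → ℂ := fun D => pts p D.1 - pts p D.2 with hz₀
  choose M hM using fun D => (hw D).2 (z₀ D)
  set N := Finset.univ.sup M with hN
  have hG : ∀ D, AnalyticAt ℂ (fun z => (z - z₀ D) ^ N * w D z) (z₀ D) := fun D => by
    have h1 : AnalyticAt ℂ (fun z => (z - z₀ D) ^ (N - M D) *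
        ((z - z₀ D) ^ M D * w D z)) (z₀ D) :=
      ((analyticAt_id.sub analyticAt_const).pow _).mul (hM D)
    refine h1.congr (Eventually.of_forall fun z => ?_)
    simp only
    rw [← mul_assoc, ← pow_add, Nat.sub_add_cancel (Finset.le_sup (Finset.mem_univ D))]
  have hdiff : ∀ D : Fin (n + 1) × Fin (n + 1),
      AnalyticAt ℂ (fun x : Fin n → ℂ => pts x D.1 - pts x D.2) p := fun D =>
    (pts_analyticAt _ _).sub (pts_analyticAt _ _)
  -- The empty set collects the constant and the summands regular at `p`; a singleton carries its
  -- own summand multiplied by the `N`-th power of the local equation. Larger sets do not enter the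
  -- sum.
  refine ⟨N, fun S x => if S = ∅ then c + ∑ D with D.1 < D.2 ∧ D ∉ divisorsThrough L p,
      w D (pts x D.1 - pts x D.2) else
      ∑ D ∈ S, ((pts x D.1 - pts x D.2) - z₀ D) ^ N * w D (pts x D.1 - pts x D.2),
    fun S => ?_, ?_⟩
  · beta_reduce
    split_ifs
    · refine analyticAt_const.add (Finset.analyticAt_fun_sum _ fun D hD => ?_)
      rw [Finset.mem_filter, divisor_mem] at hD
      exact AnalyticAt.fun_comp (g := w D)
        ((hw D).1 _ fun h => hD.2.2 ⟨hD.2.1, h⟩) (hdiff D)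
    · exact Finset.analyticAt_fun_sum _ fun D _ => AnalyticAt.fun_comp
        (g := fun z => (z - z₀ D) ^ N * w D z) (hG D) (hdiff D)
  · refine Eventually.of_forall fun x hx => ?_
    have hset : ((divisorsThrough L p).powerset.filter
        fun S => (S.card : ℤ) ≤ -(n : ℤ) + 1 + n) =
        insert ∅ ((divisorsThrough L p).image fun D => {D}) := by
      ext S
      simp only [Finset.mem_filter, Finset.mem_powerset, Finset.mem_insert, Finset.mem_image]
      constructor
      · rintro ⟨h1, h2⟩
        rcases Finset.eq_empty_or_nonempty S with h0 | ⟨D, hD⟩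
        · exact Or.inl h0
        · refine Or.inr ⟨D, h1 hD, ?_⟩
          obtain ⟨E, rfl⟩ := Finset.card_eq_one.1
            (le_antisymm (by omega : S.card ≤ 1) (Finset.card_pos.2 ⟨_, hD⟩))
          rw [Finset.mem_singleton.1 hD]
      · rintro (rfl | ⟨D, hD, rfl⟩)
        · simp
        · simp [hD]
    rw [hset, Finset.sum_insert, Finset.sum_image]
    beta_reduce
    rw [if_pos rfl, Finset.prod_empty, div_one, h x hx,
      add_assoc]
    · congr 1
      rw [← Finset.sum_filter_add_sum_filter_not (Finset.univ.filter
        fun D : Fin (n + 1) × Fin (n + 1) => D.1 < D.2) (fun D => D ∉ divisorsThrough L p),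
        Finset.filter_filter, Finset.filter_filter]
      congr 1
      have hset2 : (Finset.univ.filter fun D : Fin (n + 1) × Fin (n + 1) =>
          D.1 < D.2 ∧ ¬ D ∉ divisorsThrough L p) = divisorsThrough L p := by
        ext D
        simp only [Finset.mem_filter, Finset.mem_univ, true_and, not_not, and_iff_right_iff_imp]
        exact fun hD => (divisor_mem.1 hD).1
      rw [hset2]
      refine Finset.sum_congr rfl fun D hD => ?_
      rw [if_neg (Finset.singleton_ne_empty D), Finset.sum_singleton, Finset.prod_singleton]
      have hne : ((pts x D.1 - pts x D.2) - z₀ D) ^ N ≠ 0 := by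
        refine pow_ne_zero _ fun h0 => ?_
        obtain ⟨h1, h2⟩ := divisor_mem.1 hD
        refine hx D.1 D.2 h1.ne ?_
        rwa [sub_eq_zero.1 h0]
      exact (mul_div_cancel_left₀ _ hne).symm
    · exact fun D _ E _ h => Finset.singleton_injective h
    · simp

end IsPairSum

lemma pts_insertNear_analyticAt (i j : Fin (n + 1)) (x : Fin n → ℂ) (a : Fin (n + 2)) (s : ℂ) :
    AnalyticAt ℂ (fun t : ℂ => pts (insertNear i j x t) a) s := by
  induction a using Fin.succAboveCases i.castSucc with
  | x =>
    simp only [pts_insertNear_same]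
    exact analyticAt_const.add analyticAt_id
  | p a =>
    simp only [pts_insertNear_succAbove]
    exact analyticAt_const

lemma HasLatticePoles.meromorphicAt_insertNear {w : ℂ → ℂ} (hw : HasLatticePoles L w)
    (i j : Fin (n + 1)) (x : Fin n → ℂ) (a b : Fin (n + 2)) :
    MeromorphicAt (fun t => w (pts (insertNear i j x t) a - pts (insertNear i j x t) b)) 0 :=
  MeromorphicAt.comp_analyticAt (f := w)
    (g := fun t => pts (insertNear i j x t) a - pts (insertNear i j x t) b) (hw.2 _)
    ((pts_insertNear_analyticAt i j x a 0).sub (pts_insertNear_analyticAt i j x b 0))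

/-- If the inserted point is paired with `x_j`, the function depends on `t` alone and its
coefficients are constants. Paired with another point, it is analytic in `t`, with Taylor
coefficients that are derivatives of `w` in a difference of coordinates. A pair not involving the
inserted point contributes only for `m = 0`. -/
lemma isPairSum_laurentCoeff {w : ℂ → ℂ} (hw : HasLatticePoles L w) (i j : Fin (n + 1)) (m : ℤ)
    {a b : Fin (n + 2)} (hab : a ≠ b) :
    IsPairSum L fun x : Fin n → ℂ => laurentCoeff
      (fun t => w (pts (insertNear i j x t) a - pts (insertNear i j x t) b)) m := by
  have key : ∀ {w : ℂ → ℂ}, HasLatticePoles L w → ∀ b : Fin (n + 1),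
      IsPairSum L fun x : Fin n → ℂ => laurentCoeff (fun t => w (pts x j + t - pts x b)) m := by
    intro w hw b
    by_cases hb : j = b
    · subst hb
      simp only [add_sub_cancel_left]
      exact .const _
    · refine (IsPairSum.single (w := fun z => (if m < 0 then 0 else (m.toNat.factorial : ℂ)⁻¹) *
        iteratedDeriv m.toNat w z) ((hw.iteratedDeriv _).const_mul _) hb).congr fun x hx => ?_
      have e : (fun t => w (pts x j + t - pts x b)) = fun t => w ((pts x j - pts x b) + t) := by
        funext t
        congr 1
        ring
      have han : AnalyticAt ℂ (fun t => w ((pts x j - pts x b) + t)) 0 :=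
        AnalyticAt.fun_comp (g := w) (f := fun t => (pts x j - pts x b) + t)
          (by rw [add_zero]; exact hw.1 _ (hx j b hb)) (analyticAt_const.add analyticAt_id)
      rw [e, laurentCoeff_of_analyticAt han]
      split_ifs
      · simp
      · rw [iteratedDeriv_comp_const_add]
        simp [div_eq_inv_mul]
  induction a using Fin.succAboveCases i.castSucc with
  | x =>
    induction b using Fin.succAboveCases i.castSucc with
    | x => exact absurd rfl hab
    | p b =>
      simp only [pts_insertNear_same, pts_insertNear_succAbove]
      exact key hw b
  | p a =>
    induction b using Fin.succAboveCases i.castSucc with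
    | x =>
      simp only [pts_insertNear_same, pts_insertNear_succAbove]
      simpa only [neg_sub] using key hw.comp_neg a
    | p b =>
      simp only [pts_insertNear_succAbove]
      refine (IsPairSum.single (w := fun z => (if m = 0 then 1 else 0) * w z) (hw.const_mul _)
        (a := a) (b := b) (fun h => hab (by rw [h]))).congr fun x hx => ?_
      rw [laurentCoeff_of_analyticAt (h := fun _ : ℂ => w (pts x a - pts x b)) analyticAt_const]
      rcases lt_trichotomy m 0 with hm | hm | hm
      · simp [hm, hm.ne]
      · simp [hm]
      · obtain ⟨k, rfl⟩ : ∃ k : ℕ, m = k := ⟨m.toNat, by omega⟩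
        have : k ≠ 0 := by omega
        simp [this, iteratedDeriv_const]

lemma toFun_coeff_of_isPairSum {f : RegularFunctions L (n + 1)} {c : ℂ}
    {w : Fin (n + 2) × Fin (n + 2) → ℂ → ℂ} (hw : ∀ D, HasLatticePoles L (w D))
    (h : ∀ x ∈ conf L (n + 1), f.toFun x = c + ∑ D with D.1 < D.2, w D (pts x D.1 - pts x D.2))
    (i j : Fin (n + 1)) (m : ℤ) {x : Fin n → ℂ} (hx : x ∈ conf L n) :
    (coeff i j m f).toFun x = laurentCoeff (fun _ => c) m + ∑ D with D.1 < D.2,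
      laurentCoeff (fun t => w D (pts (insertNear i j x t) D.1 - pts (insertNear i j x t) D.2))
        m := by
  have hmer : ∀ D, MeromorphicAt (fun t => w D (pts (insertNear i j x t) D.1 -
      pts (insertNear i j x t) D.2)) 0 := fun D => (hw D).meromorphicAt_insertNear i j x _ _
  rw [toFun_coeff _ _ _ _ hx, ← laurentCoeff_sum _ (h := fun D t => w D (pts (insertNear i j x t) D.1 -
      pts (insertNear i j x t) D.2)) (fun D _ => hmer D),
    ← laurentCoeff_add (.const c 0) (MeromorphicAt.fun_sum fun D _ => hmer D)]
  refine laurentCoeff_congr (slice_meromorphicAt f.isRegular i j hx) ?_ m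
  filter_upwards [insertNear_mem_conf i j hx] with t ht
  rw [h _ ht]

/-- The point is the nonnegative coefficients: they too have poles on one divisor at a time, so
their contributions to a boundary lie one step deeper in the filtration by functions. -/
lemma IsPairSum.coeff {f : RegularFunctions L (n + 1)} (hf : IsPairSum L f.toFun)
    (i j : Fin (n + 1)) (m : ℤ) : IsPairSum L (coeff i j m f).toFun := by
  obtain ⟨c, w, hw, h⟩ := hf
  refine ((IsPairSum.const (laurentCoeff (fun _ => c) m)).add (IsPairSum.sum
    (s := Finset.univ.filter fun D : Fin (n + 2) × Fin (n + 2) => D.1 < D.2) fun D hD =>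
    isPairSum_laurentCoeff (hw D) i j m (Finset.mem_filter.1 hD).2.ne)).congr fun x hx => ?_
  exact toFun_coeff_of_isPairSum hw h i j m hx

/-- Along `xᵢ = x_j` the only summand with a pole is the one of that difference, and there it is a
function of `t` alone. -/
lemma coeff_of_neg {f : RegularFunctions L (n + 1)} {c : ℂ}
    {w : Fin (n + 2) × Fin (n + 2) → ℂ → ℂ} (hw : ∀ D, HasLatticePoles L (w D))
    (h : ∀ x ∈ conf L (n + 1), f.toFun x = c + ∑ D with D.1 < D.2, w D (pts x D.1 - pts x D.2))
    {i j : Fin (n + 1)} (hij : i ≤ j) {m : ℤ} (hm : m < 0) :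
    coeff i j m f = laurentCoeff (w (i.castSucc, j.succ)) m • one L n := by
  ext x
  by_cases hx : x ∈ conf L n
  · rw [toFun_coeff_of_isPairSum hw h i j m hx, laurentCoeff_of_analyticAt analyticAt_const,
      if_pos hm, zero_add, RegularFunctions.toFun_smul, Pi.smul_apply, toFun_one x hx, smul_eq_mul,
      mul_one, Finset.sum_eq_single (i.castSucc, j.succ)]
    · congr 1
      funext t
      simp only
      rw [← castSucc_succAbove_of_le hij, pts_insertNear_same, pts_insertNear_succAbove,
        add_sub_cancel_left]
    · intro D hD hne
      rw [laurentCoeff_of_analyticAt, if_pos hm]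
      have h0 := pts_insertNear_sub_notMem hx (Finset.mem_filter.1 hD).2 hne hij
      exact AnalyticAt.fun_comp (g := w D)
        (f := fun t => pts (insertNear i j x t) D.1 - pts (insertNear i j x t) D.2)
        ((hw D).1 _ h0) ((pts_insertNear_analyticAt i j x _ 0).sub
          (pts_insertNear_analyticAt i j x _ 0))
    · intro h0
      refine absurd (Finset.mem_filter.2 ⟨Finset.mem_univ _, ?_⟩) h0
      exact Fin.castSucc_lt_succ_iff.2 hij
  · rw [toFun_eq_zero _ hx, toFun_eq_zero _ hx]

lemma eta_add {l l' : ℂ} (hl : l ∈ L.lattice) (hl' : l' ∈ L.lattice) :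
    L.eta (l + l') = L.eta l + L.eta l' := by
  have h0 := L.ω₁_div_two_notMem_lattice
  have h1 := L.zeta_add hl h0
  have h2 := L.zeta_add hl' (z := L.ω₁ / 2 + l) (by rwa [L.add_mem_lattice_iff hl])
  have h3 := L.zeta_add (L.lattice.add_mem hl hl') h0
  rw [← add_assoc, h2, h1] at h3
  linear_combination -h3

lemma eta_zero : L.eta 0 = 0 := by simp [PeriodPair.eta]

lemma eta_sub {l l' : ℂ} (hl : l ∈ L.lattice) (hl' : l' ∈ L.lattice) :
    L.eta (l - l') = L.eta l - L.eta l' := by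
  have := eta_add (L.lattice.sub_mem hl hl') hl'
  rw [sub_add_cancel] at this
  linear_combination -this

lemma hasLatticePoles_zetaComb (K : ℕ) (c : ℕ → ℂ) : HasLatticePoles L (L.zetaComb K c) := by
  refine ⟨fun z hz => L.analyticAt_zetaComb K c hz, fun z => ?_⟩
  by_cases hz : z ∈ L.lattice
  · obtain ⟨φ, hφ, he⟩ := L.exists_zetaComb_eq K c hz
    refine MeromorphicAt.congr (MeromorphicAt.add (MeromorphicAt.fun_sum (s := Finset.range K)
      (G := fun k w => c k * (w - z) ^ (-(k : ℤ) - 1)) fun k _ => ?_) hφ.meromorphicAt)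
      (he.mono fun w hw => hw.symm)
    exact (MeromorphicAt.const _ z).fun_mul
      (((MeromorphicAt.id z).fun_sub (MeromorphicAt.const z z)).fun_zpow _)
  · exact (L.analyticAt_zetaComb K c hz).meromorphicAt

lemma laurentCoeff_zetaComb {K : ℕ} (c : ℕ → ℂ) (k : ℕ) :
    laurentCoeff (L.zetaComb K c) (-(k : ℤ) - 1) = if k < K then c k else 0 := by
  obtain ⟨φ, hφ, he⟩ := L.exists_zetaComb_eq K c L.lattice.zero_mem
  have hmer : ∀ k, MeromorphicAt (fun z : ℂ => c k * z ^ (-(k : ℤ) - 1)) 0 := fun k =>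
    (MeromorphicAt.const _ _).fun_mul ((MeromorphicAt.id (0 : ℂ)).fun_zpow _)
  simp only [sub_zero] at he
  rw [laurentCoeff_congr ((hasLatticePoles_zetaComb K c).2 0) he,
    laurentCoeff_add (MeromorphicAt.fun_sum fun k _ => hmer k) hφ.meromorphicAt,
    laurentCoeff_of_analyticAt hφ, if_pos (by omega), add_zero,
    laurentCoeff_sum _ fun k _ => hmer k]
  have : ∀ k' : ℕ, laurentCoeff (fun z : ℂ => c k' * z ^ (-(k' : ℤ) - 1)) (-(k : ℤ) - 1) =
      if k = k' then c k' else 0 := fun k' => by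
    rw [laurentCoeff_const_mul (h := fun z : ℂ => z ^ (-(k' : ℤ) - 1))
      ((MeromorphicAt.id (0 : ℂ)).fun_zpow _), laurentCoeff_zpow]
    by_cases h : k = k'
    · simp [h]
    · rw [if_neg h, if_neg (by omega), mul_zero]
  simp [this]

lemma exists_zetaComb_mul_pow (K : ℕ) (c : ℕ → ℂ) {l : ℂ} (hl : l ∈ L.lattice) :
    ∃ H : ℂ → ℂ, AnalyticAt ℂ H l ∧ ∀ᶠ z in 𝓝[≠] l, L.zetaComb K c z * (z - l) ^ K = H z := by
  obtain ⟨φ, hφ, he⟩ := L.exists_zetaComb_eq K c hl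
  have hid : AnalyticAt ℂ (fun z => z - l) l := analyticAt_id.sub analyticAt_const
  refine ⟨fun z => ∑ k ∈ Finset.range K, c k * (z - l) ^ (K - k - 1) + φ z * (z - l) ^ K,
    (Finset.analyticAt_fun_sum _ fun k _ => analyticAt_const.mul (hid.pow _)).add
      (hφ.mul (hid.pow _)), ?_⟩
  filter_upwards [he, self_mem_nhdsWithin] with z hz hzl
  have hzl' : z - l ≠ 0 := sub_ne_zero.2 hzl
  rw [hz, add_mul, Finset.sum_mul]
  congr 1
  refine Finset.sum_congr rfl fun k hk => ?_
  have hk' := Finset.mem_range.1 hk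
  rw [mul_assoc, ← zpow_natCast, ← zpow_add₀ hzl', ← zpow_natCast]
  congr 2
  omega

/-- Sums of zeta functions of the differences of the coordinates, subject to the residue
theorem, are regular functions. -/
lemma isRegular_zetaComb {K : ℕ} (hK : 0 < K) (c : Fin (n + 1) → Fin (n + 1) → ℕ → ℂ)
    (hc : ∀ a b, ¬ a < b → c a b = 0)
    (hres : ∀ i : Fin n, ∑ a, c a i.castSucc 0 = ∑ b, c i.castSucc b 0) [DecidablePred (· ∈ conf L n)] :
    IsRegular L n fun x => if x ∈ conf L n then
      ∑ a, ∑ b, L.zetaComb K (c a b) (pts x a - pts x b) else 0 := by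
  classical
  have hzero : ∀ a b, ¬ a < b → ∀ z, L.zetaComb K (c a b) z = 0 := fun a b h z =>
    L.zetaComb_eq_zero (fun k => by rw [hc a b h]; rfl) z
  refine ⟨fun x hx => if_neg hx, fun x l hl => ?_, ?_⟩
  · simp only [conf_add hl]
    split_ifs with hx
    -- Each zeta term changes by its residue times a difference of quasi-periods. Summing up, the
    -- total change at each variable is its residue defect, which vanishes by `hres`; the marked
    -- point does not move.
    · have hterm : ∀ a b, L.zetaComb K (c a b) (pts (x + l) a - pts (x + l) b) =
          L.zetaComb K (c a b) (pts x a - pts x b) +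
            (c a b 0 * L.eta (pts l a) - c a b 0 * L.eta (pts l b)) := by
        intro a b
        by_cases hab : a < b
        · rw [pts_add, Pi.add_apply, Pi.add_apply, add_sub_add_comm,
            L.zetaComb_add _ hK (L.lattice.sub_mem (pts_mem hl a) (pts_mem hl b)) (hx a b hab.ne),
            eta_sub (pts_mem hl a) (pts_mem hl b), mul_sub]
        · rw [hzero a b hab, hzero a b hab, hc a b hab]
          simp
      simp only [hterm, Finset.sum_add_distrib, Finset.sum_sub_distrib]
      rw [Finset.sum_comm (f := fun a b => c a b 0 * L.eta (pts l b))]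
      simp only [← Finset.sum_mul]
      rw [Fin.sum_univ_castSucc (f := fun a => (∑ b, c a b 0) * L.eta (pts l a)),
        Fin.sum_univ_castSucc (f := fun b => (∑ a, c a b 0) * L.eta (pts l b))]
      simp only [hres, pts_last, eta_zero]
      ring
    · rfl
  · refine ⟨K, fun p => ?_⟩
    set fac : Fin (n + 1) × Fin (n + 1) → (Fin n → ℂ) → ℂ := fun D x =>
      if D.1 ≠ D.2 ∧ pts p D.1 - pts p D.2 ∈ L.lattice then
        (pts x D.1 - pts x D.2) - (pts p D.1 - pts p D.2) else 1 with hfac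
    have hfac_an : ∀ D, AnalyticAt ℂ (fac D) p := fun D => by
      simp only [hfac]
      split_ifs
      · exact ((pts_analyticAt _ p).sub (pts_analyticAt _ p)).sub analyticAt_const
      · exact analyticAt_const
    -- Splitting off the factor of one divisor shows that its `K`-th power absorbs the pole of the
    -- corresponding term, whose order is at most `K`.
    have hdiscr : ∀ D x, discr L (pts p) (pts x) = fac D x * ∏ E ∈ Finset.univ.erase D, fac E x := by
      intro D x
      rw [Finset.mul_prod_erase _ (fun D => fac D x) (Finset.mem_univ D), discr, ← Finset.univ_product_univ,
        Finset.prod_product]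
    have hterm : ∀ D : Fin (n + 1) × Fin (n + 1), ∃ g : (Fin n → ℂ) → ℂ, AnalyticAt ℂ g p ∧
        ∀ᶠ x in 𝓝 p, x ∈ conf L n → L.zetaComb K (c D.1 D.2) (pts x D.1 - pts x D.2) *
          discr L (pts p) (pts x) ^ K = g x := by
      intro D
      have hz : AnalyticAt ℂ (fun x : Fin n → ℂ => pts x D.1 - pts x D.2) p :=
        (pts_analyticAt _ p).sub (pts_analyticAt _ p)
      by_cases hD : D.1 < D.2
      swap
      · exact ⟨fun _ => 0, analyticAt_const, Eventually.of_forall fun x _ => by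
          rw [hzero _ _ hD, zero_mul]⟩
      by_cases hl : pts p D.1 - pts p D.2 ∈ L.lattice
      · obtain ⟨H, hH, he⟩ := exists_zetaComb_mul_pow K (c D.1 D.2) hl
        refine ⟨fun x => H (pts x D.1 - pts x D.2) * (∏ E ∈ Finset.univ.erase D, fac E x) ^ K,
          (AnalyticAt.fun_comp (g := H) (f := fun x : Fin n → ℂ => pts x D.1 - pts x D.2) hH hz).mul
            ((Finset.analyticAt_fun_prod _ fun E _ => hfac_an E).pow _), ?_⟩
        filter_upwards [hz.continuousAt.tendsto.eventually (eventually_nhdsWithin_iff.1 he)]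
          with x hx hxc
        have hne : pts x D.1 - pts x D.2 ≠ pts p D.1 - pts p D.2 := fun h =>
          hxc D.1 D.2 hD.ne (by rw [h]; exact hl)
        rw [hdiscr D x, mul_pow, ← mul_assoc, ← hx hne]
        simp only [hfac]
        rw [if_pos ⟨hD.ne, hl⟩]
      · exact ⟨fun x => L.zetaComb K (c D.1 D.2) (pts x D.1 - pts x D.2) *
          discr L (pts p) (pts x) ^ K,
          (AnalyticAt.fun_comp (g := L.zetaComb K (c D.1 D.2))
            (f := fun x : Fin n → ℂ => pts x D.1 - pts x D.2) (L.analyticAt_zetaComb K _ hl)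
            hz).mul ((discr_analyticAt L _ p).pow _), Eventually.of_forall fun _ _ => rfl⟩
    choose g hg he using hterm
    refine ⟨fun x => ∑ a, ∑ b, g (a, b) x, Finset.analyticAt_fun_sum _ fun a _ =>
      Finset.analyticAt_fun_sum _ fun b _ => hg _, ?_⟩
    filter_upwards [eventually_all.2 he] with x hx hxc
    rw [if_pos hxc, Finset.sum_mul]
    refine Finset.sum_congr rfl fun a _ => ?_
    rw [Finset.sum_mul]
    exact Finset.sum_congr rfl fun b _ => hx (a, b) hxc

/-- Existence of regular functions with given constant polar parts satisfying the residue
theorem. -/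
theorem exists_of_residues {K : ℕ} (hK : 0 < K) (c : Fin (n + 2) → Fin (n + 2) → ℕ → ℂ)
    (hc : ∀ a b, ¬ a < b → c a b = 0)
    (hres : ∀ i : Fin (n + 1), ∑ a, c a i.castSucc 0 = ∑ b, c i.castSucc b 0) :
    ∃ f ∈ functionFiltration L (n + 1) (-n),
      (∀ i j, i ≤ j → ∀ k : ℕ, coeff i j (-(k : ℤ) - 1) f =
        (if k < K then c i.castSucc j.succ k else 0) • one L n) ∧
      ∀ i j m, coeff i j m f ∈ functionFiltration L n (-n + 1) := by
  classical
  have hf : ∀ x ∈ conf L (n + 1), (RegularFunctions.mk _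
      (isRegular_zetaComb (L := L) hK c hc hres)).toFun x =
      0 + ∑ D : Fin (n + 2) × Fin (n + 2) with D.1 < D.2,
        L.zetaComb K (c D.1 D.2) (pts x D.1 - pts x D.2) := by
    intro x hx
    rw [RegularFunctions.toFun_mk, if_pos hx, zero_add, Finset.sum_filter,
      ← Finset.univ_product_univ, Finset.sum_product]
    refine Finset.sum_congr rfl fun a _ => Finset.sum_congr rfl fun b _ => ?_
    split_ifs with hab
    · rfl
    · exact L.zetaComb_eq_zero (fun k => by rw [hc a b hab]; rfl) _
  have hps : IsPairSum L (RegularFunctions.mk _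
      (isRegular_zetaComb (L := L) hK c hc hres)).toFun :=
    ⟨0, fun D => L.zetaComb K (c D.1 D.2), fun D => hasLatticePoles_zetaComb _ _, hf⟩
  refine ⟨_, ?_, fun i j hij k => ?_, fun i j m => (hps.coeff i j m).mem_functionFiltration⟩
  · have := hps.mem_functionFiltration
    rwa [show -((n + 1 : ℕ) : ℤ) + 1 = -n by push_cast; ring] at this
  · rw [coeff_of_neg (fun D => hasLatticePoles_zetaComb K (c D.1 D.2)) hf hij (by omega),
      laurentCoeff_zetaComb]

end EllipticConfig

/-! ### Differential forms over the Zhu algebra and their contractions. -/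

namespace ChiralComplex

open VertexAlgebra EllipticConfig

variable {V : Type*} [AddCommGroup V] [Module ℂ V] [VertexAlgebra V] {L : PeriodPair} {n : ℕ}

section Forms

lemma toZhu_eq_zero {v : V} (hv : v ∈ c2 V) : toZhu v = 0 :=
  (Submodule.Quotient.mk_eq_zero (c2 V)).2 hv

lemma toZhu_surjective : Function.Surjective (toZhu (V := V)) := Submodule.mkQ_surjective (c2 V)

variable (V) in
/-- Differential forms of degree `n` on the spectrum of the Zhu algebra. -/
abbrev ZhuForms (n : ℕ) : Type _ := ⋀[ZhuAlgebra V]^n (Ω[ZhuAlgebra V⁄ℂ])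

variable (V) in
/-- The derivation `v ↦ d v̄`. -/
def zhuD : V →ₗ[ℂ] Ω[ZhuAlgebra V⁄ℂ] :=
  (KaehlerDifferential.D ℂ (ZhuAlgebra V)).toLinearMap ∘ₗ toZhu

lemma zhuD_apply (v : V) : zhuD V v = KaehlerDifferential.D ℂ (ZhuAlgebra V) (toZhu v) := rfl

lemma zhuD_prod (a b : V) : zhuD V (prod (-1) a b) = toZhu a • zhuD V b + toZhu b • zhuD V a := by
  simp only [zhuD_apply]
  rw [← toZhu_mul, Derivation.leibniz]

variable (V n) in
/-- The map `v₁ ⊗ ⋯ ⊗ vₙ ⊗ b ↦ b̄ d v̄₁ ∧ ⋯ ∧ d v̄ₙ`. -/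
def toForm : TPow V n →ₗ[ℂ] ZhuForms V n :=
  PiTensorProduct.lift (MultilinearMap.uncurryRight
    ((LinearMap.mk₂ ℂ (fun (x : ZhuForms V n) (b : V) => toZhu b • x)
      (fun x y b => smul_add _ _ _) (fun c x b => smul_comm _ _ _)
      (fun x b b' => by rw [map_add, add_smul])
      (fun c x b => by rw [map_smul, smul_assoc])).compMultilinearMap
      (((exteriorPower.ιMulti (ZhuAlgebra V) n).toMultilinearMap.restrictScalars ℂ).compLinearMap
        fun _ => zhuD V)))

lemma toForm_tprod (v : Fin (n + 1) → V) :
    toForm V n (PiTensorProduct.tprod ℂ v) = toZhu (v (Fin.last n)) •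
      exteriorPower.ιMulti (ZhuAlgebra V) n fun i => zhuD V (v i.castSucc) := by
  rw [toForm, PiTensorProduct.lift.tprod]
  rfl

lemma toForm_tprod_eq_zero {v : Fin (n + 1) → V} {k : Fin (n + 1)} (hk : v k ∈ c2 V) :
    toForm V n (PiTensorProduct.tprod ℂ v) = 0 := by
  rw [toForm_tprod]
  induction k using Fin.lastCases with
  | last => rw [toZhu_eq_zero hk, zero_smul]
  | cast k =>
    rw [AlternatingMap.map_coord_zero _ k (by rw [zhuD_apply, toZhu_eq_zero hk, map_zero]),
      smul_zero]

lemma toForm_translationAt (k : Fin (n + 1)) (w : TPow V n) : toForm V n (translationAt k w) = 0 := by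
  induction w using PiTensorProduct.induction_on with
  | smul_tprod c v =>
    rw [map_smul, map_smul, translationAt_tprod, toForm_tprod_eq_zero (k := k), smul_zero]
    rw [Function.update_self]
    exact translation_mem_c2 _
  | add x y hx hy => rw [map_add, map_add, hx, hy, add_zero]

lemma toForm_contract_eq_zero {m : ℤ} (hm : m ≤ -2) (i j : Fin (n + 1)) (w : TPow V (n + 1)) :
    toForm V n (contract i j m w) = 0 := by
  induction w using PiTensorProduct.induction_on with
  | smul_tprod c v =>
    rw [map_smul, map_smul, contract_tprod, toForm_tprod_eq_zero (k := j), smul_zero]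
    simp only [contractFun, Function.update_self]
    exact prod_mem_c2_of_le hm _ _
  | add x y hx hy => rw [map_add, map_add, hx, hy, add_zero]

/-- The forms `v̄ᵢ b̄ d v̄₁ ∧ ⋯ ∧ (omit d v̄ᵢ) ∧ ⋯`, with signs; zero for the last index. -/
def contractedForm (u : Fin (n + 2) → V) : Fin (n + 2) → ZhuForms V n :=
  Fin.snoc (α := fun _ => ZhuForms V n) (fun i => (-1 : ℤ) ^ (n - (i : ℕ)) •
    (toZhu (u i.castSucc) * toZhu (u (Fin.last (n + 1)))) •
      exteriorPower.ιMulti (ZhuAlgebra V) n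
        (i.removeNth fun k : Fin (n + 1) => zhuD V (u k.castSucc))) 0

lemma neg_one_pow_sub {n i : ℕ} (h : i ≤ n) : (-1 : ℤ) ^ (n - i) = (-1) ^ n * (-1) ^ i := by
  obtain ⟨k, rfl⟩ := Nat.exists_eq_add_of_le h
  rw [Nat.add_sub_cancel_left, pow_add, mul_right_comm, ← mul_pow]
  simp

/-- By the Leibniz rule `d(v̄ᵢ v̄_{j+1})` has two terms: in one `dv̄ᵢ` is missing, in the other
`dv̄_{j+1}`, with `dv̄ᵢ` moved into its place. The signs of the differential make this a difference
of the same expression at two indices. Contraction into the last factor has only the first term,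
whence the value zero of `contractedForm` there. -/
lemma toForm_contract (i j : Fin (n + 1)) (hij : i ≤ j) (u : Fin (n + 2) → V) :
    (-1 : ℤ) ^ (n - (i : ℕ)) • toForm V n (contract i j (-1) (PiTensorProduct.tprod ℂ u)) =
      contractedForm u i.castSucc - contractedForm u j.succ := by
  rw [contract_tprod, toForm_tprod]
  set y : Fin (n + 1) → Ω[ZhuAlgebra V⁄ℂ] := fun k => zhuD V (u k.castSucc) with hy
  have hrem : ∀ k : Fin n, u (i.castSucc.succAbove k.castSucc) = u (i.succAbove k).castSucc :=
    fun k => by rw [Fin.castSucc_succAbove_castSucc]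
  have hlast : i.castSucc.succAbove (Fin.last n) = Fin.last (n + 1) :=
    Fin.succAbove_ne_last_last (Fin.castSucc_lt_last i).ne
  induction j using Fin.lastCases with
  | last =>
    simp only [contractedForm, Fin.succ_last, Fin.snoc_last, Fin.snoc_castSucc, sub_zero]
    congr 1
    simp only [contractFun, Function.update_self, hlast, ← toZhu_mul]
    congr 2
    funext k
    rw [Function.update_of_ne (Fin.castSucc_lt_last k).ne, hrem]
    rfl
  | cast k =>
    have hk : (k.castSucc).succ = k.succ.castSucc := rfl
    have hsa : i.succAbove k = k.succ := Fin.succAbove_of_le_castSucc _ _ hij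
    rw [hk]
    simp only [contractedForm, Fin.snoc_castSucc]
    have hL : contractFun i k.castSucc (-1) u (Fin.last n) = u (Fin.last (n + 1)) := by
      simp only [contractFun, Function.update_of_ne (Fin.castSucc_lt_last k).ne', hlast]
    have hD : (fun l : Fin n => zhuD V (contractFun i k.castSucc (-1) u l.castSucc)) =
        Function.update (i.removeNth y) k (toZhu (u i.castSucc) • y k.succ +
          toZhu (u k.succ.castSucc) • y i) := by
      funext l
      by_cases hl : l = k
      · subst hl
        rw [Function.update_self]
        simp only [contractFun, Function.update_self, zhuD_prod, hrem, hsa, hy]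
      · rw [Function.update_of_ne hl]
        simp only [contractFun,
          Function.update_of_ne (fun h => hl (Fin.castSucc_injective _ h) :
            l.castSucc ≠ k.castSucc), hrem]
        rfl
    have hsame : Function.update (i.removeNth y) k (y k.succ) = i.removeNth y := by
      rw [Function.update_eq_self_iff, ← hsa]
      rfl
    -- The sign needed to move `dv̄ᵢ` into the slot freed by `dv̄_{k+1}`.
    have hmove := AlternatingMap.map_update_removeNth
      (exteriorPower.ιMulti (ZhuAlgebra V) n (M := Ω[ZhuAlgebra V⁄ℂ])) y i k hij
    rw [hL, hD, AlternatingMap.map_update_add, AlternatingMap.map_update_smul,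
      AlternatingMap.map_update_smul, hsame, smul_add, smul_add, sub_eq_add_neg]
    have hkn := k.isLt
    have hik : (i : ℕ) ≤ k := hij
    congr 1
    · rw [smul_smul, mul_comm (toZhu (u i.castSucc))]
    · rw [smul_smul, mul_comm (toZhu (u k.succ.castSucc)),
        smul_comm ((-1 : ℤ) ^ (n - (i : ℕ))), smul_comm ((-1 : ℤ) ^ (n - (k.succ : ℕ)))]
      have hneg : ∀ (r : ZhuAlgebra V) (x : ZhuForms V n), -(r • x) = r • (-x) := fun r x =>
        (smul_neg r x).symm
      rw [hneg]
      congr 1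
      have e1 := neg_one_pow_sub (show (i : ℕ) ≤ n by omega)
      have e2 : ((-1 : ℤ) ^ (n - (k.succ : ℕ))) = -((-1) ^ n * (-1) ^ (k : ℕ)) := by
        rw [neg_one_pow_sub (show (k.succ : ℕ) ≤ n by rw [Fin.val_succ]; omega), Fin.val_succ, pow_succ]
        ring
      rw [e1, mul_smul, hmove, e2, neg_smul, mul_smul]
      exact (neg_neg _).symm

/-- The residue theorem makes the de Rham-type boundary vanish. -/
lemma sum_residues_toForm (c : Fin (n + 1) → Fin (n + 2) → ℂ)
    (hc : ∀ a b, b ≤ a.castSucc → c a b = 0) (hres : ∀ i, ∑ a, c a i.castSucc = ∑ b, c i b)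
    (w : TPow V (n + 1)) :
    ∑ i : Fin (n + 1), ∑ j : Fin (n + 1) with i ≤ j, (-1 : ℂ) ^ (n - (i : ℕ)) • c i j.succ •
      toForm V n (contract i j (-1) w) = 0 := by
  induction w using PiTensorProduct.induction_on with
  | smul_tprod z u =>
    have h : ∑ i : Fin (n + 1), ∑ j : Fin (n + 1) with i ≤ j, (-1 : ℂ) ^ (n - (i : ℕ)) •
        c i j.succ • toForm V n (contract i j (-1) (PiTensorProduct.tprod ℂ u)) = 0 := by
      have h1 : ∀ i : Fin (n + 1), ∑ j : Fin (n + 1) with i ≤ j, (-1 : ℂ) ^ (n - (i : ℕ)) •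
          c i j.succ • toForm V n (contract i j (-1) (PiTensorProduct.tprod ℂ u)) =
          ∑ b, c i b • (contractedForm u i.castSucc - contractedForm u b) := by
        intro i
        rw [Fin.sum_univ_succ, hc i 0 (Fin.zero_le _), zero_smul, zero_add, Finset.sum_filter]
        refine Finset.sum_congr rfl fun j _ => ?_
        split_ifs with hij
        · rw [← toForm_contract i j hij, smul_comm, ← Int.cast_smul_eq_zsmul ℂ]
          push_cast
          rfl
        · rw [hc i j.succ (Fin.succ_le_castSucc_iff.2 (not_le.1 hij)), zero_smul]
      rw [Finset.sum_congr rfl fun i _ => h1 i]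
      -- The coefficient of the form at index `i` is the sum of the residues in row `i` minus that
      -- in column `i`, so the residue theorem applies; at the last index the form is zero.
      simp only [smul_sub, Finset.sum_sub_distrib]
      rw [Finset.sum_comm (f := fun i b => c i b • contractedForm u b)]
      simp only [← Finset.sum_smul]
      rw [Fin.sum_univ_castSucc (f := fun b => (∑ i, c i b) • contractedForm u b)]
      have hl : contractedForm u (Fin.last (n + 1)) = 0 := by simp [contractedForm]
      rw [hl, smul_zero, add_zero]
      simp only [hres, sub_self]
    have h2 := congrArg (z • ·) h
    simp only [Finset.smul_sum, smul_zero] at h2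
    rw [← h2]
    refine Finset.sum_congr rfl fun i _ => Finset.sum_congr rfl fun j _ => ?_
    rw [map_smul, map_smul, smul_comm (c i j.succ) z, smul_comm _ z]
  | add x y hx hy =>
    simp only [map_add, smul_add, Finset.sum_add_distrib, hx, hy, add_zero]

end Forms

end ChiralComplex

/-! ### Compatibility of the differential and of the form map with the relations. -/

namespace ChiralComplex

open VertexAlgebra EllipticConfig

variable {V : Type*} [AddCommGroup V] [Module ℂ V] [VertexAlgebra V] {L : PeriodPair} {n : ℕ}

section Relations

lemma residue_tmul (i j : Fin (n + 1)) (f : RegularFunctions L (n + 1)) (w : TPow V (n + 1)) :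
    residue V L i j (f ⊗ₜ w) = ∑ᶠ m : ℤ, coeff i j m f ⊗ₜ[ℂ] contract i j m w := rfl

variable (V L) in
/-- The operator `∂ᵢ + Tᵢ`. -/
def relationMap (i : Fin n) : PreChains V L n →ₗ[ℂ] PreChains V L n :=
  TensorProduct.map (partialDeriv (L := L) i) (LinearMap.id : TPow V n →ₗ[ℂ] TPow V n) +
    TensorProduct.map LinearMap.id (translationAt i.castSucc)

lemma relationMap_tmul (i : Fin n) (f : RegularFunctions L n) (w : TPow V n) :
    relationMap V L i (f ⊗ₜ w) = partialDeriv i f ⊗ₜ w + f ⊗ₜ translationAt i.castSucc w := rfl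

lemma relationMap_mem (i : Fin n) (z : PreChains V L n) : relationMap V L i z ∈ relations V L n :=
  (le_iSup (fun i : Fin n => LinearMap.range (relationMap V L i)) i) ⟨z, rfl⟩

/-- The residue of a total derivative vanishes: the contributions of `∂ᵢ` and of `Tᵢ` are the same
sequence up to sign and a shift of the index. -/
lemma residue_relationMap_self (i j : Fin (n + 1)) (f : RegularFunctions L (n + 1))
    (w : TPow V (n + 1)) : residue V L i j (relationMap V L i (f ⊗ₜ w)) = 0 := by
  set h : ℤ → PreChains V L n := fun m => (m : ℂ) • (coeff i j m f ⊗ₜ contract i j (m - 1) w)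
    with hh
  rw [relationMap_tmul, map_add, residue_tmul, residue_tmul]
  have h1 : ∀ m, coeff i j m (partialDeriv i f) ⊗ₜ[ℂ] contract i j m w = h (m + 1) := fun m => by
    rw [coeff_partialDeriv_self, ← TensorProduct.smul_tmul', hh]
    simp
  have h2 : ∀ m, coeff i j m f ⊗ₜ[ℂ] contract i j m (translationAt i.castSucc w) = -h m :=
    fun m => by
      rw [contract_translationAt_self, TensorProduct.tmul_smul, hh, neg_smul]
  have h3 : ∑ᶠ m, h (m + 1) = ∑ᶠ m, h m := finsum_comp_equiv (Equiv.addRight (1 : ℤ)) (f := h)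
  rw [finsum_congr h1, finsum_congr h2, finsum_neg_distrib, h3, add_neg_cancel]

/-- The residue commutes with `∂ + T` in the surviving variables. -/
lemma residue_relationMap_succAbove (i j : Fin (n + 1)) (k : Fin n)
    (f : RegularFunctions L (n + 1)) (w : TPow V (n + 1)) :
    residue V L i j (relationMap V L (i.succAbove k) (f ⊗ₜ w)) =
      relationMap V L k (residue V L i j (f ⊗ₜ w)) := by
  have hcs : (i.succAbove k).castSucc = i.castSucc.succAbove k.castSucc :=
    (Fin.castSucc_succAbove_castSucc).symm
  have hr : relationMap V L k (residue V L i j (f ⊗ₜ w)) = ∑ᶠ m : ℤ,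
      relationMap V L k (coeff i j m f ⊗ₜ contract i j m w) := by
    rw [residue_tmul]
    exact (relationMap V L k).toAddMonoidHom.map_finsum (residue_support_finite i j f w)
  have hs := fun (g : RegularFunctions L (n + 1)) (u : TPow V (n + 1)) =>
    residue_support_finite i j g u
  by_cases hjk : j = k.castSucc
  · have h0 := residue_relationMap_self (V := V) i j f w
    rw [relationMap_tmul, map_add] at h0
    -- When `xᵢ` is absorbed by the variable being differentiated, the latter also moves `xᵢ`. The
    -- discrepancy is the residue of `(∂ᵢ + Tᵢ)(f ⊗ w)`, which is zero and may be added.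
    rw [hr, relationMap_tmul, map_add, ← add_zero (residue V L i j _ + _), ← h0]
    simp only [residue_tmul]
    rw [← finsum_add_distrib (hs _ _) (hs _ _), ← finsum_add_distrib (hs _ _) (hs _ _),
      ← finsum_add_distrib (((hs _ _).union (hs _ _)).subset (Function.support_add _ _))
        (((hs _ _).union (hs _ _)).subset (Function.support_add _ _))]
    refine finsum_congr fun m => ?_
    rw [relationMap_tmul, coeff_partialDeriv_succAbove, if_pos hjk, hcs,
      contract_translationAt_succAbove, if_pos hjk, contract_translationAt_self, map_add,
      TensorProduct.add_tmul, TensorProduct.tmul_add, TensorProduct.tmul_smul,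
      TensorProduct.tmul_smul, neg_smul]
    abel
  · rw [hr, relationMap_tmul, map_add]
    simp only [residue_tmul]
    rw [← finsum_add_distrib (hs _ _) (hs _ _)]
    refine finsum_congr fun m => ?_
    rw [relationMap_tmul, coeff_partialDeriv_succAbove, if_neg hjk, hcs,
      contract_translationAt_succAbove, if_neg hjk, add_zero, add_zero]

lemma differential_apply (z : PreChains V L (n + 1)) :
    differential V L n z = ∑ i : Fin (n + 1), ∑ j : Fin (n + 1) with i ≤ j,
      ((-1 : ℂ) ^ (n - (i : ℕ))) • residue V L i j z := by
  simp [differential, LinearMap.sum_apply]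

/-- The differential is defined on the quotients by the relations. -/
lemma relations_le_comap_differential :
    relations V L (n + 1) ≤ (relations V L n).comap (differential V L n) := by
  refine iSup_le fun a => ?_
  rintro _ ⟨z, rfl⟩
  change differential V L n (relationMap V L a z) ∈ relations V L n
  rw [differential_apply]
  refine Submodule.sum_mem _ fun i _ => Submodule.sum_mem _ fun j _ => Submodule.smul_mem _ _ ?_
  induction z using TensorProduct.induction_on with
  | zero => rw [map_zero, map_zero]; exact Submodule.zero_mem _
  | tmul f w =>
    induction a using Fin.succAboveCases i with
    | x => rw [residue_relationMap_self]; exact Submodule.zero_mem _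
    | p k => rw [residue_relationMap_succAbove]; exact relationMap_mem _ _
  | add x y hx hy => rw [map_add, map_add]; exact Submodule.add_mem _ hx hy

end Relations

section FormMap

variable (L) in
/-- The map `f ⊗ w ↦ (mean value of f) · (form attached to the degree s part of w)`. -/
def formMap (𝒱 : Grading V) (n : ℕ) (s : ℤ) : PreChains V L n →ₗ[ℂ] ZhuForms V n :=
  TensorProduct.lift (LinearMap.mk₂ ℂ
    (fun f w => mean L n f • toForm V n (totalProj 𝒱 s w))
    (fun f g w => by rw [map_add, add_smul])
    (fun c f w => by rw [map_smul, smul_eq_mul, mul_smul])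
    (fun f w z => by rw [map_add, map_add, smul_add])
    (fun c f w => by rw [map_smul, map_smul, smul_comm]))

variable (𝒱 : Grading V)

lemma formMap_tmul (s : ℤ) (f : RegularFunctions L n) (w : TPow V n) :
    formMap L 𝒱 n s (f ⊗ₜ w) = mean L n f • toForm V n (totalProj 𝒱 s w) := rfl

/-- The mean value kills `∂_k f`, and the form kills the translate, whose entry lies in `V₍₋₂₎V`. -/
lemma formMap_relations (s : ℤ) : relations V L n ≤ LinearMap.ker (formMap L 𝒱 n s) := by
  refine iSup_le fun k => ?_
  rintro _ ⟨z, rfl⟩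
  change formMap L 𝒱 n s (relationMap V L k z) = 0
  induction z using TensorProduct.induction_on with
  | zero => rw [map_zero, map_zero]
  | tmul f w =>
    rw [relationMap_tmul, map_add, formMap_tmul, formMap_tmul, mean_partialDeriv, zero_smul,
      totalProj_translationAt, toForm_translationAt, smul_zero, add_zero]
  | add x y hx hy => rw [map_add, map_add, hx, hy, add_zero]

variable {ι : Type*} {a : ι → V} {Δ : ι → ℕ}

/-- In a tensor of monomials with total weight below its total degree, some factor has weight below
its degree and so lies in `V₍₋₂₎V`. -/
lemma toForm_totalProj_eq_zero (hΔ : ∀ i, a i ∈ 𝒱.component (Δ i)) {q s : ℤ} (hqs : q < s)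
    {w : TPow V n} (hw : w ∈ tensorFiltration (standardFiltration a Δ) n q) :
    toForm V n (totalProj 𝒱 s w) = 0 := by
  have : w ∈ LinearMap.ker (toForm V n ∘ₗ totalProj 𝒱 s) := by
    refine (Submodule.span_le.2 ?_) (tensorFiltration_le_span_monomial q hw)
    rintro w ⟨l, hl, rfl⟩
    change toForm V n (totalProj 𝒱 s _) = 0
    rw [totalProj_tprod 𝒱 s (δ := fun k => degree Δ (l k))
      fun k => monomial_mem_component 𝒱 hΔ (l k)]
    split_ifs with h
    · obtain ⟨k, hk⟩ : ∃ k, weight Δ (l k) < degree Δ (l k) := by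
        by_contra! hcon
        exact absurd ((Finset.sum_le_sum fun k _ => hcon k).trans hl) (by rw [h]; omega)
      exact toForm_tprod_eq_zero (k := k) (monomial_mem_c2 hk)
    · rw [map_zero]
  exact this

/-- Only the mode `(-1)` survives: more negative modes land in `V₍₋₂₎V`, and nonnegative modes lower
the filtration below `s`, where the degree `s` part has zero form. -/
lemma formMap_residue (hΔ : ∀ i, a i ∈ 𝒱.component (Δ i)) (hgen : StronglyGenerates a)
    (i j : Fin (n + 1)) {s : ℤ} (f : RegularFunctions L (n + 1)) {w : TPow V (n + 1)}
    (hw : w ∈ tensorFiltration (standardFiltration a Δ) (n + 1) s) :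
    formMap L 𝒱 n s (residue V L i j (f ⊗ₜ w)) =
      mean L n (coeff i j (-1) f) • toForm V n (contract i j (-1) (totalProj 𝒱 s w)) := by
  rw [residue_tmul]
  have h := (formMap L 𝒱 n s).toAddMonoidHom.map_finsum (residue_support_finite i j f w)
  refine h.trans ?_
  rw [finsum_eq_single _ (-1)]
  · change formMap L 𝒱 n s (_ ⊗ₜ _) = _
    rw [formMap_tmul, totalProj_contract, show s + -1 + 1 = s by ring]
  · intro m hm
    change formMap L 𝒱 n s (_ ⊗ₜ _) = _
    rw [formMap_tmul]
    rcases lt_or_ge m 0 with h0 | h0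
    · rw [totalProj_contract, toForm_contract_eq_zero (by omega), smul_zero]
    · have := contract_mem_tensorFiltration 𝒱 hΔ hgen i j m hw
      rw [if_pos h0] at this
      rw [toForm_totalProj_eq_zero 𝒱 hΔ (by omega) this, smul_zero]

lemma formMap_residue_eq_zero (hΔ : ∀ i, a i ∈ 𝒱.component (Δ i)) (hgen : StronglyGenerates a)
    (i j : Fin (n + 1)) {q s : ℤ} (hqs : q < s) (f : RegularFunctions L (n + 1))
    {w : TPow V (n + 1)} (hw : w ∈ tensorFiltration (standardFiltration a Δ) (n + 1) q) :
    formMap L 𝒱 n s (residue V L i j (f ⊗ₜ w)) = 0 := by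
  rw [formMap_residue 𝒱 hΔ hgen i j f (tensorFiltration_mono hqs.le hw)]
  have := totalProj_contract 𝒱 s (-1) i j w
  rw [show s + -1 + 1 = s by ring] at this
  have h2 := contract_mem_tensorFiltration 𝒱 hΔ hgen i j (-1) hw
  rw [if_neg (by norm_num)] at h2
  rw [← this, toForm_totalProj_eq_zero 𝒱 hΔ hqs h2, smul_zero]

lemma tensorPiece_le {V : Type*} [AddCommGroup V] [Module ℂ V] {F : ℤ → Submodule ℂ V} {p q : ℤ} {W : Submodule ℂ (PreChains V L n)}
    (h : ∀ f ∈ functionFiltration L n p, ∀ w ∈ tensorFiltration F n q, f ⊗ₜ w ∈ W) :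
    tensorPiece L F n p q ≤ W :=
  Submodule.map₂_le.2 h

lemma tmul_mem_tensorPiece {V : Type*} [AddCommGroup V] [Module ℂ V] {F : ℤ → Submodule ℂ V} {p q : ℤ} {f : RegularFunctions L n}
    {w : TPow V n} (hf : f ∈ functionFiltration L n p) (hw : w ∈ tensorFiltration F n q) :
    f ⊗ₜ w ∈ tensorPiece L F n p q :=
  Submodule.apply_mem_map₂ _ hf hw

/-- A uniform test on pure tensors: a bidegree `(p', q')` counts either because its total is below
`r`, or because it is `r` and `p'` is at least `p`. -/
lemma bifiltration_le {F : ℤ → Submodule ℂ V} {p r : ℤ} {W : Submodule ℂ (PreChains V L n)}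
    (h : ∀ p' q', p' + q' ≤ r → (p' + q' = r → p ≤ p') →
      ∀ f ∈ functionFiltration L n p', ∀ w ∈ tensorFiltration F n q', f ⊗ₜ w ∈ W)
    (hrel : relations V L n ≤ W) : bifiltration L F n p r ≤ W := by
  refine sup_le (sup_le ?_ ?_) hrel
  · exact iSup₂_le fun p' hp' => tensorPiece_le fun f hf w hw =>
      h p' (r - p') (by omega) (fun _ => hp') f hf w hw
  · exact iSup_le fun p' => iSup₂_le fun q' hq' => tensorPiece_le fun f hf w hw =>
      h p' q' (by omega) (fun h => by omega) f hf w hw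

lemma tmul_mem_bifiltration {F : ℤ → Submodule ℂ V} {p p' q' r : ℤ} (h : p' + q' ≤ r)
    (hp : p' + q' = r → p ≤ p') {f : RegularFunctions L n} {w : TPow V n}
    (hf : f ∈ functionFiltration L n p') (hw : w ∈ tensorFiltration F n q') :
    f ⊗ₜ w ∈ bifiltration L F n p r := by
  by_cases hr : p' + q' = r
  · refine Submodule.mem_sup_left (Submodule.mem_sup_left ?_)
    refine Submodule.mem_iSup_of_mem p' (Submodule.mem_iSup_of_mem (hp hr) ?_)
    rw [show r - p' = q' by omega]
    exact tmul_mem_tensorPiece hf hw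
  · refine Submodule.mem_sup_left (Submodule.mem_sup_right ?_)
    refine Submodule.mem_iSup_of_mem p' (Submodule.mem_iSup_of_mem q'
      (Submodule.mem_iSup_of_mem (by omega) ?_))
    exact tmul_mem_tensorPiece hf hw

lemma relations_le_bifiltration {F : ℤ → Submodule ℂ V} {p r : ℤ} :
    relations V L n ≤ bifiltration L F n p r := le_sup_right

/-- The form map kills the boundaries in lowest filtration. -/
theorem boundaries_le_ker_formMap (hΔ : ∀ i, a i ∈ 𝒱.component (Δ i)) (hgen : StronglyGenerates a)
    (r : ℤ) : boundaries L (standardFiltration a Δ) n (-n) r ≤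
      LinearMap.ker (formMap L 𝒱 n (r + n)) := by
  refine sup_le (bifiltration_le (fun p q hpq hp f hf w hw => ?_) (formMap_relations 𝒱 _)) ?_
  · rw [LinearMap.mem_ker, formMap_tmul]
    by_cases hpn : p + n < 0
    · rw [functionFiltration_eq_bot hpn, Submodule.mem_bot] at hf
      rw [hf, map_zero, zero_smul]
    · rw [toForm_totalProj_eq_zero 𝒱 hΔ (by omega) hw, smul_zero]
  · rw [Submodule.map_le_iff_le_comap]
    refine bifiltration_le (fun p q hpq hp f hf w hw => ?_)
      (relations_le_comap_differential.trans (Submodule.comap_mono (formMap_relations 𝒱 _)))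
    change formMap L 𝒱 n (r + n) (differential V L n (f ⊗ₜ w)) = 0
    rw [differential_apply]
    simp only [map_sum, map_smul]
    rcases lt_or_ge (p + ((n + 1 : ℕ) : ℤ)) 0 with hpn | hpn
    · rw [functionFiltration_eq_bot hpn, Submodule.mem_bot] at hf
      simp [hf]
    -- If `q` is below `r + n` the form vanishes for reasons of filtration. Otherwise `p ≤ -n`, so
    -- `f` has at most poles on one divisor at a time and the residue theorem applies.
    rcases lt_or_ge q (r + n) with hq | hq
    · refine Finset.sum_eq_zero fun i _ => Finset.sum_eq_zero fun j _ => ?_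
      rw [formMap_residue_eq_zero 𝒱 hΔ hgen i j hq f hw, smul_zero]
    · push_cast at hpn
      obtain ⟨c, h1, h2, h3⟩ := exists_residues (q := p) (by omega) hf
      have hw' : w ∈ tensorFiltration (standardFiltration a Δ) (n + 1) (r + n) :=
        tensorFiltration_mono (by omega) hw
      rw [← sum_residues_toForm c h2 h3 (totalProj 𝒱 (r + n) w)]
      refine Finset.sum_congr rfl fun i _ => Finset.sum_congr rfl fun j hj => ?_
      rw [formMap_residue 𝒱 hΔ hgen i j f hw', h1 i j (Finset.mem_filter.1 hj).2, map_smul,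
        mean_one, smul_eq_mul, mul_one]

end FormMap

end ChiralComplex

namespace MultilinearMap

/-- A multilinear map vanishing as soon as one argument lies in a given subspace depends only on
the classes of its arguments. -/
lemma eq_of_forall_sub_mem {R ι N : Type*} {M : Type*} [Ring R] [Fintype ι] [DecidableEq ι]
    [AddCommGroup M] [Module R M] [AddCommGroup N] [Module R N]
    (g : MultilinearMap R (fun _ : ι => M) N) (W : Submodule R M)
    (h : ∀ v k, v k ∈ W → g v = 0) {v w : ι → M} (hvw : ∀ k, v k - w k ∈ W) : g v = g w := by
  -- The entries of `v` are replaced by those of `w` one at a time; each replacement changes the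
  -- value by that of a tuple with an entry in `W`.
  have key : ∀ s : Finset ι, g (s.piecewise w v) = g v := by
    intro s
    induction s using Finset.induction_on with
    | empty => simp
    | insert k s hk ih =>
      rw [← ih, Finset.piecewise_insert, ← sub_eq_zero]
      have h1 : s.piecewise w v = Function.update (s.piecewise w v) k (v k) := by
        conv_lhs => rw [← Function.update_eq_self k (s.piecewise w v)]
        rw [Finset.piecewise_eq_of_notMem _ _ _ hk]
      conv_lhs => rw [h1, Function.update_idem]
      rw [← map_update_sub]
      refine h _ k ?_
      rw [Function.update_self, ← neg_sub]
      exact W.neg_mem (hvw k)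
  rw [← key Finset.univ, Finset.piecewise_univ]

end MultilinearMap

/-! ### A filtered form of membership in `V₍₋₂₎V`. -/

namespace ChiralComplex

open VertexAlgebra EllipticConfig

variable {V : Type*} [AddCommGroup V] [Module ℂ V] [VertexAlgebra V] {L : PeriodPair} {n : ℕ}

section FilteredPieces

variable {ι : Type*} {a : ι → V} {Δ : ι → ℕ}

variable (a Δ) in
/-- The span of the products `x ₍₋₂₎ y` of filtration at most `w`, together with the vectors of
filtration less than `w`. -/
def negTwoFiltration (w : ℤ) : Submodule ℂ V :=
  Submodule.span ℂ {v | ∃ p q : ℤ, p + q ≤ w ∧ ∃ x ∈ standardFiltration a Δ p,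
    ∃ y ∈ standardFiltration a Δ q, prod (-2) x y = v} ⊔ standardFiltration a Δ (w - 1)

variable (𝒱 : Grading V)

/-- Up to a nonzero factor, the mode `(-k-3)` of `x` is the mode `(-k-2)` of `Tx`, and `T` preserves
the filtration. -/
lemma prod_mem_negTwoFiltration (hΔ : ∀ i, a i ∈ 𝒱.component (Δ i)) (hgen : StronglyGenerates a)
    {p q w : ℤ} (h : p + q ≤ w) (k : ℕ) {x y : V} (hx : x ∈ standardFiltration a Δ p)
    (hy : y ∈ standardFiltration a Δ q) : prod (-k - 2) x y ∈ negTwoFiltration a Δ w := by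
  induction k generalizing x with
  | zero =>
    refine Submodule.mem_sup_left (Submodule.subset_span ⟨p, q, h, x, hx, y, hy, ?_⟩)
    simp
  | succ k ih =>
    have h1 := translation_prod x y (k + 1)
    have h' := ih (translation_mem_standardFiltration 𝒱 hΔ hgen hx)
    rw [show (-(k : ℤ) - 2) = -((k + 1 : ℕ) : ℤ) - 1 by push_cast; ring, h1] at h'
    have h2 : ((((k + 1 : ℕ) : ℤ) + 1 : ℤ) : ℂ) ≠ 0 := by
      exact_mod_cast (show ((k + 1 : ℕ) : ℤ) + 1 ≠ 0 by omega)
    rw [← Int.cast_smul_eq_zsmul ℂ] at h'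
    exact ((negTwoFiltration a Δ w).smul_mem_iff h2).1 h'

/-- Commuting `u₍₋₁₎` past `x₍₋₂₎` leaves modes of the products `u₍ⱼ₎x` with `j ≥ 0`; these have
lower filtration and are absorbed by the second summand. -/
lemma prod_neg_one_mem_negTwoFiltration (hΔ : ∀ i, a i ∈ 𝒱.component (Δ i))
    (hgen : StronglyGenerates a) {p w : ℤ} {u v : V} (hu : u ∈ standardFiltration a Δ p)
    (hv : v ∈ negTwoFiltration a Δ w) : prod (-1) u v ∈ negTwoFiltration a Δ (p + w) := by
  have : negTwoFiltration a Δ w ≤ (negTwoFiltration a Δ (p + w)).comap (prod (-1) u) := by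
    refine sup_le (Submodule.span_le.2 ?_) fun v hv => Submodule.mem_sup_right ?_
    · rintro _ ⟨p', q', h, x, hx, y, hy, rfl⟩
      change prod (-1) u (prod (-2) x y) ∈ negTwoFiltration a Δ (p + w)
      have hc := commutator_formula u x y (-1) (-2)
      rw [eq_sub_iff_add_eq] at hc
      rw [← hc]
      refine Submodule.add_mem _ (Submodule.mem_sup_right (finsum_mem_submodule _ fun j =>
        zsmul_mem_submodule _ _ ?_)) (Submodule.mem_sup_left (Submodule.subset_span
        ⟨p', p + q', by omega, x, hx, _, (prod_mem_standardFiltration 𝒱 hΔ hgen hu hy _).1, rfl⟩))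
      exact standardFiltration_mono (by omega) (prod_mem_standardFiltration 𝒱 hΔ hgen
        ((prod_mem_standardFiltration 𝒱 hΔ hgen hu hx j).2 (by positivity)) hy _).1
    · exact standardFiltration_mono (by omega) (prod_mem_standardFiltration 𝒱 hΔ hgen hu hv _).1
  exact this hv

/-- The refinement of `monomial_mem_c2` which keeps track of the filtration; a boundary must be
exhibited inside a fixed `G`-degree, so plain membership in `V₍₋₂₎V` would not do. -/
lemma monomial_mem_negTwoFiltration (hΔ : ∀ i, a i ∈ 𝒱.component (Δ i))
    (hgen : StronglyGenerates a) {l : List (ι × ℕ)} (h : weight Δ l < degree Δ l) :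
    monomial a l ∈ negTwoFiltration a Δ (weight Δ l) := by
  have hai : ∀ i, a i ∈ standardFiltration a Δ (Δ i) :=
    fun i => component_le_standardFiltration 𝒱 hΔ hgen _ (hΔ i)
  induction l with
  | nil => simp at h
  | cons s l ih =>
    rw [monomial_cons, weight_cons]
    rcases Nat.eq_zero_or_pos s.2 with h0 | h0
    · rw [h0]
      refine prod_neg_one_mem_negTwoFiltration 𝒱 hΔ hgen (hai _) (ih ?_)
      rw [weight_cons, degree_cons, h0] at h
      push_cast at h
      omega
    · obtain ⟨k, hk⟩ := Nat.exists_eq_succ_of_ne_zero h0.ne'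
      rw [hk, show -((k.succ : ℕ) : ℤ) - 1 = -k - 2 by push_cast; ring]
      exact prod_mem_negTwoFiltration 𝒱 hΔ hgen le_rfl k (hai _)
        (monomial_mem_standardFiltration le_rfl)

lemma totalProj_mem (hΔ : ∀ i, a i ∈ 𝒱.component (Δ i)) (hgen : StronglyGenerates a) (s : ℤ)
    (w : TPow V n) : totalProj 𝒱 s w ∈ tensorFiltration (standardFiltration a Δ) n s := by
  have : (tensorFiltration (standardFiltration a Δ) n s).mkQ ∘ₗ totalProj 𝒱 s = 0 := by
    refine linearMap_ext_homogeneous 𝒱 fun v δ hv => ?_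
    rw [LinearMap.comp_apply, totalProj_tprod 𝒱 s hv, LinearMap.zero_apply]
    split_ifs with h
    · exact (Submodule.Quotient.mk_eq_zero _).2 (tprod_mem_tensorFiltration
        (fun k => component_le_standardFiltration 𝒱 hΔ hgen _ (hv k)) h.le)
    · rw [map_zero]
  exact (Submodule.Quotient.mk_eq_zero _).1 (LinearMap.congr_fun this w)

lemma totalProj_totalProj_of_ne {s t : ℤ} (h : s ≠ t) (w : TPow V n) :
    totalProj 𝒱 s (totalProj 𝒱 t w) = 0 := by
  have : totalProj 𝒱 s ∘ₗ totalProj 𝒱 t = (0 : TPow V n →ₗ[ℂ] TPow V n) := by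
    refine linearMap_ext_homogeneous 𝒱 fun v δ hv => ?_
    rw [LinearMap.comp_apply, totalProj_tprod 𝒱 t hv, LinearMap.zero_apply]
    split_ifs with h'
    · rw [totalProj_tprod 𝒱 s hv, if_neg (fun h2 => h (h2.symm.trans h'))]
    · rw [map_zero]
  exact LinearMap.congr_fun this w

/-- The degree `s` part of a tensor with a factor in `V₍₋₂₎V` has filtration less than `s`. -/
lemma totalProj_tprod_mem_of_mem_c2 (hΔ : ∀ i, a i ∈ 𝒱.component (Δ i))
    (hgen : StronglyGenerates a) (s : ℤ) {v : Fin (n + 1) → V} {k : Fin (n + 1)}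
    (hk : v k ∈ c2 V) : totalProj 𝒱 s (PiTensorProduct.tprod ℂ v) ∈
      tensorFiltration (standardFiltration a Δ) n (s - 1) := by
  refine MultilinearMap.mem_of_forall_mem_span
    ((totalProj 𝒱 s).compMultilinearMap (PiTensorProduct.tprod ℂ)) _
    (fun j => if j = k then Set.image2 (fun x y => prod (-2) x y) (𝒱.homogeneous V)
      (𝒱.homogeneous V) else 𝒱.homogeneous V) ?_ v ?_
  · intro u hu
    -- For homogeneous `x`, `y` of degrees `p`, `q` the product `x₍₋₂₎y` has degree `p + q + 1` but
    -- filtration `p + q`; this is the step gained at position `k`.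
    have hu' : ∀ j, ∃ d : ℕ, u j = 0 ∨ u j ∈ 𝒱.component d ∧
        u j ∈ standardFiltration a Δ (d - if j = k then 1 else 0) := by
      intro j
      have := hu j
      split_ifs at this ⊢ with hj
      · obtain ⟨x, ⟨p, hx⟩, y, ⟨q, hy⟩, hxy⟩ := this
        change prod (-2) x y = _ at hxy
        refine ⟨p + q + 1, Or.inr ⟨?_, ?_⟩⟩
        · rw [← hxy]
          exact 𝒱.prod_mem p q _ _ x y hx hy (by push_cast; ring)
        · rw [← hxy]
          have h1 := component_le_standardFiltration 𝒱 hΔ hgen p hx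
          have h2 := component_le_standardFiltration 𝒱 hΔ hgen q hy
          exact standardFiltration_mono (by push_cast; omega)
            (prod_mem_standardFiltration 𝒱 hΔ hgen h1 h2 (-2)).1
      · obtain ⟨d, hd⟩ := this
        refine ⟨d, Or.inr ⟨hd, ?_⟩⟩
        rw [sub_zero]
        exact component_le_standardFiltration 𝒱 hΔ hgen d hd
    choose d hd using hu'
    have hd1 : ∀ j, u j ∈ 𝒱.component (d j) := fun j => by
      rcases hd j with h | h
      · rw [h]; exact Submodule.zero_mem _
      · exact h.1
    have hd2 : ∀ j, u j ∈ standardFiltration a Δ (d j - if j = k then 1 else 0) := fun j => by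
      rcases hd j with h | h
      · rw [h]; exact Submodule.zero_mem _
      · exact h.2
    change totalProj 𝒱 s (PiTensorProduct.tprod ℂ u) ∈ _
    rw [totalProj_tprod 𝒱 s hd1]
    split_ifs with hs
    · refine tprod_mem_tensorFiltration hd2 ?_
      rw [Finset.sum_sub_distrib, hs]
      simp
    · exact Submodule.zero_mem _
  · intro j
    split_ifs with hj
    · have : c2 V ≤ Submodule.map₂ (prod (-2) : V →ₗ[ℂ] V →ₗ[ℂ] V) ⊤ ⊤ := by
        refine Submodule.span_le.2 ?_
        rintro _ ⟨x, y, rfl⟩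
        exact Submodule.apply_mem_map₂ _ trivial trivial
      have h2 := this (hj ▸ hk)
      rwa [← 𝒱.span_homogeneous, Submodule.map₂_span_span] at h2
    · rw [𝒱.span_homogeneous]
      trivial

end FilteredPieces

end ChiralComplex

/-! ### Relations among constant tensors coming from boundaries. -/

namespace ChiralComplex

open VertexAlgebra EllipticConfig

variable {V : Type*} [AddCommGroup V] [Module ℂ V] [VertexAlgebra V] {L : PeriodPair} {n : ℕ}
  {ι : Type*} {a : ι → V} {Δ : ι → ℕ}

variable (V L n a Δ) in
/-- The chains modulo boundaries in lowest filtration, for the degree `s` part of the tensors. -/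
abbrev BoundaryQuotient (s : ℤ) : Type _ :=
  PreChains V L n ⧸ boundaries L (standardFiltration a Δ) n (-n) (s - n)

variable (L n a Δ) in
/-- The class of `1 ⊗ w` modulo boundaries. -/
def constClass (s : ℤ) : TPow V n →ₗ[ℂ] BoundaryQuotient V L n a Δ s :=
  (Submodule.mkQ _) ∘ₗ TensorProduct.mk ℂ (RegularFunctions L n) (TPow V n) (one L n)

lemma bifiltration_le_boundaries {F : ℤ → Submodule ℂ V} {p r : ℤ} :
    bifiltration L F n (p + 1) r ≤ boundaries L F n p r := le_sup_left

lemma one_mem_functionFiltration : one L n ∈ functionFiltration L n (-n) := by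
  refine Submodule.subset_span fun p => ⟨0, fun _ _ => 1, fun _ => analyticAt_const, ?_⟩
  refine Eventually.of_forall fun x hx => ?_
  have : (((divisorsThrough L p).powerset.filter fun S => (S.card : ℤ) ≤ -n + n)) = {∅} := by
    ext S
    simp only [neg_add_cancel, Finset.mem_filter, Finset.mem_powerset, Finset.mem_singleton]
    constructor
    · rintro ⟨-, h⟩
      exact Finset.card_eq_zero.1 (by omega)
    · rintro rfl
      simp
  rw [toFun_one x hx, this]
  simp

/-- Such a chain has `G`-degree below `s - n`, so it is zero already in the associated graded. -/
lemma constClass_eq_zero {q s : ℤ} (hq : q < s) {w : TPow V n}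
    (hw : w ∈ tensorFiltration (standardFiltration a Δ) n q) : constClass L n a Δ s w = 0 :=
  (Submodule.Quotient.mk_eq_zero _).2 (bifiltration_le_boundaries
    (tmul_mem_bifiltration (p' := -n) (q' := q) (by omega) (by omega)
      one_mem_functionFiltration hw))

variable (𝒱 : Grading V)

/-- The boundary of `f ⊗ u`, where `f` is a combination of functions with a pole along one
divisor only, with prescribed polar parts. -/
lemma sum_constClass_contract (hΔ : ∀ i, a i ∈ 𝒱.component (Δ i)) (hgen : StronglyGenerates a)
    {K : ℕ} (hK : 0 < K) (c : Fin (n + 2) → Fin (n + 2) → ℕ → ℂ)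
    (hc : ∀ x y, ¬ x < y → c x y = 0)
    (hres : ∀ i : Fin (n + 1), ∑ x, c x i.castSucc 0 = ∑ y, c i.castSucc y 0) {s : ℤ}
    {u : TPow V (n + 1)} (hu : u ∈ tensorFiltration (standardFiltration a Δ) (n + 1) s) :
    ∑ i : Fin (n + 1), ∑ j : Fin (n + 1) with i ≤ j, ∑ k ∈ Finset.range K,
      ((-1 : ℂ) ^ (n - (i : ℕ))) • c i.castSucc j.succ k •
        constClass L n a Δ s (contract i j (-(k : ℤ) - 1) u) = 0 := by
  obtain ⟨f, hf, h1, h2⟩ := exists_of_residues (L := L) hK c hc hres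
  have hmem : differential V L n (f ⊗ₜ u) ∈ boundaries L (standardFiltration a Δ) n (-n) (s - n) :=
    Submodule.mem_sup_right ⟨_, tmul_mem_bifiltration (p' := -n) (q' := s) (by omega)
      (by omega) hf hu, rfl⟩
  rw [← Submodule.Quotient.mk_eq_zero, differential_apply] at hmem
  rw [← hmem]
  change _ = Submodule.mkQ _ _
  simp only [map_sum, map_smul]
  refine Finset.sum_congr rfl fun i _ => Finset.sum_congr rfl fun j hj => ?_
  rw [← Finset.smul_sum, residue_tmul]
  congr 1
  have h := (Submodule.mkQ (boundaries L (standardFiltration a Δ) n (-n)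
    (s - n))).toAddMonoidHom.map_finsum (residue_support_finite i j f u)
  refine Eq.trans ?_ h.symm
  have hcoeff := h1 i j (Finset.mem_filter.1 hj).2
  rw [finsum_eq_sum_of_support_subset (s := (Finset.range K).image fun k : ℕ => -(k : ℤ) - 1),
    Finset.sum_image (fun x _ y _ hxy => by simpa using hxy)]
  · refine Finset.sum_congr rfl fun k hk => ?_
    rw [hcoeff, if_pos (Finset.mem_range.1 hk), ← TensorProduct.smul_tmul']
    exact ((Submodule.mkQ (boundaries L (standardFiltration a Δ) n (-n) (s - n))).map_smul
      (c i.castSucc j.succ k) (one L n ⊗ₜ contract i j (-(k : ℤ) - 1) u)).symm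
  · intro m hm
    by_contra hm'
    apply hm
    change Submodule.mkQ _ _ = 0
    rcases lt_or_ge m 0 with h0 | h0
    · obtain ⟨k, rfl⟩ : ∃ k : ℕ, m = -(k : ℤ) - 1 := ⟨(-m - 1).toNat, by omega⟩
      rw [hcoeff, if_neg, zero_smul, TensorProduct.zero_tmul, map_zero]
      intro hk
      apply hm'
      simp only [Finset.coe_image, Set.mem_image, Finset.mem_coe, Finset.mem_range]
      exact ⟨k, hk, rfl⟩
    -- A nonnegative mode lowers the filtration of the tensor by one, while the coefficient lies in
    -- `G_{-n+1}`: total degree `s - n` is kept, but the term lies in `E^{-n+1}`, hence is zero in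
    -- bidegree `(n, -n)`.
    · have h3 := contract_mem_tensorFiltration 𝒱 hΔ hgen i j m hu
      rw [if_pos h0] at h3
      exact (Submodule.Quotient.mk_eq_zero _).2 (bifiltration_le_boundaries
        (tmul_mem_bifiltration (p' := -n + 1) (q' := s - 1) (by omega) (by omega) (h2 i j m) h3))

/-- The indicator of a pair of indices and an order of pole. -/
def pairIndicator (x y : Fin (n + 2)) (k : ℕ) : Fin (n + 2) → Fin (n + 2) → ℕ → ℂ :=
  fun x' y' k' => if x' = x ∧ y' = y ∧ k' = k then 1 else 0

lemma pairIndicator_eq_zero {x y : Fin (n + 2)} (h : x < y) (k : ℕ) (x' y' : Fin (n + 2))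
    (h' : ¬ x' < y') : pairIndicator x y k x' y' = 0 := by
  funext k'
  refine if_neg ?_
  rintro ⟨rfl, rfl, -⟩
  exact h' h

lemma sum_pairIndicator_left (x y z : Fin (n + 2)) :
    ∑ x', pairIndicator x y 0 x' z 0 = if z = y then 1 else 0 := by
  simp [pairIndicator, ite_and]

lemma sum_pairIndicator_right (x y z : Fin (n + 2)) :
    ∑ y', pairIndicator x y 0 z y' 0 = if z = x then 1 else 0 := by
  simp [pairIndicator, ite_and]

lemma sum_pairIndicator_smul {Q : Type*} [AddCommGroup Q] [Module ℂ Q] {i j : Fin (n + 1)}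
    (hij : i ≤ j) {k K : ℕ} (hk : k < K) (g : Fin (n + 1) → Fin (n + 1) → ℕ → Q) :
    ∑ i' : Fin (n + 1), ∑ j' : Fin (n + 1) with i' ≤ j', ∑ k' ∈ Finset.range K,
      ((-1 : ℂ) ^ (n - (i' : ℕ))) •
        pairIndicator i.castSucc j.succ k i'.castSucc j'.succ k' • g i' j' k' =
      ((-1 : ℂ) ^ (n - (i : ℕ))) • g i j k := by
  rw [Finset.sum_eq_single i, Finset.sum_eq_single j, Finset.sum_eq_single k]
  · simp [pairIndicator]
  · intro k' _ hk'
    simp [pairIndicator, hk']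
  · intro h
    exact absurd (Finset.mem_range.2 hk) h
  · intro j' _ hj'
    refine Finset.sum_eq_zero fun k' _ => ?_
    simp [pairIndicator, hj']
  · intro h
    exact absurd (Finset.mem_filter.2 ⟨Finset.mem_univ _, hij⟩) h
  · intro i' _ hi'
    refine Finset.sum_eq_zero fun j' _ => Finset.sum_eq_zero fun k' _ => ?_
    simp [pairIndicator, hi']
  · intro h
    exact absurd (Finset.mem_univ _) h

/-- This is the boundary given by `ζ(xᵢ - x_{j+1}) - ζ(xᵢ) + ζ(x_{j+1})`, the simplest combination
of zeta functions of three points with balanced residues, the third point being the marked one. -/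
lemma constClass_contract_add_contract (hΔ : ∀ i, a i ∈ 𝒱.component (Δ i))
    (hgen : StronglyGenerates a) {s : ℤ} {u : TPow V (n + 1)}
    (hu : u ∈ tensorFiltration (standardFiltration a Δ) (n + 1) s) (i : Fin (n + 1)) (j : Fin n)
    (hij : i ≤ j.castSucc) :
    ((-1 : ℂ) ^ (n - (i : ℕ))) • (constClass L n a Δ s (contract i j.castSucc (-1) u) -
        constClass L n a Δ s (contract i (Fin.last n) (-1) u)) +
      ((-1 : ℂ) ^ (n - (j.succ : ℕ))) •
        constClass L n a Δ s (contract j.succ (Fin.last n) (-1) u) = 0 := by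
  have hlt : i.castSucc < j.castSucc.succ := by
    rw [Fin.lt_def]; rw [Fin.le_def] at hij; simpa using Nat.lt_succ_of_le hij
  have hlast : ∀ x : Fin (n + 1), x.castSucc < (Fin.last n).succ := fun x => by
    rw [Fin.succ_last]; exact Fin.castSucc_lt_last x
  have h := sum_constClass_contract (L := L) 𝒱 hΔ hgen (K := 1) one_pos
    (pairIndicator i.castSucc j.castSucc.succ 0 - pairIndicator i.castSucc (Fin.last n).succ 0 +
      pairIndicator j.succ.castSucc (Fin.last n).succ 0)
    (fun x y hxy => by
      rw [Pi.add_apply, Pi.add_apply, Pi.sub_apply, Pi.sub_apply, pairIndicator_eq_zero hlt _ _ _ hxy,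
        pairIndicator_eq_zero (hlast _) _ _ _ hxy, pairIndicator_eq_zero (hlast _) _ _ _ hxy]
      simp)
    (fun x => by
      simp only [Pi.add_apply, Pi.sub_apply, Finset.sum_add_distrib, Finset.sum_sub_distrib,
        sum_pairIndicator_left, sum_pairIndicator_right, Fin.succ_castSucc]
      ring) hu
  simp only [Pi.add_apply, Pi.sub_apply, add_smul, sub_smul, smul_add, smul_sub,
    Finset.sum_add_distrib, Finset.sum_sub_distrib] at h
  rw [sum_pairIndicator_smul hij one_pos, sum_pairIndicator_smul (Fin.le_last i) one_pos,
    sum_pairIndicator_smul (Fin.le_last j.succ) one_pos] at h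
  simpa [smul_sub] using h

/-- A tensor with a factor `x ₍₋₂₎ y` is a boundary, modulo lower filtration. -/
lemma constClass_prod_neg_two (hΔ : ∀ i, a i ∈ 𝒱.component (Δ i)) (hgen : StronglyGenerates a)
    {s p q : ℤ} {v : Fin (n + 1) → V} {δ : Fin (n + 1) → ℤ} (k : Fin (n + 1))
    (hv : ∀ j, v j ∈ standardFiltration a Δ (δ j)) (hs : ∑ j, δ j ≤ s) (hpq : p + q ≤ δ k) {x y : V}
    (hx : x ∈ standardFiltration a Δ p) (hy : y ∈ standardFiltration a Δ q) :
    constClass L n a Δ s (PiTensorProduct.tprod ℂ (Function.update v k (prod (-2) x y))) = 0 := by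
  have hu : PiTensorProduct.tprod ℂ (Fin.cons x (Function.update v k y) : Fin (n + 2) → V) ∈
      tensorFiltration (standardFiltration a Δ) (n + 1) s := by
    refine tprod_mem_tensorFiltration (δ := Fin.cons p (Function.update δ k q)) (fun j => ?_) ?_
    · refine Fin.cases ?_ (fun j => ?_) j
      · exact hx
      · simp only [Fin.cons_succ]
        by_cases hj : j = k
        · subst hj; simpa using hy
        · simpa [hj] using hv j
    · rw [Fin.sum_univ_succ]
      simp only [Fin.cons_succ, Fin.cons_zero]
      rw [Finset.sum_update_of_mem (Finset.mem_univ k)]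
      rw [← Finset.add_sum_erase _ _ (Finset.mem_univ k), Finset.erase_eq] at hs
      linarith
  have hlt : (0 : Fin (n + 1)).castSucc < k.succ := by simp
  -- The factor `x` was put in front as a new first point. The function used has one double pole,
  -- along the collision of that point with the point `k`, and no residue, so only the contraction
  -- by the mode `(-2)` appears.
  have h := sum_constClass_contract (L := L) 𝒱 hΔ hgen (K := 2) two_pos
    (pairIndicator (0 : Fin (n + 1)).castSucc k.succ 1)
    (fun x' y' hxy => pairIndicator_eq_zero hlt _ _ _ hxy)
    (fun x' => by simp [pairIndicator]) hu
  rw [sum_pairIndicator_smul (Fin.zero_le k) one_lt_two, smul_eq_zero_iff_right (by simp),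
    contract_tprod] at h
  convert h using 3
  simp [contractFun]

lemma constClass_eq_zero_of_negTwo (hΔ : ∀ i, a i ∈ 𝒱.component (Δ i))
    (hgen : StronglyGenerates a) {s : ℤ} {v : Fin (n + 1) → V} {δ : Fin (n + 1) → ℤ}
    (k : Fin (n + 1)) (hv : ∀ j, v j ∈ standardFiltration a Δ (δ j)) (hs : ∑ j, δ j ≤ s)
    (hk : v k ∈ negTwoFiltration a Δ (δ k)) :
    constClass L n a Δ s (PiTensorProduct.tprod ℂ v) = 0 := by
  have : negTwoFiltration a Δ (δ k) ≤ LinearMap.ker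
      (((constClass L n a Δ s).compMultilinearMap (PiTensorProduct.tprod ℂ)).toLinearMap v k) := by
    refine sup_le (Submodule.span_le.2 ?_) fun x hx => ?_
    · rintro _ ⟨p, q, hpq, x, hx, y, hy, rfl⟩
      exact constClass_prod_neg_two 𝒱 hΔ hgen k hv hs hpq hx hy
    · refine constClass_eq_zero (q := s - 1) (by omega)
        (tprod_mem_tensorFiltration (δ := Function.update δ k (δ k - 1)) (fun j => ?_) ?_)
      · by_cases hj : j = k
        · subst hj; simpa using hx
        · simpa [hj] using hv j
      · rw [Finset.sum_update_of_mem (Finset.mem_univ k)]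
        rw [← Finset.add_sum_erase _ _ (Finset.mem_univ k), Finset.erase_eq] at hs
        linarith
  have h2 := this hk
  rw [LinearMap.mem_ker] at h2
  simpa using h2

/-- Modulo boundaries, a tensor of filtration `s` may be replaced by its part of degree `s`. -/
lemma constClass_totalProj (hΔ : ∀ i, a i ∈ 𝒱.component (Δ i)) (hgen : StronglyGenerates a)
    {s : ℤ} {w : TPow V n} (hw : w ∈ tensorFiltration (standardFiltration a Δ) n s) :
    constClass L n a Δ s (totalProj 𝒱 s w) = constClass L n a Δ s w := by
  have : w ∈ LinearMap.eqLocus (constClass L n a Δ s ∘ₗ totalProj 𝒱 s) (constClass L n a Δ s) := by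
    refine (Submodule.span_le.2 ?_) (tensorFiltration_le_span_monomial s hw)
    rintro w ⟨l, hl, rfl⟩
    change constClass L n a Δ s (totalProj 𝒱 s _) = constClass L n a Δ s _
    rw [totalProj_tprod 𝒱 s (δ := fun k => degree Δ (l k))
      fun k => monomial_mem_component 𝒱 hΔ (l k)]
    split_ifs with h
    · rfl
    rw [map_zero]
    -- Either some factor has degree above its weight, and the tensor is a boundary; or weights
    -- equal degrees throughout, and since the total degree is not `s`, the filtration is below `s`.
    by_cases hlt : ∃ k, weight Δ (l k) < degree Δ (l k)
    · obtain ⟨k, hk⟩ := hlt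
      exact (constClass_eq_zero_of_negTwo 𝒱 hΔ hgen k
        (fun j => monomial_mem_standardFiltration le_rfl) hl
        (monomial_mem_negTwoFiltration 𝒱 hΔ hgen hk)).symm
    · push Not at hlt
      have : ∑ k, weight Δ (l k) = ∑ k, (degree Δ (l k) : ℤ) :=
        Finset.sum_congr rfl fun k _ => le_antisymm (weight_le_degree _ _) (hlt k)
      rw [← this] at h
      exact (constClass_eq_zero (lt_of_le_of_ne hl h) (tprod_mem_tensorFiltration
        (fun j => monomial_mem_standardFiltration le_rfl) le_rfl)).symm
  exact this

end ChiralComplex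

/-! ### Leibniz rule, antisymmetry and descent to differential forms. -/

namespace ChiralComplex

open VertexAlgebra EllipticConfig

variable {V : Type*} [AddCommGroup V] [Module ℂ V] [VertexAlgebra V] {L : PeriodPair} {n : ℕ}
  {ι : Type*} {a : ι → V} {Δ : ι → ℕ} (𝒱 : Grading V)

variable (L n a Δ) in
/-- The class modulo boundaries of the degree `s` part of a pure tensor. -/
def homogeneousClass (s : ℤ) :
    MultilinearMap ℂ (fun _ : Fin (n + 1) => V) (BoundaryQuotient V L n a Δ s) :=
  (constClass L n a Δ s ∘ₗ totalProj 𝒱 s).compMultilinearMap (PiTensorProduct.tprod ℂ)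

section

variable (hΔ : ∀ i, a i ∈ 𝒱.component (Δ i)) (hgen : StronglyGenerates a) (s : ℤ)
include hΔ hgen

/-- After projection to degree `s` such a tensor has filtration below `s`, so no boundary is needed
here; double poles are needed only to compare a tensor of filtration `s` with its degree `s` part.
-/
lemma homogeneousClass_eq_zero (v : Fin (n + 1) → V) (k : Fin (n + 1)) (hk : v k ∈ c2 V) :
    homogeneousClass L n a Δ 𝒱 s v = 0 :=
  constClass_eq_zero (q := s - 1) (by omega) (totalProj_tprod_mem_of_mem_c2 𝒱 hΔ hgen s hk)

lemma homogeneousClass_congr {v w : Fin (n + 1) → V} (h : ∀ k, toZhu (v k) = toZhu (w k)) :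
    homogeneousClass L n a Δ 𝒱 s v = homogeneousClass L n a Δ 𝒱 s w :=
  (homogeneousClass L n a Δ 𝒱 s).eq_of_forall_sub_mem (c2 V)
    (homogeneousClass_eq_zero 𝒱 hΔ hgen s) fun k => (Submodule.Quotient.eq _).1 (h k)

lemma homogeneousClass_contractFun (v : Fin (n + 2) → V) (i : Fin (n + 1)) (j : Fin n)
    (hij : i ≤ j.castSucc) :
    ((-1 : ℂ) ^ (n - (i : ℕ))) • (homogeneousClass L n a Δ 𝒱 s (contractFun i j.castSucc (-1) v) -
        homogeneousClass L n a Δ 𝒱 s (contractFun i (Fin.last n) (-1) v)) +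
      ((-1 : ℂ) ^ (n - (j.succ : ℕ))) •
        homogeneousClass L n a Δ 𝒱 s (contractFun j.succ (Fin.last n) (-1) v) = 0 := by
  have hc : ∀ i j : Fin (n + 1), homogeneousClass L n a Δ 𝒱 s (contractFun i j (-1) v) =
      constClass L n a Δ s (contract i j (-1)
        (totalProj 𝒱 s (PiTensorProduct.tprod ℂ v))) := fun i j => by
    have h := totalProj_contract 𝒱 s (-1) i j (PiTensorProduct.tprod ℂ v)
    rw [show s + -1 + 1 = s by ring, contract_tprod] at h
    rw [← h]
    rfl
  rw [hc, hc, hc]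
  exact constClass_contract_add_contract 𝒱 hΔ hgen (totalProj_mem 𝒱 hΔ hgen s _) i j hij

/-- The Leibniz rule. -/
lemma homogeneousClass_leibniz (t : Fin (n + 1) → V) (k : Fin n) (x y : V) :
    homogeneousClass L n a Δ 𝒱 s (Function.update t k.castSucc (prod (-1) x y)) =
      homogeneousClass L n a Δ 𝒱 s (Function.update (Function.update t k.castSucc y) (Fin.last n)
        (prod (-1) x (t (Fin.last n)))) +
      homogeneousClass L n a Δ 𝒱 s (Function.update (Function.update t k.castSucc x) (Fin.last n)
        (prod (-1) y (t (Fin.last n)))) := by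
  -- The factors `x`, `y` are placed in adjacent positions `k`, `k + 1`. The three contractions of
  -- the triangle relation then give `xy` in position `k`, and `x` or `y` multiplied into the last
  -- factor.
  set v : Fin (n + 2) → V := k.castSucc.castSucc.insertNth x (Function.update t k.castSucc y)
    with hv
  have hlast : Fin.last n ≠ k.castSucc := (Fin.castSucc_lt_last k).ne'
  have h := homogeneousClass_contractFun (L := L) 𝒱 hΔ hgen s v k.castSucc k le_rfl
  have hvx : v k.castSucc.castSucc = x := Fin.insertNth_apply_same _ _ _
  have hvs : ∀ l, v (k.castSucc.castSucc.succAbove l) = Function.update t k.castSucc y l :=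
    fun l => Fin.insertNth_apply_succAbove _ _ _ _
  have e1 : contractFun k.castSucc k.castSucc (-1) v =
      Function.update t k.castSucc (prod (-1) x y) := by
    simp only [contractFun, hvx, hvs]
    simp
  have e2 : contractFun k.castSucc (Fin.last n) (-1) v =
      Function.update (Function.update t k.castSucc y) (Fin.last n)
        (prod (-1) x (t (Fin.last n))) := by
    simp only [contractFun, hvx, hvs]
    rw [Function.update_of_ne hlast]
  have hk : v k.succ.castSucc = y := by
    have : k.succ.castSucc = k.castSucc.castSucc.succAbove k.castSucc :=
      Fin.ext (by simp [Fin.succAbove])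
    rw [this, hvs, Function.update_self]
  have hs : ∀ l, v (k.succ.castSucc.succAbove l) = Function.update t k.castSucc x l := by
    intro l
    by_cases hl : l = k.castSucc
    · have : k.succ.castSucc.succAbove k.castSucc = k.castSucc.castSucc :=
        Fin.ext (by simp [Fin.succAbove, Fin.lt_def])
      rw [hl, this, hvx, Function.update_self]
    · have hl' : (l : ℕ) ≠ k := fun h => hl (Fin.ext (by simpa using h))
      have : k.succ.castSucc.succAbove l = k.castSucc.castSucc.succAbove l := by
        refine Fin.ext ?_
        simp only [Fin.succAbove, Fin.lt_def, Fin.val_castSucc, Fin.val_succ]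
        split_ifs <;> simp <;> omega
      rw [this, hvs, Function.update_of_ne hl, Function.update_of_ne hl]
  have e3 : contractFun k.succ (Fin.last n) (-1) v =
      Function.update (Function.update t k.castSucc x) (Fin.last n)
        (prod (-1) y (t (Fin.last n))) := by
    simp only [contractFun, hs, hk]
    rw [Function.update_of_ne hlast]
  have hsign : ((-1 : ℂ) ^ (n - (k.castSucc : ℕ))) = -((-1 : ℂ) ^ (n - (k.succ : ℕ))) := by
    rw [Fin.val_castSucc, Fin.val_succ, show n - (k : ℕ) = (n - (k + 1)) + 1 by omega, pow_succ]
    ring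
  rw [e1, e2, e3, hsign, neg_smul, neg_add_eq_zero] at h
  rw [← sub_eq_iff_eq_add']
  exact smul_right_injective _ (pow_ne_zero _ (by norm_num)) h

/-- The usual proof of `d1 = 0`: the Leibniz rule for `1 · 1 = 1` says that the value is twice
itself. -/
lemma homogeneousClass_vac (t : Fin (n + 1) → V) (k : Fin n) (hk : t k.castSucc = vac) :
    homogeneousClass L n a Δ 𝒱 s t = 0 := by
  have h := homogeneousClass_leibniz (L := L) 𝒱 hΔ hgen s t k vac vac
  rw [vac_prod, vac_prod, if_pos rfl, if_pos rfl, ← hk, Function.update_eq_self,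
    Function.update_eq_self] at h
  simpa using h

/-- Antisymmetry in adjacent arguments. -/
lemma homogeneousClass_swap (t : Fin (n + 1) → V) (i j : Fin n) (hij : (i : ℕ) + 1 = j) :
    homogeneousClass L n a Δ 𝒱 s (t ∘ Equiv.swap i.castSucc j.castSucc) =
      -homogeneousClass L n a Δ 𝒱 s t := by
  -- The vacuum is inserted right after position `j`. Contracting entry `i` into it moves that entry
  -- past its neighbour; contracting the vacuum into the last factor gives back `t`; the remaining
  -- contraction leaves a vacuum among the differentiated entries and vanishes.
  set v : Fin (n + 2) → V := j.succ.castSucc.insertNth vac t with hv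
  have h := homogeneousClass_contractFun (L := L) 𝒱 hΔ hgen s v i.castSucc j
    (by rw [Fin.le_def]; simp; omega)
  have hvj : v j.succ.castSucc = vac := by simp [hv]
  have hvlt : ∀ l : Fin (n + 2), ∀ m : Fin (n + 1), (l : ℕ) = m → (m : ℕ) ≤ j → v l = t m := by
    intro l m hlm hm
    have : l = j.succ.castSucc.succAbove m := by
      rw [Fin.succAbove_of_castSucc_lt]
      · exact Fin.ext hlm
      · rw [Fin.lt_def]; simp; omega
    rw [this, hv, Fin.insertNth_apply_succAbove]
  have hvgt : ∀ l : Fin (n + 2), ∀ m : Fin (n + 1), (l : ℕ) = m + 1 → (j : ℕ) < m → v l = t m := by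
    intro l m hlm hm
    have : l = j.succ.castSucc.succAbove m := by
      rw [Fin.succAbove_of_le_castSucc]
      · exact Fin.ext hlm
      · rw [Fin.le_def]; simp; omega
    rw [this, hv, Fin.insertNth_apply_succAbove]
  have hlast : Fin.last n ≠ j.castSucc := (Fin.castSucc_lt_last j).ne'
  have hlast' : Fin.last n ≠ i.castSucc := (Fin.castSucc_lt_last i).ne'
  have hne : i.castSucc ≠ j.castSucc := by
    intro h; have := congrArg Fin.val h; simp at this; omega
  have hsA : ∀ l : Fin (n + 1), (i.castSucc.castSucc.succAbove l : ℕ) =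
      if (l : ℕ) < i then (l : ℕ) else l + 1 := by
    intro l
    simp only [Fin.succAbove, Fin.lt_def]
    split_ifs <;> simp_all
  have hvj' : v (i.castSucc.castSucc.succAbove j.castSucc) = vac := by
    rw [← hvj]
    congr 1
    refine Fin.ext ?_
    rw [hsA]
    simp
    omega
  have e1 : contractFun i.castSucc j.castSucc (-1) v = t ∘ Equiv.swap i.castSucc j.castSucc := by
    funext l
    by_cases hlj : l = j.castSucc
    · subst hlj
      rw [contractFun, Function.update_self, hvj', prod_vac_neg_one, Function.comp_apply,
        Equiv.swap_apply_right]
      exact hvlt _ _ (by simp) (by simp; omega)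
    · rw [contractFun, Function.update_of_ne hlj, Function.comp_apply]
      have hl' : (l : ℕ) ≠ j := fun h => hlj (Fin.ext (by simpa using h))
      by_cases hli : l = i.castSucc
      · subst hli
        rw [Equiv.swap_apply_left]
        exact hvlt _ _ (by rw [hsA]; simp; omega) (by simp)
      · rw [Equiv.swap_apply_of_ne_of_ne hli hlj]
        have hl'' : (l : ℕ) ≠ i := fun h => hli (Fin.ext (by simpa using h))
        rcases lt_or_ge (l : ℕ) i with h1 | h1
        · exact hvlt _ _ (by rw [hsA, if_pos h1]) (by omega)
        · exact hvgt _ _ (by rw [hsA, if_neg (by omega)]) (by omega)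
  have e2 : homogeneousClass L n a Δ 𝒱 s (contractFun i.castSucc (Fin.last n) (-1) v) = 0 := by
    refine homogeneousClass_vac 𝒱 hΔ hgen s _ j ?_
    rw [contractFun, Function.update_of_ne hlast.symm, hvj']
  have e3 : contractFun j.succ (Fin.last n) (-1) v = t := by
    rw [contractFun, hvj, vac_prod, if_pos rfl]
    simp only [hv, Fin.insertNth_apply_succAbove]
    exact Function.update_eq_self _ _
  have hsign : ((-1 : ℂ) ^ (n - (i.castSucc : ℕ))) = ((-1 : ℂ) ^ (n - (j.succ : ℕ))) := by
    have := j.isLt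
    rw [Fin.val_castSucc, Fin.val_succ, ← hij,
      show n - (i : ℕ) = (n - (i + 1 + 1)) + 2 by omega, pow_add]
    ring
  rw [e1, e2, e3, hsign, sub_zero, ← smul_add, smul_eq_zero_iff_right
    (pow_ne_zero _ (by norm_num))] at h
  exact eq_neg_of_add_eq_zero_left h

/-- The homogeneous class of a tensor only depends on the associated form. -/
theorem exists_linearMap_toForm :
    ∃ Ψ : ZhuForms V n →ₗ[ℂ] BoundaryQuotient V L n a Δ s, ∀ w : TPow V n,
      Ψ (toForm V n w) = constClass L n a Δ s (totalProj 𝒱 s w) := by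
  -- A linear section of `V → R` turns the class into a multilinear map on `R`. By
  -- `homogeneousClass_congr` the class depends only on the images in `R`, so the section need not
  -- be multiplicative.
  obtain ⟨σ, hσ⟩ := (toZhu (V := V)).exists_rightInverse_of_surjective
    (LinearMap.range_eq_top.2 toZhu_surjective)
  have hσ' : ∀ x, toZhu (σ x) = x := LinearMap.congr_fun hσ
  set ψ := ((homogeneousClass L n a Δ 𝒱 s).compLinearMap fun _ => σ).curryRight with hψ
  have hψa : ∀ (b : ZhuAlgebra V) (t : Fin n → ZhuAlgebra V),
      ψ t b = homogeneousClass L n a Δ 𝒱 s (fun k => σ (Fin.snoc (α := fun _ => ZhuAlgebra V) t b k)) :=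
    fun b t => rfl
  have h2 : algebraMap ℂ (ZhuAlgebra V) 2⁻¹ * 2 = 1 := by
    rw [← map_ofNat (algebraMap ℂ (ZhuAlgebra V)) 2, ← map_mul, inv_mul_cancel₀ two_ne_zero, map_one]
  let : Invertible (2 : ZhuAlgebra V) := ⟨_, h2, by rw [mul_comm, h2]⟩
  obtain ⟨Ψ, hΨ⟩ := exists_linearMap_of_multiderivation ψ
    (fun t i x y b => by
      simp only [hψa]
      have h := homogeneousClass_leibniz (L := L) 𝒱 hΔ hgen s
        (fun k => σ (Fin.snoc (α := fun _ => ZhuAlgebra V) t b k)) i (σ x) (σ y)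
      refine Eq.trans ?_ (h.trans (congrArg₂ (· + ·) ?_ ?_)) <;>
      · refine homogeneousClass_congr 𝒱 hΔ hgen s fun k => ?_
        refine Fin.lastCases ?_ (fun k => ?_) k
        · simp [hσ', ← toZhu_mul, (Fin.castSucc_lt_last i).ne']
        · by_cases hk : k = i
          · subst hk
            simp [hσ', ← toZhu_mul, (Fin.castSucc_lt_last k).ne]
          · simp [hσ', hk, (Fin.castSucc_lt_last k).ne])
    (fun t i j b hij => by
      simp only [hψa]
      rw [← homogeneousClass_swap 𝒱 hΔ hgen s _ i j hij]
      congr 1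
      funext k
      refine Fin.lastCases ?_ (fun k => ?_) k
      · rw [Function.comp_apply, Equiv.swap_apply_of_ne_of_ne (Fin.castSucc_lt_last i).ne'
          (Fin.castSucc_lt_last j).ne', Fin.snoc_last, Fin.snoc_last]
      · rw [Function.comp_apply, (Fin.castSucc_injective n).swap_apply, Fin.snoc_castSucc,
          Fin.snoc_castSucc, Function.comp_apply])
  refine ⟨Ψ, fun w => ?_⟩
  have : Ψ ∘ₗ (toForm V n) = constClass L n a Δ s ∘ₗ totalProj 𝒱 s := by
    refine PiTensorProduct.ext (MultilinearMap.ext fun v => ?_)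
    change Ψ (toForm V n (PiTensorProduct.tprod ℂ v)) = homogeneousClass L n a Δ 𝒱 s v
    rw [toForm_tprod]
    refine (hΨ (toZhu (v (Fin.last n))) (fun i => toZhu (v i.castSucc))).trans ?_
    rw [hψa]
    refine homogeneousClass_congr 𝒱 hΔ hgen s fun k => ?_
    rw [hσ']
    refine Fin.lastCases ?_ (fun k => ?_) k <;> simp
  exact LinearMap.congr_fun this w

end

end ChiralComplex

/-! ### The isomorphism. -/

namespace ChiralComplex

open VertexAlgebra EllipticConfig

variable {V : Type*} [AddCommGroup V] [Module ℂ V] [VertexAlgebra V] {L : PeriodPair} {n : ℕ}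
  {ι : Type*} {a : ι → V} {Δ : ι → ℕ} (𝒱 : Grading V)

/-- In function degree `-n` the function is constant and the tensor may be replaced by its degree
`s` part modulo boundaries. In higher function degree both sides vanish: the tensor has filtration
below `s`, and the chain lies in `E^{-n+1}`. -/
lemma mkQ_eq_of_mem_bifiltration (hΔ : ∀ i, a i ∈ 𝒱.component (Δ i)) {s : ℤ}
    (hgen : StronglyGenerates a) {Ψ : ZhuForms V n →ₗ[ℂ] BoundaryQuotient V L n a Δ s}
    (hΨ : ∀ w : TPow V n, Ψ (toForm V n w) = constClass L n a Δ s (totalProj 𝒱 s w))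
    {z : PreChains V L n} (hz : z ∈ bifiltration L (standardFiltration a Δ) n (-n) (s - n)) :
    Ψ (formMap L 𝒱 n s z) = Submodule.Quotient.mk z := by
  have : bifiltration L (standardFiltration a Δ) n (-n) (s - n) ≤
      LinearMap.eqLocus (Ψ ∘ₗ formMap L 𝒱 n s) (Submodule.mkQ _) := by
    refine bifiltration_le (fun p q hpq hp f hf w hw => ?_) fun z hz => ?_
    · change Ψ (formMap L 𝒱 n s (f ⊗ₜ w)) = Submodule.mkQ _ (f ⊗ₜ w)
      rcases lt_trichotomy (p + n) 0 with h | h | h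
      · rw [functionFiltration_eq_bot h, Submodule.mem_bot] at hf
        rw [hf, TensorProduct.zero_tmul, map_zero, map_zero, map_zero]
      · obtain ⟨c, rfl⟩ := Submodule.mem_span_singleton.1 (functionFiltration_le_span_one h.le hf)
        rw [← TensorProduct.smul_tmul', map_smul, map_smul, map_smul, formMap_tmul, mean_one,
          one_smul, hΨ,
          constClass_totalProj 𝒱 hΔ hgen (totalProj_mem 𝒱 hΔ hgen s w),
          constClass_totalProj 𝒱 hΔ hgen (tensorFiltration_mono (by omega) hw)]
        rfl
      · rw [formMap_tmul, toForm_totalProj_eq_zero 𝒱 hΔ (by omega) hw, smul_zero, map_zero]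
        exact ((Submodule.Quotient.mk_eq_zero _).2 (bifiltration_le_boundaries
          (tmul_mem_bifiltration hpq (by omega) hf hw))).symm
    · change Ψ (formMap L 𝒱 n s z) = Submodule.mkQ _ z
      rw [show formMap L 𝒱 n s z = 0 from formMap_relations 𝒱 s hz, map_zero]
      exact ((Submodule.Quotient.mk_eq_zero _).2 (bifiltration_le_boundaries
        (relations_le_bifiltration hz))).symm
  exact this hz

/-- `Ψ` sees only tensors of total degree `s`, whereas `formMap` for `t` produces forms of tensors
of degree `t`. This keeps the pieces of different `G`-degree apart. -/
lemma apply_formMap_of_ne {s t : ℤ} (hst : s ≠ t)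
    {Ψ : ZhuForms V n →ₗ[ℂ] BoundaryQuotient V L n a Δ s}
    (hΨ : ∀ w : TPow V n, Ψ (toForm V n w) = constClass L n a Δ s (totalProj 𝒱 s w))
    (z : PreChains V L n) : Ψ (formMap L 𝒱 n t z) = 0 := by
  induction z using TensorProduct.induction_on with
  | zero => simp
  | tmul f w =>
    rw [formMap_tmul, map_smul, hΨ, totalProj_totalProj_of_ne 𝒱 hst, map_zero, smul_zero]
  | add x y hx hy => rw [map_add, map_add, hx, hy, add_zero]

lemma cycles_le_bifiltration {F : ℤ → Submodule ℂ V} {p r : ℤ} :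
    cycles L F n p r ≤ bifiltration L F n p r := by
  cases n with
  | zero => exact le_rfl
  | succ n => exact inf_le_left

/-- The range is stable under `R`, which acts through the last factor, and contains all wedge
products of exact differentials. These generate the exterior power. -/
lemma toForm_surjective : Function.Surjective (toForm V n) := by
  set S : Submodule (ZhuAlgebra V) (ZhuForms V n) :=
    { carrier := LinearMap.range (toForm V n)
      add_mem' := fun hx hy => Submodule.add_mem _ hx hy
      zero_mem' := Submodule.zero_mem _
      smul_mem' := by
        rintro c _ ⟨w, rfl⟩
        obtain ⟨x, rfl⟩ := toZhu_surjective c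
        induction w using PiTensorProduct.induction_on with
        | smul_tprod c v =>
          refine ⟨c • PiTensorProduct.tprod ℂ
            (Function.update v (Fin.last n) (prod (-1) x (v (Fin.last n)))), ?_⟩
          rw [map_smul, map_smul, toForm_tprod, toForm_tprod, Function.update_self, ← toZhu_mul,
            mul_smul, smul_comm]
          simp [(Fin.castSucc_lt_last _).ne]
        | add w w' h h' =>
          rw [map_add, smul_add]
          exact Submodule.add_mem _ h h' } with hS
  have hιS : ∀ x : Fin n → Ω[ZhuAlgebra V⁄ℂ], exteriorPower.ιMulti (ZhuAlgebra V) n x ∈ S := by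
    have h := MultilinearMap.ext_kaehler (K := ℂ)
      (f := S.mkQ.compMultilinearMap (exteriorPower.ιMulti (ZhuAlgebra V) n).toMultilinearMap)
      (g := 0) fun t => by
        choose u hu using fun i => toZhu_surjective (t i)
        refine (Submodule.Quotient.mk_eq_zero _).2
          ⟨PiTensorProduct.tprod ℂ (Fin.snoc (α := fun _ => V) u vac), ?_⟩
        rw [toForm_tprod, Fin.snoc_last, show toZhu (vac : V) = 1 from rfl, one_smul]
        simp [zhuD_apply, hu]
    exact fun x => (Submodule.Quotient.mk_eq_zero _).1 (MultilinearMap.congr_fun h x)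
  have htop : (⊤ : Submodule (ZhuAlgebra V) (ZhuForms V n)) ≤ S := by
    rw [← exteriorPower.ιMulti_span]
    refine Submodule.span_le.2 ?_
    rintro _ ⟨x, rfl⟩
    exact hιS x
  exact fun x => htop (x := x) trivial

lemma exists_coeff_one (i j : Fin (n + 1)) (m : ℤ) :
    ∃ c : ℂ, coeff i j m (one L (n + 1)) = c • one L n ∧ (m < 0 → c = 0) := by
  refine ⟨if m < 0 then 0 else iteratedDeriv (m - 0).toNat (fun _ : ℂ => (1 : ℂ)) 0 /
    ((m - 0).toNat.factorial : ℂ), ?_, fun h => if_pos h⟩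
  refine RegularFunctions.ext fun x => ?_
  by_cases hx : x ∈ conf L n
  · rw [toFun_coeff _ _ _ _ hx, RegularFunctions.toFun_smul, Pi.smul_apply, toFun_one x hx, smul_eq_mul,
      mul_one]
    refine LaurentCoeff.laurentCoeff_eq analyticAt_const ?_ m
    filter_upwards [insertNear_mem_conf i j hx] with t ht
    rw [toFun_one _ ht, zpow_zero, one_mul]
  · rw [toFun_eq_zero _ hx, toFun_eq_zero _ hx]

/-- Constant functions times homogeneous tensors are cycles in lowest filtration. -/
lemma one_tmul_tprod_mem_cycles (hΔ : ∀ i, a i ∈ 𝒱.component (Δ i)) (hgen : StronglyGenerates a)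
    {v : Fin (n + 1) → V} {δ : Fin (n + 1) → ℕ} (hv : ∀ k, v k ∈ 𝒱.component (δ k)) :
    one L n ⊗ₜ[ℂ] PiTensorProduct.tprod ℂ v ∈
      cycles L (standardFiltration a Δ) n (-n) (∑ k, (δ k : ℤ) - n) := by
  have hw : PiTensorProduct.tprod ℂ v ∈
      tensorFiltration (standardFiltration a Δ) n (∑ k, (δ k : ℤ)) :=
    tprod_mem_tensorFiltration
      (fun k => component_le_standardFiltration 𝒱 hΔ hgen _ (hv k)) le_rfl
  have h1 : one L n ⊗ₜ[ℂ] PiTensorProduct.tprod ℂ v ∈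
      bifiltration L (standardFiltration a Δ) n (-n) (∑ k, (δ k : ℤ) - n) :=
    tmul_mem_bifiltration (by omega) (by omega) one_mem_functionFiltration hw
  cases n with
  | zero => exact h1
  | succ n =>
    refine ⟨h1, ?_⟩
    change differential V L n (one L (n + 1) ⊗ₜ PiTensorProduct.tprod ℂ v) ∈
      bifiltration L (standardFiltration a Δ) n (-((n + 1 : ℕ) : ℤ) + 1)
        (∑ k, (δ k : ℤ) - ((n + 1 : ℕ) : ℤ))
    rw [differential_apply]
    refine Submodule.sum_mem _ fun i _ => Submodule.sum_mem _ fun j _ => Submodule.smul_mem _ _ ?_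
    rw [residue_tmul]
    refine finsum_mem_submodule _ fun m => ?_
    -- A constant function has constant Laurent coefficients, and none with negative index. The
    -- modes that occur therefore lower the filtration of the tensor by one, which raises the
    -- function degree of the result to `-n` relative to the total.
    obtain ⟨c, hc, hc'⟩ := exists_coeff_one (L := L) i j m
    rw [hc]
    rcases lt_or_ge m 0 with hm | hm
    · rw [hc' hm, zero_smul, TensorProduct.zero_tmul]
      exact Submodule.zero_mem _
    · have h2 := contract_mem_tensorFiltration 𝒱 hΔ hgen i j m hw
      rw [if_pos hm] at h2
      rw [← TensorProduct.smul_tmul']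
      exact Submodule.smul_mem _ _ (tmul_mem_bifiltration (by push_cast; omega)
        (by push_cast; omega) one_mem_functionFiltration h2)

variable (L) in
/-- The map from homology in lowest filtration to differential forms. -/
def homologyToForms (hΔ : ∀ i, a i ∈ 𝒱.component (Δ i)) (hgen : StronglyGenerates a) (n : ℕ) :
    Homology L (standardFiltration a Δ) n (-n) →ₗ[ℂ] ZhuForms V n :=
  DirectSum.toModule ℂ ℤ _ fun r => Submodule.liftQ _
    (formMap L 𝒱 n (r + n) ∘ₗ (cycles L (standardFiltration a Δ) n (-n) r).subtype)
    fun _ hz => boundaries_le_ker_formMap 𝒱 hΔ hgen r hz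

lemma homologyToForms_lof (hΔ : ∀ i, a i ∈ 𝒱.component (Δ i)) (hgen : StronglyGenerates a) (r : ℤ)
    (z : cycles L (standardFiltration a Δ) n (-n) r) :
    homologyToForms L 𝒱 hΔ hgen n (DirectSum.lof ℂ ℤ
      (fun r => HomologyPiece L (standardFiltration a Δ) n (-n) r) r
        (Submodule.Quotient.mk z)) = formMap L 𝒱 n (r + n) z := by
  rw [homologyToForms, DirectSum.toModule_lof]
  rfl

lemma homologyToForms_one_tmul (hΔ : ∀ i, a i ∈ 𝒱.component (Δ i)) (hgen : StronglyGenerates a)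
    {v : Fin (n + 1) → V} {δ : Fin (n + 1) → ℕ} (hv : ∀ k, v k ∈ 𝒱.component (δ k)) :
    homologyToForms L 𝒱 hΔ hgen n (DirectSum.lof ℂ ℤ
      (fun r => HomologyPiece L (standardFiltration a Δ) n (-n) r) (∑ k, (δ k : ℤ) - n)
        (Submodule.Quotient.mk ⟨_, one_tmul_tprod_mem_cycles 𝒱 hΔ hgen hv⟩)) =
      toForm V n (PiTensorProduct.tprod ℂ v) := by
  rw [homologyToForms_lof, formMap_tmul, mean_one, one_smul, sub_add_cancel,
    totalProj_tprod 𝒱 _ hv, if_pos rfl]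

variable (L n a Δ) in
/-- The homology piece embeds in the chains modulo boundaries. -/
def homologyPieceToQuotient (s : ℤ) :
    HomologyPiece L (standardFiltration a Δ) n (-n) (s - n) →ₗ[ℂ] BoundaryQuotient V L n a Δ s :=
  Submodule.mapQ _ _ (cycles L (standardFiltration a Δ) n (-n) (s - n)).subtype le_rfl

lemma homologyPieceToQuotient_injective (s : ℤ) :
    Function.Injective (homologyPieceToQuotient L n a Δ s) := by
  refine (injective_iff_map_eq_zero _).2 fun y => ?_
  obtain ⟨y, rfl⟩ := Submodule.Quotient.mk_surjective _ y
  intro h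
  have hy : (y : PreChains V L n) ∈ boundaries L (standardFiltration a Δ) n (-n) (s - n) :=
    (Submodule.Quotient.mk_eq_zero _).1 h
  exact (Submodule.Quotient.mk_eq_zero _).2 hy

/-- For each `s`, the map `Ψ` recovers the component of a homology class in `G`-degree `s - n`, as a
class of chains modulo boundaries. -/
lemma comp_homologyToForms (hΔ : ∀ i, a i ∈ 𝒱.component (Δ i)) (hgen : StronglyGenerates a) {s : ℤ}
    {Ψ : ZhuForms V n →ₗ[ℂ] BoundaryQuotient V L n a Δ s}
    (hΨ : ∀ w : TPow V n, Ψ (toForm V n w) = constClass L n a Δ s (totalProj 𝒱 s w)) :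
    Ψ ∘ₗ homologyToForms L 𝒱 hΔ hgen n = homologyPieceToQuotient L n a Δ s ∘ₗ
      DirectSum.component ℂ ℤ (fun r => HomologyPiece L (standardFiltration a Δ) n (-n) r)
        (s - n) := by
  refine DirectSum.linearMap_ext ℂ fun t => LinearMap.ext fun y => ?_
  obtain ⟨y, rfl⟩ := Submodule.Quotient.mk_surjective _ y
  refine (congrArg Ψ (homologyToForms_lof 𝒱 hΔ hgen t y)).trans ?_
  rw [LinearMap.comp_apply, LinearMap.comp_apply]
  by_cases ht : t = s - n
  · subst ht
    rw [DirectSum.component.lof_self, sub_add_cancel]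
    exact mkQ_eq_of_mem_bifiltration 𝒱 hΔ hgen hΨ (cycles_le_bifiltration y.2)
  · rw [DirectSum.component.of, dif_neg ht, map_zero]
    exact apply_formMap_of_ne 𝒱 (by omega) hΨ _

/-- Each component is determined by the form through `comp_homologyToForms`, since homology embeds
in chains modulo boundaries. -/
lemma homologyToForms_injective (hΔ : ∀ i, a i ∈ 𝒱.component (Δ i)) (hgen : StronglyGenerates a) :
    Function.Injective (homologyToForms L 𝒱 hΔ hgen n) := by
  intro x x' hx
  refine DirectSum.ext_component ℂ fun r => ?_
  obtain ⟨s, rfl⟩ : ∃ s, r = s - n := ⟨r + n, by ring⟩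
  obtain ⟨Ψ, hΨ⟩ := exists_linearMap_toForm (L := L) (n := n) 𝒱 hΔ hgen s
  have key := comp_homologyToForms 𝒱 hΔ hgen hΨ
  refine homologyPieceToQuotient_injective s ?_
  have h := LinearMap.congr_fun key x
  have h' := LinearMap.congr_fun key x'
  rw [LinearMap.comp_apply, hx] at h
  exact h.symm.trans h'

/-- Homogeneous pure tensors give cycles, they span the tensor power, and every form comes from a
tensor. -/
lemma homologyToForms_surjective (hΔ : ∀ i, a i ∈ 𝒱.component (Δ i)) (hgen : StronglyGenerates a) :
    Function.Surjective (homologyToForms L 𝒱 hΔ hgen n) := by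
  set S := LinearMap.range (homologyToForms L 𝒱 hΔ hgen n)
  have h : S.mkQ ∘ₗ (toForm V n) = 0 := by
    refine linearMap_ext_homogeneous 𝒱 fun v δ hv => ?_
    exact (Submodule.Quotient.mk_eq_zero _).2 ⟨_, homologyToForms_one_tmul 𝒱 hΔ hgen hv⟩
  intro ω
  obtain ⟨w, rfl⟩ := toForm_surjective ω
  exact (Submodule.Quotient.mk_eq_zero _).1 (LinearMap.congr_fun h w)

end ChiralComplex

end

theorem mainTheorem3 (τ : UpperHalfPlane) {V : Type*} [AddCommGroup V] [Module ℂ V]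
    [VertexAlgebra V] (𝒱 : VertexAlgebra.Grading V) {ι : Type*} [Finite ι] (a : ι → V)
    (Δ : ι → ℕ) (ha : ∀ i, a i ≠ 0) (hΔ : ∀ i, a i ∈ 𝒱.component (Δ i))
    (hgen : VertexAlgebra.StronglyGenerates a) (n : ℕ) :
    ∃ e : ChiralComplex.Homology (EllipticConfig.periods τ)
          (VertexAlgebra.standardFiltration a Δ) n (-(n : ℤ)) ≃ₗ[ℂ]
        ⋀[VertexAlgebra.ZhuAlgebra V]^n (Ω[VertexAlgebra.ZhuAlgebra V⁄ℂ]),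
      ∀ (v : Fin (n + 1) → V) (δ : Fin (n + 1) → ℕ), (∀ k, v k ∈ 𝒱.component (δ k)) →
        ∃ h : EllipticConfig.one (EllipticConfig.periods τ) n ⊗ₜ[ℂ] PiTensorProduct.tprod ℂ v ∈
            ChiralComplex.cycles (EllipticConfig.periods τ)
              (VertexAlgebra.standardFiltration a Δ) n (-(n : ℤ)) (∑ k, (δ k : ℤ) - n),
          e (DirectSum.lof ℂ ℤ
              (fun r => ChiralComplex.HomologyPiece (EllipticConfig.periods τ)
                (VertexAlgebra.standardFiltration a Δ) n (-(n : ℤ)) r)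
              (∑ k, (δ k : ℤ) - n) (Submodule.Quotient.mk ⟨_, h⟩)) =
            VertexAlgebra.toZhu (v (Fin.last n)) •
              exteriorPower.ιMulti (VertexAlgebra.ZhuAlgebra V) n fun i : Fin n =>
                KaehlerDifferential.D ℂ (VertexAlgebra.ZhuAlgebra V)
                  (VertexAlgebra.toZhu (v i.castSucc)) := by
  refine ⟨LinearEquiv.ofBijective (ChiralComplex.homologyToForms _ 𝒱 hΔ hgen n)
    ⟨ChiralComplex.homologyToForms_injective 𝒱 hΔ hgen,
      ChiralComplex.homologyToForms_surjective 𝒱 hΔ hgen⟩, fun v δ hv =>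
    ⟨ChiralComplex.one_tmul_tprod_mem_cycles 𝒱 hΔ hgen hv, ?_⟩⟩
  exact (ChiralComplex.homologyToForms_one_tmul 𝒱 hΔ hgen hv).trans
    (ChiralComplex.toForm_tprod v)
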